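/- **Definitions.** A *rooted binary tree* is a rooted tree in which every vertex has zero or two children; write $v\le u$ if $v=u$ or $v$ is a descendant of $u$, and $\mathrm{leaf}(u)$ for the set of leaves $\le u$. A *tanglegram* $(T,S,\phi)$ of size $n$ consists of two rooted binary trees with leaves $t_1,\dots,t_n$ and $s_1,\dots,s_n$ and a permutation $\phi$ of $[n]$, which gives the between-tree edges $(t_j,s_{\phi(j)})$. A *layout* is a pair $(X,Y)$ of orderings of the leaves of $T$ and of $S$, from top to bottom, in planar drawings of the two trees with all leaves on a vertical line (at each internal vertex either child may be drawn on top). The edges $j\ne k$ *cross* in $(X,Y)$ if $t_j$ is above $t_k$ in $X$ and $s_{\phi(j)}$ is below $s_{\phi(k)}$ in $Y$, or vice versa; a layout without crossings is *planar*, and so is a tanglegram that has a planar layout. For $\emptyset\ne I\subseteq[n]$ the *induced subtanglegram* $(T_I,S_{\phi(I)},\phi|_I)$ is made of the minimal subtrees containing the leaves indexed by $I$ and $\phi(I)$, with the vertices that have only one child suppressed. A layout restricts to this subtanglegram by passing to sublists. **Problem (Tanglegram Single Edge Insertion).** Given $(T,S,\phi)$ and $i\in[n]$ such that for $I=[n]\setminus\{i\}$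 the induced subtanglegram exists (so $n\ge2$) and is planar, find a layout of $(T,S,\phi)$ that restricts to a planar layout of $(T_I,S_{\phi(I)},\phi|_I)$ and has the fewest crossings among all layouts with this property. **Algorithm (Insertion).** A *flip* at a vertex $u$ reverses the order of $\mathrm{leaf}(u)$ in the layout; a *paired flip* at $(u,v)$ is a flip at $u\in T$ and one at $v\in S$; a *subtree switch* at $u$ is a flip at $u$ and then at both children. 1. *ModifiedUntangle.* Let $P[u,v]$, for vertices $u\in T$, $v\in S$, be true iff $\phi|_I$ matches some leaf $\le u$ with some leaf $\le v$. Start with the lists $X=(\mathrm{root}\,T)$, $Y=(\mathrm{root}\,S)$ and $L=\emptyset$. As long as $X$ or $Y$ contains an internal vertex, consider the bipartite graph on $X\cup Y$ whose edges are the pairs with $P[u,v]$ true, and choose an internal vertex $u$ of highest degree. If its degree is $1$, add the pair formed by $u$ and its neighbour to $L$. Then replace $u$ in its list by its children, as $u_1u_2$ if no neighbour of $u_2$ comes before the last neighbour of $u_1$ in the other list, and as $u_2u_1$ otherwise. 2. For $(u,v)\in L$ such that $\mathrm{leaf}(u)$ contains more than one $t_j$ with $j\in I$, let $u_{red}\le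 u$ and $v_{red}\le v$ be the minimal vertices above the same leaves indexed by $I$ and $\phi(I)$. Let $L(I)$ be the set of these $(u_{red},v_{red})$, let $u_0$ and $v_0$ be the parents of $t_i$ and $s_{\phi(i)}$, and put $L(I)_T=\{(u,v)\in L(I):u>t_i,\ v\not>s_{\phi(i)}\}$, $L(I)_S=\{(u,v)\in L(I):u\not>t_i,\ v>s_{\phi(i)}\}$. Let $(u_{Smax},v_{Smax})$ be the pair in $L(I)_S$ with the largest $v$, and $(u_{Tmax},v_{Tmax})$ the pair in $L(I)_T$ with the largest $u$. For a pair $(u,v)\in L(I)_S$ let $E(v)$ be the set of edges with an endpoint in $\mathrm{leaf}(v)\setminus\mathrm{leaf}(v')$, where $v'$ is the next smaller such vertex, or $v_0$ if there is none; define $E(u)$ for $(u,v)\in L(I)_T$ likewise, with $u_0$. Let $E(u_0)$ and $E(v_0)$ be the sets of edges other than $(t_i,s_{\phi(i)})$ with an endpoint in $\mathrm{leaf}(u_0)$ and in $\mathrm{leaf}(v_0)$, respectively. To *treat* one of these sets means to perform the named operation if $(t_i,s_{\phi(i)})$ crosses more than half of its edges in the current layout. 3. If $L(I)_S\ne\emptyset$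 and $u_0>u_{Smax}$: remove from $E(u_0)$ the edges with an endpoint in $\mathrm{leaf}(u_{Smax})$; treat $E(u_0)$ (subtree switch at $u_0$), then $E(v)$ for $(u,v)\in L(I)_S$ from the largest $v$ to the smallest (paired flip at $(u,v)$), then $E(v_0)$ (subtree switch at $v_0$). If instead $L(I)_T\ne\emptyset$ and $v_0>v_{Tmax}$: proceed in the same way with $T$ and $S$ interchanged. 4. Otherwise treat $E(u)$ for $(u,v)\in L(I)_T$ from the largest $u$ to the smallest, then $E(v)$ for $(u,v)\in L(I)_S$ from the largest $v$ to the smallest (paired flips at $(u,v)$). If then $E(u_0)\cap E(v_0)=\emptyset$, perform a subtree switch at $u_0$ if $(t_i,s_{\phi(i)})$ crosses the edges in $E(u_0)$, and then one at $v_0$ if it crosses the edges in $E(v_0)$. If $E(u_0)\cap E(v_0)\neq\emptyset$, take a layout with the fewest crossings among the four obtained by performing or not performing subtree switches at $u_0$ and $v_0$. Return $(X,Y)$. **Theorem.** The Insertion algorithm solves the Tanglegram Single Edge Insertion Problem in $O(n^2)$ time and space. That is, it can be written as a program for a random access machine (unit cost per operation; trees stored by child pointers, with vertices numbered so that children precede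 their parents) such that, for an absolute constant $C$ and every input $(T,S,\phi),i$ of the problem, of size $n$, the program stops after at most $C n^2$ steps, having used at most $C n^2$ memory cells, and its output is a layout of $(T,S,\phi)$ that restricts to a planar layout of $(T_I,S_{\phi(I)},\phi|_I)$ and has the fewest crossings among all such layouts. -/

import Mathlib

namespace Tangle

/-! ### Rooted binary trees, layouts, tanglegrams -/

/-- Rooted binary trees with leaves labelled by `α`, in nested-list notation: `node t₁ t₂` is the
tree `(t₁, t₂)`. The order in which the two children are written carries no meaning; the orders
in which a tree can be drawn are described by `LeafOrder`. -/
inductive BTree (α : Type) : Type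
  | leaf (a : α) : BTree α
  | node (t₁ t₂ : BTree α) : BTree α

/-- The labels of the leaves of a tree. -/
def BTree.leaves {α : Type} : BTree α → List α
  | .leaf a => [a]
  | .node t₁ t₂ => t₁.leaves ++ t₂.leaves

/-- `LeafOrder t X`: some planar drawing of `t` (with all leaves on one vertical line, the tree on
one side of it) has the leaves `X`, listed from top to bottom. At each internal vertex either
child may be drawn above the other one. -/
inductive LeafOrder {α : Type} : BTree α → List α → Prop
  | leaf (a : α) : LeafOrder (.leaf a) [a]
  | straight {t₁ t₂ : BTree α} {X₁ X₂ : List α} :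
      LeafOrder t₁ X₁ → LeafOrder t₂ X₂ → LeafOrder (.node t₁ t₂) (X₁ ++ X₂)
  | flipped {t₁ t₂ : BTree α} {X₁ X₂ : List α} :
      LeafOrder t₁ X₁ → LeafOrder t₂ X₂ → LeafOrder (.node t₁ t₂) (X₂ ++ X₁)

/-- The rooted binary subtree induced by a set `I` of labels: the minimal subtree that contains the
leaves with labels in `I`, with the internal vertices that have only one child suppressed. It is
`none` if no leaf has its label in `I`. -/
def BTree.induced {α : Type} [DecidableEq α] (I : Finset α) : BTree α → Option (BTree α)
  | .leaf a => if a ∈ I then some (.leaf a) else none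
  | .node t₁ t₂ =>
    match t₁.induced I, t₂.induced I with
    | some s₁, some s₂ => some (.node s₁ s₂)
    | some s₁, none => some s₁
    | none, s => s

/-- The number of crossings of the layout with leaf orders `X` and `Y`, when the leaf `a` of the
left tree is joined to the leaf `φ a` of the right tree: the number of pairs of edges such that the
first one starts above the second one and ends below it. -/
def crossings {α : Type} [DecidableEq α] (φ : α → α) (X Y : List α) : ℕ :=
  ((X.toFinset ×ˢ X.toFinset).filter fun p =>
    X.idxOf p.1 < X.idxOf p.2 ∧ Y.idxOf (φ p.2) < Y.idxOf (φ p.1)).card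

/-- A tanglegram of size `n`: two rooted binary trees, the leaves of each of them indexed by
`Fin n`, and a bijection `φ`; the leaf `a` of `T` is matched with the leaf `φ a` of `S`. -/
structure Tanglegram (n : ℕ) where
  T : BTree (Fin n)
  S : BTree (Fin n)
  φ : Equiv.Perm (Fin n)
  leavesT : T.leaves.Perm (List.finRange n)
  leavesS : S.leaves.Perm (List.finRange n)

/-- `(X, Y)` is a layout of the pair of trees `(T, S)`. -/
def IsLayout {α : Type} (T S : BTree α) (X Y : List α) : Prop :=
  LeafOrder T X ∧ LeafOrder S Y

/-- `(X, Y)` is a planar layout of `(T, S, φ)`. -/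
def IsPlanarLayout {α : Type} [DecidableEq α] (T S : BTree α) (φ : α → α) (X Y : List α) : Prop :=
  IsLayout T S X Y ∧ crossings φ X Y = 0

/-- The subtanglegram induced by `I`, with the trees `T_I` and `S_{φ(I)}`, exists and is planar. -/
def Tanglegram.PlanarOn {n : ℕ} (G : Tanglegram n) (I : Finset (Fin n)) : Prop :=
  ∃ T' S' : BTree (Fin n), G.T.induced I = some T' ∧ G.S.induced (I.image G.φ) = some S' ∧
    ∃ X Y : List (Fin n), IsPlanarLayout T' S' G.φ X Y

/-- The sublists of `X` and `Y` given by the leaves of the subtanglegram induced by `I` are a planar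
layout of this subtanglegram. -/
def Tanglegram.RestrictsToPlanar {n : ℕ} (G : Tanglegram n) (I : Finset (Fin n))
    (X Y : List (Fin n)) : Prop :=
  ∃ T' S' : BTree (Fin n), G.T.induced I = some T' ∧ G.S.induced (I.image G.φ) = some S' ∧
    IsPlanarLayout T' S' G.φ (X.filter (· ∈ I)) (Y.filter (· ∈ I.image G.φ))

/-- `(X, Y)` solves the Tanglegram Single Edge Insertion Problem for `G` and the index `i`. -/
def Tanglegram.IsSingleEdgeInsertion {n : ℕ} (G : Tanglegram n) (i : Fin n)
    (X Y : List (Fin n)) : Prop :=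
  IsLayout G.T G.S X Y ∧ G.RestrictsToPlanar (Finset.univ.erase i) X Y ∧
    ∀ X' Y' : List (Fin n), IsLayout G.T G.S X' Y' →
      G.RestrictsToPlanar (Finset.univ.erase i) X' Y' →
      crossings G.φ X Y ≤ crossings G.φ X' Y'

/-! ### The machine

A random access machine with named two-dimensional arrays of natural numbers. A register is the
entry `(0, 0)` of an array, a list is kept in the entries `(k, 0)`. The only arithmetic is adding
or subtracting one, so no number can exceed the input numbers and the constants of the program
by more than the number of steps. -/

/-- The two sides of a tanglegram: the tree `T` and the tree `S`. -/
inductive Side : Type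
  | T
  | S
  deriving DecidableEq

/-- The opposite side. -/
def Side.other : Side → Side
  | .T => .S
  | .S => .T

/-- The names of the arrays. -/
inductive Name : Type
  -- Input: the size, the bijection, the inserted edge `(t_i, s_{φ(i)})`, the children.
  | size | phi | ins (s : Side) | kid (s : Side)
  -- Number of vertices, table of descendants, number of leaves that belong to the subtanglegram.
  | verts | desc (s : Side) | cnt (s : Side)
  -- Boolean table `P`, edges and degrees of the bipartite graph `(X, E, Y)`.
  | tabP | edge | deg (s : Side)
  -- The lists `X` and `Y`, their lengths, the list `L`, its length.
  | lay (s : Side) | len (s : Side) | listL (s : Side) | lenL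
  -- The set `L(I)`: the vertices that lie in its pairs, and their partners.
  | inL (s : Side) | mate (s : Side)
  -- `u₀` and `v₀` in entry `0`, then the vertices of `L(I)_T` or `L(I)_S`; partners; number.
  | own (s : Side) | mat (s : Side) | num (s : Side)
  -- The edge sets, the positions of the leaves in the layout.
  | eset (s : Side) | pos (s : Side)
  -- Best layout so far and its number of crossings.
  | opt (s : Side) | best
  -- Loop counters and temporary registers.
  | a | b | c | d | found | high | vert | side | nbr | last | good | tmp | crossed | uncrossed
  | total
  deriving DecidableEq

/-- A memory cell: an entry of an array. -/
abbrev Cell : Type := Name × ℕ × ℕ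

/-- Expressions. -/
inductive Expr : Type
  | const (k : ℕ) : Expr
  | get (x : Name) (i j : Expr) : Expr
  | succ (e : Expr) : Expr
  | pred (e : Expr) : Expr

/-- Conditions. -/
inductive Cond : Type
  | lt (e f : Expr) : Cond
  | eq (e f : Expr) : Cond
  | not (p : Cond) : Cond
  | and (p q : Cond) : Cond
  | or (p q : Cond) : Cond

/-- Programs. `set x i j e` is the assignment `x[i, j] := e`; `loop x e p` runs `p` once for each
value `0, 1, …` below `e` of the register `x`, where `e` is evaluated once, at the start. -/
inductive Prog : Type
  | skip : Prog
  | set (x : Name) (i j e : Expr) : Prog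
  | seq (p q : Prog) : Prog
  | ite (c : Cond) (p q : Prog) : Prog
  | loop (x : Name) (e : Expr) (p : Prog) : Prog

/-- The state of the machine: the memory, the number of steps made so far, and the cells that were
read or written so far. -/
structure State where
  mem : Cell → ℕ
  time : ℕ
  used : Finset Cell

/-- The value of an expression. -/
def Expr.val (m : Cell → ℕ) : Expr → ℕ
  | .const k => k
  | .get x i j => m (x, i.val m, j.val m)
  | .succ e => e.val m + 1
  | .pred e => e.val m - 1

/-- The number of steps that the evaluation of an expression takes: one for each operation. -/
def Expr.time : Expr → ℕ
  | .const _ => 1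
  | .get _ i j => i.time + j.time + 1
  | .succ e => e.time + 1
  | .pred e => e.time + 1

/-- The cells that the evaluation of an expression reads. -/
def Expr.cells (m : Cell → ℕ) : Expr → Finset Cell
  | .const _ => ∅
  | .get x i j => insert (x, i.val m, j.val m) (i.cells m ∪ j.cells m)
  | .succ e => e.cells m
  | .pred e => e.cells m

/-- The truth value of a condition. -/
def Cond.val (m : Cell → ℕ) : Cond → Bool
  | .lt e f => decide (e.val m < f.val m)
  | .eq e f => decide (e.val m = f.val m)
  | .not p => !p.val m
  | .and p q => p.val m && q.val m
  | .or p q => p.val m || q.val m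

/-- The number of steps that the evaluation of a condition takes. -/
def Cond.time : Cond → ℕ
  | .lt e f => e.time + f.time + 1
  | .eq e f => e.time + f.time + 1
  | .not p => p.time + 1
  | .and p q => p.time + q.time + 1
  | .or p q => p.time + q.time + 1

/-- The cells that the evaluation of a condition reads. -/
def Cond.cells (m : Cell → ℕ) : Cond → Finset Cell
  | .lt e f => e.cells m ∪ f.cells m
  | .eq e f => e.cells m ∪ f.cells m
  | .not p => p.cells m
  | .and p q => p.cells m ∪ q.cells m
  | .or p q => p.cells m ∪ q.cells m

/-- Count `t` steps and note the cells `A` as used. -/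
def State.charge (s : State) (t : ℕ) (A : Finset Cell) : State :=
  { s with time := s.time + t, used := s.used ∪ A }

/-- Write `v` into the cell `c`, in one step. -/
def State.write (s : State) (c : Cell) (v : ℕ) : State :=
  { mem := Function.update s.mem c v, time := s.time + 1, used := insert c s.used }

/-- Run a program. -/
def Prog.run : Prog → State → State
  | .skip, s => s
  | .set x i j e, s =>
    (s.charge (i.time + j.time + e.time) (i.cells s.mem ∪ j.cells s.mem ∪ e.cells s.mem)).write
      (x, i.val s.mem, j.val s.mem) (e.val s.mem)
  | .seq p q, s => q.run (p.run s)
  | .ite c p q, s =>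
    if c.val s.mem then p.run (s.charge (c.time + 1) (c.cells s.mem))
    else q.run (s.charge (c.time + 1) (c.cells s.mem))
  | .loop x e p, s =>
    (List.range (e.val s.mem)).foldl (fun s' k => p.run ((s'.write (x, 0, 0) k).charge 1 ∅))
      (s.charge (e.time + 1) (e.cells s.mem))

/-! ### Abbreviations for writing programs -/

instance (k : ℕ) : OfNat Expr k := ⟨.const k⟩

/-- The value of a register. -/
def reg (x : Name) : Expr := .get x 0 0

instance : Coe Name Expr := ⟨reg⟩

/-- The entry `x[i]` of a list. -/
def at1 (x : Name) (i : Expr) : Expr := .get x i 0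

/-- The entry `x[i, j]` of a table is true. -/
def holds (x : Name) (i j : Expr) : Cond := .eq (.get x i j) 1

/-- Conjunction of a list of conditions. -/
def all : List Cond → Cond
  | [] => .eq 0 0
  | [p] => p
  | p :: q :: l => .and p (all (q :: l))

/-- Run the programs of a list one after the other. -/
def block (l : List Prog) : Prog := l.foldr .seq .skip

/-- Assignment to a register. -/
def put (x : Name) (e : Expr) : Prog := .set x 0 0 e

/-- Assignment to an entry of a list. -/
def put1 (x : Name) (i e : Expr) : Prog := .set x i 0 e

/-- Add one to a register. -/
def incr (x : Name) : Prog := put x (.succ x)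

/-- Subtract one from a register. -/
def decr (x : Name) : Prog := put x (.pred x)

/-- Conditional without alternative. -/
def when (c : Cond) (l : List Prog) : Prog := .ite c (block l) .skip

/-- Loop over all `x < e`. -/
def for' (x : Name) (e : Expr) (l : List Prog) : Prog := .loop x e (block l)

/-- The vertex `v` is an internal vertex. The leaves are the vertices below `size`. -/
def internal (v : Expr) : Cond := .not (.lt v Name.size)

/-- `v ≤ u` in the tree on the side `s`. -/
def below (s : Side) (u v : Expr) : Cond := holds (.desc s) u v

/-- `u > v` in the tree on the side `s`. -/
def above (s : Side) (u v : Expr) : Cond := .and (below s u v) (.not (.eq u v))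

/-- `P[u, v]` for a vertex `u` on the side `s` and a vertex `v` on the other side. -/
def inP (s : Side) (u v : Expr) : Cond :=
  match s with
  | .T => holds .tabP u v
  | .S => holds .tabP v u

/-- `(u, v) ∈ E` for a vertex `u` on the side `s` and a vertex `v` on the other side. -/
def inE (s : Side) (u v : Expr) : Cond :=
  match s with
  | .T => holds .edge u v
  | .S => holds .edge v u

/-- Put the pair `(u, v)` into `E` (for `e = 1`), or remove it (for `e = 0`). -/
def putE (s : Side) (u v e : Expr) : Prog :=
  match s with
  | .T => .set .edge u v e
  | .S => .set .edge v u e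

/-- The endpoint on the side `s` of the edge `(t_j, s_{φ(j)})`. -/
def endpoint (s : Side) (j : Expr) : Expr :=
  match s with
  | .T => j
  | .S => at1 .phi j

/-! ### ModifiedUntangle, applied to `(T, S, φ|_I)` with `I = [n] ∖ {i}` -/

/-- The number `2n - 1` of vertices of each tree. -/
def countVerts : Prog :=
  block [put .verts 0, for' .a Name.size [incr .verts, incr .verts], decr .verts]

/-- Table of descendants, and number of leaves `≠ t_i` (or `≠ s_{φ(i)}`) below each vertex. -/
def descendants (s : Side) : Prog :=
  for' .a Name.verts [
    for' .b Name.verts [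
      when (.or (.eq Name.a Name.b) (.and (internal Name.a)
          (.or (below s (.get (.kid s) Name.a 0) Name.b)
            (below s (.get (.kid s) Name.a 1) Name.b))))
        [.set (.desc s) Name.a Name.b 1]],
    for' .b Name.size [
      when (.and (below s Name.a Name.b) (.not (.eq Name.b (Name.ins s))))
        [put1 (.cnt s) Name.a (.succ (at1 (.cnt s) Name.a))]]]

/-- The Boolean table `P`: `P[u, v]` holds if some leaf below `u` is matched by `φ|_I` with some
leaf below `v`. -/
def tableP : Prog :=
  block [
    for' .a Name.size [
      when (.not (.eq Name.a (Name.ins .T))) [.set .tabP Name.a (at1 .phi Name.a) 1]],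
    for' .a Name.verts [
      for' .b Name.verts [
        when (.or
          (.and (internal Name.a) (.or
            (holds .tabP (.get (.kid .T) Name.a 0) Name.b)
            (holds .tabP (.get (.kid .T) Name.a 1) Name.b)))
          (.and (internal Name.b) (.or
            (holds .tabP Name.a (.get (.kid .S) Name.b 0))
            (holds .tabP Name.a (.get (.kid .S) Name.b 1)))))
          [.set .tabP Name.a Name.b 1]]]]

/-- Begin with `X = (root T)`, `Y = (root S)`, `E = {(root T, root S)}`, `L = ∅`. -/
def startLayout : Prog :=
  block [
    put1 (.lay .T) 0 (.pred Name.verts), put (.len .T) 1,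
    put1 (.lay .S) 0 (.pred Name.verts), put (.len .S) 1,
    .set .edge (.pred Name.verts) (.pred Name.verts) 1,
    put1 (.deg .T) (.pred Name.verts) 1, put1 (.deg .S) (.pred Name.verts) 1,
    put .lenL 0]

/-- Look on the side `s` for an internal vertex of higher degree than the one found so far. -/
def scanDegrees (s : Side) : Prog :=
  for' .b Name.size [
    when (all [.lt Name.b (Name.len s), internal (at1 (.lay s) Name.b),
        .or (.eq Name.found 0) (.lt Name.high (at1 (.deg s) (at1 (.lay s) Name.b)))]) [
      put .found 1,
      put .high (at1 (.deg s) (at1 (.lay s) Name.b)),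
      put .vert (at1 (.lay s) Name.b),
      put .side (match s with | .T => 0 | .S => 1)]]

/-- If the chosen vertex, on the side `s`, has degree one, put it into `L` together with its
neighbor. -/
def recordPair (s : Side) : Prog :=
  when (.eq (at1 (.deg s) Name.vert) 1) [
    for' .b Name.size [
      when (.and (.lt Name.b (Name.len s.other)) (inE s Name.vert (at1 (.lay s.other) Name.b)))
        [put .nbr (at1 (.lay s.other) Name.b)]],
    put1 (.listL s) Name.lenL Name.vert,
    put1 (.listL s.other) Name.lenL Name.nbr,
    incr .lenL]

/-- Give the child `w` of the chosen vertex the edge to the vertex in place `b` on the other side,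
if `P` says so. -/
def inheritEdge (s : Side) (w : Expr) : Prog :=
  when (inP s w (at1 (.lay s.other) Name.b)) [
    putE s w (at1 (.lay s.other) Name.b) 1,
    put1 (.deg s) w (.succ (at1 (.deg s) w)),
    put1 (.deg s.other) (at1 (.lay s.other) Name.b)
      (.succ (at1 (.deg s.other) (at1 (.lay s.other) Name.b)))]

/-- Refine: replace the chosen vertex, on the side `s`, by its two children, in the order that
creates no crossing of the edges in `E`. -/
def refine (s : Side) : Prog :=
  block [
    for' .b Name.size [
      when (.and (.lt Name.b (Name.len s.other)) (inE s Name.vert (at1 (.lay s.other) Name.b))) [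
        putE s Name.vert (at1 (.lay s.other) Name.b) 0,
        put1 (.deg s.other) (at1 (.lay s.other) Name.b)
          (.pred (at1 (.deg s.other) (at1 (.lay s.other) Name.b))),
        inheritEdge s (.get (.kid s) Name.vert 0),
        inheritEdge s (.get (.kid s) Name.vert 1)]],
    put .last 0,
    for' .b Name.size [
      when (.and (.lt Name.b (Name.len s.other))
          (inE s (.get (.kid s) Name.vert 0) (at1 (.lay s.other) Name.b)))
        [put .last Name.b]],
    put .good 1,
    for' .b Name.size [
      when (all [.lt Name.b (Name.len s.other),
          inE s (.get (.kid s) Name.vert 1) (at1 (.lay s.other) Name.b), .lt Name.b Name.last])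
        [put .good 0]],
    put .d 0,
    for' .b Name.size [
      when (.lt Name.b (Name.len s)) [
        .ite (.eq (at1 (.lay s) Name.b) Name.vert)
          (.ite (.eq Name.good 1)
            (block [put1 .tmp Name.d (.get (.kid s) Name.vert 0), incr .d,
              put1 .tmp Name.d (.get (.kid s) Name.vert 1), incr .d])
            (block [put1 .tmp Name.d (.get (.kid s) Name.vert 1), incr .d,
              put1 .tmp Name.d (.get (.kid s) Name.vert 0), incr .d]))
          (block [put1 .tmp Name.d (at1 (.lay s) Name.b), incr .d])]],
    put (.len s) Name.d,
    for' .b Name.size [when (.lt Name.b Name.d) [put1 (.lay s) Name.b (at1 .tmp Name.b)]]]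

/-- The main loop: as long as `X` or `Y` contains an internal vertex, refine an internal vertex of
highest degree. This happens `2n - 2` times. -/
def untangleLoop : Prog :=
  for' .a Name.verts [
    put .found 0,
    scanDegrees .T,
    scanDegrees .S,
    when (.eq Name.found 1) [
      .ite (.eq Name.side 0)
        (block [recordPair .T, refine .T])
        (block [recordPair .S, refine .S])]]

/-- ModifiedUntangle. -/
def modifiedUntangle : Prog :=
  block [countVerts, descendants .T, descendants .S, tableP, startLayout, untangleLoop]

/-! ### Flips, switches, and counting crossings -/

/-- Flip at the vertex `u`: reverse the order of the leaves below `u`. -/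
def flip (s : Side) (u : Expr) : Prog :=
  block [
    put .d 0,
    for' .b Name.size [
      when (below s u (at1 (.lay s) Name.b)) [put1 .tmp Name.d (at1 (.lay s) Name.b), incr .d]],
    for' .b Name.size [
      when (below s u (at1 (.lay s) Name.b)) [decr .d, put1 (.lay s) Name.b (at1 .tmp Name.d)]]]

/-- Paired flip at the vertices `u` on the side `s` and `v` on the other side. -/
def pairedFlip (s : Side) (u v : Expr) : Prog := block [flip s u, flip s.other v]

/-- Subtree switch at the vertex `u`: a flip at `u`, followed by flips at its two children. -/
def subtreeSwitch (s : Side) (u : Expr) : Prog :=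
  block [flip s u, flip s (.get (.kid s) u 0), flip s (.get (.kid s) u 1)]

/-- The positions of the leaves in the layout. -/
def positions (s : Side) : Prog :=
  for' .b Name.size [put1 (.pos s) (at1 (.lay s) Name.b) Name.b]

/-- The edge with index `j` is above the one with index `k` on the side `s`. -/
def isAbove (s : Side) (j k : Expr) : Cond :=
  .lt (at1 (.pos s) (endpoint s j)) (at1 (.pos s) (endpoint s k))

/-- The edges with indices `j` and `k` cross. -/
def cross (j k : Expr) : Cond :=
  .or (.and (isAbove .T j k) (isAbove .S k j)) (.and (isAbove .T k j) (isAbove .S j k))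

/-- How many edges of the set number `k` on the side `s` are crossed by the inserted edge, and how
many are not. -/
def countInserted (s : Side) (k : Expr) : Prog :=
  block [
    positions .T, positions .S, put .crossed 0, put .uncrossed 0,
    for' .b Name.size [
      when (holds (.eset s) k Name.b) [
        .ite (cross Name.b (Name.ins .T)) (incr .crossed) (incr .uncrossed)]]]

/-- The inserted edge crosses more than half of the edges that were just counted. -/
def moreThanHalf : Cond := .lt Name.uncrossed Name.crossed

/-- The total number of crossings of the layout. -/
def countAll : Prog :=
  block [
    positions .T, positions .S, put .total 0,
    for' .b Name.size [
      for' .c Name.size [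
        when (.and (isAbove .T Name.b Name.c) (isAbove .S Name.c Name.b)) [incr .total]]]]

/-! ### The Insertion algorithm -/

/-- The reduced vertex of `u`, put into the register `x`: the minimal `w ≤ u` above the same leaves
of the subtanglegram. Vertices are numbered bottom-up, so this is the first one. -/
def reduced (s : Side) (u : Expr) (x : Name) : Prog :=
  block [
    put .found 0,
    for' .b Name.verts [
      when (all [.eq Name.found 0, below s u Name.b,
          .eq (at1 (.cnt s) Name.b) (at1 (.cnt s) u)])
        [put .found 1, put x Name.b]]]

/-- Construct `L(I)` from `L`. -/
def constructLI : Prog :=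
  for' .a Name.verts [
    when (.and (.lt Name.a Name.lenL) (.lt 1 (at1 (.cnt .T) (at1 (.listL .T) Name.a)))) [
      reduced .T (at1 (.listL .T) Name.a) .vert,
      reduced .S (at1 (.listL .S) Name.a) .nbr,
      put1 (.inL .T) Name.vert 1, put1 (.mate .T) Name.vert Name.nbr,
      put1 (.inL .S) Name.nbr 1, put1 (.mate .S) Name.nbr Name.vert]]

/-- Put the parent of the inserted leaf on the side `s` (that is, `u₀` or `v₀`) into `own s [0]`. -/
def findParent (s : Side) : Prog :=
  for' .a Name.verts [
    when (.and (internal Name.a) (.or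
        (.eq (.get (.kid s) Name.a 0) (Name.ins s)) (.eq (.get (.kid s) Name.a 1) (Name.ins s))))
      [put1 (.own s) 0 Name.a]]

/-- The parent of the inserted leaf on the side `s`. -/
def parent (s : Side) : Expr := at1 (.own s) 0

/-- List the pairs of `L(I)_T` (for `s = T`) or `L(I)_S` (for `s = S`), where the vertices on the
side `s` increase in the order of the tree; they are put into `own s [j]` and their partners into
`mat s [j]`, for `j = 1, …, num s`. -/
def chain (s : Side) : Prog :=
  block [
    put (.num s) 0,
    for' .a Name.verts [
      when (all [.eq (at1 (.inL s) Name.a) 1, above s Name.a (Name.ins s),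
          .not (above s.other (at1 (.mate s) Name.a) (Name.ins s.other))]) [
        incr (.num s),
        put1 (.own s) (Name.num s) Name.a,
        put1 (.mat s) (Name.num s) (at1 (.mate s) Name.a)]]]

/-- The set number `k` on the side `s` consists of the between-tree edges, other than the inserted
one, that have an endpoint in `leaf(u) ∖ leaf(v)`. -/
def edgeSet (s : Side) (k u v : Expr) : Prog :=
  for' .b Name.size [
    .ite (all [below s u (endpoint s Name.b), .not (below s v (endpoint s Name.b)),
        .not (.eq Name.b (Name.ins .T))])
      (.set (.eset s) k Name.b 1) (.set (.eset s) k Name.b 0)]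

/-- The sets `leaf(w_j) ∖ leaf(w_{j-1})`, where `w_0` is the parent of the inserted leaf on the side
`s` and `w_1 < w_2 < …` are the vertices of `L(I)_T` or `L(I)_S`. -/
def chainEdgeSets (s : Side) : Prog :=
  for' .a Name.size [
    when (.and (.lt 0 Name.a) (.not (.lt (Name.num s) Name.a)))
      [edgeSet s Name.a (at1 (.own s) Name.a) (at1 (.own s) (.pred Name.a))]]

/-- Go through the pairs of `L(I)_T` or `L(I)_S` from top to bottom, and perform a paired flip
where the inserted edge crosses more than half of the edge set. -/
def chainFlips (s : Side) : Prog :=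
  block [
    put .c (Name.num s),
    for' .a Name.size [
      when (.lt 0 Name.c) [
        countInserted s Name.c,
        when moreThanHalf [pairedFlip s (at1 (.own s) Name.c) (at1 (.mat s) Name.c)],
        decr .c]]]

/-- Subtree switch at the parent of the inserted leaf on the side `s`, if the inserted edge crosses
more than half of its edge set. -/
def parentSwitch (s : Side) : Prog :=
  block [countInserted s 0, when moreThanHalf [subtreeSwitch s (parent s)]]

/-- The case `u₀ > u_{Smax}` (for `s = S`), or `v₀ > v_{Tmax}` (for `s = T`). -/
def insertionChain (s : Side) : Prog :=
  block [
    edgeSet s.other 0 (parent s.other) (at1 (.mat s) (Name.num s)),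
    edgeSet s 0 (parent s) (Name.ins s),
    chainEdgeSets s,
    parentSwitch s.other,
    chainFlips s,
    parentSwitch s]

/-- Subtree switch at the parent of the inserted leaf on the side `s`, if the inserted edge crosses
the edges of its edge set. -/
def parentSwitchAll (s : Side) : Prog :=
  block [countInserted s 0, when (.eq Name.uncrossed 0) [subtreeSwitch s (parent s)]]

/-- Keep the present layout if it has fewer crossings than the best one so far. -/
def compareLayout : Prog :=
  block [
    countAll,
    when (.or (.eq Name.found 0) (.lt Name.total Name.best)) [
      put .found 1, put .best Name.total,
      for' .b Name.size [
        put1 (.opt .T) Name.b (at1 (.lay .T) Name.b),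
        put1 (.opt .S) Name.b (at1 (.lay .S) Name.b)]]]

/-- Try the four combinations of subtree switches at `u₀` and `v₀`, and take one with the fewest
crossings. -/
def tryAll : Prog :=
  block [
    put .found 0,
    compareLayout,
    subtreeSwitch .T (parent .T),
    compareLayout,
    subtreeSwitch .S (parent .S),
    compareLayout,
    subtreeSwitch .T (parent .T),
    compareLayout,
    for' .b Name.size [
      put1 (.lay .T) Name.b (at1 (.opt .T) Name.b),
      put1 (.lay .S) Name.b (at1 (.opt .S) Name.b)]]

/-- The remaining case: `u₀ ≯ u_{Smax}` and `v₀ ≯ v_{Tmax}`. -/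
def insertionRest : Prog :=
  block [
    chainEdgeSets .S,
    chainEdgeSets .T,
    edgeSet .S 0 (parent .S) (Name.ins .S),
    edgeSet .T 0 (parent .T) (Name.ins .T),
    chainFlips .T,
    chainFlips .S,
    put .found 0,
    for' .b Name.size [
      when (.and (holds (.eset .T) 0 Name.b) (holds (.eset .S) 0 Name.b)) [put .found 1]],
    .ite (.eq Name.found 0)
      (block [parentSwitchAll .T, parentSwitchAll .S])
      tryAll]

/-- `L(I)_S ≠ ∅` and `u₀ > u_{Smax}` (for `s = S`), or `L(I)_T ≠ ∅` and `v₀ > v_{Tmax}`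
(for `s = T`). -/
def parentAboveMax (s : Side) : Cond :=
  .and (.lt 0 (Name.num s)) (above s.other (parent s.other) (at1 (.mat s) (Name.num s)))

/-- The Insertion algorithm. The output is the layout in the lists `lay T` and `lay S`. -/
def insertion : Prog :=
  block [
    modifiedUntangle,
    constructLI,
    findParent .T, findParent .S,
    chain .S, chain .T,
    .ite (parentAboveMax .S) (insertionChain .S)
      (.ite (parentAboveMax .T) (insertionChain .T) insertionRest)]

/-! ### Input and output -/

/-- `StoredAt l r t v`: the tree `t` hangs at the vertex `v` of the pointer structure in which the
children of each internal vertex `w` are `l w` and `r w`. The leaf with index `a` is the vertex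
`a < n`, the internal vertices have numbers `≥ n`, and each vertex has a larger number than its
children. -/
inductive StoredAt {n : ℕ} (l r : ℕ → ℕ) : BTree (Fin n) → ℕ → Prop
  | leaf (a : Fin n) : StoredAt l r (.leaf a) a
  | node {t₁ t₂ : BTree (Fin n)} {v : ℕ} : n ≤ v → l v < v → r v < v →
      StoredAt l r t₁ (l v) → StoredAt l r t₂ (r v) → StoredAt l r (.node t₁ t₂) v

/-- The arrays `l, r` and `l', r'` store the trees of `G`, on the vertices `0, …, 2n - 2`, with the
last vertex as root. -/
def Tanglegram.IsStored {n : ℕ} (G : Tanglegram n) (l r l' r' : ℕ → ℕ) : Prop :=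
  StoredAt l r G.T (2 * n - 2) ∧ StoredAt l' r' G.S (2 * n - 2)

/-- The memory at the start: the size `n`, the bijection `φ`, the inserted edge `(t_i, s_{φ(i)})`,
and the children in the two trees; all other cells are `0`. -/
def inputMemory {n : ℕ} (φ : Equiv.Perm (Fin n)) (i : Fin n) (l r l' r' : ℕ → ℕ) : Cell → ℕ
  | (.size, 0, 0) => n
  | (.phi, j, 0) => if h : j < n then φ ⟨j, h⟩ else 0
  | (.ins .T, 0, 0) => i
  | (.ins .S, 0, 0) => φ i
  | (.kid .T, v, 0) => l v
  | (.kid .T, v, 1) => r v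
  | (.kid .S, v, 0) => l' v
  | (.kid .S, v, 1) => r' v
  | _ => 0

/-- The state in which the machine stops, when it runs the Insertion algorithm. -/
def insertionRun {n : ℕ} (φ : Equiv.Perm (Fin n)) (i : Fin n) (l r l' r' : ℕ → ℕ) : State :=
  insertion.run { mem := inputMemory φ i l r l' r', time := 0, used := ∅ }

/-- The list of the leaves on the side `s` in the final state. -/
def State.output (s : State) (n : ℕ) (d : Side) : List ℕ :=
  (List.range n).map fun k => s.mem (.lay d, k, 0)

/-- The number of memory cells used. -/
def State.space (s : State) : ℕ := s.used.card

end Tangle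

set_option linter.unusedSimpArgs false

namespace Tangle

/-! ### Semantics of programs on memories -/

/-- The effect of a program on the memory. -/
def Prog.exec : Prog → (Cell → ℕ) → (Cell → ℕ)
  | .skip, m => m
  | .set x i j e, m => Function.update m (x, i.val m, j.val m) (e.val m)
  | .seq p q, m => q.exec (p.exec m)
  | .ite c p q, m => if c.val m then p.exec m else q.exec m
  | .loop x e p, m =>
    (List.range (e.val m)).foldl (fun m' k => p.exec (Function.update m' (x, 0, 0) k)) m

theorem Prog.run_mem (p : Prog) (s : State) : (p.run s).mem = p.exec s.mem := by
  induction p generalizing s with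
  | skip => rfl
  | set x i j e => rfl
  | seq p q hp hq => simp only [Prog.run, Prog.exec, hq, hp]
  | ite c p q hp hq =>
    simp only [Prog.run, Prog.exec]
    split_ifs <;> simp [hp, hq, State.charge]
  | loop x e p hp =>
    simp only [Prog.run, Prog.exec]
    have : ∀ (l : List ℕ) (s : State),
        (l.foldl (fun s' k => p.run ((s'.write (x, 0, 0) k).charge 1 ∅)) s).mem =
          l.foldl (fun m' k => p.exec (Function.update m' (x, 0, 0) k)) s.mem := by
      intro l
      induction l with
      | nil => intro s; rfl
      | cons a l ih => intro s; simp only [List.foldl_cons, ih, hp]; rfl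
    exact this _ _

/-- The program never writes to the array `y`. -/
def Prog.keeps (y : Name) : Prog → Bool
  | .skip => true
  | .set x _ _ _ => decide (x ≠ y)
  | .seq p q => p.keeps y && q.keeps y
  | .ite _ p q => p.keeps y && q.keeps y
  | .loop x _ p => decide (x ≠ y) && p.keeps y

theorem Prog.exec_of_keeps {p : Prog} {y : Name} (h : p.keeps y = true) (m : Cell → ℕ)
    (a b : ℕ) : p.exec m (y, a, b) = m (y, a, b) := by
  induction p generalizing m with
  | skip => rfl
  | set x i j e =>
    simp only [keeps, decide_eq_true_eq] at h
    simp [Prog.exec, Function.update_apply, Ne.symm h]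
  | seq p q hp hq =>
    simp only [keeps, Bool.and_eq_true] at h
    simp only [Prog.exec, hq h.2, hp h.1]
  | ite c p q hp hq =>
    simp only [keeps, Bool.and_eq_true] at h
    simp only [Prog.exec]
    split_ifs
    · exact hp h.1 m
    · exact hq h.2 m
  | loop x e p hp =>
    simp only [keeps, Bool.and_eq_true, decide_eq_true_eq] at h
    simp only [Prog.exec]
    have : ∀ (l : List ℕ) (m : Cell → ℕ),
        l.foldl (fun m' k => p.exec (Function.update m' (x, 0, 0) k)) m (y, a, b) =
          m (y, a, b) := by
      intro l
      induction l with
      | nil => intro m; rfl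
      | cons k l ih =>
        intro m
        simp only [List.foldl_cons, ih, hp h.2]
        simp [Function.update_apply, Ne.symm h.1]
    exact this _ _

/-- The memories `m` and `m'` agree on all arrays that the program `p` does not write to. -/
def Prog.Frame (p : Prog) (m m' : Cell → ℕ) : Prop :=
  ∀ y, p.keeps y = true → ∀ a b, m' (y, a, b) = m (y, a, b)

theorem Prog.frame_exec (p : Prog) (m : Cell → ℕ) : p.Frame m (p.exec m) :=
  fun _ h a b => p.exec_of_keeps h m a b

/-- Loop invariants. In the loop body one may use that the memory agrees with the memory before the
loop on all arrays that the loop does not write to. -/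
theorem Prog.loop_inv {x : Name} {e : Expr} {p : Prog} {m : Cell → ℕ} {N : ℕ} (hN : e.val m = N)
    (Inv : ℕ → (Cell → ℕ) → Prop) (h0 : Inv 0 m)
    (hs : ∀ k < N, ∀ m', (Prog.loop x e p).Frame m m' → Inv k m' →
      Inv (k + 1) (p.exec (Function.update m' (x, 0, 0) k))) :
    Inv N ((Prog.loop x e p).exec m) := by
  have key : ∀ k ≤ N, (Prog.loop x e p).Frame m
      ((List.range k).foldl (fun m' k => p.exec (Function.update m' (x, 0, 0) k)) m) ∧
      Inv k ((List.range k).foldl (fun m' k => p.exec (Function.update m' (x, 0, 0) k)) m) := by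
    intro k
    induction k with
    | zero => intro _; exact ⟨fun _ _ _ _ => rfl, h0⟩
    | succ k ih =>
      intro hk
      obtain ⟨h1, h2⟩ := ih (by omega)
      simp only [List.range_succ, List.foldl_append, List.foldl_cons, List.foldl_nil]
      refine ⟨?_, hs k (by omega) _ h1 h2⟩
      intro y hy a b
      have hy' := hy
      simp only [keeps, Bool.and_eq_true, decide_eq_true_eq] at hy'
      rw [p.exec_of_keeps hy'.2]
      simp only [Function.update_apply, Prod.mk.injEq, Ne.symm hy'.1, false_and, if_false]
      exact h1 y hy a b
  have := (key N le_rfl).2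
  simpa only [Prog.exec, hN] using this

/-! ### Time and space -/

theorem Expr.card_cells_le (e : Expr) (m : Cell → ℕ) : (e.cells m).card ≤ e.time := by
  induction e with
  | const k => simp [Expr.cells]
  | get x i j hi hj =>
    simp only [Expr.cells, Expr.time]
    refine (Finset.card_insert_le _ _).trans ?_
    have := Finset.card_union_le (i.cells m) (j.cells m)
    omega
  | succ e h => simp only [Expr.cells, Expr.time]; omega
  | pred e h => simp only [Expr.cells, Expr.time]; omega

theorem Cond.card_cells_le (c : Cond) (m : Cell → ℕ) : (c.cells m).card ≤ c.time := by
  induction c with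
  | lt e f =>
    have := Finset.card_union_le (e.cells m) (f.cells m)
    have := e.card_cells_le m
    have := f.card_cells_le m
    simp only [Cond.cells, Cond.time]; omega
  | eq e f =>
    have := Finset.card_union_le (e.cells m) (f.cells m)
    have := e.card_cells_le m
    have := f.card_cells_le m
    simp only [Cond.cells, Cond.time]; omega
  | not p h => simp only [Cond.cells, Cond.time]; omega
  | and p q hp hq =>
    have := Finset.card_union_le (p.cells m) (q.cells m)
    simp only [Cond.cells, Cond.time]; omega
  | or p q hp hq =>
    have := Finset.card_union_le (p.cells m) (q.cells m)
    simp only [Cond.cells, Cond.time]; omega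

theorem State.card_used_charge_le {s : State} (h : s.used.card ≤ s.time) {t : ℕ} {A : Finset Cell}
    (hA : A.card ≤ t) : (s.charge t A).used.card ≤ (s.charge t A).time := by
  have := Finset.card_union_le s.used A
  simp only [State.charge]; omega

theorem State.card_used_write_le {s : State} (h : s.used.card ≤ s.time) (c : Cell) (v : ℕ) :
    (s.write c v).used.card ≤ (s.write c v).time := by
  have := Finset.card_insert_le c s.used
  simp only [State.write]; omega

theorem Prog.card_used_run_le (p : Prog) {s : State} (h : s.used.card ≤ s.time) :
    (p.run s).used.card ≤ (p.run s).time := by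
  induction p generalizing s with
  | skip => exact h
  | set x i j e =>
    refine State.card_used_write_le (State.card_used_charge_le h ?_) _ _
    have := Finset.card_union_le (i.cells s.mem ∪ j.cells s.mem) (e.cells s.mem)
    have := Finset.card_union_le (i.cells s.mem) (j.cells s.mem)
    have := i.card_cells_le s.mem
    have := j.card_cells_le s.mem
    have := e.card_cells_le s.mem
    omega
  | seq p q hp hq => exact hq (hp h)
  | ite c p q hp hq =>
    have hc := c.card_cells_le s.mem
    simp only [Prog.run]
    split_ifs
    · exact hp (State.card_used_charge_le h (by omega))
    · exact hq (State.card_used_charge_le h (by omega))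
  | loop x e p hp =>
    have he := e.card_cells_le s.mem
    simp only [Prog.run]
    have : ∀ (l : List ℕ) (s : State), s.used.card ≤ s.time →
        (l.foldl (fun s' k => p.run ((s'.write (x, 0, 0) k).charge 1 ∅)) s).used.card ≤
        (l.foldl (fun s' k => p.run ((s'.write (x, 0, 0) k).charge 1 ∅)) s).time := by
      intro l
      induction l with
      | nil => intro s h; exact h
      | cons a l ih =>
        intro s h
        exact ih _ (hp (State.card_used_charge_le (State.card_used_write_le h _ _) (by simp)))
    exact this _ _ (State.card_used_charge_le h (by omega))

/-- The nesting depth of the loops of a program. -/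
def Prog.depth : Prog → ℕ
  | .skip => 0
  | .set _ _ _ _ => 0
  | .seq p q => max p.depth q.depth
  | .ite _ p q => max p.depth q.depth
  | .loop _ _ p => p.depth + 1

/-- The constant in the bound for the running time. -/
def Prog.coef : Prog → ℕ
  | .skip => 0
  | .set _ i j e => i.time + j.time + e.time + 1
  | .seq p q => p.coef + q.coef
  | .ite c p q => c.time + 1 + p.coef + q.coef
  | .loop _ e p => e.time + 1 + 2 * (2 + p.coef)

/-- All loops of the program are bounded by registers from the list `R`, and the program does not
write to these registers. -/
def Prog.boundedBy (R : List Name) : Prog → Bool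
  | .skip => true
  | .set x _ _ _ => decide (x ∉ R)
  | .seq p q => p.boundedBy R && q.boundedBy R
  | .ite _ p q => p.boundedBy R && q.boundedBy R
  | .loop x e p =>
    decide (x ∉ R) && p.boundedBy R &&
      match e with
      | .get y (.const 0) (.const 0) => decide (y ∈ R)
      | _ => false

theorem Prog.keeps_of_boundedBy {R : List Name} {y : Name} (hy : y ∈ R) {p : Prog}
    (h : p.boundedBy R = true) : p.keeps y = true := by
  induction p with
  | skip => rfl
  | set x i j e =>
    simp only [boundedBy, decide_eq_true_eq] at h
    simp only [keeps, decide_eq_true_eq]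
    rintro rfl; exact h hy
  | seq p q hp hq =>
    simp only [boundedBy, Bool.and_eq_true] at h
    simp only [keeps, Bool.and_eq_true]; exact ⟨hp h.1, hq h.2⟩
  | ite c p q hp hq =>
    simp only [boundedBy, Bool.and_eq_true] at h
    simp only [keeps, Bool.and_eq_true]; exact ⟨hp h.1, hq h.2⟩
  | loop x e p hp =>
    simp only [boundedBy, Bool.and_eq_true, decide_eq_true_eq] at h
    simp only [keeps, Bool.and_eq_true, decide_eq_true_eq]
    refine ⟨?_, hp h.1.2⟩
    rintro rfl; exact h.1.1 hy

theorem Prog.time_run_le {R : List Name} {n : ℕ} (hn : 1 ≤ n) (p : Prog)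
    (h : p.boundedBy R = true) {s : State} (hR : ∀ y ∈ R, s.mem (y, 0, 0) ≤ 2 * n) :
    (p.run s).time ≤ s.time + p.coef * n ^ p.depth := by
  induction p generalizing s with
  | skip => simp [Prog.run]
  | set x i j e =>
    simp only [Prog.run, State.write, State.charge, coef, depth, pow_zero]; omega
  | seq p q hp hq =>
    simp only [boundedBy, Bool.and_eq_true] at h
    have h1 := hp h.1 hR
    have h2 := hq h.2 (s := p.run s) (fun y hy => by
      rw [run_mem, exec_of_keeps (keeps_of_boundedBy hy h.1)]; exact hR y hy)
    simp only [Prog.run, coef, depth]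
    have h3 : n ^ p.depth ≤ n ^ max p.depth q.depth := Nat.pow_le_pow_right hn (le_max_left _ _)
    have h4 : n ^ q.depth ≤ n ^ max p.depth q.depth := Nat.pow_le_pow_right hn (le_max_right _ _)
    have h5 := Nat.mul_le_mul_left p.coef h3
    have h6 := Nat.mul_le_mul_left q.coef h4
    rw [add_mul]; omega
  | ite c p q hp hq =>
    simp only [boundedBy, Bool.and_eq_true] at h
    have h3 : n ^ p.depth ≤ n ^ max p.depth q.depth := Nat.pow_le_pow_right hn (le_max_left _ _)
    have h4 : n ^ q.depth ≤ n ^ max p.depth q.depth := Nat.pow_le_pow_right hn (le_max_right _ _)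
    have h5 := Nat.mul_le_mul_left p.coef h3
    have h6 := Nat.mul_le_mul_left q.coef h4
    have h7 := Nat.mul_le_mul_left (c.time + 1)
      (Nat.one_le_pow (max p.depth q.depth) n hn)
    have h1 := hp h.1 (s := s.charge (c.time + 1) (c.cells s.mem)) hR
    have h2 := hq h.2 (s := s.charge (c.time + 1) (c.cells s.mem)) hR
    have h8 : (s.charge (c.time + 1) (c.cells s.mem)).time = s.time + (c.time + 1) := rfl
    rw [h8] at h1 h2
    simp only [Prog.run, coef, depth]
    rw [add_mul, add_mul]
    split_ifs <;> omega
  | loop x e p hp =>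
    have hb := h
    simp only [boundedBy, Bool.and_eq_true, decide_eq_true_eq] at h
    obtain ⟨⟨hx, hpb⟩, he⟩ := h
    have heN : e.val s.mem ≤ 2 * n := by
      split at he
      · simp only [decide_eq_true_eq] at he
        exact hR _ he
      · simp at he
    have key : ∀ (l : List ℕ) (s : State), (∀ y ∈ R, s.mem (y, 0, 0) ≤ 2 * n) →
        (l.foldl (fun s' k => p.run ((s'.write (x, 0, 0) k).charge 1 ∅)) s).time ≤
        s.time + l.length * (2 + p.coef * n ^ p.depth) := by
      intro l
      induction l with
      | nil => intro s _; simp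
      | cons a l ih =>
        intro s hs
        have hs' : ∀ y ∈ R, ((s.write (x, 0, 0) a).charge 1 ∅).mem (y, 0, 0) ≤ 2 * n := by
          intro y hy
          have : y ≠ x := by rintro rfl; exact hx hy
          simpa [State.charge, State.write, Function.update_apply, this] using hs y hy
        have h1 := hp hpb hs'
        have h2 := ih (p.run ((s.write (x, 0, 0) a).charge 1 ∅)) (fun y hy => by
          rw [run_mem, exec_of_keeps (keeps_of_boundedBy hy hpb)]; exact hs' y hy)
        have h3 : ((s.write (x, 0, 0) a).charge 1 ∅).time = s.time + 2 := rfl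
        simp only [List.foldl_cons, List.length_cons]
        rw [add_mul]; omega
    have h1 := key (List.range (e.val s.mem)) (s.charge (e.time + 1) (e.cells s.mem)) hR
    have h8 : (s.charge (e.time + 1) (e.cells s.mem)).time = s.time + (e.time + 1) := rfl
    rw [h8, List.length_range] at h1
    simp only [Prog.run, coef, depth]
    have h2 := Nat.mul_le_mul_right (2 + p.coef * n ^ p.depth) heN
    have h3 := Nat.one_le_pow p.depth n hn
    have h4 : e.time + 1 ≤ (e.time + 1) * (n ^ (p.depth + 1)) :=
      Nat.le_mul_of_pos_right _ (Nat.one_le_pow _ n hn)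
    have h5 : 2 * n * (2 + p.coef * n ^ p.depth) ≤ 2 * (2 + p.coef) * n ^ (p.depth + 1) := by
      have : 2 * n * (2 + p.coef * n ^ p.depth) ≤
          2 * n * (2 * n ^ p.depth + p.coef * n ^ p.depth) := by gcongr; omega
      refine this.trans (le_of_eq ?_)
      ring
    rw [add_mul]; omega

/-! ### Evaluation rules -/

@[simp] theorem val_ofNat (k : ℕ) (m : Cell → ℕ) : (OfNat.ofNat k : Expr).val m = k := rfl
@[simp] theorem val_zero (m : Cell → ℕ) : (0 : Expr).val m = 0 := rfl
@[simp] theorem val_one (m : Cell → ℕ) : (1 : Expr).val m = 1 := rfl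
@[simp] theorem other_ne (s : Side) : s.other ≠ s := by cases s <;> decide
@[simp] theorem ne_other (s : Side) : s ≠ s.other := by cases s <;> decide
@[simp] theorem other_other (s : Side) : s.other.other = s := by cases s <;> rfl

@[simp] theorem update_cell (m : Cell → ℕ) (x y : Name) (i j i' j' v : ℕ) :
    Function.update m (x, i, j) v (y, i', j') =
      if y = x ∧ i' = i ∧ j' = j then v else m (y, i', j') := by
  simp [Function.update_apply]

attribute [simp] Expr.val Cond.val reg at1 put put1 incr decr when block all holds

@[simp] theorem exec_skip (m : Cell → ℕ) : Prog.skip.exec m = m := rfl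
@[simp] theorem exec_set (x : Name) (i j e : Expr) (m : Cell → ℕ) :
    (Prog.set x i j e).exec m = Function.update m (x, i.val m, j.val m) (e.val m) := rfl
@[simp] theorem exec_seq (p q : Prog) (m : Cell → ℕ) :
    (Prog.seq p q).exec m = q.exec (p.exec m) := rfl
@[simp] theorem exec_ite (c : Cond) (p q : Prog) (m : Cell → ℕ) :
    (Prog.ite c p q).exec m = if c.val m = true then p.exec m else q.exec m := rfl

theorem insertion_eq : ∃ p q, insertion = .seq (.seq countVerts p) q ∧
    countVerts.boundedBy [.size] = true ∧ countVerts.depth ≤ 2 ∧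
    (Prog.seq p q).boundedBy [.size, .verts] = true ∧ (Prog.seq p q).depth ≤ 2 := by
  refine ⟨_, _, rfl, ?_, ?_, ?_, ?_⟩
  · rfl
  · decide
  · rfl
  · decide

end Tangle

namespace Tangle

/-! ### Tree hierarchies on the index set of the edges -/

/-- A rooted binary tree with the vertices `0, …, 2n - 2`, whose leaves are the vertices below `n`,
described by the children `k0 v`, `k1 v` of the internal vertices and by the sets
`{j | c v j}` of (indices of) edges that end below `v`. The edge `j` ends in the leaf `e j`. -/
structure Hier (n : ℕ) (e k0 k1 : ℕ → ℕ) (c : ℕ → ℕ → Prop) : Prop where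
  e_lt : ∀ j < n, e j < n
  e_inj : ∀ j < n, ∀ k < n, e j = e k → j = k
  e_surj : ∀ v < n, ∃ j < n, e j = v
  c_lt : ∀ v j, c v j → j < n
  kid0_lt : ∀ v, n ≤ v → v < 2 * n - 1 → k0 v < v
  kid1_lt : ∀ v, n ≤ v → v < 2 * n - 1 → k1 v < v
  leaf : ∀ v < n, ∀ j < n, (c v j ↔ e j = v)
  node : ∀ v, n ≤ v → v < 2 * n - 1 → ∀ j, (c v j ↔ c (k0 v) j ∨ c (k1 v) j)
  disj : ∀ v, n ≤ v → v < 2 * n - 1 → ∀ j, c (k0 v) j → ¬ c (k1 v) j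
  root : ∀ j < n, c (2 * n - 2) j
  laminar : ∀ u < 2 * n - 1, ∀ v < 2 * n - 1, (∀ j, c u j → c v j) ∨ (∀ j, c v j → c u j) ∨
    ∀ j, c u j → ¬ c v j
  inj : ∀ u < 2 * n - 1, ∀ v < 2 * n - 1, (∀ j, c u j ↔ c v j) → u = v
  mono : ∀ u < 2 * n - 1, ∀ v < 2 * n - 1, (∀ j, c u j → c v j) → u ≤ v

namespace Hier

variable {n : ℕ} {e k0 k1 : ℕ → ℕ} {c : ℕ → ℕ → Prop}

theorem nonempty (H : Hier n e k0 k1 c) (v : ℕ) (hv : v < 2 * n - 1) : ∃ j, c v j := by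
  induction v using Nat.strong_induction_on with
  | _ v ih =>
    rcases lt_or_ge v n with h | h
    · obtain ⟨j, hj, rfl⟩ := H.e_surj v h
      exact ⟨j, (H.leaf _ h j hj).2 rfl⟩
    · obtain ⟨j, hj⟩ := ih (k0 v) (H.kid0_lt v h hv) ((H.kid0_lt v h hv).trans hv)
      exact ⟨j, (H.node v h hv j).2 (Or.inl hj)⟩

/-- A proper descendant is a descendant of one of the children. -/
theorem le_kid (H : Hier n e k0 k1 c) {u w : ℕ} (hu : u < 2 * n - 1) (hw : w < 2 * n - 1)
    (h : ∀ j, c u j → c w j) (hne : u ≠ w) :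
    n ≤ w ∧ ((∀ j, c u j → c (k0 w) j) ∨ ∀ j, c u j → c (k1 w) j) := by
  have hwn : n ≤ w := by
    by_contra hlt
    push Not at hlt
    apply hne
    apply H.inj u hu w hw
    intro j
    refine ⟨h j, fun hj => ?_⟩
    obtain ⟨k, hk⟩ := H.nonempty u hu
    have h1 := (H.leaf w hlt j (H.c_lt _ _ hj)).1 hj
    have h2 := (H.leaf w hlt k (H.c_lt _ _ hk)).1 (h k hk)
    rwa [H.e_inj j (H.c_lt _ _ hj) k (H.c_lt _ _ hk) (h1.trans h2.symm)]
  refine ⟨hwn, ?_⟩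
  have hk0 := (H.kid0_lt w hwn hw).trans hw
  have hk1 := (H.kid1_lt w hwn hw).trans hw
  have hnode := H.node w hwn hw
  obtain ⟨x, hx⟩ := H.nonempty u hu
  rcases H.laminar u hu _ hk0 with h0 | h0 | h0
  · exact Or.inl h0
  · rcases H.laminar u hu _ hk1 with h1 | h1 | h1
    · exact Or.inr h1
    · exact absurd (H.inj u hu w hw fun j => ⟨h j, fun hj => ((hnode j).1 hj).elim (h0 j) (h1 j)⟩)
        hne
    · left; intro j hj
      exact ((hnode j).1 (h j hj)).resolve_right (h1 j hj)
  · right; intro j hj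
    exact ((hnode j).1 (h j hj)).resolve_left (h0 j hj)

/-- The edges `j` and `k` end below different children of `w`. -/
def Split (k0 k1 : ℕ → ℕ) (c : ℕ → ℕ → Prop) (w j k : ℕ) : Prop :=
  (c (k0 w) j ∧ c (k1 w) k) ∨ (c (k1 w) j ∧ c (k0 w) k)

theorem Split.symm {w j k : ℕ} (h : Split k0 k1 c w j k) : Split k0 k1 c w k j := by
  unfold Split at *; tauto

theorem Split.ne (H : Hier n e k0 k1 c) {w j k : ℕ} (hw : n ≤ w) (hw' : w < 2 * n - 1)
    (h : Split k0 k1 c w j k) : j ≠ k := by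
  rintro rfl
  have := H.disj w hw hw' j
  unfold Split at h; tauto

theorem Split.left (H : Hier n e k0 k1 c) {w j k : ℕ} (hw : n ≤ w) (hw' : w < 2 * n - 1)
    (h : Split k0 k1 c w j k) : c w j := by
  rw [H.node w hw hw']; unfold Split at h; tauto

theorem Split.right (H : Hier n e k0 k1 c) {w j k : ℕ} (hw : n ≤ w) (hw' : w < 2 * n - 1)
    (h : Split k0 k1 c w j k) : c w k :=
  h.symm.left H hw hw'

/-- The smallest vertex above a set of at least two leaves. -/
theorem exists_cover (H : Hier n e k0 k1 c) (A : ℕ → Prop) {x y : ℕ} (hA : ∀ j, A j → j < n)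
    (hx : A x) (hy : A y) (hxy : x ≠ y) :
    ∃ w, n ≤ w ∧ w < 2 * n - 1 ∧ (∀ j, A j → c w j) ∧ (∃ j, A j ∧ c (k0 w) j) ∧
      (∃ j, A j ∧ c (k1 w) j) ∧
      ∀ u < 2 * n - 1, (∀ j, A j → c u j) → ∀ j, c w j → c u j := by
  classical
  have hn := hA x hx
  have hex : ∃ w, w < 2 * n - 1 ∧ ∀ j, A j → c w j :=
    ⟨2 * n - 2, by omega, fun j hj => H.root j (hA j hj)⟩
  obtain ⟨hw, hwA⟩ := Nat.find_spec hex
  have hmin := fun u hu => Nat.find_min hex (m := u) hu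
  set w := Nat.find hex
  have hnw : n ≤ w := by
    by_contra hlt
    push Not at hlt
    exact hxy (H.e_inj x (hA x hx) y (hA y hy)
      (((H.leaf w hlt x (hA x hx)).1 (hwA x hx)).trans
        ((H.leaf w hlt y (hA y hy)).1 (hwA y hy)).symm))
  have hk0 := H.kid0_lt w hnw hw
  have hk1 := H.kid1_lt w hnw hw
  have hnode := H.node w hnw hw
  refine ⟨w, hnw, hw, hwA, ?_, ?_, ?_⟩
  · by_contra hno
    push Not at hno
    exact hmin _ hk1 ⟨hk1.trans hw, fun j hj =>
      ((hnode j).1 (hwA j hj)).resolve_left (hno j hj)⟩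
  · by_contra hno
    push Not at hno
    exact hmin _ hk0 ⟨hk0.trans hw, fun j hj =>
      ((hnode j).1 (hwA j hj)).resolve_right (hno j hj)⟩
  · intro u hu huA
    rcases H.laminar u hu w hw with h | h | h
    · have h1 := H.mono u hu w hw h
      have h2 : ¬ u < w := fun h2 => hmin u h2 ⟨hu, huA⟩
      have : u = w := by omega
      rw [this]; exact fun _ h => h
    · exact h
    · exact absurd (hwA x hx) (h x (huA x hx))

/-- The lowest common ancestor of two leaves. -/
theorem exists_split (H : Hier n e k0 k1 c) {j k : ℕ} (hj : j < n) (hk : k < n) (hjk : j ≠ k) :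
    ∃ w, n ≤ w ∧ w < 2 * n - 1 ∧ Split k0 k1 c w j k := by
  obtain ⟨w, h1, h2, -, ⟨a, ha, ha'⟩, ⟨b, hb, hb'⟩, -⟩ :=
    H.exists_cover (fun x => x = j ∨ x = k) (by rintro x (rfl | rfl) <;> assumption)
      (Or.inl rfl) (Or.inr rfl) hjk
  refine ⟨w, h1, h2, ?_⟩
  have hd := H.disj w h1 h2
  have := hd j
  have := hd k
  rcases ha with rfl | rfl <;> rcases hb with rfl | rfl <;> unfold Split <;> tauto

/-- A vertex above two leaves is above their lowest common ancestor. -/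
theorem Split.le (H : Hier n e k0 k1 c) {w j k u : ℕ} (hw : n ≤ w) (hw' : w < 2 * n - 1)
    (h : Split k0 k1 c w j k) (hu : u < 2 * n - 1) (hj : c u j) (hk : c u k) :
    ∀ x, c w x → c u x := by
  have hjw := h.left H hw hw'
  rcases H.laminar u hu w hw' with h1 | h1 | h1
  · rcases eq_or_ne u w with rfl | hne
    · exact fun _ h => h
    · have := H.disj w hw hw'
      unfold Split at h
      rcases (H.le_kid hu hw' h1 hne).2 with h2 | h2
      · have := h2 j hj; have := h2 k hk; grind
      · have := h2 j hj; have := h2 k hk; grind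
  · exact h1
  · exact absurd hjw (h1 j hj)

/-! ### Orders of the leaves -/

/-- The relation `b` is the order, from top to bottom, of the leaves in some drawing of the tree:
at each internal vertex, one of the children is above the other one. -/
structure IsOrder (n : ℕ) (k0 k1 : ℕ → ℕ) (c : ℕ → ℕ → Prop) (b : ℕ → ℕ → Prop) : Prop where
  total : ∀ j < n, ∀ k < n, j ≠ k → (b j k ↔ ¬ b k j)
  split : ∀ w, n ≤ w → w < 2 * n - 1 → ∀ x x' y y', c (k0 w) x → c (k0 w) x' → c (k1 w) y →
    c (k1 w) y' → (b x y ↔ b x' y')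

/-- A leaf that is not below `u` is on the same side of all leaves below `u`. -/
theorem IsOrder.contig (H : Hier n e k0 k1 c) {b : ℕ → ℕ → Prop} (hb : IsOrder n k0 k1 c b)
    {u j k m : ℕ} (hu : u < 2 * n - 1) (hj : c u j) (hk : c u k) (hmn : m < n) (hm : ¬ c u m) :
    (b j m ↔ b k m) ∧ (b m j ↔ b m k) := by
  have hjn := H.c_lt _ _ hj
  have hkn := H.c_lt _ _ hk
  have h2 : b j m ↔ b k m := by
    obtain ⟨w, hw, hw', hs⟩ := H.exists_split hjn hmn (by rintro rfl; exact hm hj)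
    have hjw := hs.left H hw hw'
    have hmw := hs.right H hw hw'
    have hle : ∀ x, c u x → c w x := by
      rcases H.laminar u hu w hw' with h1 | h1 | h1
      · exact h1
      · exact absurd (h1 m hmw) hm
      · exact absurd hjw (h1 j hj)
    have hd := H.disj w hw hw'
    have hsp := hb.split w hw hw'
    rcases hs with ⟨hs1, hs2⟩ | ⟨hs1, hs2⟩
    · have hk0 : c (k0 w) k := by
        rcases (H.le_kid hu hw' hle (by rintro rfl; exact hm hmw)).2 with h3 | h3
        · exact h3 k hk
        · exact absurd (h3 j hj) (hd j hs1)
      exact hsp j k m m hs1 hk0 hs2 hs2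
    · have hk0 : c (k1 w) k := by
        rcases (H.le_kid hu hw' hle (by rintro rfl; exact hm hmw)).2 with h3 | h3
        · exact absurd hs1 (hd j (h3 j hj))
        · exact h3 k hk
      have h4 := hsp m m j k hs2 hs2 hs1 hk0
      have h5 := hb.total j hjn m hmn (by rintro rfl; exact hm hj)
      have h6 := hb.total k hkn m hmn (by rintro rfl; exact hm hk)
      tauto
  have h5 := hb.total j hjn m hmn (by rintro rfl; exact hm hj)
  have h6 := hb.total k hkn m hmn (by rintro rfl; exact hm hk)
  tauto

/-- Reversing the order of the leaves below `u`. -/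
def flipOrder (c : ℕ → ℕ → Prop) (u : ℕ) (b : ℕ → ℕ → Prop) (j k : ℕ) : Prop :=
  (c u j ∧ c u k ∧ b k j) ∨ (¬ (c u j ∧ c u k) ∧ b j k)

theorem IsOrder.flip (H : Hier n e k0 k1 c) {b : ℕ → ℕ → Prop} (hb : IsOrder n k0 k1 c b)
    {u : ℕ} (hu : u < 2 * n - 1) : IsOrder n k0 k1 c (flipOrder c u b) := by
  constructor
  · intro j hj k hk hjk
    have := hb.total j hj k hk hjk
    unfold flipOrder; tauto
  · intro w hw hw' x x' y y' hx hx' hy hy'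
    have hs := hb.split w hw hw' x x' y y' hx hx' hy hy'
    have h1 : Split k0 k1 c w x y := Or.inl ⟨hx, hy⟩
    have h1' : Split k0 k1 c w x' y' := Or.inl ⟨hx', hy'⟩
    have h2 := hb.total x (H.c_lt _ _ hx) y (H.c_lt _ _ hy) (h1.ne H hw hw')
    have h2' := hb.total x' (H.c_lt _ _ hx') y' (H.c_lt _ _ hy') (h1'.ne H hw hw')
    have h3 : c u x → c u y → c u x' ∧ c u y' := fun hux huy =>
      ⟨h1.le H hw hw' hu hux huy x' (h1'.left H hw hw'),
        h1.le H hw hw' hu hux huy y' (h1'.right H hw hw')⟩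
    have h4 : c u x' → c u y' → c u x ∧ c u y := fun hux huy =>
      ⟨h1'.le H hw hw' hu hux huy x (h1.left H hw hw'),
        h1'.le H hw hw' hu hux huy y (h1.right H hw hw')⟩
    unfold flipOrder
    tauto

end Hier

/-- A tanglegram together with an index `i`, with both trees described on the index set of the
edges. -/
structure Setup where
  n : ℕ
  i : ℕ
  e : Side → ℕ → ℕ
  k0 : Side → ℕ → ℕ
  k1 : Side → ℕ → ℕ
  c : Side → ℕ → ℕ → Prop
  two_le : 2 ≤ n
  i_lt : i < n
  hier : ∀ s, Hier n (e s) (k0 s) (k1 s) (c s)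

namespace Setup

open Hier

variable (G : Setup)

/-- The vertex `v`, on the side `s`, is below `u`. -/
def Le (s : Side) (v u : ℕ) : Prop := ∀ j, G.c s v j → G.c s u j

/-- `u` is an internal vertex of the tree induced by `[n] ∖ {i}`. -/
structure Red (s : Side) (u : ℕ) : Prop where
  ge : G.n ≤ u
  lt : u < 2 * G.n - 1
  kid0 : ∃ j, j ≠ G.i ∧ G.c s (G.k0 s u) j
  kid1 : ∃ j, j ≠ G.i ∧ G.c s (G.k1 s u) j

/-- The vertices `u` and `v` are above the same edges of the induced subtanglegram. -/
def Matched (s : Side) (u v : ℕ) : Prop := ∀ j, j ≠ G.i → (G.c s u j ↔ G.c s.other v j)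

/-- Matched internal vertices of the two induced trees. -/
structure Pair (s : Side) (u v : ℕ) : Prop where
  left : G.Red s u
  right : G.Red s.other v
  matched : G.Matched s u v

/-- A pair of orders of the leaves of the two trees that restricts to a planar layout. -/
structure Planar (b : Side → ℕ → ℕ → Prop) : Prop where
  order : ∀ s, IsOrder G.n (G.k0 s) (G.k1 s) (G.c s) (b s)
  planar : ∀ s, ∀ j < G.n, ∀ k < G.n, j ≠ G.i → k ≠ G.i → (b s j k ↔ b s.other j k)

/-- The edge `j` crosses the inserted edge. -/
def Crosses (b : Side → ℕ → ℕ → Prop) (j : ℕ) : Prop := ¬ (b .T j G.i ↔ b .S j G.i)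

/-- The vertex `u` is the parent of the inserted leaf. -/
structure Parent (s : Side) (u : ℕ) : Prop where
  ge : G.n ≤ u
  lt : u < 2 * G.n - 1
  kid : (∀ j, G.c s (G.k0 s u) j ↔ j = G.i) ∨ (∀ j, G.c s (G.k1 s u) j ↔ j = G.i)

/-- The vertices of the pairs in `L(I)_T` or `L(I)_S`. -/
def Own (s : Side) (u : ℕ) : Prop :=
  ∃ v, G.Pair s u v ∧ G.c s u G.i ∧ ¬ G.c s.other v G.i

variable {G}

theorem Pair.symm {s : Side} {u v : ℕ} (h : G.Pair s u v) : G.Pair s.other v u :=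
  ⟨h.right, by simpa using h.left, fun j hj => by simpa using (h.matched j hj).symm⟩

/-- Among all vertices, `Red` vertices are determined by the edges of the subtanglegram. -/
theorem Red.le {s : Side} {u u' : ℕ} (h : G.Red s u) (hu' : u' < 2 * G.n - 1)
    (hs : ∀ j, j ≠ G.i → G.c s u j → G.c s u' j) : G.Le s u u' := by
  obtain ⟨x, hx, hx'⟩ := h.kid0
  obtain ⟨y, hy, hy'⟩ := h.kid1
  have hsp : Split (G.k0 s) (G.k1 s) (G.c s) u x y := Or.inl ⟨hx', hy'⟩
  exact hsp.le (G.hier s) h.ge h.lt hu' (hs x hx (hsp.left (G.hier s) h.ge h.lt))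
    (hs y hy (hsp.right (G.hier s) h.ge h.lt))

theorem Pair.le {s : Side} {u v u' v' : ℕ} (h : G.Pair s u v) (h' : G.Pair s u' v')
    (hle : ∀ j, j ≠ G.i → G.c s u j → G.c s u' j) : G.Le s u u' ∧ G.Le s.other v v' :=
  ⟨h.left.le h'.left.lt hle, h.right.le h'.right.lt fun j hj hv =>
    (h'.matched j hj).1 (hle j hj ((h.matched j hj).2 hv))⟩

/-! ### Rigidity of planar layouts -/

/-- The two layouts differ in the order of the children of `w`. -/
def Differ (G : Setup) (b b' : Side → ℕ → ℕ → Prop) (s : Side) (w : ℕ) : Prop :=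
  ∃ x y, Split (G.k0 s) (G.k1 s) (G.c s) w x y ∧ ¬ (b s x y ↔ b' s x y)

section

variable {b b' : Side → ℕ → ℕ → Prop}

theorem Planar.differ_iff (hb : G.Planar b) (hb' : G.Planar b') {s : Side} {w x y : ℕ}
    (hw : G.n ≤ w) (hw' : w < 2 * G.n - 1) (h : Split (G.k0 s) (G.k1 s) (G.c s) w x y) :
    G.Differ b b' s w ↔ ¬ (b s x y ↔ b' s x y) := by
  refine ⟨?_, fun h' => ⟨x, y, h, h'⟩⟩
  rintro ⟨x', y', hs, hd⟩
  have H := G.hier s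
  have h1 := (hb.order s).split w hw hw'
  have h2 := (hb'.order s).split w hw hw'
  have hxn := H.c_lt _ _ (h.left H hw hw')
  have hyn := H.c_lt _ _ (h.right H hw hw')
  have h3 := (hb.order s).total x hxn y hyn (h.ne H hw hw')
  have h4 := (hb'.order s).total x hxn y hyn (h.ne H hw hw')
  rcases h with ⟨ha, hc⟩ | ⟨ha, hc⟩ <;> rcases hs with ⟨ha', hc'⟩ | ⟨ha', hc'⟩
  · have := h1 _ _ _ _ ha ha' hc hc'
    have := h2 _ _ _ _ ha ha' hc hc'
    grind
  · have := h1 _ _ _ _ ha hc' hc ha'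
    have := h2 _ _ _ _ ha hc' hc ha'
    have h5 := (hb.order s).total x' (H.c_lt _ _ ha') y' (H.c_lt _ _ hc')
      (Split.ne H hw hw' (Or.inr ⟨ha', hc'⟩))
    have h6 := (hb'.order s).total x' (H.c_lt _ _ ha') y' (H.c_lt _ _ hc')
      (Split.ne H hw hw' (Or.inr ⟨ha', hc'⟩))
    grind
  · have := h1 _ _ _ _ hc ha' ha hc'
    have := h2 _ _ _ _ hc ha' ha hc'
    grind
  · have := h1 _ _ _ _ hc hc' ha ha'
    have := h2 _ _ _ _ hc hc' ha ha'
    have h5 := (hb.order s).total x' (H.c_lt _ _ ha') y' (H.c_lt _ _ hc')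
      (Split.ne H hw hw' (Or.inr ⟨ha', hc'⟩))
    have h6 := (hb'.order s).total x' (H.c_lt _ _ ha') y' (H.c_lt _ _ hc')
      (Split.ne H hw hw' (Or.inr ⟨ha', hc'⟩))
    grind

/-- If `z` is the smallest vertex above the edges of the subtanglegram below `w`, then two planar
layouts differ at `z` if and only if they differ at `w`. -/
theorem Planar.differ_cover (hb : G.Planar b) (hb' : G.Planar b') {s : Side} {w z : ℕ}
    (hw : G.Red s w) (hz : G.n ≤ z) (hz' : z < 2 * G.n - 1)
    (hle : ∀ j, j ≠ G.i → G.c s w j → G.c s.other z j)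
    (h0 : ∃ j, (j ≠ G.i ∧ G.c s w j) ∧ G.c s.other (G.k0 s.other z) j)
    (h1 : ∃ j, (j ≠ G.i ∧ G.c s w j) ∧ G.c s.other (G.k1 s.other z) j) :
    G.Differ b b' s w ↔ G.Differ b b' s.other z := by
  have H := G.hier s
  have H' := G.hier s.other
  obtain ⟨p, ⟨hpi, hpw⟩, hp⟩ := h0
  obtain ⟨q, ⟨hqi, hqw⟩, hq⟩ := h1
  obtain ⟨x, hxi, hx⟩ := hw.kid0
  obtain ⟨y, hyi, hy⟩ := hw.kid1
  have hnode := H.node w hw.ge hw.lt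
  have hnode' := H'.node z hz hz'
  have hxw := (hnode x).2 (Or.inl hx)
  have hyw := (hnode y).2 (Or.inr hy)
  have hxz := (hnode' x).1 (hle x hxi hxw)
  have hyz := (hnode' y).1 (hle y hyi hyw)
  have hpw' := (hnode p).1 hpw
  have hqw' := (hnode q).1 hqw
  obtain ⟨g, h, hg, hh, hgi, hhi⟩ : ∃ g h, Split (G.k0 s) (G.k1 s) (G.c s) w g h ∧
      Split (G.k0 s.other) (G.k1 s.other) (G.c s.other) z g h ∧ g ≠ G.i ∧ h ≠ G.i := by
    unfold Split
    by_cases hpx : G.c s (G.k0 s w) p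
    · by_cases hqx : G.c s (G.k1 s w) q
      · exact ⟨p, q, Or.inl ⟨hpx, hqx⟩, Or.inl ⟨hp, hq⟩, hpi, hqi⟩
      · have hqx' := hqw'.resolve_right hqx
        rcases hyz with hyz | hyz
        · exact ⟨q, y, Or.inl ⟨hqx', hy⟩, Or.inr ⟨hq, hyz⟩, hqi, hyi⟩
        · exact ⟨p, y, Or.inl ⟨hpx, hy⟩, Or.inl ⟨hp, hyz⟩, hpi, hyi⟩
    · have hpx' := hpw'.resolve_left hpx
      by_cases hqx : G.c s (G.k1 s w) q
      · rcases hxz with hxz | hxz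
        · exact ⟨q, x, Or.inr ⟨hqx, hx⟩, Or.inr ⟨hq, hxz⟩, hqi, hxi⟩
        · exact ⟨p, x, Or.inr ⟨hpx', hx⟩, Or.inl ⟨hp, hxz⟩, hpi, hxi⟩
      · exact ⟨p, q, Or.inr ⟨hpx', hqw'.resolve_right hqx⟩, Or.inl ⟨hp, hq⟩, hpi, hqi⟩
  rw [hb.differ_iff hb' hw.ge hw.lt hg, hb.differ_iff hb' hz hz' hh]
  have hgn := H.c_lt _ _ (hg.left H hw.ge hw.lt)
  have hhn := H.c_lt _ _ (hg.right H hw.ge hw.lt)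
  rw [hb.planar s g hgn h hhn hgi hhi, hb'.planar s g hgn h hhn hgi hhi]

theorem Pair.differ_iff {s : Side} {u v : ℕ} (h : G.Pair s u v) (hb : G.Planar b)
    (hb' : G.Planar b') : G.Differ b b' s u ↔ G.Differ b b' s.other v := by
  have hnode := (G.hier s.other).node v h.right.ge h.right.lt
  refine hb.differ_cover hb' h.left h.right.ge h.right.lt (fun j hj => (h.matched j hj).1) ?_ ?_
  · obtain ⟨j, hj, hj'⟩ := h.right.kid0
    exact ⟨j, ⟨hj, (h.matched j hj).2 ((hnode j).2 (Or.inl hj'))⟩, hj'⟩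
  · obtain ⟨j, hj, hj'⟩ := h.right.kid1
    exact ⟨j, ⟨hj, (h.matched j hj).2 ((hnode j).2 (Or.inr hj'))⟩, hj'⟩

/-- Two planar layouts differ at `w` if and only if they differ at the smallest vertex `u ≥ w` that
belongs to a pair. -/
theorem Planar.differ_pair (hb : G.Planar b) (hb' : G.Planar b') {s : Side} {u v : ℕ}
    (huv : G.Pair s u v) (w : ℕ) (hw : G.Red s w) (hwu : G.Le s w u)
    (hmin : ∀ u' v', G.Pair s u' v' → G.Le s w u' → G.Le s u u') :
    G.Differ b b' s w ↔ G.Differ b b' s u := by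
  have H := G.hier s
  have H' := G.hier s.other
  induction hk : 2 * G.n - 1 - w using Nat.strong_induction_on generalizing w with
  | _ k ih =>
  obtain ⟨x, hxi, hx⟩ := hw.kid0
  obtain ⟨y, hyi, hy⟩ := hw.kid1
  have hnode := H.node w hw.ge hw.lt
  have hxw := (hnode x).2 (Or.inl hx)
  have hyw := (hnode y).2 (Or.inr hy)
  obtain ⟨z, hz, hz', hcov, h0, h1, hzmin⟩ := H'.exists_cover (fun j => j ≠ G.i ∧ G.c s w j)
    (fun j hj => H.c_lt _ _ hj.2) ⟨hxi, hxw⟩ ⟨hyi, hyw⟩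
    (by rintro rfl; exact H.disj w hw.ge hw.lt x hx hy)
  have hdz := hb.differ_cover hb' hw hz hz' (fun j h1 h2 => hcov j ⟨h1, h2⟩) h0 h1
  by_cases hall : ∀ m, m ≠ G.i → G.c s.other z m → G.c s w m
  · have hp : G.Pair s w z := by
      refine ⟨hw, ⟨hz, hz', ?_, ?_⟩, fun j hj => ⟨fun h => hcov j ⟨hj, h⟩, hall j hj⟩⟩
      · obtain ⟨j, hj, hj'⟩ := h0
        exact ⟨j, hj.1, hj'⟩
      · obtain ⟨j, hj, hj'⟩ := h1
        exact ⟨j, hj.1, hj'⟩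
    have := hmin w z hp (fun _ h => h)
    rw [H.inj w hw.lt u huv.left.lt fun j => ⟨hwu j, this j⟩]
  · push Not at hall
    obtain ⟨m, hmi, hmz, hmw⟩ := hall
    obtain ⟨p, hpi, hpw, hsp⟩ : ∃ p, p ≠ G.i ∧ G.c s w p ∧
        Split (G.k0 s.other) (G.k1 s.other) (G.c s.other) z m p := by
      obtain ⟨p, hp, hp'⟩ := h0
      obtain ⟨q, hq, hq'⟩ := h1
      rcases (H'.node z hz hz' m).1 hmz with h | h
      · exact ⟨q, hq.1, hq.2, Or.inl ⟨h, hq'⟩⟩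
      · exact ⟨p, hp.1, hp.2, Or.inr ⟨h, hp'⟩⟩
    have hmn := H'.c_lt _ _ hmz
    have hpn := H.c_lt _ _ hpw
    obtain ⟨w', hw1, hw2, hs⟩ := H.exists_split hmn hpn (by rintro rfl; exact hmw hpw)
    have hred : G.Red s w' := by
      refine ⟨hw1, hw2, ?_, ?_⟩ <;> unfold Split at hs <;> grind
    have hmw' := hs.left H hw1 hw2
    have hpw' := hs.right H hw1 hw2
    have hww' : G.Le s w w' := by
      rcases H.laminar w hw.lt w' hw2 with h | h | h
      · exact h
      · exact absurd (h m hmw') hmw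
      · exact absurd hpw' (h p hpw)
    have hlt : w < w' := lt_of_le_of_ne (H.mono w hw.lt w' hw2 hww')
      (by rintro rfl; exact hmw hmw')
    have hzv := hzmin v huv.right.lt (fun j hj => (huv.matched j hj.1).1 (hwu j hj.2))
    have hmu : G.c s u m := (huv.matched m hmi).2 (hzv m hmz)
    have hw'u : G.Le s w' u := hs.le H hw1 hw2 huv.left.lt hmu (hwu p hpw)
    rw [hdz, hb.differ_iff hb' hz hz' hsp, ← hb.planar s m hmn p hpn hmi hpi,
      ← hb'.planar s m hmn p hpn hmi hpi, ← hb.differ_iff hb' hw1 hw2 hs]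
    exact ih _ (by omega) w' hred hw'u
      (fun u' v' h h' => hmin u' v' h fun j hj => h' j (hww' j hj)) rfl

/-- The root pair. -/
theorem exists_pair (G : Setup) (s : Side) {x y : ℕ} (hx : x < G.n) (hy : y < G.n) (hxy : x ≠ y)
    (hxi : x ≠ G.i) (hyi : y ≠ G.i) :
    ∃ u v, G.Pair s u v ∧ ∀ j < G.n, j ≠ G.i → G.c s u j := by
  obtain ⟨u, h1, h2, h3, ⟨p, hp, hp'⟩, ⟨q, hq, hq'⟩, -⟩ :=
    (G.hier s).exists_cover (fun j => j < G.n ∧ j ≠ G.i) (fun j h => h.1) ⟨hx, hxi⟩ ⟨hy, hyi⟩ hxy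
  obtain ⟨v, h1', h2', h3', ⟨r, hr, hr'⟩, ⟨t, ht, ht'⟩, -⟩ :=
    (G.hier s.other).exists_cover (fun j => j < G.n ∧ j ≠ G.i) (fun j h => h.1) ⟨hx, hxi⟩
      ⟨hy, hyi⟩ hxy
  refine ⟨u, v, ⟨⟨h1, h2, ⟨p, hp.2, hp'⟩, ⟨q, hq.2, hq'⟩⟩,
    ⟨h1', h2', ⟨r, hr.2, hr'⟩, ⟨t, ht.2, ht'⟩⟩, fun j hj => ?_⟩, fun j hj hj' => h3 j ⟨hj, hj'⟩⟩
  exact ⟨fun h => h3' j ⟨(G.hier s).c_lt _ _ h, hj⟩,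
    fun h => h3 j ⟨(G.hier s.other).c_lt _ _ h, hj⟩⟩

theorem Parent.inserted {s : Side} {u : ℕ} (h : G.Parent s u) : G.c s u G.i := by
  rw [(G.hier s).node u h.ge h.lt]
  rcases h.kid with h | h
  · left; rw [h]
  · right; rw [h]

theorem Parent.exists_ne {s : Side} {u : ℕ} (h : G.Parent s u) : ∃ j, j ≠ G.i ∧ G.c s u j := by
  have H := G.hier s
  have h0 := (H.kid0_lt u h.ge h.lt).trans h.lt
  have h1 := (H.kid1_lt u h.ge h.lt).trans h.lt
  have hd := H.disj u h.ge h.lt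
  have hnode := H.node u h.ge h.lt
  obtain ⟨x, hx⟩ := H.nonempty _ h0
  obtain ⟨y, hy⟩ := H.nonempty _ h1
  rcases h.kid with h | h
  · refine ⟨y, ?_, (hnode y).2 (Or.inr hy)⟩
    rintro rfl; exact hd _ ((h _).2 rfl) hy
  · refine ⟨x, ?_, (hnode x).2 (Or.inl hx)⟩
    rintro rfl; exact hd _ hx ((h _).2 rfl)

theorem Parent.split {s : Side} {u j : ℕ} (h : G.Parent s u) (hj : G.c s u j) (hji : j ≠ G.i) :
    Split (G.k0 s) (G.k1 s) (G.c s) u j G.i := by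
  have hnode := (G.hier s).node u h.ge h.lt
  unfold Split
  rcases h.kid with h | h
  · right; exact ⟨((hnode j).1 hj).resolve_left (by rw [h]; exact hji), (h _).2 rfl⟩
  · left; exact ⟨((hnode j).1 hj).resolve_right (by rw [h]; exact hji), (h _).2 rfl⟩

/-- A vertex above the inserted leaf and some other leaf is above the parent. -/
theorem Parent.le {s : Side} {u w : ℕ} (h : G.Parent s u) (hw : w < 2 * G.n - 1)
    (hi : G.c s w G.i) {j : ℕ} (hj : G.c s w j) (hji : j ≠ G.i) : G.Le s u w := by
  have H := G.hier s
  rcases H.laminar u h.lt w hw with h1 | h1 | h1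
  · exact h1
  · have hs := h.split (h1 j hj) hji
    exact hs.le H h.ge h.lt hw hj hi
  · exact absurd hi (h1 _ h.inserted)

theorem Red.exists_ne {s : Side} {u : ℕ} (h : G.Red s u) : ∃ j, j ≠ G.i ∧ G.c s u j := by
  obtain ⟨j, hj, hj'⟩ := h.kid0
  exact ⟨j, hj, ((G.hier s).node u h.ge h.lt j).2 (Or.inl hj')⟩

theorem Parent.le_red {s : Side} {u w : ℕ} (h : G.Parent s u) (hw : G.Red s w)
    (hi : G.c s w G.i) : G.Le s u w := by
  obtain ⟨j, hj, hj'⟩ := hw.exists_ne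
  exact h.le hw.lt hi hj' hj

/-- Two planar layouts differ in the order of the inserted leaf and the leaf of the edge `j`. -/
def DifferAt (G : Setup) (b b' : Side → ℕ → ℕ → Prop) (s : Side) (j : ℕ) : Prop :=
  ¬ (b s j G.i ↔ b' s j G.i)

theorem Planar.differAt_pair (hb : G.Planar b) (hb' : G.Planar b') {s : Side} {u₀ j : ℕ}
    (h₀ : G.Parent s u₀) (hjn : j < G.n) (hj : j ≠ G.i) (hju : ¬ G.c s u₀ j) :
    ∃ u v, G.Pair s u v ∧ G.c s u G.i ∧ G.c s u j ∧
      (∀ u' v', G.Pair s u' v' → G.c s u' G.i → G.c s u' j → G.Le s u u') ∧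
      (G.DifferAt b b' s j ↔ G.Differ b b' s u) := by
  classical
  have H := G.hier s
  obtain ⟨w, hw, hw', hs⟩ := H.exists_split hjn G.i_lt hj
  have hle : G.Le s u₀ w := h₀.le hw' (hs.right H hw hw') (hs.left H hw hw') hj
  have hkid := (H.le_kid h₀.lt hw' hle (by rintro rfl; exact hju (hs.left H hw hw'))).2
  obtain ⟨x, hx, hxu⟩ := h₀.exists_ne
  have hsx : Split (G.k0 s) (G.k1 s) (G.c s) w j x := by
    have := H.disj w hw hw'
    have := h₀.inserted
    unfold Split at hs ⊢
    grind
  have hxn := H.c_lt _ _ hxu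
  have hred : G.Red s w := by
    refine ⟨hw, hw', ?_, ?_⟩ <;> unfold Split at hsx <;> grind
  obtain ⟨r, t, hrt, hall⟩ := G.exists_pair s hjn hxn (hsx.ne H hw hw') hj hx
  have hex : ∃ u, ∃ v, G.Pair s u v ∧ G.Le s w u :=
    ⟨r, t, hrt, hred.le hrt.left.lt fun k hk hkw => hall k (H.c_lt _ _ hkw) hk⟩
  obtain ⟨v, hp, hwu⟩ := Nat.find_spec hex
  have hmin' := fun u hu => Nat.find_min hex (m := u) hu
  set u := Nat.find hex
  have hmin : ∀ u' v', G.Pair s u' v' → G.Le s w u' → G.Le s u u' := by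
    intro u' v' hp' hle'
    rcases H.laminar u hp.left.lt u' hp'.left.lt with h | h | h
    · exact h
    · have h1 := H.mono u' hp'.left.lt u hp.left.lt h
      have h2 : ¬ u' < u := fun h2 => hmin' u' h2 ⟨v', hp', hle'⟩
      have : u = u' := by omega
      rw [this]; exact fun _ h => h
    · exact absurd (hle' x (hle x hxu)) (h x (hwu x (hle x hxu)))
  refine ⟨u, v, hp, hwu _ (hs.right H hw hw'), hwu _ (hs.left H hw hw'), ?_, ?_⟩
  · intro u' v' hp' hi' hj'
    exact hmin u' v' hp' (hs.le H hw hw' hp'.left.lt hj' hi')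
  · rw [← hb.differ_pair hb' hp w hred hwu hmin, hb.differ_iff hb' hw hw' hs]
    rfl

/-- Pairs above the inserted leaves on both sides. -/
structure Both (G : Setup) (s : Side) (u v : ℕ) : Prop where
  pair : G.Pair s u v
  left : G.c s u G.i
  right : G.c s.other v G.i

theorem Both.symm {s : Side} {u v : ℕ} (h : G.Both s u v) : G.Both s.other v u :=
  ⟨h.pair.symm, h.right, by simpa using h.left⟩

/-- Two planar layouts differ at the smallest pair above the edges `j` and `i`. -/
def DifferBoth (G : Setup) (b b' : Side → ℕ → ℕ → Prop) (s : Side) (j : ℕ) : Prop :=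
  ∃ u v, G.Both s u v ∧ G.c s u j ∧
    (∀ u' v', G.Both s u' v' → G.c s u' j → G.Le s u u') ∧ G.Differ b b' s u

theorem differBoth_of_other (hb : G.Planar b) (hb' : G.Planar b') {s : Side} {j : ℕ}
    (hj : j ≠ G.i) (h : G.DifferBoth b b' s j) : G.DifferBoth b b' s.other j := by
  obtain ⟨u, v, h1, h2, h3, h4⟩ := h
  refine ⟨v, u, h1.symm, (h1.pair.matched j hj).1 h2, ?_, (h1.pair.differ_iff hb hb').1 h4⟩
  intro v' u' h' hj'
  have h'' : G.Both s u' v' := by simpa using h'.symm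
  have := h3 u' v' h'' ((h''.pair.matched j hj).2 hj')
  exact (h1.pair.le h''.pair fun k _ => this k).2

theorem differBoth_iff {s : Side} {j u v : ℕ} (h1 : G.Both s u v) (h2 : G.c s u j)
    (h3 : ∀ u' v', G.Both s u' v' → G.c s u' j → G.Le s u u') :
    G.DifferBoth b b' s j ↔ G.Differ b b' s u := by
  refine ⟨?_, fun h => ⟨u, v, h1, h2, h3, h⟩⟩
  rintro ⟨u', v', h1', h2', h3', h4'⟩
  rwa [(G.hier s).inj u h1.pair.left.lt u' h1'.pair.left.lt
    fun k => ⟨h3 u' v' h1' h2' k, h3' u v h1 h2 k⟩]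

/-- Whether two planar layouts differ in the order of the inserted leaf and the leaf of the edge
`j`, relative to the smallest pair above both edges, depends only on the vertices in `L(I)_T` or
`L(I)_S` that are above this leaf, and on the parent of the inserted leaf. -/
theorem Planar.differAt_rigid (hb : G.Planar b) (hb' : G.Planar b') {s : Side} {u₀ : ℕ}
    (h₀ : G.Parent s u₀) :
    (∀ j < G.n, j ≠ G.i → ¬ G.c s u₀ j → (∀ u, G.Own s u → ¬ G.c s u j) →
      (G.DifferAt b b' s j ↔ G.DifferBoth b b' s j)) ∧
    ∀ j < G.n, ∀ k < G.n, j ≠ G.i → k ≠ G.i → (G.c s u₀ j ↔ G.c s u₀ k) →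
      (∀ u, G.Own s u → (G.c s u j ↔ G.c s u k)) →
      ((G.DifferAt b b' s j ↔ G.DifferBoth b b' s j) ↔
        (G.DifferAt b b' s k ↔ G.DifferBoth b b' s k)) := by
  have H := G.hier s
  have key : ∀ j < G.n, j ≠ G.i → ¬ G.c s u₀ j →
      (G.DifferAt b b' s j ↔ G.DifferBoth b b' s j) ∨
      ∃ u v, G.Pair s u v ∧ G.c s u G.i ∧ ¬ G.c s.other v G.i ∧ G.c s u j ∧
      (∀ u' v', G.Pair s u' v' → G.c s u' G.i → G.c s u' j → G.Le s u u') ∧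
      (G.DifferAt b b' s j ↔ G.Differ b b' s u) := by
    intro j hjn hj hju
    obtain ⟨u, v, h1, h2, h3, h4, h5⟩ := hb.differAt_pair hb' h₀ hjn hj hju
    by_cases hv : G.c s.other v G.i
    · left
      rw [h5]
      exact (differBoth_iff ⟨h1, h2, hv⟩ h3 fun u' v' h hj' => h4 u' v' h.pair h.left hj').symm
    · right
      exact ⟨u, v, h1, h2, hv, h3, h4, h5⟩
  constructor
  · intro j hjn hj hju hout
    rcases key j hjn hj hju with h | ⟨u, v, h1, h2, h3, h4, -⟩
    · exact h
    · exact absurd h4 (hout u ⟨v, h1, h2, h3⟩)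
  · intro j hjn k hkn hj hk hjk hown
    by_cases hju : G.c s u₀ j
    · have hku := hjk.1 hju
      have h1 : G.DifferAt b b' s j ↔ G.DifferAt b b' s k := by
        have h1 := hb.differ_iff hb' h₀.ge h₀.lt (h₀.split hju hj)
        have h2 := hb.differ_iff hb' h₀.ge h₀.lt (h₀.split hku hk)
        exact h1.symm.trans h2
      have h2 : ∀ u v, G.Both s u v → (G.c s u j ↔ G.c s u k) := by
        intro u v h
        have := h₀.le_red h.pair.left h.left
        exact iff_of_true (this j hju) (this k hku)
      have h3 : G.DifferBoth b b' s j ↔ G.DifferBoth b b' s k := by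
        constructor
        · rintro ⟨u, v, a, b, c, d⟩
          exact ⟨u, v, a, (h2 u v a).1 b, fun u' v' h h' => c u' v' h ((h2 u' v' h).2 h'), d⟩
        · rintro ⟨u, v, a, b, c, d⟩
          exact ⟨u, v, a, (h2 u v a).2 b, fun u' v' h h' => c u' v' h ((h2 u' v' h).1 h'), d⟩
      rw [h1, h3]
    · have hku : ¬ G.c s u₀ k := fun h => hju (hjk.2 h)
      have transfer : ∀ {u v j k}, G.Pair s u v → G.c s u G.i → ¬ G.c s.other v G.i →
          (∀ u, G.Own s u → (G.c s u j ↔ G.c s u k)) → G.c s u j →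
          (∀ u' v', G.Pair s u' v' → G.c s u' G.i → G.c s u' k → G.Le s u' u →
            ¬ G.c s.other v' G.i) := by
        intro u v j k h1 h2 h3 hown h4 u' v' h1' _ _ hle hi
        exact h3 ((h1'.le h1 fun x _ => hle x).2 _ hi)
      rcases key j hjn hj hju with h | ⟨u, v, h1, h2, h3, h4, h5, h6⟩
      · rcases key k hkn hk hku with h' | ⟨u', v', h1', h2', h3', h4', h5', h6'⟩
        · exact iff_of_true h h'
        · -- the smallest pair above `k` does not contain `i` on the other side, but contains `j`
          have hju' := (hown u' ⟨v', h1', h2', h3'⟩).2 h4'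
          obtain ⟨u, v, h1, h2, h4, h5, h6⟩ := hb.differAt_pair hb' h₀ hjn hj hju
          have hle := h5 u' v' h1' h2' hju'
          have h3 : ¬ G.c s.other v G.i := fun hi => h3' ((h1.le h1' fun x _ => hle x).2 _ hi)
          have hle' := h5' u v h1 h2 ((hown u ⟨v, h1, h2, h3⟩).1 h4)
          have heq := H.inj u h1.left.lt u' h1'.left.lt fun x => ⟨hle x, hle' x⟩
          subst heq
          have hab : ∀ r t, G.Both s r t → (G.c s r j ↔ G.c s r k) := by
            intro r t hr
            have : G.Le s u r := by
              rcases H.laminar u h1.left.lt r hr.pair.left.lt with hh | hh | hh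
              · exact hh
              · exact absurd ((hr.pair.le h1 fun x _ => hh x).2 _ hr.right) h3
              · exact absurd hr.left (hh _ h2)
            exact iff_of_true (this j h4) (this k h4')
          have h3 : G.DifferBoth b b' s j ↔ G.DifferBoth b b' s k := by
            constructor
            · rintro ⟨u, v, a, b, c, d⟩
              exact ⟨u, v, a, (hab u v a).1 b, fun u' v' h h' => c u' v' h ((hab u' v' h).2 h'), d⟩
            · rintro ⟨u, v, a, b, c, d⟩
              exact ⟨u, v, a, (hab u v a).2 b, fun u' v' h h' => c u' v' h ((hab u' v' h).1 h'), d⟩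
          rw [h6, h6', h3]
      · obtain ⟨u', v', h1', h2', h4', h5', h6'⟩ := hb.differAt_pair hb' h₀ hkn hk hku
        have hku' := (hown u ⟨v, h1, h2, h3⟩).1 h4
        have hle := h5' u v h1 h2 hku'
        have h3' : ¬ G.c s.other v' G.i := fun hi => h3 ((h1'.le h1 fun x _ => hle x).2 _ hi)
        have hle' := h5 u' v' h1' h2' ((hown u' ⟨v', h1', h2', h3'⟩).2 h4')
        have heq := H.inj u h1.left.lt u' h1'.left.lt fun x => ⟨hle' x, hle x⟩
        subst heq
        have hab : ∀ r t, G.Both s r t → (G.c s r j ↔ G.c s r k) := by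
          intro r t hr
          have : G.Le s u r := by
            rcases H.laminar u h1.left.lt r hr.pair.left.lt with hh | hh | hh
            · exact hh
            · exact absurd ((hr.pair.le h1 fun x _ => hh x).2 _ hr.right) h3
            · exact absurd hr.left (hh _ h2)
          exact iff_of_true (this j h4) (this k h4')
        have h3 : G.DifferBoth b b' s j ↔ G.DifferBoth b b' s k := by
          constructor
          · rintro ⟨u, v, a, b, c, d⟩
            exact ⟨u, v, a, (hab u v a).1 b, fun u' v' h h' => c u' v' h ((hab u' v' h).2 h'), d⟩
          · rintro ⟨u, v, a, b, c, d⟩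
            exact ⟨u, v, a, (hab u v a).2 b, fun u' v' h h' => c u' v' h ((hab u' v' h).1 h'), d⟩
        rw [h6, h6', h3]

end

end Setup

end Tangle

namespace Tangle

namespace Setup

open Hier

variable {G : Setup} {b b' : Side → ℕ → ℕ → Prop}

/-! ### The effect of flips -/

/-- Flip at the vertex `u` on the side `s`. -/
def flipAt (G : Setup) (s : Side) (u : ℕ) (b : Side → ℕ → ℕ → Prop) : Side → ℕ → ℕ → Prop :=
  fun t => if t = s then flipOrder (G.c s) u (b s) else b t

@[simp] theorem flipAt_same (s : Side) (u : ℕ) : G.flipAt s u b s = flipOrder (G.c s) u (b s) := by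
  simp [flipAt]

@[simp] theorem flipAt_other (s : Side) (u : ℕ) : G.flipAt s u b s.other = b s.other := by
  simp [flipAt]

theorem forall_side {p : Side → Prop} (s : Side) : (∀ t, p t) ↔ p s ∧ p s.other := by
  constructor
  · intro h; exact ⟨h _, h _⟩
  · rintro ⟨h, h'⟩ t
    cases s <;> cases t <;> assumption

theorem crosses_iff (s : Side) (j : ℕ) : G.Crosses b j ↔ ¬ (b s j G.i ↔ b s.other j G.i) := by
  cases s
  · exact Iff.rfl
  · simp only [Crosses, Side.other]; tauto

theorem Planar.of_side (s : Side) (h : ∀ t, IsOrder G.n (G.k0 t) (G.k1 t) (G.c t) (b t))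
    (hp : ∀ j < G.n, ∀ k < G.n, j ≠ G.i → k ≠ G.i → (b s j k ↔ b s.other j k)) : G.Planar b :=
  ⟨h, (forall_side s).2 ⟨hp, fun j hj k hk hj' hk' => by
    rw [other_other]; exact (hp j hj k hk hj' hk').symm⟩⟩

theorem isOrder_flipAt (h : ∀ t, IsOrder G.n (G.k0 t) (G.k1 t) (G.c t) (b t)) (s : Side) {u : ℕ}
    (hu : u < 2 * G.n - 1) (t : Side) :
    IsOrder G.n (G.k0 t) (G.k1 t) (G.c t) (G.flipAt s u b t) := by
  revert t
  rw [forall_side s]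
  simp only [flipAt_same, flipAt_other]
  exact ⟨(h s).flip (G.hier s) hu, h _⟩

theorem crosses_flipAt (h : ∀ t, IsOrder G.n (G.k0 t) (G.k1 t) (G.c t) (b t)) (s : Side) (u : ℕ)
    {j : ℕ} (hj : j < G.n) (hji : j ≠ G.i) :
    G.Crosses (G.flipAt s u b) j ↔ ¬ (G.Crosses b j ↔ (G.c s u j ∧ G.c s u G.i)) := by
  have := (h s).total j hj G.i G.i_lt hji
  rw [crosses_iff s, crosses_iff s, flipAt_same, flipAt_other]
  unfold flipOrder
  by_cases h1 : G.c s u j <;> by_cases h2 : G.c s u G.i <;> simp only [h1, h2] <;> tauto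

theorem Planar.pairedFlip (hb : G.Planar b) {s : Side} {u v : ℕ} (hu : u < 2 * G.n - 1)
    (hv : v < 2 * G.n - 1) (h : G.Matched s u v) :
    G.Planar (G.flipAt s.other v (G.flipAt s u b)) := by
  refine Planar.of_side s (isOrder_flipAt (isOrder_flipAt hb.order s hu) s.other hv) ?_
  intro j hj k hk hji hki
  have h1 := hb.planar s j hj k hk hji hki
  have h2 := hb.planar s k hk j hj hki hji
  have h3 := h j hji
  have h4 := h k hki
  have h5 := flipAt_other (G := G) (b := G.flipAt s u b) s.other v
  rw [other_other] at h5
  rw [h5, flipAt_same, flipAt_same, flipAt_other]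
  unfold flipOrder
  tauto

theorem Planar.crosses_pairedFlip (hb : G.Planar b) {s : Side} {u v : ℕ} (hu : u < 2 * G.n - 1)
    (hi : G.c s u G.i) (hi' : ¬ G.c s.other v G.i) {j : ℕ} (hj : j < G.n) (hji : j ≠ G.i) :
    G.Crosses (G.flipAt s.other v (G.flipAt s u b)) j ↔ ¬ (G.Crosses b j ↔ G.c s u j) := by
  rw [crosses_flipAt (isOrder_flipAt hb.order s hu) _ _ hj hji, crosses_flipAt hb.order _ _ hj hji]
  tauto

/-- Subtree switch at the vertex `u`. -/
def switchAt (G : Setup) (s : Side) (u : ℕ) (b : Side → ℕ → ℕ → Prop) : Side → ℕ → ℕ → Prop :=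
  G.flipAt s (G.k1 s u) (G.flipAt s (G.k0 s u) (G.flipAt s u b))

theorem Planar.switchAt (hb : G.Planar b) {s : Side} {u : ℕ} (hu : G.Parent s u) :
    G.Planar (G.switchAt s u b) := by
  have H := G.hier s
  have h0 := (H.kid0_lt u hu.ge hu.lt).trans hu.lt
  have h1 := (H.kid1_lt u hu.ge hu.lt).trans hu.lt
  refine Planar.of_side s (isOrder_flipAt (isOrder_flipAt (isOrder_flipAt hb.order s hu.lt) s h0)
    s h1) ?_
  intro j hj k hk hji hki
  have e1 : G.switchAt s u b s.other = b s.other := by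
    unfold Setup.switchAt; simp only [flipAt_other]
  have e2 : G.switchAt s u b s =
      flipOrder (G.c s) (G.k1 s u) (flipOrder (G.c s) (G.k0 s u) (flipOrder (G.c s) u (b s))) := by
    unfold Setup.switchAt; simp only [flipAt_same]
  rw [e1, e2, ← hb.planar s j hj k hk hji hki]
  have hj' := H.node u hu.ge hu.lt j
  have hk' := H.node u hu.ge hu.lt k
  have dj := H.disj u hu.ge hu.lt j
  have dk := H.disj u hu.ge hu.lt k
  unfold flipOrder
  rcases hu.kid with h | h <;> rw [h] at hj' hk' dj dk <;> simp only [h, hji, hki, false_or, or_false] at * <;>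
    by_cases a : G.c s u j <;> by_cases c : G.c s u k <;> simp_all

theorem Planar.crosses_switchAt (hb : G.Planar b) {s : Side} {u : ℕ} (hu : G.Parent s u) {j : ℕ}
    (hj : j < G.n) (hji : j ≠ G.i) :
    G.Crosses (G.switchAt s u b) j ↔ ¬ (G.Crosses b j ↔ G.c s u j) := by
  have H := G.hier s
  have h0 := (H.kid0_lt u hu.ge hu.lt).trans hu.lt
  have e1 := isOrder_flipAt hb.order s hu.lt
  have e2 := isOrder_flipAt e1 s h0
  unfold Setup.switchAt
  rw [crosses_flipAt e2 _ _ hj hji, crosses_flipAt e1 _ _ hj hji,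
    crosses_flipAt hb.order _ _ hj hji]
  have hi := hu.inserted
  have di := H.disj u hu.ge hu.lt G.i
  rcases hu.kid with h | h
  · have := (h G.i).2 rfl
    simp only [h, hji, hi, di this]
    tauto
  · have := (h G.i).2 rfl
    have h3 : ¬ G.c s (G.k0 s u) G.i := fun h => di h this
    simp only [h, hji, hi, h3]
    tauto

/-! ### Counting crossings -/

open Classical in
/-- The number of edges that cross the inserted edge. -/
noncomputable def numCross (G : Setup) (b : Side → ℕ → ℕ → Prop) : ℕ :=
  ((Finset.range G.n).filter fun j => j ≠ G.i ∧ G.Crosses b j).card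

open Classical in
/-- The inserted edge crosses at most half of the edges in `R`. -/
def Half (G : Setup) (b : Side → ℕ → ℕ → Prop) (R : ℕ → Prop) : Prop :=
  2 * ((Finset.range G.n).filter fun j => (j ≠ G.i ∧ R j) ∧ G.Crosses b j).card ≤
    ((Finset.range G.n).filter fun j => j ≠ G.i ∧ R j).card

theorem Half.congr {R R' : ℕ → Prop} (h : G.Half b R)
    (h1 : ∀ j < G.n, j ≠ G.i → (R j ↔ R' j))
    (h2 : ∀ j < G.n, j ≠ G.i → R j → (G.Crosses b j ↔ G.Crosses b' j)) : G.Half b' R' := by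
  classical
  unfold Half at *
  have e1 : ((Finset.range G.n).filter fun j => (j ≠ G.i ∧ R' j) ∧ G.Crosses b' j) =
      (Finset.range G.n).filter fun j => (j ≠ G.i ∧ R j) ∧ G.Crosses b j := by
    apply Finset.filter_congr
    intro j hj
    have := h1 j (Finset.mem_range.1 hj)
    have := h2 j (Finset.mem_range.1 hj)
    grind
  have e2 : ((Finset.range G.n).filter fun j => j ≠ G.i ∧ R' j) =
      (Finset.range G.n).filter fun j => j ≠ G.i ∧ R j := by
    apply Finset.filter_congr
    intro j hj
    have := h1 j (Finset.mem_range.1 hj)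
    grind
  rw [e1, e2]
  exact h

/-- The edges `j` and `k` are separated neither by the parents of the inserted leaves, nor by the
vertices in `L(I)_T` and `L(I)_S`. -/
def SameClass (G : Setup) (p : Side → ℕ) (j k : ℕ) : Prop :=
  ∀ s u, u = p s ∨ G.Own s u → (G.c s u j ↔ G.c s u k)

theorem Planar.crosses_rigid (hb : G.Planar b) (hb' : G.Planar b') {p : Side → ℕ}
    (hp : ∀ s, G.Parent s (p s)) :
    ∃ E : Side → ℕ → Prop,
      (∀ j < G.n, j ≠ G.i → (G.Crosses b' j ↔ (G.Crosses b j ↔ (E .T j ↔ E .S j)))) ∧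
      (∀ s, ∀ j < G.n, j ≠ G.i → (∀ u, u = p s ∨ G.Own s u → ¬ G.c s u j) → ¬ E s j) ∧
      ∀ s, ∀ j < G.n, ∀ k < G.n, j ≠ G.i → k ≠ G.i →
        (∀ u, u = p s ∨ G.Own s u → (G.c s u j ↔ G.c s u k)) → (E s j ↔ E s k) := by
  refine ⟨fun s j => ¬ (G.DifferAt b b' s j ↔ G.DifferBoth b b' s j), ?_, ?_, ?_⟩
  · intro j hj hji
    have h1 := differBoth_of_other hb hb' (s := .T) hji
    have h2 := differBoth_of_other hb hb' (s := .S) hji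
    simp only [Side.other] at h1 h2
    unfold Crosses DifferAt
    by_cases h3 : G.DifferBoth b b' .T j
    · have := h1 h3; grind
    · have : ¬ G.DifferBoth b b' .S j := fun h => h3 (h2 h)
      grind
  · intro s j hj hji h
    have := (hb.differAt_rigid hb' (hp s)).1 j hj hji (h _ (Or.inl rfl))
      (fun u hu => h u (Or.inr hu))
    tauto
  · intro s j hj k hk hji hki h
    have := (hb.differAt_rigid hb' (hp s)).2 j hj k hk hji hki (h _ (Or.inl rfl))
      (fun u hu => h u (Or.inr hu))
    tauto

theorem Planar.numCross_le (hb : G.Planar b) (hb' : G.Planar b') {p : Side → ℕ}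
    (hp : ∀ s, G.Parent s (p s))
    (hhalf : ∀ j < G.n, j ≠ G.i → (∃ s u, (u = p s ∨ G.Own s u) ∧ G.c s u j) →
      G.Half b (G.SameClass p j)) : G.numCross b ≤ G.numCross b' := by
  classical
  obtain ⟨E, hE, hout, hconst⟩ := hb.crosses_rigid hb' hp
  let key : ℕ → (Side → Finset ℕ) := fun j s =>
    (Finset.range (2 * G.n - 1)).filter fun u => (u = p s ∨ G.Own s u) ∧ G.c s u j
  have hlt : ∀ s u, u = p s ∨ G.Own s u → u < 2 * G.n - 1 := by
    rintro s u (rfl | ⟨v, h, -⟩)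
    · exact (hp s).lt
    · exact h.left.lt
  have hkey : ∀ j k, key j = key k ↔ G.SameClass p j k := by
    intro j k
    constructor
    · intro h s u hu
      have h1 : u ∈ key j s ↔ u ∈ key k s := by rw [h]
      simpa [key, hu, hlt s u hu] using h1
    · intro h
      funext s
      ext u
      simp only [key, Finset.mem_filter, Finset.mem_range]
      have := h s u
      tauto
  let I := (Finset.range G.n).filter fun j => j ≠ G.i
  have e1 : G.numCross b = (I.filter fun j => G.Crosses b j).card := by
    unfold numCross; rw [Finset.filter_filter]
  have e2 : G.numCross b' = (I.filter fun j => G.Crosses b' j).card := by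
    unfold numCross; rw [Finset.filter_filter]
  rw [e1, e2,
    Finset.card_eq_sum_card_fiberwise (f := key) (t := I.image key)
      (fun j hj => Finset.mem_coe.2 (Finset.mem_image_of_mem _ (Finset.mem_filter.1 hj).1)),
    Finset.card_eq_sum_card_fiberwise (s := I.filter fun j => G.Crosses b' j) (f := key)
      (t := I.image key)
      (fun j hj => Finset.mem_coe.2 (Finset.mem_image_of_mem _ (Finset.mem_filter.1 hj).1))]
  apply Finset.sum_le_sum
  intro K hK
  obtain ⟨j₀, hj₀, rfl⟩ := Finset.mem_image.1 hK
  obtain ⟨hj₀n, hj₀i⟩ := Finset.mem_filter.1 hj₀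
  rw [Finset.mem_range] at hj₀n
  have hcl : ∀ j ∈ I, key j = key j₀ → (E .T j ↔ E .T j₀) ∧ (E .S j ↔ E .S j₀) := by
    intro j hj hjk
    have h1 := (hkey _ _).1 hjk
    obtain ⟨hjn, hji⟩ := Finset.mem_filter.1 hj
    rw [Finset.mem_range] at hjn
    exact ⟨hconst .T j hjn j₀ hj₀n hji hj₀i (h1 .T), hconst .S j hjn j₀ hj₀n hji hj₀i (h1 .S)⟩
  by_cases hd : E .T j₀ ↔ E .S j₀
  · apply Finset.card_le_card
    intro j hj
    simp only [Finset.mem_filter] at hj ⊢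
    obtain ⟨⟨hjI, hjc⟩, hjk⟩ := hj
    have h1 := hcl j hjI hjk
    obtain ⟨hjn, hji⟩ := Finset.mem_filter.1 hjI
    have h2 := hE j (Finset.mem_range.1 hjn) hji
    exact ⟨⟨hjI, by grind⟩, hjk⟩
  · have hex : ∃ s u, (u = p s ∨ G.Own s u) ∧ G.c s u j₀ := by
      by_contra hno
      push Not at hno
      have h1 := hout .T j₀ hj₀n hj₀i (hno .T)
      have h2 := hout .S j₀ hj₀n hj₀i (hno .S)
      tauto
    have h3 := hhalf j₀ hj₀n hj₀i hex
    unfold Half at h3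
    have h4 : ((Finset.range G.n).filter fun j => j ≠ G.i ∧ G.SameClass p j₀ j).card =
        ((I.filter fun j => G.Crosses b j).filter fun j => key j = key j₀).card +
        ((I.filter fun j => G.Crosses b' j).filter fun j => key j = key j₀).card := by
      rw [← Finset.card_union_of_disjoint]
      · congr 1
        ext j
        simp only [Finset.mem_union, Finset.mem_filter, Finset.mem_range, I]
        have h5 := hkey j₀ j
        rw [eq_comm] at h5
        constructor
        · rintro ⟨h6, h7, h8⟩
          have h9 := hcl j (Finset.mem_filter.2 ⟨Finset.mem_range.2 h6, h7⟩) (h5.2 h8)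
          have h10 := hE j h6 h7
          have h11 := h5.2 h8
          by_cases h12 : G.Crosses b j
          · exact Or.inl ⟨⟨⟨h6, h7⟩, h12⟩, h11⟩
          · exact Or.inr ⟨⟨⟨h6, h7⟩, by grind⟩, h11⟩
        · rintro (⟨⟨⟨h6, h7⟩, -⟩, h8⟩ | ⟨⟨⟨h6, h7⟩, -⟩, h8⟩) <;> exact ⟨h6, h7, h5.1 h8⟩
      · rw [Finset.disjoint_left]
        intro j hj hj'
        simp only [Finset.mem_filter] at hj hj'
        have h9 := hcl j hj.1.1 hj.2
        have h10 := hE j (Finset.mem_range.1 (Finset.mem_filter.1 hj.1.1).1)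
          (Finset.mem_filter.1 hj.1.1).2
        have h11 := hj.1.2
        have h12 := hj'.1.2
        grind
    have h5 : ((Finset.range G.n).filter fun j => (j ≠ G.i ∧ G.SameClass p j₀ j) ∧
        G.Crosses b j).card =
        ((I.filter fun j => G.Crosses b j).filter fun j => key j = key j₀).card := by
      congr 1
      ext j
      simp only [Finset.mem_filter, Finset.mem_range, I]
      have h5 := hkey j₀ j
      rw [eq_comm] at h5
      rw [h5]
      constructor
      · rintro ⟨a1, ⟨a2, a3⟩, a4⟩; exact ⟨⟨⟨a1, a2⟩, a4⟩, a3⟩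
      · rintro ⟨⟨⟨a1, a2⟩, a4⟩, a3⟩; exact ⟨a1, ⟨a2, a3⟩, a4⟩
    rw [h4, h5] at h3
    have h6 : ∀ {a b : ℕ}, 2 * a ≤ a + b → a ≤ b := by intro a b h; omega
    exact h6 h3

/-! ### The vertices of `L(I)_T` and `L(I)_S` -/

theorem Own.lt {s : Side} {u : ℕ} (h : G.Own s u) : u < 2 * G.n - 1 := by
  obtain ⟨v, h, -⟩ := h; exact h.left.lt

theorem Own.disjoint {s : Side} {u u' : ℕ} (h : G.Own s u) (h' : G.Own s.other u') {j : ℕ}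
    (hj : j ≠ G.i) (hu : G.c s u j) : ¬ G.c s.other u' j := by
  intro hu'
  obtain ⟨v, hp, hi, hv⟩ := h
  obtain ⟨v', hp', hi', hv'⟩ := h'
  have hp'' := hp'.symm
  rw [other_other] at hp'' hv'
  have h1 : G.Le s v' u := by
    rcases (G.hier s).laminar u hp.left.lt v' hp''.left.lt with h | h | h
    · exact absurd (h _ hi) hv'
    · exact h
    · exact absurd ((hp''.matched j hj).2 hu') (h j hu)
  have h2 : G.Le s.other v u' := by
    rcases (G.hier s.other).laminar u' hp'.left.lt v hp.right.lt with h | h | h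
    · exact absurd (h _ hi') hv
    · exact h
    · exact absurd ((hp.matched j hj).1 hu) (h j hu')
  have h3 : G.Le s u v' := hp.left.le hp''.left.lt fun k hk hku =>
    (hp''.matched k hk).2 (h2 k ((hp.matched k hk).1 hku))
  exact hv' (h3 _ hi)

/-- The partner of a vertex in `L(I)_S` is below `u₀`, or disjoint from it. -/
theorem Parent.mate_le {s : Side} {p u v : ℕ} (h : G.Parent s p) (hp : G.Pair s.other u v)
    (hv : ¬ G.c s v G.i) {j : ℕ} (hj : j ≠ G.i) (hjp : G.c s p j) (hju : G.c s.other u j) :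
    G.Le s v p := by
  have hp' := hp.symm
  rw [other_other] at hp'
  rcases (G.hier s).laminar v hp'.left.lt p h.lt with h1 | h1 | h1
  · exact h1
  · exact absurd (h1 _ h.inserted) hv
  · exact absurd hjp (h1 j ((hp'.matched j hj).2 hju))

/-- The parent of the inserted leaf and the vertices in `L(I)_T` or `L(I)_S`, from bottom to
top. -/
structure Chain (G : Setup) (s : Side) (w : ℕ → ℕ) (q : ℕ) : Prop where
  parent : G.Parent s (w 0)
  own : ∀ k, 1 ≤ k → k ≤ q → G.Own s (w k)
  complete : ∀ u, G.Own s u → ∃ k, 1 ≤ k ∧ k ≤ q ∧ w k = u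
  mono : ∀ k l, k ≤ l → l ≤ q → G.Le s (w k) (w l)

/-- The edges that end below the vertex number `k` of a chain, but not below the one before it. -/
def Ring (G : Setup) (s : Side) (w : ℕ → ℕ) (k j : ℕ) : Prop :=
  G.c s (w k) j ∧ (0 < k → ¬ G.c s (w (k - 1)) j)

theorem Chain.exists_ring {s : Side} {w : ℕ → ℕ} {q j : ℕ} (h : G.c s (w q) j) :
    ∃ k ≤ q, G.Ring s w k j := by
  classical
  have hex : ∃ k, G.c s (w k) j := ⟨q, h⟩
  refine ⟨Nat.find hex, Nat.find_min' hex h, Nat.find_spec hex, fun hpos => ?_⟩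
  exact Nat.find_min hex (by omega)

theorem Chain.lt {s : Side} {w : ℕ → ℕ} {q : ℕ} (h : G.Chain s w q) {k : ℕ} (hk : k ≤ q) :
    w k < 2 * G.n - 1 := by
  rcases Nat.eq_zero_or_pos k with rfl | hk'
  · exact h.parent.lt
  · exact (h.own k hk' hk).lt

theorem Chain.forall_iff {s : Side} {w : ℕ → ℕ} {q : ℕ} (h : G.Chain s w q) {P : ℕ → Prop} :
    (∀ u, u = w 0 ∨ G.Own s u → P u) ↔ ∀ k ≤ q, P (w k) := by
  constructor
  · intro h' k hk
    rcases Nat.eq_zero_or_pos k with rfl | hk'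
    · exact h' _ (Or.inl rfl)
    · exact h' _ (Or.inr (h.own k hk' hk))
  · rintro h' u (rfl | hu)
    · exact h' 0 (Nat.zero_le _)
    · obtain ⟨k, -, hk, rfl⟩ := h.complete u hu
      exact h' k hk

theorem Chain.ring_iff {s : Side} {w : ℕ → ℕ} {q : ℕ} (h : G.Chain s w q) {k j x : ℕ} (hk : k ≤ q)
    (hj : G.Ring s w k j) :
    G.Ring s w k x ↔ ∀ l ≤ q, (G.c s (w l) j ↔ G.c s (w l) x) := by
  have hup : ∀ y, G.Ring s w k y → ∀ l ≤ q, (G.c s (w l) y ↔ k ≤ l) := by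
    intro y hy l hl
    constructor
    · intro h1
      by_contra h2
      exact hy.2 (by omega) (h.mono l (k - 1) (by omega) (by omega) y h1)
    · intro h1
      exact h.mono k l h1 hl y hy.1
  constructor
  · intro hx l hl
    rw [hup j hj l hl, hup x hx l hl]
  · intro hx
    refine ⟨(hx k hk).1 hj.1, fun h1 h2 => hj.2 h1 ((hx (k - 1) (by omega)).2 h2)⟩

variable {w : Side → ℕ → ℕ} {q : Side → ℕ}

theorem sameClass_iff (h : ∀ s, G.Chain s (w s) (q s)) (s : Side) {j x : ℕ} :
    G.SameClass (fun s => w s 0) j x ↔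
      (∀ k ≤ q s, (G.c s (w s k) j ↔ G.c s (w s k) x)) ∧
      ∀ k ≤ q s.other, (G.c s.other (w s.other k) j ↔ G.c s.other (w s.other k) x) := by
  unfold SameClass
  rw [forall_side s, (h s).forall_iff, (h s.other).forall_iff]

/-- Optimality in the case in which the sets of edges at the two sides are disjoint. -/
theorem Planar.numCross_le_of_disjoint (hb : G.Planar b) (hb' : G.Planar b')
    (h : ∀ s, G.Chain s (w s) (q s))
    (hdisj : ∀ j, j ≠ G.i → G.c .T (w .T (q .T)) j → ¬ G.c .S (w .S (q .S)) j)
    (hhalf : ∀ s, ∀ k ≤ q s, G.Half b (G.Ring s (w s) k)) : G.numCross b ≤ G.numCross b' := by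
  refine hb.numCross_le hb' (p := fun s => w s 0) (fun s => (h s).parent) ?_
  rintro j hjn hji ⟨s, u, hu, hju⟩
  have hd : ∀ s, ∀ j, j ≠ G.i → G.c s (w s (q s)) j →
      ¬ G.c s.other (w s.other (q s.other)) j := by
    intro s j hj
    cases s
    · exact hdisj j hj
    · intro h1 h2; exact hdisj j hj h2 h1
  have hq : G.c s (w s (q s)) j := by
    by_contra hno
    exact (h s).forall_iff (P := fun u => ¬ G.c s u j) |>.2
      (fun k hk h' => hno ((h s).mono k _ hk le_rfl j h')) u hu hju
  obtain ⟨k, hk, hr⟩ := Chain.exists_ring hq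
  refine (hhalf s k hk).congr ?_ fun _ _ _ _ => Iff.rfl
  intro x hxn hxi
  rw [sameClass_iff h s, (h s).ring_iff hk hr]
  refine ⟨fun hx => ⟨hx, fun l hl => ?_⟩, fun hx => hx.1⟩
  have hq' := (hx _ le_rfl).1 hq
  have h1 := hd s j hji hq
  have h2 := hd s x hxi hq'
  exact iff_of_false (fun h' => h1 ((h _).mono l _ hl le_rfl _ h'))
    (fun h' => h2 ((h _).mono l _ hl le_rfl _ h'))

/-- Optimality in the case in which the parent of the inserted leaf on one side is above all
vertices in `L(I)_T` or `L(I)_S`. -/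
theorem Planar.numCross_le_of_above (hb : G.Planar b) (hb' : G.Planar b')
    (h : ∀ s, G.Chain s (w s) (q s)) {s : Side} (hq : q s.other = 0)
    (habove : ∀ j, j ≠ G.i → G.c s (w s (q s)) j → G.c s.other (w s.other 0) j)
    (hhalf : ∀ k ≤ q s, G.Half b (G.Ring s (w s) k))
    (hhalf' : G.Half b fun j => G.c s.other (w s.other 0) j ∧ ¬ G.c s (w s (q s)) j) :
    G.numCross b ≤ G.numCross b' := by
  refine hb.numCross_le hb' (p := fun s => w s 0) (fun s => (h s).parent) ?_
  rintro j hjn hji hex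
  by_cases hqj : G.c s (w s (q s)) j
  · obtain ⟨k, hk, hr⟩ := Chain.exists_ring hqj
    refine (hhalf k hk).congr ?_ fun _ _ _ _ => Iff.rfl
    intro x hxn hxi
    rw [sameClass_iff h s, (h s).ring_iff hk hr]
    refine ⟨fun hx => ⟨hx, fun l hl => ?_⟩, fun hx => hx.1⟩
    obtain rfl : l = 0 := by omega
    exact iff_of_true (habove j hji hqj) (habove x hxi ((hx _ le_rfl).1 hqj))
  · have hno : ∀ l ≤ q s, ¬ G.c s (w s l) j := fun l hl h' => hqj ((h s).mono l _ hl le_rfl _ h')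
    have hj0 : G.c s.other (w s.other 0) j := by
      obtain ⟨t, u, hu, hju⟩ := hex
      by_contra hno'
      have : ∀ t u, (u = w t 0 ∨ G.Own t u) → ¬ G.c t u j := by
        rw [forall_side s, (h s).forall_iff, (h s.other).forall_iff]
        refine ⟨hno, fun l hl => ?_⟩
        obtain rfl : l = 0 := by omega
        exact hno'
      exact this t u hu hju
    refine hhalf'.congr ?_ fun _ _ _ _ => Iff.rfl
    intro x hxn hxi
    rw [sameClass_iff h s]
    constructor
    · rintro ⟨h1, h2⟩
      refine ⟨fun l hl => iff_of_false (hno l hl)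
        fun h' => h2 ((h s).mono l _ hl le_rfl _ h'), fun l hl => ?_⟩
      obtain rfl : l = 0 := by omega
      exact iff_of_true hj0 h1
    · rintro ⟨h1, h2⟩
      exact ⟨(h2 0 (by omega)).1 hj0, fun h' => hqj ((h1 _ le_rfl).2 h')⟩

/-- If `L(I)_T` and `L(I)_S` are empty, then any two planar layouts differ by subtree switches at
the parents of the inserted leaves. -/
theorem Planar.crosses_of_empty (hb : G.Planar b) (hb' : G.Planar b') {p : Side → ℕ}
    (hp : ∀ s, G.Parent s (p s)) (hemp : ∀ s u, ¬ G.Own s u) :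
    ∃ x : Side → Prop, ∀ j < G.n, j ≠ G.i → (G.Crosses b' j ↔
      (G.Crosses b j ↔ ((x .T ∧ G.c .T (p .T) j) ↔ (x .S ∧ G.c .S (p .S) j)))) := by
  obtain ⟨E, hE, hout, hconst⟩ := hb.crosses_rigid hb' hp
  refine ⟨fun s => ∃ k < G.n, k ≠ G.i ∧ G.c s (p s) k ∧ E s k, fun j hj hji => ?_⟩
  have h1 : ∀ s, E s j ↔ ((∃ k < G.n, k ≠ G.i ∧ G.c s (p s) k ∧ E s k) ∧ G.c s (p s) j) := by
    intro s
    constructor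
    · intro h
      have : G.c s (p s) j := by
        by_contra hno
        refine hout s j hj hji ?_ h
        rintro u (rfl | hu)
        · exact hno
        · exact absurd hu (hemp s u)
      exact ⟨⟨j, hj, hji, this, h⟩, this⟩
    · rintro ⟨⟨k, hk, hki, hkp, hkE⟩, hjp⟩
      refine (hconst s k hk j hj hki hji ?_).1 hkE
      rintro u (rfl | hu)
      · exact iff_of_true hkp hjp
      · exact absurd hu (hemp s u)
  rw [hE j hj hji, h1, h1]

/-- If no edge ends below both parents of the inserted leaves, then the inserted edge crosses all
edges that end below the one parent, or none of them. -/
theorem Planar.crosses_parent (hb : G.Planar b) {s : Side} {p p' : ℕ} (hp : G.Parent s p)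
    (hp' : G.Parent s.other p') (hdisj : ∀ j, j ≠ G.i → G.c s p j → ¬ G.c s.other p' j) {j k : ℕ}
    (hji : j ≠ G.i) (hki : k ≠ G.i) (hj : G.c s p j) (hk : G.c s p k) :
    G.Crosses b j ↔ G.Crosses b k := by
  have H := G.hier s
  have H' := G.hier s.other
  have hjn := H.c_lt _ _ hj
  have hkn := H.c_lt _ _ hk
  obtain ⟨m, hmi, hm⟩ := hp'.exists_ne
  have hmn := H'.c_lt _ _ hm
  have hmp : ¬ G.c s p m := fun h => hdisj m hmi h hm
  have h1 : b s j G.i ↔ b s k G.i := by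
    have h1 := hb.differ_iff hb hp.ge hp.lt (hp.split hj hji)
    have hsj := hp.split hj hji
    have hsk := hp.split hk hki
    have hd := H.disj p hp.ge hp.lt
    have hs := (hb.order s).split p hp.ge hp.lt
    rcases hsj with ⟨a1, a2⟩ | ⟨a1, a2⟩
    · rcases hsk with ⟨a3, a4⟩ | ⟨a3, a4⟩
      · exact hs _ _ _ _ a1 a3 a2 a2
      · exact absurd a2 (hd _ a4)
    · rcases hsk with ⟨a3, a4⟩ | ⟨a3, a4⟩
      · exact absurd a4 (fun h => hd _ a2 h)
      · have := hs _ _ _ _ a2 a2 a1 a3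
        have := (hb.order s).total j hjn G.i G.i_lt hji
        have := (hb.order s).total k hkn G.i G.i_lt hki
        tauto
  have h2 : b s j m ↔ b s k m := ((hb.order s).contig H hp.lt hj hk hmn hmp).1
  have h3 : ∀ x, x ≠ G.i → G.c s p x → (b s.other x m ↔ b s.other x G.i) := fun x hx hxp =>
    ((hb.order s.other).contig H' hp'.lt hm hp'.inserted (H.c_lt _ _ hxp) (hdisj x hx hxp)).2
  rw [crosses_iff s, crosses_iff s, h1, ← h3 j hji hj, ← h3 k hki hk,
    ← hb.planar s j hjn m hmn hji hmi, ← hb.planar s k hkn m hmn hki hmi, h2]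

end Setup

end Tangle

namespace Tangle

/-! ### Trees in a pointer structure -/

section Stored

variable {n : ℕ} {l r : ℕ → ℕ}

theorem StoredAt.eq_of_leaf {a : Fin n} {v : ℕ} (h : StoredAt l r (.leaf a) v) : v = a := by
  cases h; rfl

theorem StoredAt.of_node {t₁ t₂ : BTree (Fin n)} {v : ℕ} (h : StoredAt l r (.node t₁ t₂) v) :
    n ≤ v ∧ l v < v ∧ r v < v ∧ StoredAt l r t₁ (l v) ∧ StoredAt l r t₂ (r v) := by
  cases h with
  | node h1 h2 h3 h4 h5 => exact ⟨h1, h2, h3, h4, h5⟩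

theorem StoredAt.unique {x y : BTree (Fin n)} {v : ℕ} (hx : StoredAt l r x v)
    (hy : StoredAt l r y v) : x = y := by
  induction x generalizing y v with
  | leaf a =>
    have h1 := hx.eq_of_leaf
    cases y with
    | leaf b =>
      have h2 := hy.eq_of_leaf
      rw [Fin.ext (h1.symm.trans h2)]
    | node y₁ y₂ =>
      have := hy.of_node.1
      have := a.2
      omega
  | node x₁ x₂ h1 h2 =>
    obtain ⟨hv, -, -, hl, hr⟩ := hx.of_node
    cases y with
    | leaf b =>
      have := hy.eq_of_leaf
      have := b.2
      omega
    | node y₁ y₂ =>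
      obtain ⟨-, -, -, hl', hr'⟩ := hy.of_node
      rw [h1 hl hl', h2 hr hr']

/-- The numbers of the vertices of a tree in a pointer structure. -/
def BTree.vertexList (l r : ℕ → ℕ) : BTree (Fin n) → ℕ → List ℕ
  | .leaf _, v => [v]
  | .node t₁ t₂, v => v :: (t₁.vertexList l r (l v) ++ t₂.vertexList l r (r v))

theorem BTree.length_vertexList (t : BTree (Fin n)) (v : ℕ) :
    (t.vertexList l r v).length + 1 = 2 * t.leaves.length := by
  induction t generalizing v with
  | leaf a => rfl
  | node t₁ t₂ h1 h2 =>
    have := h1 (l v)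
    have := h2 (r v)
    simp only [vertexList, leaves, List.length_cons, List.length_append]
    omega

theorem BTree.leaves_ne_nil (t : BTree (Fin n)) : t.leaves ≠ [] := by
  induction t with
  | leaf a => simp [leaves]
  | node t₁ t₂ h1 h2 => simp [leaves, h1]

theorem StoredAt.of_mem_vertexList {t : BTree (Fin n)} {v w : ℕ} (h : StoredAt l r t v)
    (hw : w ∈ t.vertexList l r v) :
    w ≤ v ∧ ∃ x, StoredAt l r x w ∧ x.leaves.Sublist t.leaves := by
  induction t generalizing v with
  | leaf a =>
    simp only [BTree.vertexList, List.mem_singleton] at hw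
    subst hw
    exact ⟨le_rfl, _, h, List.Sublist.refl _⟩
  | node t₁ t₂ h1 h2 =>
    obtain ⟨hv, hl, hr, hl', hr'⟩ := h.of_node
    simp only [BTree.vertexList, List.mem_cons, List.mem_append] at hw
    rcases hw with rfl | hw | hw
    · exact ⟨le_rfl, _, h, List.Sublist.refl _⟩
    · obtain ⟨a, x, b, c⟩ := h1 hl' hw
      exact ⟨by omega, x, b, c.trans (List.sublist_append_left _ _)⟩
    · obtain ⟨a, x, b, c⟩ := h2 hr' hw
      exact ⟨by omega, x, b, c.trans (List.sublist_append_right _ _)⟩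

/-- The leaf `a` is below the vertex `v`. -/
def LeafBelow (l r : ℕ → ℕ) (v : ℕ) (a : Fin n) : Prop := ∃ x, StoredAt l r x v ∧ a ∈ x.leaves

theorem StoredAt.leafBelow_iff {x : BTree (Fin n)} {v : ℕ} (h : StoredAt l r x v) (a : Fin n) :
    LeafBelow l r v a ↔ a ∈ x.leaves := by
  constructor
  · rintro ⟨y, hy, ha⟩; rwa [h.unique hy]
  · intro ha; exact ⟨x, h, ha⟩

theorem StoredAt.leafBelow_of_mem {t : BTree (Fin n)} {v w : ℕ} (h : StoredAt l r t v)
    (hw : w ∈ t.vertexList l r v) {a : Fin n} (ha : LeafBelow l r w a) : a ∈ t.leaves := by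
  obtain ⟨-, x, hx, hs⟩ := h.of_mem_vertexList hw
  exact hs.subset ((hx.leafBelow_iff a).1 ha)

theorem StoredAt.exists_leafBelow {t : BTree (Fin n)} {v w : ℕ} (h : StoredAt l r t v)
    (hw : w ∈ t.vertexList l r v) : ∃ a : Fin n, LeafBelow l r w a := by
  obtain ⟨-, x, hx, hs⟩ := h.of_mem_vertexList hw
  obtain ⟨a, ha⟩ := List.exists_mem_of_ne_nil _ x.leaves_ne_nil
  exact ⟨a, x, hx, ha⟩

theorem StoredAt.nodup_vertexList {t : BTree (Fin n)} {v : ℕ} (h : StoredAt l r t v)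
    (hn : t.leaves.Nodup) : (t.vertexList l r v).Nodup := by
  induction t generalizing v with
  | leaf a => simp [BTree.vertexList]
  | node t₁ t₂ h1 h2 =>
    obtain ⟨hv, hl, hr, hl', hr'⟩ := h.of_node
    simp only [BTree.leaves] at hn
    obtain ⟨n1, n2, n3⟩ := List.nodup_append.1 hn
    simp only [BTree.vertexList, List.nodup_cons, List.mem_append]
    refine ⟨?_, List.nodup_append.2 ⟨h1 hl' n1, h2 hr' n2, ?_⟩⟩
    · rintro (h | h)
      · have := (hl'.of_mem_vertexList h).1; omega
      · have := (hr'.of_mem_vertexList h).1; omega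
    · rintro w hw w' hw' rfl
      obtain ⟨a, ha⟩ := hl'.exists_leafBelow hw
      exact n3 a (hl'.leafBelow_of_mem hw ha) a (hr'.leafBelow_of_mem hw' ha) rfl

theorem StoredAt.laminar {t : BTree (Fin n)} {v : ℕ} (h : StoredAt l r t v)
    (hn : t.leaves.Nodup) {u w : ℕ} (hu : u ∈ t.vertexList l r v) (hw : w ∈ t.vertexList l r v) :
    (u ≤ w ∧ (∀ a : Fin n, LeafBelow l r u a → LeafBelow l r w a) ∧
      ((∀ a : Fin n, LeafBelow l r w a → LeafBelow l r u a) → u = w)) ∨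
    (w ≤ u ∧ (∀ a : Fin n, LeafBelow l r w a → LeafBelow l r u a) ∧
      ((∀ a : Fin n, LeafBelow l r u a → LeafBelow l r w a) → u = w)) ∨
    ∀ a : Fin n, LeafBelow l r u a → ¬ LeafBelow l r w a := by
  induction t generalizing v with
  | leaf a =>
    simp only [BTree.vertexList, List.mem_singleton] at hu hw
    subst hu; subst hw
    exact Or.inl ⟨le_rfl, fun _ h => h, fun _ => rfl⟩
  | node t₁ t₂ h1 h2 =>
    obtain ⟨hv, hl, hr, hl', hr'⟩ := h.of_node
    simp only [BTree.leaves] at hn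
    obtain ⟨n1, n2, n3⟩ := List.nodup_append.1 hn
    have n3' : ∀ a ∈ t₁.leaves, a ∉ t₂.leaves := fun a ha hb => n3 a ha a hb rfl
    have hroot : ∀ w ∈ t₁.vertexList l r (l v) ++ t₂.vertexList l r (r v),
        w ≤ v ∧ (∀ a : Fin n, LeafBelow l r w a → LeafBelow l r v a) ∧
        ((∀ a : Fin n, LeafBelow l r v a → LeafBelow l r w a) → v = w) := by
      intro w hw
      have hw0 : w ∈ (BTree.node t₁ t₂).vertexList l r v := List.mem_cons_of_mem _ hw
      refine ⟨(h.of_mem_vertexList hw0).1,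
        fun a ha => (h.leafBelow_iff a).2 (h.leafBelow_of_mem hw0 ha), fun hle => ?_⟩
      exfalso
      rcases List.mem_append.1 hw with hw | hw
      · obtain ⟨a, ha⟩ := List.exists_mem_of_ne_nil _ t₂.leaves_ne_nil
        exact n3' a (hl'.leafBelow_of_mem hw (hle a ((h.leafBelow_iff a).2
          (List.mem_append_right _ ha)))) ha
      · obtain ⟨a, ha⟩ := List.exists_mem_of_ne_nil _ t₁.leaves_ne_nil
        exact n3' a ha (hr'.leafBelow_of_mem hw (hle a ((h.leafBelow_iff a).2
          (List.mem_append_left _ ha))))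
    simp only [BTree.vertexList, List.mem_cons] at hu hw
    rcases hu with rfl | hu
    · rcases hw with rfl | hw
      · exact Or.inl ⟨le_rfl, fun _ h => h, fun _ => rfl⟩
      · exact Or.inr (Or.inl (hroot w hw))
    · rcases hw with rfl | hw
      · obtain ⟨a, b, c⟩ := hroot u hu
        exact Or.inl ⟨a, b, fun h => (c h).symm⟩
      · rcases List.mem_append.1 hu with hu | hu <;> rcases List.mem_append.1 hw with hw | hw
        · exact h1 hl' n1 hu hw
        · exact Or.inr (Or.inr fun a ha hb =>
            n3' a (hl'.leafBelow_of_mem hu ha) (hr'.leafBelow_of_mem hw hb))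
        · exact Or.inr (Or.inr fun a ha hb =>
            n3' a (hl'.leafBelow_of_mem hw hb) (hr'.leafBelow_of_mem hu ha))
        · exact h2 hr' n2 hu hw

theorem StoredAt.mem_vertexList {t : BTree (Fin n)} (ht : t.leaves.Perm (List.finRange n))
    (h : StoredAt l r t (2 * n - 2)) {v : ℕ} (hv : v < 2 * n - 1) :
    v ∈ t.vertexList l r (2 * n - 2) := by
  have hnd : t.leaves.Nodup := ht.nodup_iff.2 (List.nodup_finRange n)
  have hlen := t.length_vertexList (l := l) (r := r) (2 * n - 2)
  rw [ht.length_eq, List.length_finRange] at hlen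
  have hsub : (t.vertexList l r (2 * n - 2)).toFinset ⊆ Finset.range (2 * n - 1) := by
    intro w hw
    have := (h.of_mem_vertexList (List.mem_toFinset.1 hw)).1
    rw [Finset.mem_range]; omega
  have heq := Finset.eq_of_subset_of_card_le hsub (by
    rw [List.toFinset_card_of_nodup (h.nodup_vertexList hnd), Finset.card_range]; omega)
  rw [← List.mem_toFinset, heq, Finset.mem_range]
  exact hv

/-- The end of the edge with index `j`. -/
def endIndex (σ : Equiv.Perm (Fin n)) (j : ℕ) : ℕ := if h : j < n then σ ⟨j, h⟩ else 0

/-- The edge with index `j` ends below the vertex `v`. -/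
def EdgeBelow (σ : Equiv.Perm (Fin n)) (l r : ℕ → ℕ) (v j : ℕ) : Prop :=
  ∃ h : j < n, LeafBelow l r v (σ ⟨j, h⟩)

theorem StoredAt.hier {t : BTree (Fin n)} (ht : t.leaves.Perm (List.finRange n))
    (h : StoredAt l r t (2 * n - 2)) (σ : Equiv.Perm (Fin n)) :
    Hier n (endIndex σ) l r (EdgeBelow σ l r) := by
  have hnd : t.leaves.Nodup := ht.nodup_iff.2 (List.nodup_finRange n)
  have hmem : ∀ v < 2 * n - 1, v ∈ t.vertexList l r (2 * n - 2) :=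
    fun v hv => h.mem_vertexList ht hv
  have hsub : ∀ v < 2 * n - 1, ∃ x, StoredAt l r x v ∧ x.leaves.Sublist t.leaves :=
    fun v hv => (h.of_mem_vertexList (hmem v hv)).2
  have hnode : ∀ v, n ≤ v → v < 2 * n - 1 → ∃ x₁ x₂ : BTree (Fin n), StoredAt l r (.node x₁ x₂) v ∧
      (x₁.leaves ++ x₂.leaves).Nodup := by
    intro v hv hv'
    obtain ⟨x, hx, hs⟩ := hsub v hv'
    cases x with
    | leaf a => have := hx.eq_of_leaf; have := a.2; omega
    | node x₁ x₂ => exact ⟨x₁, x₂, hx, hnd.sublist hs⟩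
  have hlift : ∀ u w, (∀ j, EdgeBelow σ l r u j → EdgeBelow σ l r w j) ↔
      ∀ a : Fin n, LeafBelow l r u a → LeafBelow l r w a := by
    intro u w
    constructor
    · intro h a ha
      obtain ⟨h1, h2⟩ := h (σ.symm a) ⟨(σ.symm a).2, by simpa using ha⟩
      simpa using h2
    · rintro h j ⟨hj, hj'⟩
      exact ⟨hj, h _ hj'⟩
  refine ⟨?_, ?_, ?_, ?_, ?_, ?_, ?_, ?_, ?_, ?_, ?_, ?_, ?_⟩
  · intro j hj; simp [endIndex, hj]
  · intro j hj k hk hjk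
    simp only [endIndex, hj, hk, dif_pos] at hjk
    simpa using σ.injective (Fin.ext hjk)
  · intro v hv
    exact ⟨σ.symm ⟨v, hv⟩, (σ.symm ⟨v, hv⟩).2, by simp [endIndex]⟩
  · rintro v j ⟨h, -⟩; exact h
  · intro v hv hv'
    obtain ⟨x₁, x₂, hx, -⟩ := hnode v hv hv'
    exact hx.of_node.2.1
  · intro v hv hv'
    obtain ⟨x₁, x₂, hx, -⟩ := hnode v hv hv'
    exact hx.of_node.2.2.1
  · intro v hv j hj
    obtain ⟨x, hx, -⟩ := hsub v (by omega)
    cases x with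
    | leaf a =>
      have h1 := hx.eq_of_leaf
      have h2 := hx.leafBelow_iff (σ ⟨j, hj⟩)
      rw [BTree.leaves, List.mem_singleton, Fin.ext_iff, ← h1] at h2
      simp only [EdgeBelow, hj, exists_true_left, endIndex, dif_pos, h2]
    | node x₁ x₂ => have := hx.of_node.1; omega
  · intro v hv hv' j
    obtain ⟨x₁, x₂, hx, -⟩ := hnode v hv hv'
    obtain ⟨-, -, -, h1, h2⟩ := hx.of_node
    simp only [EdgeBelow, hx.leafBelow_iff, h1.leafBelow_iff, h2.leafBelow_iff, BTree.leaves,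
      List.mem_append, ← exists_or]
  · rintro v hv hv' j ⟨hj, h3⟩ ⟨_, h4⟩
    obtain ⟨x₁, x₂, hx, hnd'⟩ := hnode v hv hv'
    obtain ⟨-, -, -, h1, h2⟩ := hx.of_node
    rw [h1.leafBelow_iff] at h3
    rw [h2.leafBelow_iff] at h4
    exact (List.nodup_append.1 hnd').2.2 _ h3 _ h4 rfl
  · intro j hj
    exact ⟨hj, (h.leafBelow_iff _).2 (ht.mem_iff.2 (List.mem_finRange _))⟩
  · intro u hu w hw
    rw [hlift, hlift]
    rcases h.laminar hnd (hmem u hu) (hmem w hw) with h | h | h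
    · exact Or.inl h.2.1
    · exact Or.inr (Or.inl h.2.1)
    · right; right
      rintro j ⟨hj, h1⟩ ⟨_, h2⟩
      exact h _ h1 h2
  · intro u hu w hw huw
    have h1 := (hlift u w).1 fun j => (huw j).1
    have h2 := (hlift w u).1 fun j => (huw j).2
    rcases h.laminar hnd (hmem u hu) (hmem w hw) with h3 | h3 | h3
    · exact h3.2.2 h2
    · exact h3.2.2 h1
    · obtain ⟨a, ha⟩ := h.exists_leafBelow (hmem u hu)
      exact absurd (h1 a ha) (h3 a ha)
  · intro u hu w hw huw
    have h1 := (hlift u w).1 huw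
    rcases h.laminar hnd (hmem u hu) (hmem w hw) with h3 | h3 | h3
    · exact h3.1
    · exact (h3.2.2 h1).le
    · obtain ⟨a, ha⟩ := h.exists_leafBelow (hmem u hu)
      exact absurd (h1 a ha) (h3 a ha)

end Stored

/-! ### Lists of leaves -/

theorem LeafOrder.perm {α : Type} {t : BTree α} {X : List α} (h : LeafOrder t X) : X.Perm t.leaves := by
  induction h with
  | leaf a => exact List.Perm.refl _
  | straight _ _ h1 h2 => exact h1.append h2
  | flipped _ _ h1 h2 => exact (List.perm_append_comm).trans (h1.append h2)

theorem LeafOrder.leaves {α : Type} (t : BTree α) : LeafOrder t t.leaves := by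
  induction t with
  | leaf a => exact .leaf a
  | node t₁ t₂ h1 h2 => exact .straight h1 h2

section Lists

variable {α : Type} [DecidableEq α]

theorem idxOf_filter_lt (p : α → Prop) [DecidablePred p] (X : List α) {a b : α} (ha : p a)
    (hb : p b) : (X.filter p).idxOf a < (X.filter p).idxOf b ↔ X.idxOf a < X.idxOf b := by
  induction X with
  | nil => simp
  | cons x X ih =>
    by_cases hx : p x
    · simp only [List.filter_cons, hx, decide_true, if_true, List.idxOf_cons]
      by_cases hxa : x = a <;> by_cases hxb : x = b <;> grind
    · have hxa : x ≠ a := by rintro rfl; exact hx ha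
      have hxb : x ≠ b := by rintro rfl; exact hx hb
      simp [hx, hxa, hxb, ih]

theorem eq_filter_append (p : α → Prop) [DecidablePred p] (X : List α) (hnd : X.Nodup)
    (h : ∀ a ∈ X, ∀ b ∈ X, p a → ¬ p b → X.idxOf a < X.idxOf b) :
    X = X.filter p ++ X.filter (fun a => ¬ p a) := by
  induction X with
  | nil => rfl
  | cons x X ih =>
    obtain ⟨hx, hnd⟩ := List.nodup_cons.1 hnd
    have hne : ∀ a ∈ X, x ≠ a := by rintro a ha rfl; exact hx ha
    have ih' := ih hnd (fun a ha b hb hpa hpb => by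
      have := h a (List.mem_cons_of_mem _ ha) b (List.mem_cons_of_mem _ hb) hpa hpb
      simpa [List.idxOf_cons, hne a ha, hne b hb] using this)
    by_cases hpx : p x
    · have : (x :: X).filter p = x :: X.filter p := by simp [hpx]
      rw [this]
      have : (x :: X).filter (fun a => ¬ p a) = X.filter (fun a => ¬ p a) := by simp [hpx]
      rw [this, List.cons_append, ← ih']
    · have h1 : X.filter p = [] := by
        rw [List.filter_eq_nil_iff]
        intro a ha
        simp only [decide_eq_true_eq]
        intro hpa
        have := h a (List.mem_cons_of_mem _ ha) x List.mem_cons_self hpa hpx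
        simp at this
      rw [h1, List.nil_append] at ih'
      have h2 : (x :: X).filter p = [] := by simp [hpx, h1]
      have h3 : (x :: X).filter (fun a => ¬ p a) = x :: X.filter (fun a => ¬ p a) := by simp [hpx]
      rw [h2, h3, ← ih']; rfl

theorem LeafOrder.filter {t : BTree α} {X : List α} (h : LeafOrder t X) (I : Finset α) :
    (∀ t', t.induced I = some t' → LeafOrder t' (X.filter (· ∈ I))) ∧
      (t.induced I = none → X.filter (· ∈ I) = []) := by
  induction h with
  | leaf a =>
    by_cases ha : a ∈ I
    · simp only [BTree.induced, ha, if_true]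
      refine ⟨?_, by simp⟩
      rintro t' ⟨⟩
      simpa [ha] using LeafOrder.leaf a
    · simp [BTree.induced, ha]
  | @straight t₁ t₂ X₁ X₂ _ _ h1 h2 =>
    simp only [BTree.induced, List.filter_append]
    cases e1 : t₁.induced I <;> cases e2 : t₂.induced I <;> simp only [e1, e2] at h1 h2 ⊢
    · simpa [h1] using h2.2
    · simpa [h1] using h2.1
    · have := h2.2 trivial
      rw [this, List.append_nil]
      exact ⟨h1.1, by simp⟩
    · refine ⟨?_, by simp⟩
      rintro t' ⟨⟩
      exact .straight (h1.1 _ rfl) (h2.1 _ rfl)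
  | @flipped t₁ t₂ X₁ X₂ _ _ h1 h2 =>
    simp only [BTree.induced, List.filter_append]
    cases e1 : t₁.induced I <;> cases e2 : t₂.induced I <;> simp only [e1, e2] at h1 h2 ⊢
    · simpa [h1] using h2.2
    · simpa [h1] using h2.1
    · have := h2.2 trivial
      rw [this, List.nil_append]
      exact ⟨h1.1, by simp⟩
    · refine ⟨?_, by simp⟩
      rintro t' ⟨⟩
      exact .flipped (h1.1 _ rfl) (h2.1 _ rfl)

theorem LeafOrder.exists_filter (t : BTree α) (I : Finset α) :
    (∀ t' Y, t.induced I = some t' → LeafOrder t' Y →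
      ∃ X, LeafOrder t X ∧ X.filter (· ∈ I) = Y) := by
  induction t with
  | leaf a =>
    intro t' Y ht' hY
    by_cases ha : a ∈ I
    · simp only [BTree.induced, ha, if_true, Option.some.injEq] at ht'
      subst ht'
      cases hY
      exact ⟨[a], .leaf a, by simp [ha]⟩
    · simp [BTree.induced, ha] at ht'
  | node t₁ t₂ h1 h2 =>
    intro t' Y ht' hY
    simp only [BTree.induced] at ht'
    cases e1 : t₁.induced I <;> cases e2 : t₂.induced I <;> simp only [e1, e2] at ht' h1 h2
    · simp at ht'
    · obtain ⟨X, hX, hX'⟩ := h2 _ _ rfl (by injection ht' with ht'; rwa [ht'])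
      refine ⟨t₁.leaves ++ X, .straight (LeafOrder.leaves t₁) hX, ?_⟩
      rw [List.filter_append, ((LeafOrder.leaves t₁).filter I).2 e1, hX', List.nil_append]
    · obtain ⟨X, hX, hX'⟩ := h1 _ _ rfl (by injection ht' with ht'; rwa [ht'])
      refine ⟨X ++ t₂.leaves, .straight hX (LeafOrder.leaves t₂), ?_⟩
      rw [List.filter_append, ((LeafOrder.leaves t₂).filter I).2 e2, hX', List.append_nil]
    · injection ht' with ht'
      subst ht'
      cases hY with
      | straight a b =>
        obtain ⟨X₁, hX₁, hX₁'⟩ := h1 _ _ rfl a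
        obtain ⟨X₂, hX₂, hX₂'⟩ := h2 _ _ rfl b
        exact ⟨X₁ ++ X₂, .straight hX₁ hX₂, by rw [List.filter_append, hX₁', hX₂']⟩
      | flipped a b =>
        obtain ⟨X₁, hX₁, hX₁'⟩ := h1 _ _ rfl a
        obtain ⟨X₂, hX₂, hX₂'⟩ := h2 _ _ rfl b
        exact ⟨X₂ ++ X₁, .flipped hX₁ hX₂, by rw [List.filter_append, hX₁', hX₂']⟩

theorem BTree.induced_empty (t : BTree α) : t.induced ∅ = none := by
  induction t with
  | leaf a => simp [induced]
  | node t₁ t₂ h1 h2 => simp [induced, h1, h2]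

end Lists

section Split

variable {n : ℕ} {l r : ℕ → ℕ}

theorem LeafOrder.split {t : BTree (Fin n)} {X : List (Fin n)} (h : LeafOrder t X)
    (hn : t.leaves.Nodup) {v : ℕ} (hs : StoredAt l r t v) {w : ℕ}
    (hw : w ∈ t.vertexList l r v) (hwn : n ≤ w) {a a' b b' : Fin n} (ha : LeafBelow l r (l w) a)
    (ha' : LeafBelow l r (l w) a') (hb : LeafBelow l r (r w) b) (hb' : LeafBelow l r (r w) b') :
    X.idxOf a < X.idxOf b ↔ X.idxOf a' < X.idxOf b' := by
  have hin : ∀ {t : BTree (Fin n)} {v : ℕ}, StoredAt l r t v → w ∈ t.vertexList l r v →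
      ∀ {X : List (Fin n)}, LeafOrder t X → a ∈ X ∧ a' ∈ X ∧ b ∈ X ∧ b' ∈ X := by
    intro t v h hw X hX
    have hmem : ∀ {c : Fin n}, LeafBelow l r w c → c ∈ X := fun hc =>
      hX.perm.mem_iff.2 (h.leafBelow_of_mem hw hc)
    obtain ⟨-, x, hx, -⟩ := h.of_mem_vertexList hw
    cases x with
    | leaf a => have := hx.eq_of_leaf; have := a.2; omega
    | node x₁ x₂ =>
      obtain ⟨-, -, -, h1, h2⟩ := hx.of_node
      rw [h1.leafBelow_iff] at ha ha'
      rw [h2.leafBelow_iff] at hb hb'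
      refine ⟨hmem ?_, hmem ?_, hmem ?_, hmem ?_⟩ <;> rw [hx.leafBelow_iff] <;>
        simp [BTree.leaves, *]
  have hap : ∀ {P Q : List (Fin n)}, (∀ c ∈ P, c ∉ Q) → ∀ {c d}, c ∈ P → d ∈ Q →
      (P ++ Q).idxOf c < (P ++ Q).idxOf d := by
    intro P Q hPQ c d hc hd
    have hd' : d ∉ P := fun h => hPQ d h hd
    have := List.idxOf_lt_length_iff.2 hc
    rw [List.idxOf_append_of_mem hc, List.idxOf_append_of_notMem hd']
    omega
  induction h generalizing v with
  | leaf c =>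
    simp only [BTree.vertexList, List.mem_singleton] at hw
    have := hs.eq_of_leaf
    have := c.2
    omega
  | @straight t₁ t₂ X₁ X₂ o1 o2 h1 h2 =>
    obtain ⟨hv, hl, hr, hl', hr'⟩ := hs.of_node
    obtain ⟨n1, n2, n3⟩ := List.nodup_append.1 hn
    have hd : ∀ c ∈ X₁, c ∉ X₂ := fun c hc hc' =>
      n3 c (o1.perm.mem_iff.1 hc) c (o2.perm.mem_iff.1 hc') rfl
    simp only [BTree.vertexList, List.mem_cons, List.mem_append] at hw
    rcases hw with rfl | hw | hw
    · rw [hl'.leafBelow_iff, ← o1.perm.mem_iff] at ha ha'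
      rw [hr'.leafBelow_iff, ← o2.perm.mem_iff] at hb hb'
      exact iff_of_true (hap hd ha hb) (hap hd ha' hb')
    · obtain ⟨m1, m2, m3, m4⟩ := hin hl' hw o1
      rw [List.idxOf_append_of_mem m1, List.idxOf_append_of_mem m2, List.idxOf_append_of_mem m3,
        List.idxOf_append_of_mem m4]
      exact h1 n1 hl' hw
    · obtain ⟨m1, m2, m3, m4⟩ := hin hr' hw o2
      rw [List.idxOf_append_of_notMem (fun h => hd _ h m1),
        List.idxOf_append_of_notMem (fun h => hd _ h m2),
        List.idxOf_append_of_notMem (fun h => hd _ h m3),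
        List.idxOf_append_of_notMem (fun h => hd _ h m4)]
      have := h2 n2 hr' hw
      omega
  | @flipped t₁ t₂ X₁ X₂ o1 o2 h1 h2 =>
    obtain ⟨hv, hl, hr, hl', hr'⟩ := hs.of_node
    obtain ⟨n1, n2, n3⟩ := List.nodup_append.1 hn
    have hd : ∀ c ∈ X₂, c ∉ X₁ := fun c hc' hc =>
      n3 c (o1.perm.mem_iff.1 hc) c (o2.perm.mem_iff.1 hc') rfl
    simp only [BTree.vertexList, List.mem_cons, List.mem_append] at hw
    rcases hw with rfl | hw | hw
    · rw [hl'.leafBelow_iff, ← o1.perm.mem_iff] at ha ha'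
      rw [hr'.leafBelow_iff, ← o2.perm.mem_iff] at hb hb'
      exact iff_of_false (hap hd hb ha).not_gt (hap hd hb' ha').not_gt
    · obtain ⟨m1, m2, m3, m4⟩ := hin hl' hw o1
      rw [List.idxOf_append_of_notMem (fun h => hd _ h m1),
        List.idxOf_append_of_notMem (fun h => hd _ h m2),
        List.idxOf_append_of_notMem (fun h => hd _ h m3),
        List.idxOf_append_of_notMem (fun h => hd _ h m4)]
      have := h1 n1 hl' hw
      omega
    · obtain ⟨m1, m2, m3, m4⟩ := hin hr' hw o2
      rw [List.idxOf_append_of_mem m1, List.idxOf_append_of_mem m2, List.idxOf_append_of_mem m3,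
        List.idxOf_append_of_mem m4]
      exact h2 n2 hr' hw

theorem LeafOrder.of_split {t : BTree (Fin n)} {X : List (Fin n)} (hp : X.Perm t.leaves)
    (hn : t.leaves.Nodup) {v : ℕ} (hs : StoredAt l r t v)
    (h : ∀ w ∈ t.vertexList l r v, n ≤ w → ∀ a a' b b' : Fin n, LeafBelow l r (l w) a →
      LeafBelow l r (l w) a' → LeafBelow l r (r w) b → LeafBelow l r (r w) b' →
      (X.idxOf a < X.idxOf b ↔ X.idxOf a' < X.idxOf b')) : LeafOrder t X := by
  induction t generalizing v X with
  | leaf a =>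
    rw [List.perm_singleton.1 hp]; exact .leaf a
  | node t₁ t₂ h1 h2 =>
    obtain ⟨hv, hl, hr, hl', hr'⟩ := hs.of_node
    obtain ⟨n1, n2, n3⟩ := List.nodup_append.1 hn
    have hd : ∀ c ∈ t₁.leaves, c ∉ t₂.leaves := fun c hc hc' => n3 c hc c hc' rfl
    have hXn : X.Nodup := hp.nodup_iff.2 hn
    have hmem : ∀ c, c ∈ X ↔ c ∈ t₁.leaves ∨ c ∈ t₂.leaves := fun c => by
      rw [hp.mem_iff]; simp [BTree.leaves]
    have p1 : (X.filter (· ∈ t₁.leaves)).Perm t₁.leaves := by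
      rw [List.perm_ext_iff_of_nodup (hXn.filter _) n1]
      intro c; simp only [List.mem_filter, hmem, decide_eq_true_eq]; tauto
    have p2 : (X.filter (· ∈ t₂.leaves)).Perm t₂.leaves := by
      rw [List.perm_ext_iff_of_nodup (hXn.filter _) n2]
      intro c; simp only [List.mem_filter, hmem, decide_eq_true_eq]; tauto
    have e1 : X.filter (fun c => ¬ c ∈ t₁.leaves) = X.filter (· ∈ t₂.leaves) := by
      apply List.filter_congr
      intro c hc
      have := hd c
      have := (hmem c).1 hc
      simp only [decide_eq_decide]; tauto
    have e2 : X.filter (fun c => ¬ c ∈ t₂.leaves) = X.filter (· ∈ t₁.leaves) := by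
      apply List.filter_congr
      intro c hc
      have := hd c
      have := (hmem c).1 hc
      simp only [decide_eq_decide]; tauto
    have o1 : LeafOrder t₁ (X.filter (· ∈ t₁.leaves)) := by
      refine h1 p1 n1 hl' fun w hw hwn a a' b b' ha ha' hb hb' => ?_
      have hin : ∀ c : Fin n, LeafBelow l r w c → c ∈ t₁.leaves := fun c =>
        hl'.leafBelow_of_mem hw
      obtain ⟨-, x, hx, -⟩ := hl'.of_mem_vertexList hw
      cases x with
      | leaf a => have := hx.eq_of_leaf; have := a.2; omega
      | node x₁ x₂ =>
        obtain ⟨-, -, -, s1, s2⟩ := hx.of_node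
        have hh := h w (by simp [BTree.vertexList, hw]) hwn a a' b b' ha ha' hb hb'
        rw [s1.leafBelow_iff] at ha ha'
        rw [s2.leafBelow_iff] at hb hb'
        rwa [idxOf_filter_lt, idxOf_filter_lt] <;> apply hin <;> rw [hx.leafBelow_iff] <;>
          simp [BTree.leaves, *]
    have o2 : LeafOrder t₂ (X.filter (· ∈ t₂.leaves)) := by
      refine h2 p2 n2 hr' fun w hw hwn a a' b b' ha ha' hb hb' => ?_
      have hin : ∀ c : Fin n, LeafBelow l r w c → c ∈ t₂.leaves := fun c =>
        hr'.leafBelow_of_mem hw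
      obtain ⟨-, x, hx, -⟩ := hr'.of_mem_vertexList hw
      cases x with
      | leaf a => have := hx.eq_of_leaf; have := a.2; omega
      | node x₁ x₂ =>
        obtain ⟨-, -, -, s1, s2⟩ := hx.of_node
        have hh := h w (by simp [BTree.vertexList, hw]) hwn a a' b b' ha ha' hb hb'
        rw [s1.leafBelow_iff] at ha ha'
        rw [s2.leafBelow_iff] at hb hb'
        rwa [idxOf_filter_lt, idxOf_filter_lt] <;> apply hin <;> rw [hx.leafBelow_iff] <;>
          simp [BTree.leaves, *]
    have hroot := h v (by simp [BTree.vertexList]) hv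
    simp only [hl'.leafBelow_iff, hr'.leafBelow_iff] at hroot
    obtain ⟨a₀, ha₀⟩ := List.exists_mem_of_ne_nil _ t₁.leaves_ne_nil
    obtain ⟨b₀, hb₀⟩ := List.exists_mem_of_ne_nil _ t₂.leaves_ne_nil
    by_cases hlt : X.idxOf a₀ < X.idxOf b₀
    · have := eq_filter_append (· ∈ t₁.leaves) X hXn fun a ha b hb hpa hpb =>
        (hroot a a₀ b b₀ hpa ha₀ (((hmem b).1 hb).resolve_left hpb) hb₀).2 hlt
      rw [e1] at this
      rw [this]
      exact .straight o1 o2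
    · have := eq_filter_append (· ∈ t₂.leaves) X hXn fun b hb a ha hpb hpa => by
        have ha' := ((hmem a).1 ha).resolve_right hpa
        have h3 := (hroot a a₀ b b₀ ha' ha₀ hpb hb₀).not.2 hlt
        refine lt_of_le_of_ne (not_lt.1 h3) fun heq => ?_
        rw [List.idxOf_inj hb] at heq
        exact hd a ha' (heq ▸ hpb)
      rw [e2] at this
      rw [this]
      exact .flipped o1 o2

end Split

end Tangle

namespace Tangle

/-! ### Layouts as orders on the index set of the edges -/

section Order

variable {n : ℕ} {l r : ℕ → ℕ} (σ : Equiv.Perm (Fin n))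

/-- The order of the edges given by a list of their ends. -/
def listOrder (X : List (Fin n)) (j k : ℕ) : Prop :=
  ∃ (hj : j < n) (hk : k < n), X.idxOf (σ ⟨j, hj⟩) < X.idxOf (σ ⟨k, hk⟩)

/-- The order of the edges given by an array of the numbers of their ends. -/
def arrayOrder (n : ℕ) (e a : ℕ → ℕ) (j k : ℕ) : Prop :=
  j < n ∧ k < n ∧ ∃ p q, p < q ∧ q < n ∧ a p = e j ∧ a q = e k

/-- The first `n` entries of the array `a` are the numbers below `n`. -/
structure IsPermArray (n : ℕ) (a : ℕ → ℕ) : Prop where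
  lt : ∀ k < n, a k < n
  inj : ∀ j < n, ∀ k < n, a j = a k → j = k

theorem IsPermArray.surj {a : ℕ → ℕ} (h : IsPermArray n a) {v : ℕ} (hv : v < n) :
    ∃ k < n, a k = v := by
  have := Finset.surj_on_of_inj_on_of_card_le (s := Finset.range n) (t := Finset.range n)
    (fun k _ => a k) (fun k hk => Finset.mem_range.2 (h.lt k (Finset.mem_range.1 hk)))
    (fun j k hj hk hjk => h.inj j (Finset.mem_range.1 hj) k (Finset.mem_range.1 hk) hjk) le_rfl
    v (Finset.mem_range.2 hv)
  obtain ⟨k, hk, rfl⟩ := this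
  exact ⟨k, Finset.mem_range.1 hk, rfl⟩

theorem IsPermArray.exists_list {a : ℕ → ℕ} (h : IsPermArray n a) :
    ∃ X : List (Fin n), X.Perm (List.finRange n) ∧ (List.range n).map a = X.map Fin.val ∧
      listOrder σ X = arrayOrder n (endIndex σ) a := by
  let X : List (Fin n) := List.ofFn fun k : Fin n => ⟨a k, h.lt k k.2⟩
  have hlen : X.length = n := List.length_ofFn
  have hnd : X.Nodup := by
    rw [List.nodup_ofFn]
    intro j k hjk
    exact Fin.ext (h.inj j j.2 k k.2 (congrArg Fin.val hjk))
  have hmem : ∀ v, v ∈ X := by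
    intro v
    obtain ⟨k, hk, hv⟩ := h.surj v.2
    rw [List.mem_ofFn]
    exact ⟨⟨k, hk⟩, Fin.ext hv⟩
  have hidx : ∀ p (hp : p < n) (v : Fin n), a p = v → X.idxOf v = p := by
    intro p hp v hv
    have h1 : X[p]'(by omega) = v := by
      simp only [X, List.getElem_ofFn]; exact Fin.ext hv
    rw [← h1, hnd.idxOf_getElem]
  refine ⟨X, ?_, ?_, ?_⟩
  · rw [List.perm_ext_iff_of_nodup hnd (List.nodup_finRange n)]
    intro v; simp [hmem]
  · apply List.ext_getElem
    · simp [hlen]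
    · intro k h1 h2; simp [X]
  · funext j k
    apply propext
    constructor
    · rintro ⟨hj, hk, hlt⟩
      obtain ⟨p, hp, hpj⟩ := h.surj (σ ⟨j, hj⟩).2
      obtain ⟨q, hq, hqk⟩ := h.surj (σ ⟨k, hk⟩).2
      rw [hidx p hp _ hpj, hidx q hq _ hqk] at hlt
      exact ⟨hj, hk, p, q, hlt, hq, by simp [endIndex, hj, hpj], by simp [endIndex, hk, hqk]⟩
    · rintro ⟨hj, hk, p, q, hpq, hq, hpj, hqk⟩
      simp only [endIndex, hj, hk, dif_pos] at hpj hqk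
      exact ⟨hj, hk, by rw [hidx p (hpq.trans hq) _ hpj, hidx q hq _ hqk]; exact hpq⟩

variable {t : BTree (Fin n)} {σ}

theorem LeafOrder.isOrder (ht : t.leaves.Perm (List.finRange n))
    (h : StoredAt l r t (2 * n - 2)) {X : List (Fin n)} (hX : LeafOrder t X) :
    Hier.IsOrder n l r (EdgeBelow σ l r) (listOrder σ X) := by
  have hnd : t.leaves.Nodup := ht.nodup_iff.2 (List.nodup_finRange n)
  have hmem : ∀ v, v ∈ X := fun v => hX.perm.mem_iff.2 (ht.mem_iff.2 (List.mem_finRange v))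
  constructor
  · intro j hj k hk hjk
    simp only [listOrder, hj, hk, exists_true_left]
    have : X.idxOf (σ ⟨j, hj⟩) ≠ X.idxOf (σ ⟨k, hk⟩) := by
      rw [Ne, List.idxOf_inj (hmem _), σ.injective.eq_iff, Fin.mk.injEq]
      exact hjk
    omega
  · rintro w hw hw' x x' y y' ⟨hx, hx1⟩ ⟨hx', hx1'⟩ ⟨hy, hy1⟩ ⟨hy', hy1'⟩
    simp only [listOrder, hx, hx', hy, hy', exists_true_left]
    exact hX.split hnd h (h.mem_vertexList ht hw') hw hx1 hx1' hy1 hy1'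

theorem LeafOrder.of_isOrder (ht : t.leaves.Perm (List.finRange n))
    (h : StoredAt l r t (2 * n - 2)) {X : List (Fin n)} (hX : X.Perm (List.finRange n))
    (ho : Hier.IsOrder n l r (EdgeBelow σ l r) (listOrder σ X)) : LeafOrder t X := by
  have hnd : t.leaves.Nodup := ht.nodup_iff.2 (List.nodup_finRange n)
  refine LeafOrder.of_split (hX.trans ht.symm) hnd h fun w hw hwn a a' b b' ha ha' hb hb' => ?_
  have hlift : ∀ {v} {a : Fin n}, LeafBelow l r v a → EdgeBelow σ l r v (σ.symm a) :=
    fun {v a} h => ⟨(σ.symm a).2, by simpa using h⟩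
  have hn := a.2
  have hle := (h.of_mem_vertexList hw).1
  have := ho.split w hwn (by omega) _ _ _ _ (hlift ha) (hlift ha') (hlift hb) (hlift hb')
  simpa [listOrder] using this

end Order

/-- The bijection between the edges and the leaves on one side. -/
def sidePerm {n : ℕ} (φ : Equiv.Perm (Fin n)) : Side → Equiv.Perm (Fin n)
  | .T => Equiv.refl _
  | .S => φ

namespace Tanglegram

variable {n : ℕ} (G : Tanglegram n)

/-- The tree on one side. -/
def tree : Side → BTree (Fin n)
  | .T => G.T
  | .S => G.S

theorem leaves_tree (s : Side) : (G.tree s).leaves.Perm (List.finRange n) := by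
  cases s
  · exact G.leavesT
  · exact G.leavesS

/-- The pointers of one side. -/
def pointers (l l' : ℕ → ℕ) : Side → ℕ → ℕ
  | .T => l
  | .S => l'

variable {G} {l r l' r' : ℕ → ℕ}

theorem IsStored.side (h : G.IsStored l r l' r') (s : Side) :
    StoredAt (pointers l l' s) (pointers r r' s) (G.tree s) (2 * n - 2) := by
  cases s
  · exact h.1
  · exact h.2

variable (G) in
/-- The description of a tanglegram in a pointer structure by sets of edges. -/
def setup (h : G.IsStored l r l' r') (hn : 2 ≤ n) (i : Fin n) : Setup where
  n := n
  i := i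
  e s := endIndex (sidePerm G.φ s)
  k0 := pointers l l'
  k1 := pointers r r'
  c s := EdgeBelow (sidePerm G.φ s) (pointers l l' s) (pointers r r' s)
  two_le := hn
  i_lt := i.2
  hier s := (h.side s).hier (G.leaves_tree s) _

/-- The orders of the edges given by the lists of leaves in a layout. -/
def layoutOrder (φ : Equiv.Perm (Fin n)) (X Y : List (Fin n)) : Side → ℕ → ℕ → Prop
  | .T => listOrder (sidePerm φ .T) X
  | .S => listOrder (sidePerm φ .S) Y

theorem two_le_of_planarOn {i : Fin n} (h : G.PlanarOn (Finset.univ.erase i)) : 2 ≤ n := by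
  by_contra hlt
  have hn : n = 1 := by have := i.2; omega
  subst hn
  obtain ⟨T', S', h1, -⟩ := h
  have : (Finset.univ.erase i : Finset (Fin 1)) = ∅ := by
    ext x; simp [Subsingleton.elim x i]
  rw [this, BTree.induced_empty] at h1
  cases h1

theorem crossings_filter_eq_zero {I : Finset (Fin n)} {X Y : List (Fin n)}
    (hX : X.Perm (List.finRange n)) (hY : Y.Perm (List.finRange n)) :
    crossings G.φ (X.filter (· ∈ I)) (Y.filter (· ∈ I.image G.φ)) = 0 ↔
      ∀ a ∈ I, ∀ b ∈ I, (X.idxOf a < X.idxOf b ↔ Y.idxOf (G.φ a) < Y.idxOf (G.φ b)) := by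
  have hXm : ∀ v, v ∈ X := fun v => hX.mem_iff.2 (List.mem_finRange v)
  have hYm : ∀ v, v ∈ Y := fun v => hY.mem_iff.2 (List.mem_finRange v)
  unfold crossings
  rw [Finset.card_eq_zero, Finset.filter_eq_empty_iff]
  have key : ∀ a ∈ I, ∀ b ∈ I, ((X.filter (· ∈ I)).idxOf a < (X.filter (· ∈ I)).idxOf b ↔
      X.idxOf a < X.idxOf b) ∧ ((Y.filter (· ∈ I.image G.φ)).idxOf (G.φ b) <
      (Y.filter (· ∈ I.image G.φ)).idxOf (G.φ a) ↔ Y.idxOf (G.φ b) < Y.idxOf (G.φ a)) :=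
    fun a ha b hb => ⟨idxOf_filter_lt _ _ ha hb,
      idxOf_filter_lt _ _ (Finset.mem_image_of_mem _ hb) (Finset.mem_image_of_mem _ ha)⟩
  constructor
  · intro h a ha b hb
    have h1 := @h (a, b) (by simp [ha, hb, hXm])
    have h2 := @h (b, a) (by simp [ha, hb, hXm])
    rw [(key a ha b hb).1, (key a ha b hb).2] at h1
    rw [(key b hb a ha).1, (key b hb a ha).2] at h2
    rcases eq_or_ne a b with rfl | hab
    · exact iff_of_false (lt_irrefl _) (lt_irrefl _)
    · have h3 : X.idxOf a ≠ X.idxOf b := by rwa [Ne, List.idxOf_inj (hXm a)]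
      have h4 : Y.idxOf (G.φ a) ≠ Y.idxOf (G.φ b) := by
        rwa [Ne, List.idxOf_inj (hYm _), G.φ.injective.eq_iff]
      omega
  · rintro h ⟨a, b⟩ hab
    simp only [Finset.mem_product, List.mem_toFinset, List.mem_filter, decide_eq_true_eq] at hab
    have := h a hab.1.2 b hab.2.2
    rw [(key a hab.1.2 b hab.2.2).1, (key a hab.1.2 b hab.2.2).2]
    omega

theorem planar_of_layout (h : G.IsStored l r l' r') (hn : 2 ≤ n) {i : Fin n}
    {X Y : List (Fin n)} (hXY : IsLayout G.T G.S X Y)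
    (hr : G.RestrictsToPlanar (Finset.univ.erase i) X Y) :
    (G.setup h hn i).Planar (layoutOrder G.φ X Y) := by
  obtain ⟨hX, hY⟩ := hXY
  refine Setup.Planar.of_side .T ?_ ?_
  · intro t
    cases t
    · exact hX.isOrder G.leavesT h.1
    · exact hY.isOrder G.leavesS h.2
  · obtain ⟨T', S', -, -, -, h0⟩ := hr
    rw [crossings_filter_eq_zero (hX.perm.trans G.leavesT) (hY.perm.trans G.leavesS)] at h0
    intro j hj k hk hji hki
    have := h0 ⟨j, hj⟩ (Finset.mem_erase.2 ⟨fun h => hji (congrArg Fin.val h), Finset.mem_univ _⟩) ⟨k, hk⟩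
      (Finset.mem_erase.2 ⟨fun h => hki (congrArg Fin.val h), Finset.mem_univ _⟩)
    have hj' : j < n := hj
    have hk' : k < n := hk
    simpa [layoutOrder, Side.other, listOrder, hj', hk', sidePerm] using this

theorem layout_of_planar (h : G.IsStored l r l' r') (hn : 2 ≤ n) {i : Fin n}
    (hp : G.PlanarOn (Finset.univ.erase i)) {X Y : List (Fin n)}
    (hX : X.Perm (List.finRange n)) (hY : Y.Perm (List.finRange n))
    (hpl : (G.setup h hn i).Planar (layoutOrder G.φ X Y)) :
    IsLayout G.T G.S X Y ∧ G.RestrictsToPlanar (Finset.univ.erase i) X Y := by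
  have oX : LeafOrder G.T X := LeafOrder.of_isOrder G.leavesT h.1 hX (hpl.order .T)
  have oY : LeafOrder G.S Y := LeafOrder.of_isOrder G.leavesS h.2 hY (hpl.order .S)
  refine ⟨⟨oX, oY⟩, ?_⟩
  obtain ⟨T', S', e1, e2, -⟩ := hp
  refine ⟨T', S', e1, e2, ⟨(oX.filter _).1 _ e1, (oY.filter _).1 _ e2⟩, ?_⟩
  rw [crossings_filter_eq_zero hX hY]
  intro a ha b hb
  have hne : ∀ {a : Fin n}, a ∈ Finset.univ.erase i → (a : ℕ) ≠ i := by
    intro a ha heq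
    exact (Finset.mem_erase.1 ha).1 (Fin.ext heq)
  have := hpl.planar .T a a.2 b b.2 (hne ha) (hne hb)
  simpa [layoutOrder, Side.other, listOrder, sidePerm] using this

theorem exists_planar (h : G.IsStored l r l' r') (hn : 2 ≤ n) {i : Fin n}
    (hp : G.PlanarOn (Finset.univ.erase i)) :
    ∃ b, (G.setup h hn i).Planar b := by
  obtain ⟨T', S', e1, e2, X, Y, ⟨hX, hY⟩, h0⟩ := hp
  obtain ⟨X', hX', rfl⟩ := LeafOrder.exists_filter _ _ _ _ e1 hX
  obtain ⟨Y', hY', rfl⟩ := LeafOrder.exists_filter _ _ _ _ e2 hY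
  exact ⟨_, planar_of_layout h hn ⟨hX', hY'⟩ ⟨T', S', e1, e2, ⟨hX, hY⟩, h0⟩⟩

theorem crossings_eq (h : G.IsStored l r l' r') (hn : 2 ≤ n) {i : Fin n}
    {X Y : List (Fin n)} (hX : X.Perm (List.finRange n)) (hY : Y.Perm (List.finRange n))
    (hpl : (G.setup h hn i).Planar (layoutOrder G.φ X Y)) :
    crossings G.φ X Y = (G.setup h hn i).numCross (layoutOrder G.φ X Y) := by
  classical
  have hXm : ∀ v, v ∈ X := fun v => hX.mem_iff.2 (List.mem_finRange v)
  have hYm : ∀ v, v ∈ Y := fun v => hY.mem_iff.2 (List.mem_finRange v)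
  have hXne : ∀ {a b}, a ≠ b → X.idxOf a ≠ X.idxOf b := by
    intro a b hab; rwa [Ne, List.idxOf_inj (hXm a)]
  have hYne : ∀ {a b}, a ≠ b → Y.idxOf (G.φ a) ≠ Y.idxOf (G.φ b) := by
    intro a b hab; rwa [Ne, List.idxOf_inj (hYm _), G.φ.injective.eq_iff]
  have hcr : ∀ a : Fin n, (G.setup h hn i).Crosses (layoutOrder G.φ X Y) a ↔
      ¬ (X.idxOf a < X.idxOf i ↔ Y.idxOf (G.φ a) < Y.idxOf (G.φ i)) := by
    intro a
    have : (G.setup h hn i).i = i := rfl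
    simp [Setup.Crosses, this, layoutOrder, listOrder, sidePerm]
  have hpl' : ∀ a b : Fin n, a ≠ i → b ≠ i →
      (X.idxOf a < X.idxOf b ↔ Y.idxOf (G.φ a) < Y.idxOf (G.φ b)) := by
    intro a b ha hb
    have := hpl.planar .T a a.2 b b.2 (fun h => ha (Fin.ext h)) (fun h => hb (Fin.ext h))
    simpa [layoutOrder, Side.other, listOrder, sidePerm] using this
  unfold crossings Setup.numCross
  refine Finset.card_bij (fun p _ => if p.1 = i then (p.2 : ℕ) else p.1) ?_ ?_ ?_
  · rintro ⟨a, b⟩ hab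
    simp only [Finset.mem_filter] at hab
    obtain ⟨-, h1, h2⟩ := hab
    have hab' : a ≠ b := by rintro rfl; simp at h1
    simp only [Finset.mem_filter, Finset.mem_range]
    have := hpl' a b
    split_ifs with hai
    · subst hai
      refine ⟨b.2, fun h => hab' (Fin.ext h).symm, ?_⟩
      rw [hcr]
      omega
    · refine ⟨a.2, fun h => hai (Fin.ext h), ?_⟩
      have hb : b = i := by
        by_contra hb
        have := this hai hb
        omega
      subst hb
      rw [hcr]
      omega
  · rintro ⟨a, b⟩ hab ⟨a', b'⟩ hab' heq
    simp only [Finset.mem_filter] at hab hab'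
    obtain ⟨-, h1, h2⟩ := hab
    obtain ⟨-, h1', h2'⟩ := hab'
    have hb : a ≠ i → b = i := by
      intro hai
      by_contra hb
      have := hpl' a b hai hb
      omega
    have hb' : a' ≠ i → b' = i := by
      intro hai
      by_contra hb
      have := hpl' a' b' hai hb
      omega
    simp only at heq
    split_ifs at heq with c1 c2 c2
    · rw [c1, c2, Fin.ext heq]
    · have e1 := Fin.ext heq
      have e2 := hb' c2
      subst c1 e1 e2
      omega
    · have e1 := Fin.ext heq
      have e2 := hb c1
      subst c2 e1 e2
      omega
    · rw [hb c1, hb' c2, Fin.ext heq]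
  · intro j hj
    simp only [Finset.mem_filter, Finset.mem_range] at hj
    obtain ⟨hjn, hji, hjc⟩ := hj
    have hjn' : j < n := hjn
    have hjc' := (hcr ⟨j, hjn'⟩).1 hjc
    have hne : (⟨j, hjn'⟩ : Fin n) ≠ i := fun h => hji (congrArg Fin.val h)
    have n1 := hXne hne
    have n2 := hYne hne
    by_cases hlt : X.idxOf (⟨j, hjn'⟩ : Fin n) < X.idxOf i
    · refine ⟨(⟨j, hjn'⟩, i), ?_, by simp [hne]⟩
      simp only [Finset.mem_filter, Finset.mem_product, List.mem_toFinset, hXm, true_and]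
      omega
    · refine ⟨(i, ⟨j, hjn'⟩), ?_, by simp⟩
      simp only [Finset.mem_filter, Finset.mem_product, List.mem_toFinset, hXm, true_and]
      omega

/-- A layout stored in two arrays solves the problem if the orders given by these arrays restrict to
a planar layout, and have the fewest crossings among all such orders. -/
theorem exists_solution (h : G.IsStored l r l' r') (hn : 2 ≤ n) {i : Fin n}
    (hp : G.PlanarOn (Finset.univ.erase i)) {a : Side → ℕ → ℕ} (ha : ∀ s, IsPermArray n (a s))
    (hpl : (G.setup h hn i).Planar fun s => arrayOrder n ((G.setup h hn i).e s) (a s))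
    (hopt : ∀ b, (G.setup h hn i).Planar b → (G.setup h hn i).numCross
      (fun s => arrayOrder n ((G.setup h hn i).e s) (a s)) ≤ (G.setup h hn i).numCross b) :
    ∃ X Y : List (Fin n), (List.range n).map (a .T) = X.map Fin.val ∧
      (List.range n).map (a .S) = Y.map Fin.val ∧ G.IsSingleEdgeInsertion i X Y := by
  obtain ⟨X, hX, eX, oX⟩ := (ha .T).exists_list (sidePerm G.φ .T)
  obtain ⟨Y, hY, eY, oY⟩ := (ha .S).exists_list (sidePerm G.φ .S)
  have heq : (fun s => arrayOrder n ((G.setup h hn i).e s) (a s)) = layoutOrder G.φ X Y := by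
    funext s
    cases s
    · exact oX.symm
    · exact oY.symm
  rw [heq] at hpl hopt
  obtain ⟨h1, h2⟩ := layout_of_planar h hn hp hX hY hpl
  refine ⟨X, Y, eX, eY, h1, h2, fun X' Y' h3 h4 => ?_⟩
  have h5 := planar_of_layout h hn h3 h4
  rw [crossings_eq h hn hX hY hpl,
    crossings_eq h hn (h3.1.perm.trans G.leavesT) (h3.2.perm.trans G.leavesS) h5]
  exact hopt _ h5

end Tanglegram

end Tangle

namespace Tangle

/-! ### Tools for the verification of programs -/

/-- Loop invariants that do not depend on the loop counter. -/
theorem for_ind {x : Name} {e : Expr} {l : List Prog} {m : Cell → ℕ} {N : ℕ} (hN : e.val m = N)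
    (Inv : ℕ → (Cell → ℕ) → Prop) (h0 : Inv 0 m)
    (hx : ∀ k m' v, Inv k m' → Inv k (Function.update m' (x, 0, 0) v))
    (hs : ∀ k < N, ∀ m', (for' x e l).Frame m m' → m' (x, 0, 0) = k → Inv k m' →
      Inv (k + 1) ((block l).exec m')) :
    Inv N ((for' x e l).exec m) := by
  refine Prog.loop_inv hN Inv h0 fun k hk m' hF hI => hs k hk _ ?_ (by simp) (hx k m' k hI)
  intro y hy a b
  have hy' := hy
  simp only [for', Prog.keeps, Bool.and_eq_true, decide_eq_true_eq] at hy'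
  simp only [update_cell, Ne.symm hy'.1, false_and, if_false]
  exact hF y hy a b

theorem exec_when_pos {c : Cond} {l : List Prog} {m : Cell → ℕ} (h : c.val m = true) :
    (when c l).exec m = (block l).exec m := if_pos h

theorem exec_when_neg {c : Cond} {l : List Prog} {m : Cell → ℕ} (h : ¬ c.val m = true) :
    (when c l).exec m = m := if_neg h

theorem exec_nil (m : Cell → ℕ) : (block []).exec m = m := rfl

theorem exec_cons (p : Prog) (l : List Prog) (m : Cell → ℕ) :
    (block (p :: l)).exec m = (block l).exec (p.exec m) := rfl

/-- The program does not write to the arrays in the list. -/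
def Prog.keepsAll (L : List Name) (p : Prog) : Bool := L.all fun y => p.keeps y

theorem Prog.Frame.of_keepsAll {p : Prog} {m m' : Cell → ℕ} (h : p.Frame m m') {L : List Name}
    (hL : p.keepsAll L = true) {y : Name} (hy : y ∈ L) (a b : ℕ) : m' (y, a, b) = m (y, a, b) :=
  h y (List.all_eq_true.1 hL y hy) a b

namespace Setup

variable {G : Setup}

theorem le_end {s : Side} {j : ℕ} (hj : j < G.n) (u : ℕ) :
    G.Le s (G.e s j) u ↔ G.c s u j := by
  have H := G.hier s
  have h1 := fun k hk => H.leaf (G.e s j) (H.e_lt j hj) k hk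
  constructor
  · intro h; exact h j ((h1 j hj).2 rfl)
  · intro h k hk
    have hkn := H.c_lt _ _ hk
    rwa [H.e_inj k hkn j hj ((h1 k hkn).1 hk)]

variable (G)

/-- The input is in the memory. -/
structure Input (m : Cell → ℕ) : Prop where
  size : m (.size, 0, 0) = G.n
  phi : ∀ j < G.n, m (.phi, j, 0) = G.e .S j
  eT : ∀ j < G.n, G.e .T j = j
  ins : ∀ s, m (.ins s, 0, 0) = G.e s G.i
  kid0 : ∀ s v, G.n ≤ v → v < 2 * G.n - 1 → m (.kid s, v, 0) = G.k0 s v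
  kid1 : ∀ s v, G.n ≤ v → v < 2 * G.n - 1 → m (.kid s, v, 1) = G.k1 s v

/-- The arrays that contain the input. -/
def inputNames : List Name := [.size, .phi, .ins .T, .ins .S, .kid .T, .kid .S]

/-- The number of leaves of the subtanglegram below `u`. -/
noncomputable def count (s : Side) (u : ℕ) : ℕ :=
  open Classical in ((Finset.range G.n).filter fun j => j ≠ G.i ∧ G.c s u j).card

/-- The input and the tables of descendants are in the memory. -/
structure Base (m : Cell → ℕ) : Prop extends G.Input m where
  verts : m (.verts, 0, 0) = 2 * G.n - 1
  desc : ∀ s, ∀ u < 2 * G.n - 1, ∀ v < 2 * G.n - 1, m (.desc s, u, v) = 1 ↔ G.Le s v u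
  cnt : ∀ s, ∀ u < 2 * G.n - 1, m (.cnt s, u, 0) = G.count s u

/-- The arrays that contain the input and the tables of descendants. -/
def baseNames : List Name :=
  [.size, .phi, .ins .T, .ins .S, .kid .T, .kid .S, .verts, .desc .T, .desc .S, .cnt .T, .cnt .S]

variable {G} {m m' : Cell → ℕ}

theorem Input.congr (h : G.Input m) (he : ∀ y ∈ inputNames, ∀ a b, m' (y, a, b) = m (y, a, b)) :
    G.Input m' := by
  constructor
  · rw [he _ (by decide)]; exact h.size
  · intro j hj; rw [he _ (by decide)]; exact h.phi j hj
  · exact h.eT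
  · intro s; rw [he _ (by cases s <;> decide)]; exact h.ins s
  · intro s v hv hv'; rw [he _ (by cases s <;> decide)]; exact h.kid0 s v hv hv'
  · intro s v hv hv'; rw [he _ (by cases s <;> decide)]; exact h.kid1 s v hv hv'

theorem Base.congr (h : G.Base m) (he : ∀ y ∈ baseNames, ∀ a b, m' (y, a, b) = m (y, a, b)) :
    G.Base m' := by
  refine ⟨h.toInput.congr fun y hy => he y ?_, ?_, ?_, ?_⟩
  · revert y; decide
  · rw [he _ (by decide)]; exact h.verts
  · intro s u hu v hv; rw [he _ (by cases s <;> decide)]; exact h.desc s u hu v hv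
  · intro s u hu; rw [he _ (by cases s <;> decide)]; exact h.cnt s u hu

theorem Input.frame (h : G.Input m) {p : Prog} (hF : p.Frame m m')
    (hp : p.keepsAll inputNames = true) : G.Input m' :=
  h.congr fun _ hy a b => hF.of_keepsAll hp hy a b

theorem Base.frame (h : G.Base m) {p : Prog} (hF : p.Frame m m')
    (hp : p.keepsAll baseNames = true) : G.Base m' :=
  h.congr fun _ hy a b => hF.of_keepsAll hp hy a b

theorem Base.exec (h : G.Base m) {p : Prog} (hp : p.keepsAll baseNames = true) :
    G.Base (p.exec m) :=
  h.frame (p.frame_exec m) hp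

/-! ### Number of vertices, tables -/

theorem exec_countVerts (h : G.Input m) : countVerts.exec m (.verts, 0, 0) = 2 * G.n - 1 := by
  have key : ∀ m : Cell → ℕ, m (.size, 0, 0) = G.n → m (.verts, 0, 0) = 0 →
      (for' .a Name.size [incr .verts, incr .verts]).exec m (.verts, 0, 0) = 2 * G.n := by
    intro m hs hv
    refine for_ind (N := G.n) (by simpa using hs) (fun k m' => m' (.verts, 0, 0) = 2 * k)
      hv (by simp) ?_
    intro k hk m' hF hk' hI
    simp [hI]; omega
  simp only [countVerts, block, List.foldr, exec_seq, exec_skip]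
  have := key ((put .verts 0).exec m) (by simpa using h.size) (by simp)
  have e : ∀ m : Cell → ℕ, (decr .verts).exec m (.verts, 0, 0) = m (.verts, 0, 0) - 1 := by
    intro m; simp
  rw [e, this]

theorem le_iff {s : Side} {u v : ℕ} (hu : u < 2 * G.n - 1) (hv : v < 2 * G.n - 1) :
    G.Le s v u ↔ u = v ∨ (G.n ≤ u ∧ (G.Le s v (G.k0 s u) ∨ G.Le s v (G.k1 s u))) := by
  have H := G.hier s
  constructor
  · intro h
    rcases eq_or_ne u v with rfl | hne
    · exact Or.inl rfl
    · exact Or.inr (H.le_kid hv hu h hne.symm)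
  · rintro (rfl | ⟨h1, h2 | h2⟩)
    · exact fun _ h => h
    · exact fun j hj => (H.node u h1 hu j).2 (Or.inl (h2 j hj))
    · exact fun j hj => (H.node u h1 hu j).2 (Or.inr (h2 j hj))

/-- One row of the table of descendants. -/
def descRow (s : Side) : Prog :=
  for' .b Name.verts [
      when (.or (.eq Name.a Name.b) (.and (internal Name.a)
          (.or (below s (.get (.kid s) Name.a 0) Name.b)
            (below s (.get (.kid s) Name.a 1) Name.b))))
        [.set (.desc s) Name.a Name.b 1]]

theorem exec_descRow (s : Side) {a : ℕ} (h : G.Input m) (hv : m (.verts, 0, 0) = 2 * G.n - 1)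
    (ha : a < 2 * G.n - 1) (hka : m (.a, 0, 0) = a)
    (h1 : ∀ u < a, ∀ v < 2 * G.n - 1, (m (.desc s, u, v) = 1 ↔ G.Le s v u))
    (h2 : ∀ v, m (.desc s, a, v) = 0) :
    (∀ v < 2 * G.n - 1, ((descRow s).exec m (.desc s, a, v) = 1 ↔ G.Le s v a)) ∧
      ∀ u v, u ≠ a → (descRow s).exec m (.desc s, u, v) = m (.desc s, u, v) := by
  have H := G.hier s
  have L1 := for_ind (x := .b) (e := Name.verts) (l := [
      when (.or (.eq Name.a Name.b) (.and (internal Name.a)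
          (.or (below s (.get (.kid s) Name.a 0) Name.b)
            (below s (.get (.kid s) Name.a 1) Name.b))))
        [.set (.desc s) Name.a Name.b 1]])
    (N := 2 * G.n - 1) (m := m) (by simpa using hv)
    (fun b m' => (∀ v < b, (m' (.desc s, a, v) = 1 ↔ G.Le s v a)) ∧
      (∀ v, b ≤ v → m' (.desc s, a, v) = 0) ∧
      ∀ u v, u ≠ a → m' (.desc s, u, v) = m (.desc s, u, v))
    ⟨by simp, fun v _ => h2 v, fun _ _ _ => rfl⟩ (by simp) ?_
  · exact ⟨L1.1, L1.2.2⟩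
  intro b hb m' hF' hb' ⟨i1, i2, i3⟩
  have hI' : G.Input m' := h.frame hF' (by cases s <;> rfl)
  have ha' : m' (.a, 0, 0) = a := (hF' _ (by cases s <;> rfl) _ _).trans hka
  have hcond : ((Cond.or (.eq Name.a Name.b) (.and (internal Name.a)
        (.or (below s (.get (.kid s) Name.a 0) Name.b)
          (below s (.get (.kid s) Name.a 1) Name.b)))).val m' = true) ↔ G.Le s b a := by
    rw [le_iff ha hb]
    simp only [Cond.val, Expr.val, reg, internal, below, holds, val_zero, val_one, ha', hb',
      hI'.size, Bool.or_eq_true, Bool.and_eq_true, decide_eq_true_eq, Bool.not_eq_true',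
      decide_eq_false_iff_not, not_lt]
    refine or_congr Iff.rfl (and_congr_right fun h5 => ?_)
    have k0 := H.kid0_lt a h5 ha
    have k1 := H.kid1_lt a h5 ha
    rw [hI'.kid0 s a h5 ha, hI'.kid1 s a h5 ha, i3 _ _ k0.ne, i3 _ _ k1.ne,
      h1 _ k0 b hb, h1 _ k1 b hb]
  rw [exec_cons, exec_nil]
  by_cases hle : G.Le s b a
  · rw [exec_when_pos (hcond.2 hle)]
    simp only [exec_cons, exec_nil, exec_set, Expr.val, reg, val_zero, val_one, ha', hb', update_cell]
    refine ⟨?_, ?_, ?_⟩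
    · intro v hv
      rcases eq_or_ne v b with rfl | hne
      · simp [hle]
      · simpa [hne] using i1 v (by omega)
    · intro v hv
      have : v ≠ b := by omega
      simpa [this] using i2 v (by omega)
    · intro u v hu
      simpa [hu] using i3 u v hu
  · rw [exec_when_neg (hcond.not.2 hle)]
    refine ⟨?_, fun v hv => i2 v (by omega), i3⟩
    intro v hv
    rcases eq_or_ne v b with rfl | hne
    · rw [i2 v le_rfl]; simp [hle]
    · exact i1 v (by omega)

/-- Count the leaves of the subtanglegram below a vertex. -/
def cntRow (s : Side) : Prog :=
  for' .b Name.size [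
      when (.and (below s Name.a Name.b) (.not (.eq Name.b (Name.ins s))))
        [put1 (.cnt s) Name.a (.succ (at1 (.cnt s) Name.a))]]

theorem exec_cntRow (s : Side) {a : ℕ} (h : G.Input m) (hka : m (.a, 0, 0) = a)
    (h1 : ∀ v < 2 * G.n - 1, (m (.desc s, a, v) = 1 ↔ G.Le s v a))
    (h2 : m (.cnt s, a, 0) = 0) :
    (cntRow s).exec m (.cnt s, a, 0) = G.count s a ∧
      ∀ u, u ≠ a → (cntRow s).exec m (.cnt s, u, 0) = m (.cnt s, u, 0) := by
  classical
  have H := G.hier s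
  have L1 := for_ind (x := .b) (e := Name.size) (l := [
      when (.and (below s Name.a Name.b) (.not (.eq Name.b (Name.ins s))))
        [put1 (.cnt s) Name.a (.succ (at1 (.cnt s) Name.a))]])
      (N := G.n) (m := m) (by simpa using h.size)
      (fun b m' => (m' (.cnt s, a, 0) =
          ((Finset.range b).filter fun v => G.Le s v a ∧ v ≠ G.e s G.i).card) ∧
        ∀ u, u ≠ a → m' (.cnt s, u, 0) = m (.cnt s, u, 0))
      ⟨by simp [h2], fun _ _ => rfl⟩ (by simp) ?_
  · refine ⟨?_, L1.2⟩
    refine L1.1.trans ?_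
    unfold count
    symm
    refine Finset.card_bij (fun j _ => G.e s j) ?_ ?_ ?_
    · intro j hj
      simp only [Finset.mem_filter, Finset.mem_range] at hj ⊢
      exact ⟨H.e_lt j hj.1, (le_end hj.1 a).2 hj.2.2,
        fun h => hj.2.1 (H.e_inj _ hj.1 _ G.i_lt h)⟩
    · intro j hj k hk
      simp only [Finset.mem_filter, Finset.mem_range] at hj hk
      exact H.e_inj j hj.1 k hk.1
    · intro v hv
      simp only [Finset.mem_filter, Finset.mem_range] at hv
      obtain ⟨j, hj, rfl⟩ := H.e_surj v hv.1
      refine ⟨j, ?_, rfl⟩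
      simp only [Finset.mem_filter, Finset.mem_range]
      exact ⟨hj, fun h => hv.2.2 (by rw [h]), (le_end hj a).1 hv.2.1⟩
  intro b hb m' hF' hb' ⟨i1, i2⟩
  have hI' : G.Input m' := h.frame hF' (by cases s <;> rfl)
  have ha' : m' (.a, 0, 0) = a := (hF' _ (by cases s <;> rfl) _ _).trans hka
  have hd' : m' (.desc s, a, b) = 1 ↔ G.Le s b a := by
    rw [hF' _ (by cases s <;> rfl)]; exact h1 b (by have := G.two_le; omega)
  have hins := hI'.ins s
  have hr : (Finset.range (b + 1)).filter (fun v => G.Le s v a ∧ v ≠ G.e s G.i) =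
      if G.Le s b a ∧ b ≠ G.e s G.i then
        insert b ((Finset.range b).filter fun v => G.Le s v a ∧ v ≠ G.e s G.i)
      else (Finset.range b).filter fun v => G.Le s v a ∧ v ≠ G.e s G.i := by
    rw [Finset.range_add_one, Finset.filter_insert]
  rw [hr]
  by_cases hcond : G.Le s b a ∧ b ≠ G.e s G.i
  · simp [below, ha', hb', hd', hins, hcond, i1]
    exact fun u hu => by simp [hu, i2 u hu]
  · have : ¬ (m' (.desc s, a, b) = 1 ∧ ¬ b = G.e s G.i) := by rw [hd']; exact hcond
    simp [below, ha', hb', hins, this, i1, hcond]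
    exact i2

theorem exec_descendants (s : Side) (h : G.Input m) (hv : m (.verts, 0, 0) = 2 * G.n - 1)
    (hd : ∀ u v, m (.desc s, u, v) = 0) (hc : ∀ u, m (.cnt s, u, 0) = 0) :
    (∀ u < 2 * G.n - 1, ∀ v < 2 * G.n - 1,
      ((descendants s).exec m (.desc s, u, v) = 1 ↔ G.Le s v u)) ∧
    ∀ u < 2 * G.n - 1, (descendants s).exec m (.cnt s, u, 0) = G.count s u := by
  have := for_ind (x := .a) (e := Name.verts) (l := [descRow s, cntRow s])
    (N := 2 * G.n - 1) (m := m) (by simpa using hv)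
    (fun a m' => (∀ u < a, ∀ v < 2 * G.n - 1, (m' (.desc s, u, v) = 1 ↔ G.Le s v u)) ∧
      (∀ u, a ≤ u → ∀ v, m' (.desc s, u, v) = 0) ∧ (∀ u < a, m' (.cnt s, u, 0) = G.count s u) ∧
      ∀ u, a ≤ u → m' (.cnt s, u, 0) = 0)
    ⟨by simp, fun u _ v => hd u v, by simp, fun u _ => hc u⟩ (by simp) ?_
  · exact ⟨fun u hu => this.1 u hu, fun u hu => this.2.2.1 u hu⟩
  intro a ha m₁ hF hka ⟨h1, h2, h3, h4⟩
  have hI₁ : G.Input m₁ := h.frame hF (by cases s <;> rfl)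
  have hv₁ : m₁ (.verts, 0, 0) = 2 * G.n - 1 := (hF _ (by cases s <;> rfl) _ _).trans hv
  simp only [block, List.foldr, exec_seq, exec_skip]
  obtain ⟨l1, l2⟩ := exec_descRow s hI₁ hv₁ ha hka h1 (h2 a le_rfl)
  have hF₂ := (descRow s).frame_exec m₁
  generalize (descRow s).exec m₁ = m₂ at *
  obtain ⟨l4, l5⟩ := exec_cntRow s (hI₁.frame hF₂ (by cases s <;> rfl))
    ((hF₂ _ (by cases s <;> rfl) _ _).trans hka) l1
    ((hF₂ _ (by cases s <;> rfl) _ _).trans (h4 a le_rfl))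
  have hF₃ := (cntRow s).frame_exec m₂
  generalize (cntRow s).exec m₂ = m₃ at *
  have hd₃ : ∀ u v, m₃ (.desc s, u, v) = m₂ (.desc s, u, v) :=
    fun u v => hF₃ _ (by cases s <;> rfl) _ _
  have hc₂ : ∀ u, m₂ (.cnt s, u, 0) = m₁ (.cnt s, u, 0) :=
    fun u => hF₂ _ (by cases s <;> rfl) _ _
  refine ⟨?_, ?_, ?_, ?_⟩
  · intro u hu v hv
    rw [hd₃]
    rcases eq_or_ne u a with rfl | hne
    · exact l1 v hv
    · rw [l2 u v hne]; exact h1 u (by omega) v hv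
  · intro u hu v
    rw [hd₃, l2 u v (by omega)]; exact h2 u (by omega) v
  · intro u hu
    rcases eq_or_ne u a with rfl | hne
    · exact l4
    · rw [l5 u hne, hc₂]; exact h3 u (by omega)
  · intro u hu
    rw [l5 u (by omega), hc₂]; exact h4 u (by omega)

/-! ### The table `P` -/

/-- Some edge of the subtanglegram joins a leaf below `u` to a leaf below `v`. -/
def Adj (G : Setup) (u v : ℕ) : Prop := ∃ j, j ≠ G.i ∧ G.c .T u j ∧ G.c .S v j

theorem adj_iff {u v : ℕ} (hu : u < 2 * G.n - 1) (hv : v < 2 * G.n - 1) :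
    G.Adj u v ↔ (∃ j < G.n, j ≠ G.i ∧ G.e .T j = u ∧ G.e .S j = v) ∨
      (G.n ≤ u ∧ (G.Adj (G.k0 .T u) v ∨ G.Adj (G.k1 .T u) v)) ∨
      (G.n ≤ v ∧ (G.Adj u (G.k0 .S v) ∨ G.Adj u (G.k1 .S v))) := by
  have HT := G.hier .T
  have HS := G.hier .S
  constructor
  · rintro ⟨j, hj, h1, h2⟩
    have hjn := HT.c_lt _ _ h1
    by_cases hu' : G.n ≤ u
    · right; left
      refine ⟨hu', ?_⟩
      rcases (HT.node u hu' hu j).1 h1 with h | h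
      · exact Or.inl ⟨j, hj, h, h2⟩
      · exact Or.inr ⟨j, hj, h, h2⟩
    · by_cases hv' : G.n ≤ v
      · right; right
        refine ⟨hv', ?_⟩
        rcases (HS.node v hv' hv j).1 h2 with h | h
        · exact Or.inl ⟨j, hj, h1, h⟩
        · exact Or.inr ⟨j, hj, h1, h⟩
      · left
        exact ⟨j, hjn, hj, (HT.leaf u (by omega) j hjn).1 h1, (HS.leaf v (by omega) j hjn).1 h2⟩
  · rintro (⟨j, hjn, hj, h1, h2⟩ | ⟨h, ⟨j, hj, h1, h2⟩ | ⟨j, hj, h1, h2⟩⟩ |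
      ⟨h, ⟨j, hj, h1, h2⟩ | ⟨j, hj, h1, h2⟩⟩)
    · have h3 := HT.e_lt j hjn
      have h4 := HS.e_lt j hjn
      exact ⟨j, hj, (HT.leaf u (by omega) j hjn).2 h1, (HS.leaf v (by omega) j hjn).2 h2⟩
    · exact ⟨j, hj, (HT.node u h hu j).2 (Or.inl h1), h2⟩
    · exact ⟨j, hj, (HT.node u h hu j).2 (Or.inr h1), h2⟩
    · exact ⟨j, hj, h1, (HS.node v h hv j).2 (Or.inl h2)⟩
    · exact ⟨j, hj, h1, (HS.node v h hv j).2 (Or.inr h2)⟩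

/-- The part of the table `P` for the leaves. -/
def leafP : Prog :=
  for' .a Name.size [
      when (.not (.eq Name.a (Name.ins .T))) [.set .tabP Name.a (at1 .phi Name.a) 1]]

theorem exec_leafP (h : G.Input m) (h0 : ∀ u v, m (.tabP, u, v) = 0) (u v : ℕ) :
    leafP.exec m (.tabP, u, v) = 1 ↔ ∃ j < G.n, j ≠ G.i ∧ G.e .T j = u ∧ G.e .S j = v := by
  refine for_ind (N := G.n) (by simpa using h.size) (fun k m' => m' (.tabP, u, v) = 1 ↔
    ∃ j < k, j ≠ G.i ∧ G.e .T j = u ∧ G.e .S j = v) (by simp [h0]) (by simp) ?_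
  intro k hk m' hF hk' hI
  have h' : G.Input m' := h.frame hF (by decide)
  have e1 : (∃ j < k + 1, j ≠ G.i ∧ G.e .T j = u ∧ G.e .S j = v) ↔
      (k ≠ G.i ∧ k = u ∧ G.e .S k = v) ∨ ∃ j < k, j ≠ G.i ∧ G.e .T j = u ∧ G.e .S j = v := by
    constructor
    · rintro ⟨j, hj, hj'⟩
      rcases Nat.lt_succ_iff_lt_or_eq.1 hj with h | rfl
      · exact Or.inr ⟨j, h, hj'⟩
      · rw [h'.eT j hk] at hj'; exact Or.inl hj'
    · rintro (h | ⟨j, hj, hj'⟩)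
      · rw [← h'.eT k hk] at h; exact ⟨k, by omega, by rw [← h'.eT k hk]; simpa [h'.eT k hk] using h⟩
      · exact ⟨j, by omega, hj'⟩
  rw [e1]
  have h1 := h'.ins .T
  rw [h'.eT _ G.i_lt] at h1
  rw [exec_cons, exec_nil]
  by_cases hki : k = G.i
  · rw [exec_when_neg (by simp [hk', h1, hki]), hI]
    tauto
  · rw [exec_when_pos (by simp [hk', h1, hki])]
    simp only [exec_cons, exec_nil, exec_set, Expr.val, reg, at1, val_zero, val_one, hk',
      h'.phi k hk, update_cell, true_and]
    split_ifs with h2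
    · simp [h2, hki]
    · rw [hI]
      have : ¬ (k = u ∧ G.e .S k = v) := fun h => h2 ⟨h.1.symm, h.2.symm⟩
      grind

/-- One row of the table `P`. -/
def rowP : Prog :=
  for' .b Name.verts [
        when (.or
          (.and (internal Name.a) (.or
            (holds .tabP (.get (.kid .T) Name.a 0) Name.b)
            (holds .tabP (.get (.kid .T) Name.a 1) Name.b)))
          (.and (internal Name.b) (.or
            (holds .tabP Name.a (.get (.kid .S) Name.b 0))
            (holds .tabP Name.a (.get (.kid .S) Name.b 1)))))
          [.set .tabP Name.a Name.b 1]]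

theorem exec_rowP {a : ℕ} (h : G.Input m) (hv : m (.verts, 0, 0) = 2 * G.n - 1)
    (ha : a < 2 * G.n - 1) (hka : m (.a, 0, 0) = a)
    (h1 : ∀ u < a, ∀ v < 2 * G.n - 1, (m (.tabP, u, v) = 1 ↔ G.Adj u v))
    (h2 : ∀ v, m (.tabP, a, v) = 1 ↔ ∃ j < G.n, j ≠ G.i ∧ G.e .T j = a ∧ G.e .S j = v) :
    (∀ v < 2 * G.n - 1, (rowP.exec m (.tabP, a, v) = 1 ↔ G.Adj a v)) ∧
      ∀ u v, u ≠ a → rowP.exec m (.tabP, u, v) = m (.tabP, u, v) := by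
  have HT := G.hier .T
  have HS := G.hier .S
  have L1 := for_ind (x := .b) (e := Name.verts) (l := [
        when (.or
          (.and (internal Name.a) (.or
            (holds .tabP (.get (.kid .T) Name.a 0) Name.b)
            (holds .tabP (.get (.kid .T) Name.a 1) Name.b)))
          (.and (internal Name.b) (.or
            (holds .tabP Name.a (.get (.kid .S) Name.b 0))
            (holds .tabP Name.a (.get (.kid .S) Name.b 1)))))
          [.set .tabP Name.a Name.b 1]])
    (N := 2 * G.n - 1) (m := m) (by simpa using hv)
    (fun b m' => (∀ v < b, (m' (.tabP, a, v) = 1 ↔ G.Adj a v)) ∧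
      (∀ v, b ≤ v → (m' (.tabP, a, v) = 1 ↔
        ∃ j < G.n, j ≠ G.i ∧ G.e .T j = a ∧ G.e .S j = v)) ∧
      ∀ u v, u ≠ a → m' (.tabP, u, v) = m (.tabP, u, v))
    ⟨by simp, fun v _ => h2 v, fun _ _ _ => rfl⟩ (by simp) ?_
  · exact ⟨L1.1, L1.2.2⟩
  intro b hb m' hF' hb' ⟨i1, i2, i3⟩
  have hI' : G.Input m' := h.frame hF' (by decide)
  have ha' : m' (.a, 0, 0) = a := (hF' _ (by decide) _ _).trans hka
  have hcond : ((Cond.or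
          (.and (internal Name.a) (.or
            (holds .tabP (.get (.kid .T) Name.a 0) Name.b)
            (holds .tabP (.get (.kid .T) Name.a 1) Name.b)))
          (.and (internal Name.b) (.or
            (holds .tabP Name.a (.get (.kid .S) Name.b 0))
            (holds .tabP Name.a (.get (.kid .S) Name.b 1))))).val m' = true) ↔
      (G.n ≤ a ∧ (G.Adj (G.k0 .T a) b ∨ G.Adj (G.k1 .T a) b)) ∨
      (G.n ≤ b ∧ (G.Adj a (G.k0 .S b) ∨ G.Adj a (G.k1 .S b))) := by
    simp only [Cond.val, Expr.val, reg, internal, holds, val_zero, val_one, ha', hb',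
      hI'.size, Bool.or_eq_true, Bool.and_eq_true, decide_eq_true_eq, Bool.not_eq_true',
      decide_eq_false_iff_not, not_lt]
    refine or_congr (and_congr_right fun h5 => ?_) (and_congr_right fun h5 => ?_)
    · have k0 := HT.kid0_lt a h5 ha
      have k1 := HT.kid1_lt a h5 ha
      rw [hI'.kid0 .T a h5 ha, hI'.kid1 .T a h5 ha, i3 _ _ k0.ne, i3 _ _ k1.ne,
        h1 _ k0 b hb, h1 _ k1 b hb]
    · have k0 := HS.kid0_lt b h5 hb
      have k1 := HS.kid1_lt b h5 hb
      rw [hI'.kid0 .S b h5 hb, hI'.kid1 .S b h5 hb, i1 _ k0, i1 _ k1]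
  have hadj := adj_iff ha hb
  rw [exec_cons, exec_nil]
  by_cases hle : (G.n ≤ a ∧ (G.Adj (G.k0 .T a) b ∨ G.Adj (G.k1 .T a) b)) ∨
      (G.n ≤ b ∧ (G.Adj a (G.k0 .S b) ∨ G.Adj a (G.k1 .S b)))
  · rw [exec_when_pos (hcond.2 hle)]
    simp only [exec_cons, exec_nil, exec_set, Expr.val, reg, val_zero, val_one, ha', hb', update_cell]
    refine ⟨?_, ?_, ?_⟩
    · intro v hv
      rcases eq_or_ne v b with rfl | hne
      · simp [hadj, hle]
      · simpa [hne] using i1 v (by omega)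
    · intro v hv
      have : v ≠ b := by omega
      simpa [this] using i2 v (by omega)
    · intro u v hu
      simpa [hu] using i3 u v hu
  · rw [exec_when_neg (hcond.not.2 hle)]
    refine ⟨?_, fun v hv => i2 v (by omega), i3⟩
    intro v hv
    rcases eq_or_ne v b with rfl | hne
    · rw [i2 v le_rfl, hadj]; exact (or_iff_left hle).symm
    · exact i1 v (by omega)

theorem exec_tableP (h : G.Input m) (hv : m (.verts, 0, 0) = 2 * G.n - 1)
    (h0 : ∀ u v, m (.tabP, u, v) = 0) :
    ∀ u < 2 * G.n - 1, ∀ v < 2 * G.n - 1, (tableP.exec m (.tabP, u, v) = 1 ↔ G.Adj u v) := by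
  have e1 : tableP.exec m = (for' .a Name.verts [rowP]).exec (leafP.exec m) := rfl
  rw [e1]
  have h1 := exec_leafP h h0
  have hF := leafP.frame_exec m
  generalize leafP.exec m = m₁ at *
  have hI₁ : G.Input m₁ := h.frame hF (by decide)
  have hv₁ : m₁ (.verts, 0, 0) = 2 * G.n - 1 := (hF _ (by decide) _ _).trans hv
  have := for_ind (x := .a) (e := Name.verts) (l := [rowP]) (N := 2 * G.n - 1) (m := m₁)
    (by simpa using hv₁)
    (fun a m' => (∀ u < a, ∀ v < 2 * G.n - 1, (m' (.tabP, u, v) = 1 ↔ G.Adj u v)) ∧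
      (∀ u, a ≤ u → ∀ v, m' (.tabP, u, v) = 1 ↔
        ∃ j < G.n, j ≠ G.i ∧ G.e .T j = u ∧ G.e .S j = v))
    ⟨by simp, fun u _ v => h1 u v⟩ (by simp) ?_
  · exact this.1
  intro a ha m₂ hF₂ hka ⟨i1, i2⟩
  have hI₂ : G.Input m₂ := hI₁.frame hF₂ (by decide)
  have hv₂ : m₂ (.verts, 0, 0) = 2 * G.n - 1 := (hF₂ _ (by decide) _ _).trans hv₁
  simp only [block, List.foldr, exec_seq, exec_skip]
  obtain ⟨l1, l2⟩ := exec_rowP hI₂ hv₂ ha hka i1 (i2 a le_rfl)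
  refine ⟨fun u hu v hv => ?_, fun u hu v => ?_⟩
  · rcases eq_or_ne u a with rfl | hne
    · exact l1 v hv
    · rw [l2 u v hne]; exact i1 u (by omega) v hv
  · rw [l2 u v (by omega)]; exact i2 u (by omega) v

end Setup

end Tangle

namespace Tangle

namespace Setup

open Hier

variable {G : Setup}

/-! ### Partial layouts -/

/-- Some edge of the subtanglegram joins a leaf below `u` to a leaf below `v`. -/
def Meets (G : Setup) (s : Side) (u v : ℕ) : Prop := ∃ j, j ≠ G.i ∧ G.c s u j ∧ G.c s.other v j

theorem Meets.symm {s : Side} {u v : ℕ} (h : G.Meets s u v) : G.Meets s.other v u := by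
  obtain ⟨j, hj, h1, h2⟩ := h
  exact ⟨j, hj, h2, by rwa [other_other]⟩

theorem meets_comm {s : Side} {u v : ℕ} : G.Meets s.other v u ↔ G.Meets s u v :=
  ⟨fun h => by simpa using h.symm, Meets.symm⟩

theorem meets_kid {s : Side} {u v : ℕ} (hu : G.n ≤ u) (hu' : u < 2 * G.n - 1) :
    G.Meets s u v ↔ G.Meets s (G.k0 s u) v ∨ G.Meets s (G.k1 s u) v := by
  have := (G.hier s).node u hu hu'
  unfold Meets
  constructor
  · rintro ⟨j, hj, h1, h2⟩
    rcases (this j).1 h1 with h | h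
    · exact Or.inl ⟨j, hj, h, h2⟩
    · exact Or.inr ⟨j, hj, h, h2⟩
  · rintro (⟨j, hj, h1, h2⟩ | ⟨j, hj, h1, h2⟩)
    · exact ⟨j, hj, (this j).2 (Or.inl h1), h2⟩
    · exact ⟨j, hj, (this j).2 (Or.inr h1), h2⟩

/-- All leaves below `u` come before the leaves below `v`. -/
def Before (G : Setup) (b : Side → ℕ → ℕ → Prop) (s : Side) (u v : ℕ) : Prop :=
  ∀ j k, G.c s u j → G.c s v k → j ≠ k ∧ b s j k

theorem Before.mono {b : Side → ℕ → ℕ → Prop} {s : Side} {u v u' v' : ℕ} (h : G.Before b s u v)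
    (hu : ∀ j, G.c s u' j → G.c s u j) (hv : ∀ j, G.c s v' j → G.c s v j) : G.Before b s u' v' :=
  fun j k hj hk => h j k (hu j hj) (hv k hk)

/-- The lists `X` consist of vertices such that the sets of leaves below them can be arranged in
the given order by a planar layout. -/
structure Cut (G : Setup) (X : Side → List ℕ) : Prop where
  lt : ∀ s, ∀ u ∈ X s, u < 2 * G.n - 1
  cover : ∀ s, ∀ j < G.n, ∃ u ∈ X s, G.c s u j
  planar : ∃ b, G.Planar b ∧ ∀ s, (X s).Pairwise (G.Before b s)

theorem eq_of_pairwise {X : List ℕ} {b : Side → ℕ → ℕ → Prop} {s : Side}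
    (hX : X.Pairwise (G.Before b s)) {u v j : ℕ} (hu : u ∈ X) (hv : v ∈ X)
    (hj : G.c s u j) (hj' : G.c s v j) : u = v := by
  by_contra hne
  have h2 : X.Pairwise (fun u v => ∀ j, G.c s u j → ¬ G.c s v j) :=
    hX.imp fun {u v} h j h1 h2 => (h j j h1 h2).1 rfl
  have : Std.Symm fun u v => ∀ j, G.c s u j → ¬ G.c s v j := ⟨fun u v h j h1 h2 => h j h2 h1⟩
  exact h2.forall hu hv hne j hj hj'

namespace Cut

variable {X : Side → List ℕ}

theorem eq_of_mem (h : G.Cut X) {s : Side} {u v j : ℕ} (hu : u ∈ X s) (hv : v ∈ X s)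
    (hj : G.c s u j) (hj' : G.c s v j) : u = v := by
  obtain ⟨b, -, hb⟩ := h.planar
  exact eq_of_pairwise (hb s) hu hv hj hj'

theorem nodup (h : G.Cut X) (s : Side) : (X s).Nodup := by
  obtain ⟨b, -, hb⟩ := h.planar
  refine List.Pairwise.imp_of_mem ?_ (hb s)
  rintro u v hu - huv rfl
  obtain ⟨j, hj⟩ := (G.hier s).nonempty u (h.lt s u hu)
  exact (huv j j hj hj).1 rfl

theorem length_le (h : G.Cut X) (s : Side) : (X s).length ≤ G.n := by
  have h1 : ∀ u, ∃ j, u ∈ X s → G.c s u j := by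
    intro u
    by_cases hu : u ∈ X s
    · obtain ⟨j, hj⟩ := (G.hier s).nonempty u (h.lt s u hu)
      exact ⟨j, fun _ => hj⟩
    · exact ⟨0, fun h => absurd h hu⟩
  choose f hf using h1
  rw [← List.toFinset_card_of_nodup (h.nodup s), ← Finset.card_range G.n]
  refine Finset.card_le_card_of_injOn f ?_ ?_
  · intro u hu
    exact Finset.mem_coe.2 (Finset.mem_range.2 ((G.hier s).c_lt _ _ (hf u (by simpa using hu))))
  · intro u hu v hv huv
    have hu' : u ∈ X s := by simpa using hu
    have hv' : v ∈ X s := by simpa using hv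
    exact h.eq_of_mem hu' hv' (hf u hu') (by rw [huv]; exact hf v hv')

end Cut

open Classical in
/-- The number of neighbors of `w` in the bipartite graph on `X`. -/
noncomputable def degree (G : Setup) (X : Side → List ℕ) (s : Side) (w : ℕ) : ℕ :=
  (X s.other).countP fun y => G.Meets s w y

theorem Cut.degree_le_one_iff {X : Side → List ℕ} (h : G.Cut X) (s : Side) (w : ℕ) :
    G.degree X s w ≤ 1 ↔
      ∀ y ∈ X s.other, ∀ z ∈ X s.other, G.Meets s w y → G.Meets s w z → y = z := by
  classical
  unfold degree
  rw [List.countP_eq_length_filter, ← List.toFinset_card_of_nodup ((h.nodup _).filter _),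
    Finset.card_le_one]
  simp only [List.mem_toFinset, List.mem_filter, decide_eq_true_eq]
  exact ⟨fun H y hy z hz h1 h2 => H y ⟨hy, h1⟩ z ⟨hz, h2⟩,
    fun H y hy z hz => H y hy.1 z hz.1 hy.2 hz.2⟩

theorem degree_pos_iff {X : Side → List ℕ} (s : Side) (w : ℕ) :
    0 < G.degree X s w ↔ ∃ y ∈ X s.other, G.Meets s w y := by
  classical
  unfold degree
  rw [List.countP_pos_iff]
  simp

/-- An internal vertex of maximal degree, if it has a single neighbor, is matched with it. -/
theorem Cut.matched {X : Side → List ℕ} (h : G.Cut X) {s : Side} {u y : ℕ} (hu : u ∈ X s)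
    (hmax : ∀ t, ∀ w ∈ X t, G.n ≤ w → G.degree X t w ≤ G.degree X s u) (hy : y ∈ X s.other)
    (huy : G.Meets s u y) (huniq : ∀ z ∈ X s.other, G.Meets s u z → z = y) : G.Matched s u y := by
  have h1 : G.degree X s u ≤ 1 := (h.degree_le_one_iff s u).2 fun a ha b hb h1 h2 =>
    (huniq a ha h1).trans (huniq b hb h2).symm
  have h2 : ∀ x ∈ X s, ∀ x' ∈ X s, G.Meets s.other y x → G.Meets s.other y x' → x = x' := by
    rcases lt_or_ge y G.n with hyn | hyn
    · rintro x hx x' hx' ⟨j, hj, h3, h4⟩ ⟨k, hk, h5, h6⟩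
      rw [other_other] at h4 h6
      have H := G.hier s.other
      have hj' := H.c_lt _ _ h3
      have hk' := H.c_lt _ _ h5
      have : j = k := H.e_inj j hj' k hk'
        (((H.leaf y hyn j hj').1 h3).trans ((H.leaf y hyn k hk').1 h5).symm)
      subst this
      exact h.eq_of_mem hx hx' h4 h6
    · have := (h.degree_le_one_iff s.other y).1 ((hmax s.other y hy hyn).trans h1)
      simpa only [other_other] using this
  intro j hj
  constructor
  · intro hj'
    obtain ⟨z, hz, hzj⟩ := h.cover s.other j ((G.hier s).c_lt _ _ hj')
    rwa [← huniq z hz ⟨j, hj, hj', hzj⟩]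
  · intro hj'
    obtain ⟨x, hx, hxj⟩ := h.cover s j ((G.hier s.other).c_lt _ _ hj')
    rwa [← h2 x hx u hu ⟨j, hj, hj', by rwa [other_other]⟩ huy.symm]

theorem flipOrder_of_not {c : ℕ → ℕ → Prop} {u : ℕ} {b : ℕ → ℕ → Prop} {j k : ℕ}
    (h : ¬ (c u j ∧ c u k)) : flipOrder c u b j k ↔ b j k := by
  unfold flipOrder; tauto

theorem flipOrder_of_mem {c : ℕ → ℕ → Prop} {u : ℕ} {b : ℕ → ℕ → Prop} {j k : ℕ}
    (h : c u j) (h' : c u k) : flipOrder c u b j k ↔ b k j := by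
  unfold flipOrder; tauto

/-- A flip below a vertex of a partial layout does not change the partial layout. -/
theorem pairwise_flip {X : List ℕ} {b : Side → ℕ → ℕ → Prop} {s : Side} {u w : ℕ}
    (hX : X.Pairwise (G.Before b s)) (hu : u ∈ X)
    (hw : ∀ j, G.c s w j → G.c s u j) : X.Pairwise (G.Before (G.flipAt s w b) s) := by
  refine List.Pairwise.imp_of_mem ?_ hX
  intro x y hx hy hxy j k hj hk
  refine ⟨(hxy j k hj hk).1, ?_⟩
  have : ¬ (G.c s w j ∧ G.c s w k) := by
    rintro ⟨h1, h2⟩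
    have e1 := eq_of_pairwise hX hx hu hj (hw _ h1)
    have e2 := eq_of_pairwise hX hy hu hk (hw _ h2)
    subst e1 e2
    exact (hxy j j hj hj).1 rfl
  simp only [flipAt, if_true]
  exact (flipOrder_of_not this).2 (hxy j k hj hk).2

theorem pairwise_flip_other {X : List ℕ} {b : Side → ℕ → ℕ → Prop} {s : Side} {w : ℕ}
    (hX : X.Pairwise (G.Before b s.other)) : X.Pairwise (G.Before (G.flipAt s w b) s.other) := by
  refine hX.imp ?_
  intro x y h j k hj hk
  simpa [flipAt] using h j k hj hk

theorem planar_asymm {b : Side → ℕ → ℕ → Prop} (hb : G.Planar b) {s : Side} {j k : ℕ}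
    (hj : j < G.n) (hk : k < G.n) (hne : j ≠ k) (h : b s j k) : ¬ b s k j :=
  ((hb.order s).total j hj k hk hne).1 h

/-- The children of a vertex of a partial layout can be put in the order chosen by the algorithm. -/
theorem Cut.exists_planar_kids {X : Side → List ℕ} (h : G.Cut X) {s : Side} {u x y : ℕ}
    (hu : u ∈ X s) (hn : G.n ≤ u)
    (hdeg : ∀ y ∈ X s.other, G.Meets s u y → (∀ z ∈ X s.other, G.Meets s u z → z = y) →
      G.Matched s u y) {Q : Prop}
    (hQ : Q ↔ ∀ p (hp : p < (X s.other).length) q (hq : q < (X s.other).length),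
      G.Meets s (G.k0 s u) (X s.other)[p] → G.Meets s (G.k1 s u) (X s.other)[q] → p ≤ q)
    (hxy : (x = G.k0 s u ∧ y = G.k1 s u ∧ Q) ∨ (x = G.k1 s u ∧ y = G.k0 s u ∧ ¬ Q)) :
    ∃ b, G.Planar b ∧ (∀ s, (X s).Pairwise (G.Before b s)) ∧ G.Before b s x y := by
  obtain ⟨b, hb, hbX⟩ := h.planar
  have H := G.hier s
  have hu' := h.lt s u hu
  have hk0 := (H.kid0_lt u hn hu').trans hu'
  have hk1 := (H.kid1_lt u hn hu').trans hu'
  obtain ⟨j0, hj0⟩ := H.nonempty _ hk0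
  obtain ⟨j1, hj1⟩ := H.nonempty _ hk1
  have hsub0 : ∀ j, G.c s (G.k0 s u) j → G.c s u j := fun j hj => (H.node u hn hu' j).2 (Or.inl hj)
  have hsub1 : ∀ j, G.c s (G.k1 s u) j → G.c s u j := fun j hj => (H.node u hn hu' j).2 (Or.inr hj)
  have hne : ∀ j k, G.c s (G.k0 s u) j → G.c s (G.k1 s u) k → j ≠ k := by
    rintro j k hj hk rfl; exact H.disj u hn hu' j hj hk
  have hor : G.Before b s (G.k0 s u) (G.k1 s u) ∨ G.Before b s (G.k1 s u) (G.k0 s u) := by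
    by_cases hbj : b s j0 j1
    · left; intro j k hj hk
      exact ⟨hne j k hj hk, ((hb.order s).split u hn hu' j j0 k j1 hj hj0 hk hj1).2 hbj⟩
    · right; intro k j hk hj
      refine ⟨(hne j k hj hk).symm, ?_⟩
      have h1 := ((hb.order s).split u hn hu' j j0 k j1 hj hj0 hk hj1).not.2 hbj
      exact ((hb.order s).total k (H.c_lt _ _ hk) j (H.c_lt _ _ hj) (hne j k hj hk).symm).2 h1
  by_cases hgood : G.Before b s x y
  · exact ⟨b, hb, hbX, hgood⟩
  have hyx : G.Before b s y x := by
    rcases hxy with ⟨rfl, rfl, -⟩ | ⟨rfl, rfl, -⟩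
    · exact hor.resolve_left hgood
    · exact hor.resolve_right hgood
  have hkids : ∀ j k, G.c s x j → G.c s y k → G.c s u j ∧ G.c s u k := by
    rcases hxy with ⟨rfl, rfl, -⟩ | ⟨rfl, rfl, -⟩
    · exact fun j k hj hk => ⟨hsub0 j hj, hsub1 k hk⟩
    · exact fun j k hj hk => ⟨hsub1 j hj, hsub0 k hk⟩
  -- the case where the inserted leaf is a child
  have hleaf : ∀ v, v < 2 * G.n - 1 → (∀ j, G.c s v j → j = G.i) → ∀ j, G.c s v j ↔ j = G.i := by
    intro v hv hvj j
    refine ⟨hvj j, ?_⟩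
    rintro rfl
    obtain ⟨j, hj⟩ := H.nonempty v hv
    rwa [← hvj j hj]
  have hswitch : G.Parent s u →
      ∃ b, G.Planar b ∧ (∀ s, (X s).Pairwise (G.Before b s)) ∧ G.Before b s x y := by
    intro hp
    refine ⟨G.switchAt s u b, hb.switchAt hp, (forall_side s).2 ⟨?_, ?_⟩, ?_⟩
    · exact pairwise_flip (pairwise_flip (pairwise_flip (hbX s) hu fun _ h => h)
        hu hsub0) hu hsub1
    · exact pairwise_flip_other (pairwise_flip_other (pairwise_flip_other (hbX _)))
    · intro j k hj hk
      have h1 := hyx k j hk hj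
      refine ⟨h1.1.symm, ?_⟩
      have h2 := hkids j k hj hk
      simp only [switchAt, flipAt, if_true]
      rw [flipOrder_of_not, flipOrder_of_not, flipOrder_of_mem h2.1 h2.2]
      · exact h1.2
      · rintro ⟨h3, h4⟩
        rcases hxy with ⟨rfl, rfl, -⟩ | ⟨rfl, rfl, -⟩
        · exact hne k k h4 hk rfl
        · exact hne j j h3 hj rfl
      · rintro ⟨h3, h4⟩
        rcases hxy with ⟨rfl, rfl, -⟩ | ⟨rfl, rfl, -⟩
        · exact hne j j hj h3 rfl
        · exact hne k k hk h4 rfl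
  by_cases he0 : ∀ j, G.c s (G.k0 s u) j → j = G.i
  · exact hswitch ⟨hn, hu', Or.inl (hleaf _ hk0 he0)⟩
  by_cases he1 : ∀ j, G.c s (G.k1 s u) j → j = G.i
  · exact hswitch ⟨hn, hu', Or.inr (hleaf _ hk1 he1)⟩
  push Not at he0 he1
  obtain ⟨a0, ha0, hai0⟩ := he0
  obtain ⟨a1, ha1, hai1⟩ := he1
  have hXo := hbX s.other
  -- order of neighbors
  have hcmp : ∀ p (hp : p < (X s.other).length) q (hq : q < (X s.other).length) j k,
      j ≠ G.i → k ≠ G.i → G.c s.other (X s.other)[p] j → G.c s.other (X s.other)[q] k →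
      p < q → b s j k ∧ j ≠ k := by
    intro p hp q hq j k hj hk hpj hqk hpq
    have := List.pairwise_iff_getElem.1 hXo p q hp hq hpq j k hpj hqk
    exact ⟨(hb.planar s j ((G.hier _).c_lt _ _ hpj) k ((G.hier _).c_lt _ _ hqk) hj hk).2 this.2,
      this.1⟩
  rcases hxy with ⟨rfl, rfl, hq⟩ | ⟨rfl, rfl, hq⟩
  · have hQ' := hQ.1 hq
    have heq : ∀ p (hp : p < (X s.other).length) q (hq : q < (X s.other).length),
        G.Meets s (G.k0 s u) (X s.other)[p] → G.Meets s (G.k1 s u) (X s.other)[q] → p = q := by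
      intro p hp q hq hmp hmq
      rcases (hQ' p hp q hq hmp hmq).lt_or_eq with hlt | rfl
      · obtain ⟨j, hj, hj1, hj2⟩ := hmp
        obtain ⟨k, hk, hk1, hk2⟩ := hmq
        have h1 := hcmp p hp q hq j k hj hk hj2 hk2 hlt
        exact absurd h1.1 (planar_asymm hb (H.c_lt _ _ hk1) (H.c_lt _ _ hj1) h1.2.symm
          (hyx k j hk1 hj1).2)
      · rfl
    obtain ⟨z0, hz0, hz0'⟩ := h.cover s.other a0 (H.c_lt _ _ ha0)
    obtain ⟨z1, hz1, hz1'⟩ := h.cover s.other a1 (H.c_lt _ _ ha1)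
    obtain ⟨p0, hp0, rfl⟩ := List.getElem_of_mem hz0
    obtain ⟨p1, hp1, rfl⟩ := List.getElem_of_mem hz1
    have hm0 : G.Meets s (G.k0 s u) (X s.other)[p0] := ⟨a0, hai0, ha0, hz0'⟩
    have hm1 : G.Meets s (G.k1 s u) (X s.other)[p1] := ⟨a1, hai1, ha1, hz1'⟩
    have h01 := heq p0 hp0 p1 hp1 hm0 hm1
    have hmat : G.Matched s u (X s.other)[p0] := by
      refine hdeg _ hz0 ((meets_kid hn hu').2 (Or.inl hm0)) ?_
      intro z hz hmz
      obtain ⟨q, hq, rfl⟩ := List.getElem_of_mem hz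
      rcases (meets_kid hn hu').1 hmz with h1 | h1
      · have h2 := heq q hq p1 hp1 h1 hm1
        simp only [h2, h01]
      · simp only [heq p0 hp0 q hq hm0 h1]
    have hlt' := h.lt s.other _ hz0
    refine ⟨_, hb.pairedFlip hu' hlt' hmat, (forall_side s).2 ⟨?_, ?_⟩, ?_⟩
    · have h1 := pairwise_flip (hbX s) hu (w := u) fun _ h => h
      have h2 := pairwise_flip_other (s := s.other) (w := (X s.other)[p0])
        (by rw [other_other]; exact h1)
      rwa [other_other] at h2
    · exact pairwise_flip (pairwise_flip_other (hbX _)) hz0 fun _ h => h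
    · intro j k hj hk
      have h1 := hyx k j hk hj
      refine ⟨h1.1.symm, ?_⟩
      simp only [flipAt, ne_other, if_false, if_true]
      exact (flipOrder_of_mem (hsub0 j hj) (hsub1 k hk)).2 h1.2
  · exfalso
    apply hq
    rw [hQ]
    intro p hp q hq ⟨j, hj, hj1, hj2⟩ ⟨k, hk, hk1, hk2⟩
    by_contra! hlt
    have h1 := hcmp q hq p hp k j hk hj hk2 hj2 hlt
    exact planar_asymm hb (H.c_lt _ _ hj1) (H.c_lt _ _ hk1) h1.2.symm (hyx j k hj1 hk1).2 h1.1

/-- Replace `u` by `x, y` in the list on the side `s`. -/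
def replace (X : Side → List ℕ) (s : Side) (u x y : ℕ) : Side → List ℕ :=
  fun t => if t = s then (X s).flatMap fun w => if w = u then [x, y] else [w] else X t

@[simp] theorem replace_other (X : Side → List ℕ) (s : Side) (u x y : ℕ) :
    replace X s u x y s.other = X s.other := by simp [replace]

theorem flatMap_eq_self {u x y : ℕ} {A : List ℕ} (h : u ∉ A) :
    (A.flatMap fun w => if w = u then [x, y] else [w]) = A := by
  induction A with
  | nil => rfl
  | cons a A ih =>
    simp only [List.mem_cons, not_or] at h
    simp [ih h.2, Ne.symm h.1]

theorem Cut.exists_replace {X : Side → List ℕ} (h : G.Cut X) {s : Side} {u : ℕ} (hu : u ∈ X s) :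
    ∃ A B, X s = A ++ u :: B ∧ ∀ x y, replace X s u x y s = A ++ x :: y :: B := by
  obtain ⟨A, B, hAB⟩ := List.append_of_mem hu
  refine ⟨A, B, hAB, fun x y => ?_⟩
  have hnd := h.nodup s
  rw [hAB, List.nodup_append] at hnd
  have hA : u ∉ A := fun hm => hnd.2.2 u hm u (by simp) rfl
  have hB : u ∉ B := (List.nodup_cons.1 hnd.2.1).1
  simp [replace, hAB, flatMap_eq_self hA, flatMap_eq_self hB]

theorem Cut.mem_replace {X : Side → List ℕ} (h : G.Cut X) {s : Side} {u : ℕ} (hu : u ∈ X s)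
    {x y w : ℕ} : w ∈ replace X s u x y s ↔ w = x ∨ w = y ∨ (w ∈ X s ∧ w ≠ u) := by
  obtain ⟨A, B, hAB, hr⟩ := h.exists_replace hu
  have hnd := h.nodup s
  rw [hAB, List.nodup_append] at hnd
  have hA : u ∉ A := fun hm => hnd.2.2 u hm u (by simp) rfl
  have hB : u ∉ B := (List.nodup_cons.1 hnd.2.1).1
  rw [hr, hAB]
  simp only [List.mem_append, List.mem_cons]
  constructor
  · rintro (h | rfl | rfl | h)
    · exact Or.inr (Or.inr ⟨Or.inl h, fun e => hA (e ▸ h)⟩)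
    · exact Or.inl rfl
    · exact Or.inr (Or.inl rfl)
    · exact Or.inr (Or.inr ⟨Or.inr (Or.inr h), fun e => hB (e ▸ h)⟩)
  · rintro (rfl | rfl | ⟨h | h | h, hne⟩)
    · simp
    · simp
    · exact Or.inl h
    · exact absurd h hne
    · exact Or.inr (Or.inr (Or.inr h))

theorem Cut.length_replace {X : Side → List ℕ} (h : G.Cut X) {s : Side} {u : ℕ} (hu : u ∈ X s)
    (x y : ℕ) : (replace X s u x y s).length = (X s).length + 1 := by
  obtain ⟨A, B, hAB, hr⟩ := h.exists_replace hu
  rw [hr, hAB]; simp; omega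

/-- The refined lists are a partial layout again. -/
theorem Cut.replace {X : Side → List ℕ} (h : G.Cut X) {s : Side} {u x y : ℕ}
    (hu : u ∈ X s) (hn : G.n ≤ u)
    (hdeg : ∀ y ∈ X s.other, G.Meets s u y → (∀ z ∈ X s.other, G.Meets s u z → z = y) →
      G.Matched s u y) {Q : Prop}
    (hQ : Q ↔ ∀ p (hp : p < (X s.other).length) q (hq : q < (X s.other).length),
      G.Meets s (G.k0 s u) (X s.other)[p] → G.Meets s (G.k1 s u) (X s.other)[q] → p ≤ q)
    (hxy : (x = G.k0 s u ∧ y = G.k1 s u ∧ Q) ∨ (x = G.k1 s u ∧ y = G.k0 s u ∧ ¬ Q)) :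
    G.Cut (Setup.replace X s u x y) := by
  obtain ⟨b, hb, hbX, hbk⟩ := h.exists_planar_kids hu hn hdeg hQ hxy
  have H := G.hier s
  have hu' := h.lt s u hu
  have hk0 := (H.kid0_lt u hn hu').trans hu'
  have hk1 := (H.kid1_lt u hn hu').trans hu'
  have hx' : x < 2 * G.n - 1 ∧ y < 2 * G.n - 1 ∧ ∀ j, G.c s u j ↔ G.c s x j ∨ G.c s y j := by
    rcases hxy with ⟨rfl, rfl, -⟩ | ⟨rfl, rfl, -⟩
    · exact ⟨hk0, hk1, H.node u hn hu'⟩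
    · exact ⟨hk1, hk0, fun j => (H.node u hn hu' j).trans or_comm⟩
  obtain ⟨hxl, hyl, hxy'⟩ := hx'
  refine ⟨(forall_side s).2 ⟨?_, ?_⟩, (forall_side s).2 ⟨?_, ?_⟩, b, hb,
    (forall_side s).2 ⟨?_, ?_⟩⟩
  · intro w hw
    rcases (h.mem_replace hu).1 hw with rfl | rfl | hw
    · exact hxl
    · exact hyl
    · exact h.lt s w hw.1
  · rw [replace_other]; exact h.lt _
  · intro j hj
    obtain ⟨w, hw, hwj⟩ := h.cover s j hj
    by_cases hwu : w = u
    · subst hwu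
      rcases (hxy' j).1 hwj with h1 | h1
      · exact ⟨x, (h.mem_replace hu).2 (Or.inl rfl), h1⟩
      · exact ⟨y, (h.mem_replace hu).2 (Or.inr (Or.inl rfl)), h1⟩
    · exact ⟨w, (h.mem_replace hu).2 (Or.inr (Or.inr ⟨hw, hwu⟩)), hwj⟩
  · rw [replace_other]; exact h.cover _
  · obtain ⟨A, B, hAB, hr⟩ := h.exists_replace hu
    have h1 := hbX s
    rw [hAB] at h1
    rw [hr]
    simp only [List.pairwise_append, List.pairwise_cons, List.mem_cons, forall_eq_or_imp] at h1 ⊢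
    obtain ⟨h2, ⟨h3, h4⟩, h5⟩ := h1
    have hx1 : ∀ j, G.c s x j → G.c s u j := fun j hj => (hxy' j).2 (Or.inl hj)
    have hy1 : ∀ j, G.c s y j → G.c s u j := fun j hj => (hxy' j).2 (Or.inr hj)
    refine ⟨h2, ⟨⟨hbk, fun a ha => (h3 a ha).mono hx1 fun _ h => h⟩,
      fun a ha => (h3 a ha).mono hy1 fun _ h => h, h4⟩, ?_⟩
    intro a ha
    obtain ⟨h6, h7⟩ := h5 a ha
    exact ⟨h6.mono (fun _ h => h) hx1, h6.mono (fun _ h => h) hy1, h7⟩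
  · rw [replace_other]; exact hbX _

/-! ### Completeness of the list `L` -/

/-- Each matched pair with at least two edges of the subtanglegram is recorded, or it is below a pair
of vertices of the partial layout. -/
def Complete (G : Setup) (X : Side → List ℕ) (D : (ℕ → Prop) → Prop) : Prop :=
  ∀ s, ∀ w < 2 * G.n - 1, ∀ z < 2 * G.n - 1, G.Matched s w z →
    (∃ j k, j ≠ k ∧ j ≠ G.i ∧ k ≠ G.i ∧ G.c s w j ∧ G.c s w k) →
    D (G.c s w) ∨ ∃ x ∈ X s, ∃ y ∈ X s.other, ∀ j, j ≠ G.i → G.c s w j →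
      G.c s x j ∧ G.c s.other y j

theorem Complete.replace {X : Side → List ℕ} {D D' : (ℕ → Prop) → Prop} (hC : G.Complete X D)
    (h : G.Cut X) {s : Side} {u x y : ℕ} (hu : u ∈ X s) (hn : G.n ≤ u)
    (hD : ∀ A, D A → D' A)
    (hcongr : ∀ A B : ℕ → Prop, (∀ j, j ≠ G.i → (A j ↔ B j)) → D' A → D' B)
    (hdeg : ∀ y ∈ X s.other, G.Meets s u y → (∀ z ∈ X s.other, G.Meets s u z → z = y) →
      D' (G.c s u))
    (hxy : (x = G.k0 s u ∧ y = G.k1 s u) ∨ (x = G.k1 s u ∧ y = G.k0 s u)) :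
    G.Complete (Setup.replace X s u x y) D' := by
  have H := G.hier s
  have hu' := h.lt s u hu
  have key : ∀ w < 2 * G.n - 1, ∀ z < 2 * G.n - 1, G.Matched s w z →
      (∃ j k, j ≠ k ∧ j ≠ G.i ∧ k ≠ G.i ∧ G.c s w j ∧ G.c s w k) →
      D' (G.c s w) ∨ ∃ x' ∈ Setup.replace X s u x y s, ∃ y' ∈ X s.other,
        ∀ j, j ≠ G.i → G.c s w j → G.c s x' j ∧ G.c s.other y' j := by
    intro w hw z hz hm h2
    rcases hC s w hw z hz hm h2 with h3 | ⟨x', hx', y', hy', h3⟩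
    · exact Or.inl (hD _ h3)
    by_cases hxu : x' = u
    · subst hxu
      by_cases h4 : ∀ j, j ≠ G.i → G.c s w j → G.c s (G.k0 s x') j
      · right
        exact ⟨_, (h.mem_replace hu).2 (by tauto), y', hy', fun j hj hjw => ⟨h4 j hj hjw,
          (h3 j hj hjw).2⟩⟩
      by_cases h5 : ∀ j, j ≠ G.i → G.c s w j → G.c s (G.k1 s x') j
      · right
        exact ⟨_, (h.mem_replace hu).2 (by tauto), y', hy', fun j hj hjw => ⟨h5 j hj hjw,
          (h3 j hj hjw).2⟩⟩
      left
      push Not at h4 h5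
      obtain ⟨a, ha, haw, ha0⟩ := h4
      obtain ⟨d, hd, hdw, hd1⟩ := h5
      have hle : ∀ j, G.c s x' j → G.c s w j := by
        rcases H.laminar _ hu' w hw with h6 | h6 | h6
        · exact h6
        · by_cases hwx : w = x'
          · subst hwx; exact fun _ h => h
          · obtain ⟨-, h7 | h7⟩ := H.le_kid hw hu' h6 hwx
            · exact absurd (h7 a haw) ha0
            · exact absurd (h7 d hdw) hd1
        · exact absurd haw (h6 a (h3 a ha haw).1)
      refine hcongr (G.c s x') _ (fun j hj => ⟨hle j, fun hjw => (h3 j hj hjw).1⟩) ?_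
      refine hdeg y' hy' ⟨a, ha, (h3 a ha haw).1, (h3 a ha haw).2⟩ ?_
      rintro z hz ⟨j, hj, hjx, hjz⟩
      exact h.eq_of_mem hz hy' hjz (h3 j hj (hle j hjx)).2
    · right
      exact ⟨x', (h.mem_replace hu).2 (by tauto), y', hy', h3⟩
  refine (forall_side s).2 ⟨?_, ?_⟩
  · intro w hw z hz hm h2
    rw [replace_other]
    exact key w hw z hz hm h2
  · intro w hw z hz hm h2
    rw [replace_other, other_other]
    have hm' : G.Matched s z w := fun j hj => by
      have := hm j hj
      rw [other_other] at this
      exact this.symm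
    rcases key z hz w hw hm' (by
      obtain ⟨j, k, hjk, hj, hk, h3, h4⟩ := h2
      exact ⟨j, k, hjk, hj, hk, (hm' j hj).2 h3, (hm' k hk).2 h4⟩) with h3 | ⟨x', hx', y', hy', h3⟩
    · exact Or.inl (hcongr _ _ hm' h3)
    · exact Or.inr ⟨y', hy', x', hx', fun j hj hjw => (h3 j hj ((hm' j hj).2 hjw)).symm⟩

end Setup

end Tangle

namespace Tangle

/-! ### The bipartite graph in the memory -/

/-- The cell of the table `edge` for the vertices `u` on the side `s` and `v` on the other side. -/
def edgeCell (s : Side) (u v : ℕ) : Cell :=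
  match s with
  | .T => (.edge, u, v)
  | .S => (.edge, v, u)

/-- The cell of the table `P` for the vertices `u` on the side `s` and `v` on the other side. -/
def tabCell (s : Side) (u v : ℕ) : Cell :=
  match s with
  | .T => (.tabP, u, v)
  | .S => (.tabP, v, u)

theorem edgeCell_other (s : Side) (u v : ℕ) : edgeCell s.other v u = edgeCell s u v := by
  cases s <;> rfl

theorem val_inE (s : Side) (u v : Expr) (m : Cell → ℕ) :
    (inE s u v).val m = decide (m (edgeCell s (u.val m) (v.val m)) = 1) := by
  cases s <;> rfl

theorem val_inP (s : Side) (u v : Expr) (m : Cell → ℕ) :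
    (inP s u v).val m = decide (m (tabCell s (u.val m) (v.val m)) = 1) := by
  cases s <;> rfl

theorem exec_putE (s : Side) (u v e : Expr) (m : Cell → ℕ) :
    (putE s u v e).exec m = Function.update m (edgeCell s (u.val m) (v.val m)) (e.val m) := by
  cases s <;> rfl

theorem update_edgeCell (m : Cell → ℕ) (s : Side) (u v u' v' k : ℕ) :
    Function.update m (edgeCell s u v) k (edgeCell s u' v') =
      if u' = u ∧ v' = v then k else m (edgeCell s u' v') := by
  cases s <;> simp [edgeCell, and_comm]

theorem update_edgeCell_of_ne (m : Cell → ℕ) (s : Side) (u v k : ℕ) {x : Name} (hx : x ≠ .edge)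
    (a b : ℕ) : Function.update m (edgeCell s u v) k (x, a, b) = m (x, a, b) := by
  cases s <;> simp [edgeCell, hx]

theorem update_apply_edgeCell (m : Cell → ℕ) (s : Side) (u v k : ℕ) {x : Name} (hx : x ≠ .edge)
    (a b : ℕ) : Function.update m (x, a, b) k (edgeCell s u v) = m (edgeCell s u v) := by
  cases s <;> simp [edgeCell, hx.symm]

theorem update_tabCell (m : Cell → ℕ) (s : Side) (u v k : ℕ) {x : Name} (hx : x ≠ .tabP)
    (a b : ℕ) : Function.update m (x, a, b) k (tabCell s u v) = m (tabCell s u v) := by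
  cases s <;> simp [tabCell, hx.symm]

theorem update_edgeCell_tabCell (m : Cell → ℕ) (s t : Side) (u v u' v' k : ℕ) :
    Function.update m (edgeCell s u v) k (tabCell t u' v') = m (tabCell t u' v') := by
  cases s <;> cases t <;> simp [tabCell, edgeCell]

theorem Prog.Frame.edgeCell {p : Prog} {m m' : Cell → ℕ} (h : p.Frame m m')
    (hp : p.keeps .edge = true) (s : Side) (u v : ℕ) :
    m' (Tangle.edgeCell s u v) = m (Tangle.edgeCell s u v) := by
  cases s <;> exact h _ hp _ _

theorem Prog.Frame.tabCell {p : Prog} {m m' : Cell → ℕ} (h : p.Frame m m')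
    (hp : p.keeps .tabP = true) (s : Side) (u v : ℕ) :
    m' (Tangle.tabCell s u v) = m (Tangle.tabCell s u v) := by
  cases s <;> exact h _ hp _ _

/-- `inheritEdge`, for the child number `e` of the chosen vertex. -/
theorem exec_inheritEdge (s : Side) {e : Expr} {q : ℕ} (he : ∀ m, e.val m = q) {m : Cell → ℕ}
    {u w b y : ℕ} (hu : m (.vert, 0, 0) = u) (hw : m (.kid s, u, q) = w)
    (hb : m (.b, 0, 0) = b) (hy : m (.lay s.other, b, 0) = y) :
    (inheritEdge s (.get (.kid s) Name.vert e)).exec m =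
      if m (tabCell s w y) = 1 then
        Function.update (Function.update (Function.update m (edgeCell s w y) 1)
          (.deg s, w, 0) (m (.deg s, w, 0) + 1)) (.deg s.other, y, 0) (m (.deg s.other, y, 0) + 1)
      else m := by
  unfold inheritEdge
  have hc : (inP s (.get (.kid s) Name.vert e) (at1 (.lay s.other) Name.b)).val m =
      decide (m (tabCell s w y) = 1) := by
    simp [val_inP, he, hu, hw, hb, hy]
  by_cases h : m (tabCell s w y) = 1
  · rw [exec_when_pos (hc.trans (decide_eq_true h)), if_pos h]
    simp [exec_putE, he, hu, hw, hb, hy, update_edgeCell_of_ne]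
  · rw [exec_when_neg (by rw [hc]; simpa using h), if_neg h]

/-- Give the edge to the vertex in place `b` on the other side to the children. -/
def moveEdge (s : Side) : Prog :=
  when (.and (.lt Name.b (Name.len s.other)) (inE s Name.vert (at1 (.lay s.other) Name.b))) [
    putE s Name.vert (at1 (.lay s.other) Name.b) 0,
    put1 (.deg s.other) (at1 (.lay s.other) Name.b)
      (.pred (at1 (.deg s.other) (at1 (.lay s.other) Name.b))),
    inheritEdge s (.get (.kid s) Name.vert 0),
    inheritEdge s (.get (.kid s) Name.vert 1)]

/-- Give the edges of the chosen vertex to the children. -/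
def moveEdges (s : Side) : Prog := for' .b Name.size [moveEdge s]

/-- Find the last neighbor of the first child. -/
def findLast (s : Side) : Prog :=
  for' .b Name.size [
    when (.and (.lt Name.b (Name.len s.other))
        (inE s (.get (.kid s) Name.vert 0) (at1 (.lay s.other) Name.b)))
      [put .last Name.b]]

/-- Check whether a neighbor of the second child comes before `last`. -/
def checkGood (s : Side) : Prog :=
  for' .b Name.size [
    when (all [.lt Name.b (Name.len s.other),
        inE s (.get (.kid s) Name.vert 1) (at1 (.lay s.other) Name.b), .lt Name.b Name.last])
      [put .good 0]]

/-- Write the entries of the new list that come from the place `b` of the old list. -/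
def fillStep (s : Side) : Prog :=
  .ite (.eq (at1 (.lay s) Name.b) Name.vert)
    (.ite (.eq Name.good 1)
      (block [put1 .tmp Name.d (.get (.kid s) Name.vert 0), incr .d,
        put1 .tmp Name.d (.get (.kid s) Name.vert 1), incr .d])
      (block [put1 .tmp Name.d (.get (.kid s) Name.vert 1), incr .d,
        put1 .tmp Name.d (.get (.kid s) Name.vert 0), incr .d]))
    (block [put1 .tmp Name.d (at1 (.lay s) Name.b), incr .d])

/-- Write the new list into `tmp`. -/
def fillTmp (s : Side) : Prog :=
  for' .b Name.size [when (.lt Name.b (Name.len s)) [fillStep s]]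

/-- Copy the new list from `tmp`. -/
def copyTmp (s : Side) : Prog :=
  for' .b Name.size [when (.lt Name.b Name.d) [put1 (.lay s) Name.b (at1 .tmp Name.b)]]

theorem refine_eq (s : Side) : refine s = block [moveEdges s, put .last 0, findLast s, put .good 1,
    checkGood s, put .d 0, fillTmp s, put (.len s) Name.d, copyTmp s] := rfl

namespace Setup

open Hier

variable {G : Setup}

/-- The partial layout `X` is in the memory. -/
structure Link (G : Setup) (m : Cell → ℕ) (X : Side → List ℕ) : Prop extends G.Base m where
  tab : ∀ s, ∀ u < 2 * G.n - 1, ∀ v < 2 * G.n - 1, m (tabCell s u v) = 1 ↔ G.Meets s u v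
  len : ∀ s, m (.len s, 0, 0) = (X s).length
  lay : ∀ s k (h : k < (X s).length), m (.lay s, k, 0) = (X s)[k]
  edge : ∀ s u v, m (edgeCell s u v) = 1 ↔ u ∈ X s ∧ v ∈ X s.other ∧ G.Meets s u v
  deg : ∀ s, ∀ w ∈ X s, m (.deg s, w, 0) = G.degree X s w
  deg_zero : ∀ s, ∀ u ∈ X s, ∀ w < 2 * G.n - 1, w ≠ u → G.Le s w u → m (.deg s, w, 0) = 0

open Classical in
theorem exec_moveEdge (s : Side) {m : Cell → ℕ} {u x y b z : ℕ} (hu : m (.vert, 0, 0) = u)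
    (hx : m (.kid s, u, 0) = x) (hy : m (.kid s, u, 1) = y) (hb : m (.b, 0, 0) = b)
    (hz : m (.lay s.other, b, 0) = z) (hbl : b < m (.len s.other, 0, 0))
    (hE : m (edgeCell s u z) = 1 ↔ G.Meets s u z)
    (hPx : m (tabCell s x z) = 1 ↔ G.Meets s x z) (hPy : m (tabCell s y z) = 1 ↔ G.Meets s y z)
    (hxy : G.Meets s u z ↔ G.Meets s x z ∨ G.Meets s y z) (hux : x ≠ u) (huy : y ≠ u)
    (hne : x ≠ y) :
    (∀ v z', (moveEdge s).exec m (edgeCell s v z') = 1 ↔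
      if z' = z then (v = x ∧ G.Meets s x z) ∨ (v = y ∧ G.Meets s y z) ∨
        (v ≠ u ∧ m (edgeCell s v z) = 1) else m (edgeCell s v z') = 1) ∧
    (∀ v, (moveEdge s).exec m (.deg s, v, 0) = m (.deg s, v, 0) +
      (if v = x ∧ G.Meets s x z then 1 else 0) + (if v = y ∧ G.Meets s y z then 1 else 0)) ∧
    (∀ z', (moveEdge s).exec m (.deg s.other, z', 0) = if z' = z then m (.deg s.other, z, 0) -
      (if G.Meets s u z then 1 else 0) + (if G.Meets s x z then 1 else 0) +
      (if G.Meets s y z then 1 else 0) else m (.deg s.other, z', 0)) := by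
  unfold moveEdge
  have hc : (Cond.and (.lt Name.b (Name.len s.other))
      (inE s Name.vert (at1 (.lay s.other) Name.b))).val m = decide (G.Meets s u z) := by
    simp [val_inE, hu, hb, hz, hbl, hE]
  by_cases h : G.Meets s u z
  · rw [exec_when_pos (hc.trans (decide_eq_true h))]
    simp only [exec_cons, exec_nil]
    have e1 : (put1 (.deg s.other) (at1 (.lay s.other) Name.b)
      (.pred (at1 (.deg s.other) (at1 (.lay s.other) Name.b)))).exec
        ((putE s Name.vert (at1 (.lay s.other) Name.b) 0).exec m) =
        Function.update (Function.update m (edgeCell s u z) 0) (.deg s.other, z, 0)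
          (m (.deg s.other, z, 0) - 1) := by
      simp [exec_putE, hu, hb, hz, update_edgeCell_of_ne]
    rw [e1]
    rw [exec_inheritEdge s (e := 0) (q := 0) (fun _ => rfl) (u := u) (w := x) (b := b) (y := z)
      (by simpa [update_edgeCell_of_ne] using hu) (by simpa [update_edgeCell_of_ne] using hx)
      (by simpa [update_edgeCell_of_ne] using hb) (by simpa [update_edgeCell_of_ne] using hz)]
    rw [exec_inheritEdge s (e := 1) (q := 1) (fun _ => rfl) (u := u) (w := y) (b := b) (y := z)
      (by split_ifs <;> simpa [update_edgeCell_of_ne] using hu)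
      (by split_ifs <;> simpa [update_edgeCell_of_ne] using hy)
      (by split_ifs <;> simpa [update_edgeCell_of_ne] using hb)
      (by split_ifs <;> simpa [update_edgeCell_of_ne] using hz)]
    have hoth : s ≠ s.other := by simp
    simp only [update_tabCell, update_edgeCell_tabCell, ne_eq, reduceCtorEq, not_false_eq_true]
    by_cases hmx : G.Meets s x z <;> by_cases hmy : G.Meets s y z
    · simp only [hPx.2 hmx, if_true, update_tabCell, update_edgeCell_tabCell, ne_eq, reduceCtorEq,
        not_false_eq_true, hPy.2 hmy, update_edgeCell, update_apply_edgeCell,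
        update_edgeCell_of_ne, update_cell, Name.deg.injEq, other_ne, ne_other, false_and,
        if_false, true_and, and_true, h, hmx, hmy]
      refine ⟨?_, ?_, ?_⟩
      · intro v z'
        split_ifs <;> simp_all
      · intro v
        split_ifs <;> simp_all
      · intro z'
        split_ifs <;> simp_all
    · have hPy' := hPy.not.2 hmy
      simp only [hPx.2 hmx, if_true, update_tabCell, update_edgeCell_tabCell, ne_eq, reduceCtorEq,
        not_false_eq_true, hPy', update_edgeCell, update_apply_edgeCell,
        update_edgeCell_of_ne, update_cell, Name.deg.injEq, other_ne, ne_other, false_and,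
        if_false, true_and, and_true, h, hmx, hmy]
      refine ⟨?_, ?_, ?_⟩
      · intro v z'
        split_ifs <;> simp_all
      · intro v
        split_ifs <;> simp_all
      · intro z'
        split_ifs <;> simp_all
    · have hPx' := hPx.not.2 hmx
      simp only [hPx', if_true, update_tabCell, update_edgeCell_tabCell, ne_eq, reduceCtorEq,
        not_false_eq_true, hPy.2 hmy, update_edgeCell, update_apply_edgeCell,
        update_edgeCell_of_ne, update_cell, Name.deg.injEq, other_ne, ne_other, false_and,
        if_false, true_and, and_true, h, hmx, hmy]
      refine ⟨?_, ?_, ?_⟩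
      · intro v z'
        split_ifs <;> simp_all
      · intro v
        split_ifs <;> simp_all
      · intro z'
        split_ifs <;> simp_all
    · exact absurd (hxy.1 h) (by tauto)
  · rw [exec_when_neg (by rw [hc]; simpa using h)]
    have hmx : ¬ G.Meets s x z := fun h' => h (hxy.2 (Or.inl h'))
    have hmy : ¬ G.Meets s y z := fun h' => h (hxy.2 (Or.inr h'))
    have hE' := hE.not.2 h
    refine ⟨?_, ?_, ?_⟩
    · intro v z'
      split_ifs with h1
      · subst h1
        simp only [hmx, hmy, and_false, false_or]
        constructor
        · intro h2; exact ⟨fun h3 => hE' (h3 ▸ h2), h2⟩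
        · exact fun h => h.2
      · rfl
    · intro v; simp [hmx, hmy]
    · intro z'; simp only [h, hmx, hmy, if_false]; split_ifs with h1 <;> simp [h1]

theorem mem_take_succ {l : List ℕ} {b : ℕ} (h : b < l.length) (y : ℕ) :
    y ∈ l.take (b + 1) ↔ y ∈ l.take b ∨ y = l[b] := by
  rw [List.take_succ_eq_append_getElem h, List.mem_append, List.mem_singleton]

theorem Cut.getElem_not_mem_take {X : Side → List ℕ} (h : G.Cut X) {s : Side} {b : ℕ}
    (hb : b < (X s).length) : (X s)[b] ∉ (X s).take b := by
  have := h.nodup s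
  rw [← List.take_append_drop b (X s), List.nodup_append] at this
  intro hm
  refine this.2.2 _ hm (X s)[b] ?_ rfl
  rw [List.drop_eq_getElem_cons hb]; exact List.mem_cons_self

section Kids

variable {X : Side → List ℕ} {s : Side} {u : ℕ}

theorem Cut.kid_lt (h : G.Cut X) (hu : u ∈ X s) (hn : G.n ≤ u) :
    G.k0 s u < u ∧ G.k1 s u < u ∧ u < 2 * G.n - 1 :=
  ⟨(G.hier s).kid0_lt u hn (h.lt s u hu), (G.hier s).kid1_lt u hn (h.lt s u hu), h.lt s u hu⟩

theorem Cut.kid_ne (h : G.Cut X) (hu : u ∈ X s) (hn : G.n ≤ u) : G.k0 s u ≠ G.k1 s u := by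
  obtain ⟨h0, h1, h2⟩ := h.kid_lt hu hn
  obtain ⟨j, hj⟩ := (G.hier s).nonempty _ (h0.trans h2)
  intro he
  exact (G.hier s).disj u hn h2 j hj (he ▸ hj)

theorem Cut.not_le_of_mem (h : G.Cut X) (hu : u ∈ X s) {v w : ℕ} (hv : v ∈ X s) (hne : v ≠ u)
    (hw : w < 2 * G.n - 1) (hwu : G.Le s w u) : ¬ G.Le s w v := by
  obtain ⟨j, hj⟩ := (G.hier s).nonempty w hw
  exact fun hwv => hne (h.eq_of_mem hv hu (hwv j hj) (hwu j hj))

theorem Cut.kid_not_mem (h : G.Cut X) (hu : u ∈ X s) (hn : G.n ≤ u) :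
    G.k0 s u ∉ X s ∧ G.k1 s u ∉ X s := by
  obtain ⟨h0, h1, h2⟩ := h.kid_lt hu hn
  have H := (G.hier s).node u hn h2
  constructor
  · intro hm
    exact h.not_le_of_mem hu hm h0.ne (h0.trans h2) (fun j hj => (H j).2 (Or.inl hj))
      fun _ h => h
  · intro hm
    exact h.not_le_of_mem hu hm h1.ne (h1.trans h2) (fun j hj => (H j).2 (Or.inr hj))
      fun _ h => h

open Classical in
theorem exec_moveEdges {m : Cell → ℕ} (hL : G.Link m X) (h : G.Cut X) (hu : u ∈ X s)
    (hn : G.n ≤ u) (hvert : m (.vert, 0, 0) = u) :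
    (∀ x z, (moveEdges s).exec m (edgeCell s x z) = 1 ↔
      (x = G.k0 s u ∨ x = G.k1 s u ∨ (x ∈ X s ∧ x ≠ u)) ∧ z ∈ X s.other ∧ G.Meets s x z) ∧
    (∀ w, (moveEdges s).exec m (.deg s, w, 0) = m (.deg s, w, 0) +
      (if w = G.k0 s u then G.degree X s (G.k0 s u) else 0) +
      (if w = G.k1 s u then G.degree X s (G.k1 s u) else 0)) ∧
    (∀ z, (moveEdges s).exec m (.deg s.other, z, 0) = if z ∈ X s.other then
      m (.deg s.other, z, 0) - (if G.Meets s u z then 1 else 0) +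
        (if G.Meets s (G.k0 s u) z then 1 else 0) + (if G.Meets s (G.k1 s u) z then 1 else 0)
      else m (.deg s.other, z, 0)) := by
  obtain ⟨hk0, hk1, hu'⟩ := h.kid_lt hu hn
  have hne := h.kid_ne hu hn
  obtain ⟨hm0, hm1⟩ := h.kid_not_mem hu hn
  have hlen := h.length_le s.other
  have key := for_ind (x := .b) (e := Name.size) (l := [moveEdge s]) (m := m) (N := G.n)
    (by simpa using hL.size)
    (fun b m' =>
      (∀ x z, m' (edgeCell s x z) = 1 ↔ z ∈ X s.other ∧ G.Meets s x z ∧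
        if z ∈ (X s.other).take b then x = G.k0 s u ∨ x = G.k1 s u ∨ (x ∈ X s ∧ x ≠ u)
        else x ∈ X s) ∧
      (∀ w, m' (.deg s, w, 0) = m (.deg s, w, 0) +
        (if w = G.k0 s u then ((X s.other).take b).countP (fun y => G.Meets s (G.k0 s u) y) else 0) +
        (if w = G.k1 s u then ((X s.other).take b).countP (fun y => G.Meets s (G.k1 s u) y)
          else 0)) ∧
      (∀ z, m' (.deg s.other, z, 0) = if z ∈ (X s.other).take b then
        m (.deg s.other, z, 0) - (if G.Meets s u z then 1 else 0) +
          (if G.Meets s (G.k0 s u) z then 1 else 0) + (if G.Meets s (G.k1 s u) z then 1 else 0)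
        else m (.deg s.other, z, 0)))
    ⟨by simpa [and_assoc, and_left_comm, and_comm] using hL.edge s, by simp, by simp⟩ ?_ ?_
  · rw [List.take_of_length_le hlen] at key
    obtain ⟨k1, k2, k3⟩ := key
    refine ⟨fun x z => ?_, k2, k3⟩
    refine (k1 x z).trans ⟨?_, ?_⟩
    · rintro ⟨hz, hmz, h3⟩
      rw [if_pos hz] at h3
      exact ⟨h3, hz, hmz⟩
    · rintro ⟨h3, hz, hmz⟩
      exact ⟨hz, hmz, by rwa [if_pos hz]⟩
  · rintro k m' v ⟨i1, i2, i3⟩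
    refine ⟨?_, ?_, ?_⟩
    · intro x z; rw [update_apply_edgeCell _ _ _ _ _ (by decide)]; exact i1 x z
    · intro w; simpa using i2 w
    · intro z; simpa using i3 z
  · rintro b hb m' hF hb' ⟨i1, i2, i3⟩
    rw [exec_cons, exec_nil]
    have hlen' : m' (.len s.other, 0, 0) = (X s.other).length :=
      (hF _ (by cases s <;> decide) _ _).trans (hL.len _)
    by_cases hbl : b < (X s.other).length
    · have hmem : (X s.other)[b] ∈ X s.other := List.getElem_mem hbl
      have hnot := h.getElem_not_mem_take hbl
      have hkid := hL.toInput
      have hBase := hL.toBase.frame hF (by cases s <;> decide)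
      obtain ⟨f1, f2, f3⟩ := exec_moveEdge (G := G) s (m := m') (u := u) (x := G.k0 s u)
        (y := G.k1 s u) (b := b) (z := (X s.other)[b])
        ((hF _ (by cases s <;> decide) _ _).trans hvert) (hBase.kid0 s u hn hu')
        (hBase.kid1 s u hn hu') hb'
        ((hF _ (by cases s <;> decide) _ _).trans (hL.lay _ _ hbl)) (by omega)
        (by rw [i1]; simp [hmem, hnot, hu])
        (by rw [hF.tabCell (by cases s <;> decide)]
            exact hL.tab s _ (hk0.trans hu') _ (h.lt _ _ hmem))
        (by rw [hF.tabCell (by cases s <;> decide)]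
            exact hL.tab s _ (hk1.trans hu') _ (h.lt _ _ hmem))
        (meets_kid hn hu') hk0.ne hk1.ne hne
      refine ⟨?_, ?_, ?_⟩
      · intro x z
        rw [f1]
        have hs := mem_take_succ hbl z
        by_cases hz : z = (X s.other)[b]
        · subst hz
          rw [if_pos rfl, if_pos (hs.2 (Or.inr rfl)), i1, if_neg hnot]
          constructor
          · rintro (⟨rfl, h1⟩ | ⟨rfl, h1⟩ | ⟨h1, h2, h3, h4⟩)
            · exact ⟨hmem, h1, Or.inl rfl⟩
            · exact ⟨hmem, h1, Or.inr (Or.inl rfl)⟩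
            · exact ⟨h2, h3, Or.inr (Or.inr ⟨h4, h1⟩)⟩
          · rintro ⟨h1, h2, rfl | rfl | ⟨h3, h4⟩⟩
            · exact Or.inl ⟨rfl, h2⟩
            · exact Or.inr (Or.inl ⟨rfl, h2⟩)
            · exact Or.inr (Or.inr ⟨h4, h1, h2, h3⟩)
        · rw [if_neg hz, i1]
          have : z ∈ (X s.other).take (b + 1) ↔ z ∈ (X s.other).take b := by
            rw [hs]; simp [hz]
          simp only [this]
      · intro w
        rw [f2, i2, List.take_succ_eq_append_getElem hbl]
        simp only [List.countP_append, List.countP_cons, List.countP_nil, decide_eq_true_eq,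
          zero_add]
        by_cases hw0 : w = G.k0 s u
        · subst hw0; simp [hne]; omega
        · by_cases hw1 : w = G.k1 s u
          · subst hw1; simp [hw0]; omega
          · simp [hw0, hw1]
      · intro z
        rw [f3]
        have hs := mem_take_succ hbl z
        by_cases hz : z = (X s.other)[b]
        · subst hz
          rw [if_pos rfl, if_pos (hs.2 (Or.inr rfl)), i3, if_neg hnot]
        · rw [if_neg hz, i3]
          have : z ∈ (X s.other).take (b + 1) ↔ z ∈ (X s.other).take b := by
            rw [hs]; simp [hz]
          simp only [this]
    · have e1 : (moveEdge s).exec m' = m' := exec_when_neg (by simp [hb', hlen', hbl])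
      have e2 : (X s.other).take (b + 1) = (X s.other).take b := by
        rw [List.take_of_length_le (by omega), List.take_of_length_le (by omega)]
      rw [e1, e2]
      exact ⟨i1, i2, i3⟩

/-- The comparison of the children. -/
theorem exec_findLast {m : Cell → ℕ} {Y : List ℕ} {u x : ℕ} {P : ℕ → Prop}
    (hsize : m (.size, 0, 0) = G.n) (hYn : Y.length ≤ G.n)
    (hlen : m (.len s.other, 0, 0) = Y.length)
    (hlay : ∀ k (h : k < Y.length), m (.lay s.other, k, 0) = Y[k])
    (hvert : m (.vert, 0, 0) = u) (hkid : m (.kid s, u, 0) = x)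
    (hE : ∀ y ∈ Y, m (edgeCell s x y) = 1 ↔ P y) (hl : m (.last, 0, 0) = 0) :
    (∀ p (hp : p < Y.length), P Y[p] → p ≤ (findLast s).exec m (.last, 0, 0)) ∧
      ((findLast s).exec m (.last, 0, 0) = 0 ∨ ∃ hp : (findLast s).exec m (.last, 0, 0) < Y.length,
        P Y[(findLast s).exec m (.last, 0, 0)]) := by
  have key := for_ind (x := .b) (e := Name.size) (l := [
    when (.and (.lt Name.b (Name.len s.other))
        (inE s (.get (.kid s) Name.vert 0) (at1 (.lay s.other) Name.b)))
      [put .last Name.b]]) (m := m) (N := G.n) (by simpa using hsize)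
    (fun b m' => (∀ p (hp : p < Y.length), p < b → P Y[p] → p ≤ m' (.last, 0, 0)) ∧
      (m' (.last, 0, 0) = 0 ∨ ∃ hp : m' (.last, 0, 0) < Y.length, P Y[m' (.last, 0, 0)]))
    ⟨by simp, Or.inl hl⟩ (fun k m' v h => by
      simpa only [update_cell, reduceCtorEq, false_and, if_false] using h) ?_
  · exact ⟨fun p hp => key.1 p hp (by omega), key.2⟩
  rintro b hb m' hF hb' ⟨i1, i2⟩
  rw [exec_cons, exec_nil]
  have hlen' : m' (.len s.other, 0, 0) = Y.length :=
    (hF _ (by cases s <;> decide) _ _).trans hlen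
  have hv' : m' (.vert, 0, 0) = u := (hF _ (by cases s <;> decide) _ _).trans hvert
  have hk' : m' (.kid s, u, 0) = x := (hF _ (by cases s <;> decide) _ _).trans hkid
  by_cases hc : ∃ hbl : b < Y.length, P Y[b]
  · obtain ⟨hbl, hP⟩ := hc
    have hl' : m' (.lay s.other, b, 0) = Y[b] :=
      (hF _ (by cases s <;> decide) _ _).trans (hlay b hbl)
    have hE' : m' (edgeCell s x Y[b]) = 1 := by
      rw [hF.edgeCell (by cases s <;> decide)]; exact (hE _ (List.getElem_mem hbl)).2 hP
    rw [exec_when_pos (by simp [val_inE, hb', hlen', hv', hk', hl', hE', hbl])]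
    simp only [exec_cons, exec_nil, put, exec_set, Expr.val, reg, val_zero, hb', update_cell,
      and_self, if_true]
    exact ⟨fun p _ hp _ => by omega, Or.inr ⟨hbl, hP⟩⟩
  · rw [exec_when_neg]
    · refine ⟨fun p hp hpb hP => ?_, i2⟩
      rcases Nat.lt_succ_iff_lt_or_eq.1 hpb with h1 | rfl
      · exact i1 p hp h1 hP
      · exact absurd ⟨hp, hP⟩ hc
    · intro hcond
      simp only [Cond.val, val_inE, Expr.val, reg, at1, val_zero, hb', hlen', hv', hk',
        Bool.and_eq_true, decide_eq_true_eq] at hcond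
      obtain ⟨h1, h2⟩ := hcond
      rw [hF (.lay s.other) (by cases s <;> decide), hlay b h1, hF.edgeCell (by cases s <;> decide),
        hE _ (List.getElem_mem h1)] at h2
      exact hc ⟨h1, h2⟩

theorem exec_checkGood {m : Cell → ℕ} {Y : List ℕ} {u x : ℕ} {P : ℕ → Prop}
    (hsize : m (.size, 0, 0) = G.n) (hYn : Y.length ≤ G.n)
    (hlen : m (.len s.other, 0, 0) = Y.length)
    (hlay : ∀ k (h : k < Y.length), m (.lay s.other, k, 0) = Y[k])
    (hvert : m (.vert, 0, 0) = u) (hkid : m (.kid s, u, 1) = x)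
    (hE : ∀ y ∈ Y, m (edgeCell s x y) = 1 ↔ P y) (hl : m (.good, 0, 0) = 1) :
    (checkGood s).exec m (.good, 0, 0) = 1 ↔
      ∀ q (hq : q < Y.length), P Y[q] → m (.last, 0, 0) ≤ q := by
  have key := for_ind (x := .b) (e := Name.size) (l := [
    when (all [.lt Name.b (Name.len s.other),
        inE s (.get (.kid s) Name.vert 1) (at1 (.lay s.other) Name.b), .lt Name.b Name.last])
      [put .good 0]]) (m := m) (N := G.n) (by simpa using hsize)
    (fun b m' => m' (.good, 0, 0) = 1 ↔
      ∀ q (hq : q < Y.length), q < b → P Y[q] → m (.last, 0, 0) ≤ q)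
    (by simp [hl]) (fun k m' v h => by
      simpa only [update_cell, reduceCtorEq, false_and, if_false] using h) ?_
  · exact key.trans ⟨fun H q hq => H q hq (by omega), fun H q hq _ => H q hq⟩
  rintro b hb m' hF hb' i1
  rw [exec_cons, exec_nil]
  have hlen' : m' (.len s.other, 0, 0) = Y.length :=
    (hF _ (by cases s <;> decide) _ _).trans hlen
  have hv' : m' (.vert, 0, 0) = u := (hF _ (by cases s <;> decide) _ _).trans hvert
  have hk' : m' (.kid s, u, 1) = x := (hF _ (by cases s <;> decide) _ _).trans hkid
  have hlast : m' (.last, 0, 0) = m (.last, 0, 0) := hF _ (by cases s <;> decide) _ _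
  by_cases hc : ∃ hbl : b < Y.length, P Y[b] ∧ b < m (.last, 0, 0)
  · obtain ⟨hbl, hP, hlt⟩ := hc
    have hl' : m' (.lay s.other, b, 0) = Y[b] :=
      (hF _ (by cases s <;> decide) _ _).trans (hlay b hbl)
    have hE' : m' (edgeCell s x Y[b]) = 1 := by
      rw [hF.edgeCell (by cases s <;> decide)]; exact (hE _ (List.getElem_mem hbl)).2 hP
    rw [exec_when_pos (by simp [all, val_inE, hb', hlen', hv', hk', hl', hE', hbl, hlast, hlt])]
    simp only [exec_cons, exec_nil, put, exec_set, Expr.val, reg, val_zero, hb', update_cell,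
      and_self, if_true]
    refine ⟨fun h => absurd h (by decide), fun H => ?_⟩
    have := H b hbl (by omega) hP
    omega
  · rw [exec_when_neg, i1]
    · refine ⟨fun H q hq hqb hP => ?_, fun H q hq hqb => H q hq (by omega)⟩
      rcases Nat.lt_succ_iff_lt_or_eq.1 hqb with h1 | rfl
      · exact H q hq h1 hP
      · by_contra! hlt
        exact hc ⟨hq, hP, hlt⟩
    · intro hcond
      simp only [all, Cond.val, val_inE, Expr.val, reg, at1, val_zero, val_one, hb', hlen', hv', hk',
        hlast, Bool.and_eq_true, decide_eq_true_eq] at hcond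
      obtain ⟨h1, h2, h3⟩ := hcond
      rw [hF (.lay s.other) (by cases s <;> decide), hlay b h1, hF.edgeCell (by cases s <;> decide),
        hE _ (List.getElem_mem h1)] at h2
      exact hc ⟨h1, h2, h3⟩

/-- The list `L` is in the temporary array, and its length is in the register `d`. -/
def TmpList (m : Cell → ℕ) (L : List ℕ) : Prop :=
  m (.d, 0, 0) = L.length ∧ ∀ k (h : k < L.length), m (.tmp, k, 0) = L[k]

theorem TmpList.push {m : Cell → ℕ} {L : List ℕ} (h : TmpList m L) {e : Expr} {v : ℕ}
    (he : e.val m = v) : TmpList ((incr .d).exec ((put1 .tmp Name.d e).exec m)) (L ++ [v]) := by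
  constructor
  · simp [h.1]
  · intro k hk
    rw [List.length_append, List.length_singleton] at hk
    simp only [incr, put, put1, exec_set, Expr.val, reg, val_zero, update_cell, reduceCtorEq,
      false_and, if_false, true_and, and_true, h.1, he]
    split_ifs with h1
    · subst h1; simp
    · rw [h.2 k (by omega), List.getElem_append_left]

theorem exec_fillTmp {m : Cell → ℕ} {Z : List ℕ} {u x y k₀ k₁ : ℕ}
    (hsize : m (.size, 0, 0) = G.n) (hZn : Z.length ≤ G.n)
    (hlen : m (.len s, 0, 0) = Z.length)
    (hlay : ∀ k (h : k < Z.length), m (.lay s, k, 0) = Z[k])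
    (hvert : m (.vert, 0, 0) = u) (hk₀ : m (.kid s, u, 0) = k₀) (hk₁ : m (.kid s, u, 1) = k₁)
    (hxy : (m (.good, 0, 0) = 1 ∧ x = k₀ ∧ y = k₁) ∨ (m (.good, 0, 0) ≠ 1 ∧ x = k₁ ∧ y = k₀))
    (hd : m (.d, 0, 0) = 0) :
    TmpList ((fillTmp s).exec m) (Z.flatMap fun w => if w = u then [x, y] else [w]) := by
  have key := for_ind (x := .b) (e := Name.size) (l := [when (.lt Name.b (Name.len s)) [fillStep s]])
    (m := m) (N := G.n) (by simpa using hsize)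
    (fun b m' => TmpList m' ((Z.take b).flatMap fun w => if w = u then [x, y] else [w]))
    ⟨by simpa using hd, by simp⟩ (fun k m' v h => by
      simpa only [TmpList, update_cell, reduceCtorEq, false_and, if_false] using h) ?_
  · rwa [List.take_of_length_le hZn] at key
  intro b hb m' hF hb' hI
  rw [exec_cons, exec_nil]
  have hlen' : m' (.len s, 0, 0) = Z.length := (hF _ (by cases s <;> decide) _ _).trans hlen
  have hv' : m' (.vert, 0, 0) = u := (hF _ (by cases s <;> decide) _ _).trans hvert
  have hg' : m' (.good, 0, 0) = m (.good, 0, 0) := hF _ (by cases s <;> decide) _ _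
  have hk₀' : m' (.kid s, u, 0) = k₀ := (hF _ (by cases s <;> decide) _ _).trans hk₀
  have hk₁' : m' (.kid s, u, 1) = k₁ := (hF _ (by cases s <;> decide) _ _).trans hk₁
  by_cases hbl : b < Z.length
  · have hl' : m' (.lay s, b, 0) = Z[b] := (hF _ (by cases s <;> decide) _ _).trans (hlay b hbl)
    rw [exec_when_pos (by simp [hb', hlen', hbl]), exec_cons, exec_nil,
      List.take_succ_eq_append_getElem hbl, List.flatMap_append]
    simp only [List.flatMap_cons, List.flatMap_nil, List.append_nil]
    unfold fillStep
    by_cases hz : Z[b] = u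
    · rw [exec_ite, if_pos (by simp [hb', hl', hv', hz]), if_pos hz, exec_ite]
      rcases hxy with ⟨hg, rfl, rfl⟩ | ⟨hg, rfl, rfl⟩
      · rw [if_pos (by simp [hg', hg])]
        simp only [exec_cons, exec_nil]
        have h1 := (hI.push (e := .get (.kid s) Name.vert 0) (v := x)
          (by simp [hv', hk₀'])).push (e := .get (.kid s) Name.vert 1) (v := y)
          (by simp [hv', hk₁'])
        simpa using h1
      · rw [if_neg (by simp [hg', hg])]
        simp only [exec_cons, exec_nil]
        have h1 := (hI.push (e := .get (.kid s) Name.vert 1) (v := x)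
          (by simp [hv', hk₁'])).push (e := .get (.kid s) Name.vert 0) (v := y)
          (by simp [hv', hk₀'])
        simpa using h1
    · rw [exec_ite, if_neg (by simp [hb', hl', hv', hz]), if_neg hz]
      exact hI.push (by simp [hb', hl'])
  · rw [exec_when_neg (by simp [hb', hlen', hbl]), List.take_of_length_le (by omega)]
    rwa [List.take_of_length_le (by omega)] at hI

theorem exec_copyTmp {m : Cell → ℕ} {L : List ℕ} (hsize : m (.size, 0, 0) = G.n)
    (hL : TmpList m L) (hLn : L.length ≤ G.n) (k : ℕ) (hk : k < L.length) :
    (copyTmp s).exec m (.lay s, k, 0) = L[k] := by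
  have key := for_ind (x := .b) (e := Name.size)
    (l := [when (.lt Name.b Name.d) [put1 (.lay s) Name.b (at1 .tmp Name.b)]])
    (m := m) (N := G.n) (by simpa using hsize)
    (fun b m' => ∀ k (hk : k < L.length), k < b → m' (.lay s, k, 0) = L[k])
    (by simp) (fun k m' v h => by
      simpa only [update_cell, reduceCtorEq, false_and, if_false] using h) ?_
  · exact key k hk (by omega)
  intro b hb m' hF hb' hI
  rw [exec_cons, exec_nil]
  have hd' : m' (.d, 0, 0) = L.length := (hF _ (by cases s <;> decide) _ _).trans hL.1
  by_cases hbl : b < L.length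
  · have ht' : m' (.tmp, b, 0) = L[b] := (hF _ (by cases s <;> decide) _ _).trans (hL.2 b hbl)
    rw [exec_when_pos (by simp [hb', hd', hbl])]
    intro k hk hkb
    simp only [exec_cons, exec_nil, put1, at1, exec_set, Expr.val, reg, val_zero, hb', ht',
      update_cell, true_and, and_true]
    split_ifs with h1
    · subst h1; rfl
    · exact hI k hk (by omega)
  · rw [exec_when_neg (by simp [hb', hd', hbl])]
    exact fun k hk _ => hI k hk (by omega)

end Kids

end Setup

end Tangle

namespace Tangle

namespace Setup

open Hier

variable {G : Setup} {X : Side → List ℕ} {s : Side} {u : ℕ}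

open Classical in
theorem degree_replace_other (h : G.Cut X) (hu : u ∈ X s) (x y z : ℕ) :
    G.degree (replace X s u x y) s.other z + (if G.Meets s u z then 1 else 0) =
      G.degree X s.other z + (if G.Meets s x z then 1 else 0) +
        (if G.Meets s y z then 1 else 0) := by
  obtain ⟨A, B, hAB, hr⟩ := h.exists_replace hu
  unfold degree
  rw [other_other, hr, hAB]
  simp only [List.countP_append, List.countP_cons, meets_comm, decide_eq_true_eq]
  omega

theorem degree_replace_self (x y w : ℕ) : G.degree (replace X s u x y) s w = G.degree X s w := by
  unfold degree; rw [replace_other]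

theorem Link.frame {m m' : Cell → ℕ} (hL : G.Link m X) {p : Prog} (hF : p.Frame m m')
    (hp : p.keepsAll baseNames = true) (h1 : p.keeps .tabP = true) (h2 : p.keeps .edge = true)
    (h3 : ∀ s, p.keeps (.len s) = true) (h4 : ∀ s, p.keeps (.lay s) = true)
    (h5 : ∀ s, p.keeps (.deg s) = true) : G.Link m' X where
  toBase := hL.toBase.frame hF hp
  tab s u hu v hv := by rw [hF.tabCell h1]; exact hL.tab s u hu v hv
  len s := (hF _ (h3 s) _ _).trans (hL.len s)
  lay s k h := (hF _ (h4 s) _ _).trans (hL.lay s k h)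
  edge s u v := by rw [hF.edgeCell h2]; exact hL.edge s u v
  deg s w hw := (hF _ (h5 s) _ _).trans (hL.deg s w hw)
  deg_zero s u hu w hw h h' := (hF _ (h5 s) _ _).trans (hL.deg_zero s u hu w hw h h')

/-- The chosen vertex is replaced by its children. -/
theorem exec_refine {m : Cell → ℕ} (hL : G.Link m X) (h : G.Cut X) (hu : u ∈ X s)
    (hn : G.n ≤ u) (hvert : m (.vert, 0, 0) = u)
    (hdeg : ∀ y ∈ X s.other, G.Meets s u y → (∀ z ∈ X s.other, G.Meets s u z → z = y) →
      G.Matched s u y) :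
    ∃ x y, ((x = G.k0 s u ∧ y = G.k1 s u) ∨ (x = G.k1 s u ∧ y = G.k0 s u)) ∧
      G.Cut (Setup.replace X s u x y) ∧ G.Link ((Tangle.refine s).exec m) (Setup.replace X s u x y) := by
  classical
  obtain ⟨hk0, hk1, hu'⟩ := h.kid_lt hu hn
  have hne := h.kid_ne hu hn
  obtain ⟨hm0, hm1⟩ := h.kid_not_mem hu hn
  have hnode := (G.hier s).node u hn hu'
  have hle0 : G.Le s (G.k0 s u) u := fun j hj => (hnode j).2 (Or.inl hj)
  have hle1 : G.Le s (G.k1 s u) u := fun j hj => (hnode j).2 (Or.inr hj)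
  have hlt : ∀ s, ∀ w ∈ X s, w < 2 * G.n - 1 := h.lt
  have hkeep : ∀ y ∈ [Name.edge, .deg .T, .deg .S, .tabP], (block [put .last 0, findLast s,
      put .good 1, checkGood s, put .d 0, fillTmp s, put (.len s) Name.d, copyTmp s]).keeps y =
      true := by
    cases s <;> decide
  rw [refine_eq, exec_cons]
  obtain ⟨e1, e2, e3⟩ := exec_moveEdges hL h hu hn hvert
  have hB1 := hL.toBase.exec (p := moveEdges s) (by cases s <;> decide)
  have hF1 := (moveEdges s).frame_exec m
  generalize (moveEdges s).exec m = m₁ at *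
  have hF5 := (block [put .last 0, findLast s, put .good 1, checkGood s, put .d 0, fillTmp s,
    put (.len s) Name.d, copyTmp s]).frame_exec m₁
  have hB5 := hB1.exec (p := block [put .last 0, findLast s, put .good 1, checkGood s, put .d 0,
    fillTmp s, put (.len s) Name.d, copyTmp s]) (by cases s <;> decide)
  have hv1 : m₁ (.vert, 0, 0) = u := (hF1 _ (by cases s <;> decide) _ _).trans hvert
  have hlen1 : ∀ t, m₁ (.len t, 0, 0) = (X t).length :=
    fun t => (hF1 _ (by cases s <;> cases t <;> decide) _ _).trans (hL.len t)
  have hlay1 : ∀ t k (h : k < (X t).length), m₁ (.lay t, k, 0) = (X t)[k] :=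
    fun t k hk => (hF1 _ (by cases s <;> cases t <;> decide) _ _).trans (hL.lay t k hk)
  -- the rest of the program
  have rest : ∃ x y, ((x = G.k0 s u ∧ y = G.k1 s u) ∨ (x = G.k1 s u ∧ y = G.k0 s u)) ∧
      G.Cut (Setup.replace X s u x y) ∧
      (block [put .last 0, findLast s, put .good 1, checkGood s, put .d 0, fillTmp s,
        put (.len s) Name.d, copyTmp s]).exec m₁ (.len s, 0, 0) =
          (Setup.replace X s u x y s).length ∧
      ∀ k (h : k < (Setup.replace X s u x y s).length),
        (block [put .last 0, findLast s, put .good 1, checkGood s, put .d 0, fillTmp s,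
          put (.len s) Name.d, copyTmp s]).exec m₁ (.lay s, k, 0) =
            (Setup.replace X s u x y s)[k] := by
    clear hF5 hB5 hkeep e2 e3
    rw [exec_cons, exec_cons]
    have hF2a := (put .last 0).frame_exec m₁
    have hl2 : (put .last 0).exec m₁ (.last, 0, 0) = 0 := by simp
    generalize (put .last 0).exec m₁ = m₂ at *
    have hB2 := hB1.frame hF2a (by decide)
    have hlen2 : ∀ t, m₂ (.len t, 0, 0) = (X t).length :=
      fun t => (hF2a _ (by cases t <;> decide) _ _).trans (hlen1 t)
    have hlay2 : ∀ t k (h : k < (X t).length), m₂ (.lay t, k, 0) = (X t)[k] :=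
      fun t k hk => (hF2a _ (by cases t <;> decide) _ _).trans (hlay1 t k hk)
    have hv2 : m₂ (.vert, 0, 0) = u := (hF2a _ (by decide) _ _).trans hv1
    have hE2 : ∀ x z, m₂ (edgeCell s x z) = 1 ↔
        (x = G.k0 s u ∨ x = G.k1 s u ∨ (x ∈ X s ∧ x ≠ u)) ∧ z ∈ X s.other ∧ G.Meets s x z := by
      intro x z; rw [hF2a.edgeCell (by decide)]; exact e1 x z
    obtain ⟨f1, f2⟩ := exec_findLast (G := G) (s := s) (Y := X s.other) (x := G.k0 s u)
      (P := fun z => G.Meets s (G.k0 s u) z) hB2.size (h.length_le _) (hlen2 _) (hlay2 _) hv2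
      (hB2.kid0 s u hn hu') (fun y hy => by rw [hE2]; simp [hy]) hl2
    have hF3a := (findLast s).frame_exec m₂
    generalize (findLast s).exec m₂ = m₃ at *
    rw [exec_cons, exec_cons]
    have hF3b := (put .good 1).frame_exec m₃
    have hg3 : (put .good 1).exec m₃ (.good, 0, 0) = 1 := by simp
    generalize (put .good 1).exec m₃ = m₄ at *
    have hB4 := (hB2.frame hF3a (by cases s <;> decide)).frame hF3b (by decide)
    have hlen4 : ∀ t, m₄ (.len t, 0, 0) = (X t).length := fun t =>
      (hF3b _ (by cases t <;> decide) _ _).trans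
        ((hF3a _ (by cases s <;> cases t <;> decide) _ _).trans (hlen2 t))
    have hlay4 : ∀ t k (h : k < (X t).length), m₄ (.lay t, k, 0) = (X t)[k] := fun t k hk =>
      (hF3b _ (by cases t <;> decide) _ _).trans
        ((hF3a _ (by cases s <;> cases t <;> decide) _ _).trans (hlay2 t k hk))
    have hv4 : m₄ (.vert, 0, 0) = u :=
      (hF3b _ (by decide) _ _).trans ((hF3a _ (by cases s <;> decide) _ _).trans hv2)
    have hlast : m₄ (.last, 0, 0) = m₃ (.last, 0, 0) := hF3b _ (by decide) _ _
    have hE4 : ∀ x z, m₄ (edgeCell s x z) = 1 ↔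
        (x = G.k0 s u ∨ x = G.k1 s u ∨ (x ∈ X s ∧ x ≠ u)) ∧ z ∈ X s.other ∧ G.Meets s x z := by
      intro x z
      rw [hF3b.edgeCell (by decide), hF3a.edgeCell (by cases s <;> decide)]; exact hE2 x z
    have g1 := exec_checkGood (G := G) (s := s) (Y := X s.other) (x := G.k1 s u)
      (P := fun z => G.Meets s (G.k1 s u) z) hB4.size (h.length_le _) (hlen4 _) (hlay4 _) hv4
      (hB4.kid1 s u hn hu') (fun y hy => by rw [hE4]; simp [hy]) hg3
    rw [hlast] at g1
    have hF5a := (checkGood s).frame_exec m₄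
    generalize (checkGood s).exec m₄ = m₅ at *
    have hQ : m₅ (.good, 0, 0) = 1 ↔
        ∀ p (hp : p < (X s.other).length) q (hq : q < (X s.other).length),
        G.Meets s (G.k0 s u) (X s.other)[p] → G.Meets s (G.k1 s u) (X s.other)[q] → p ≤ q := by
      rw [g1]
      constructor
      · intro H p hp q hq h1 h2
        exact (f1 p hp h1).trans (H q hq h2)
      · intro H q hq h2
        rcases f2 with f2 | ⟨hp, f2⟩
        · omega
        · exact H _ hp q hq f2 h2
    have hxy : ∃ x y, (x = G.k0 s u ∧ y = G.k1 s u ∧ m₅ (.good, 0, 0) = 1) ∨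
        (x = G.k1 s u ∧ y = G.k0 s u ∧ ¬ m₅ (.good, 0, 0) = 1) := by
      by_cases hg : m₅ (.good, 0, 0) = 1
      · exact ⟨_, _, Or.inl ⟨rfl, rfl, hg⟩⟩
      · exact ⟨_, _, Or.inr ⟨rfl, rfl, hg⟩⟩
    obtain ⟨x, y, hxy⟩ := hxy
    have hcut := h.replace hu hn hdeg hQ hxy
    refine ⟨x, y, hxy.imp (fun h => ⟨h.1, h.2.1⟩) (fun h => ⟨h.1, h.2.1⟩), hcut, ?_⟩
    have hZ := hcut.length_le s
    rw [exec_cons, exec_cons]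
    have hF6 := (put .d 0).frame_exec m₅
    have hd6 : (put .d 0).exec m₅ (.d, 0, 0) = 0 := by simp
    generalize (put .d 0).exec m₅ = m₆ at *
    have hB6 := (hB4.frame hF5a (by cases s <;> decide)).frame hF6 (by decide)
    have g6 : m₆ (.good, 0, 0) = m₅ (.good, 0, 0) := hF6 _ (by decide) _ _
    have hr : Setup.replace X s u x y s = (X s).flatMap fun w => if w = u then [x, y] else [w] := by
      simp [Setup.replace]
    have t1 := exec_fillTmp (G := G) (s := s) (m := m₆) (Z := X s) (u := u) (x := x) (y := y)
      hB6.size (h.length_le s)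
      ((hF6 _ (by cases s <;> decide) _ _).trans
        ((hF5a _ (by cases s <;> decide) _ _).trans (hlen4 s)))
      (fun k hk => (hF6 _ (by cases s <;> decide) _ _).trans
        ((hF5a _ (by cases s <;> decide) _ _).trans (hlay4 s k hk)))
      ((hF6 _ (by decide) _ _).trans ((hF5a _ (by cases s <;> decide) _ _).trans hv4))
      (hB6.kid0 s u hn hu') (hB6.kid1 s u hn hu')
      (by rw [g6]; exact hxy.imp (fun h => ⟨h.2.2, h.1, h.2.1⟩) (fun h => ⟨h.2.2, h.1, h.2.1⟩)) hd6
    rw [← hr] at t1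
    have hF7 := (fillTmp s).frame_exec m₆
    generalize (fillTmp s).exec m₆ = m₇ at *
    rw [exec_cons, exec_cons, exec_nil]
    have hF8 := (put (.len s) Name.d).frame_exec m₇
    have hl8 : (put (.len s) Name.d).exec m₇ (.len s, 0, 0) = m₇ (.d, 0, 0) := by simp
    generalize (put (.len s) Name.d).exec m₇ = m₈ at *
    have t8 : TmpList m₈ (Setup.replace X s u x y s) :=
      ⟨(hF8 _ (by cases s <;> decide) _ _).trans t1.1,
        fun k hk => (hF8 _ (by cases s <;> decide) _ _).trans (t1.2 k hk)⟩
    have hF9 := (copyTmp s).frame_exec m₈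
    have hs8 : m₈ (.size, 0, 0) = G.n := ((hB6.frame hF7 (by cases s <;> decide)).frame hF8
      (by cases s <;> decide)).size
    exact ⟨(hF9 _ (by cases s <;> decide) _ _).trans (hl8.trans t1.1),
      fun k hk => exec_copyTmp hs8 t8 hZ k hk⟩
  obtain ⟨x, y, hxy, hcut, r1, r2⟩ := rest
  refine ⟨x, y, hxy, hcut, ?_⟩
  generalize (block [put .last 0, findLast s, put .good 1, checkGood s, put .d 0, fillTmp s,
        put (.len s) Name.d, copyTmp s]).exec m₁ = m' at *
  have hmem : ∀ w, w ∈ Setup.replace X s u x y s ↔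
      w = G.k0 s u ∨ w = G.k1 s u ∨ (w ∈ X s ∧ w ≠ u) := by
    intro w
    rw [h.mem_replace hu]
    rcases hxy with ⟨rfl, rfl⟩ | ⟨rfl, rfl⟩ <;> tauto
  have hE : ∀ v z, m' (edgeCell s v z) = 1 ↔ v ∈ Setup.replace X s u x y s ∧
      z ∈ X s.other ∧ G.Meets s v z := by
    intro v z
    rw [hF5.edgeCell (hkeep _ (by decide)), e1, hmem]
  have hdeg5 : ∀ t w, m' (.deg t, w, 0) = m₁ (.deg t, w, 0) :=
    fun t w => hF5 _ (hkeep _ (by cases t <;> decide)) _ _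
  have hd0 : m (.deg s, G.k0 s u, 0) = 0 :=
    hL.deg_zero s u hu _ (hk0.trans hu') hk0.ne hle0
  have hd1 : m (.deg s, G.k1 s u, 0) = 0 :=
    hL.deg_zero s u hu _ (hk1.trans hu') hk1.ne hle1
  refine ⟨hB5, ?_, (forall_side s).2 ⟨r1, ?_⟩, (forall_side s).2 ⟨r2, ?_⟩,
    (forall_side s).2 ⟨?_, ?_⟩, (forall_side s).2 ⟨?_, ?_⟩, (forall_side s).2 ⟨?_, ?_⟩⟩
  · intro t v hv w hw
    rw [hF5.tabCell (hkeep _ (by decide)), hF1.tabCell (by cases s <;> decide)]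
    exact hL.tab t v hv w hw
  · rw [replace_other]
    exact (hF5 _ (by cases s <;> decide) _ _).trans (hlen1 _)
  · intro k hk
    simp only [replace_other] at hk ⊢
    exact (hF5 _ (by cases s <;> decide) _ _).trans (hlay1 _ k hk)
  · intro v z; rw [replace_other]; exact hE v z
  · intro v z
    rw [replace_other, other_other, edgeCell_other, hE, meets_comm]
    tauto
  · intro w hw
    rw [hdeg5, e2, degree_replace_self]
    rcases (hmem w).1 hw with rfl | rfl | ⟨hw, hwu⟩
    · simp [hne, hd0]
    · simp [hne.symm, hd1]
    · have h0 : w ≠ G.k0 s u := fun he => hm0 (he ▸ hw)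
      have h1 : w ≠ G.k1 s u := fun he => hm1 (he ▸ hw)
      simp [h0, h1, hL.deg s w hw]
  · intro z hz
    rw [replace_other] at hz
    rw [hdeg5, e3, if_pos hz, hL.deg _ z hz]
    have h1 := degree_replace_other h hu x y z
    have h2 : (if G.Meets s u z then 1 else 0) ≤ G.degree X s.other z := by
      split_ifs with h3
      · exact (degree_pos_iff _ _).2 ⟨u, by rwa [other_other], h3.symm⟩
      · omega
    rcases hxy with ⟨rfl, rfl⟩ | ⟨rfl, rfl⟩ <;> omega
  · intro v hv w hw hwv hle
    have h4 : ∀ z ∈ X s, z ≠ u → G.Le s w u → ¬ G.Le s w z :=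
      fun z hz hzu h5 => h.not_le_of_mem hu hz hzu hw h5
    have hwk : w ≠ G.k0 s u ∧ w ≠ G.k1 s u ∧ m (.deg s, w, 0) = 0 := by
      rcases (hmem v).1 hv with rfl | rfl | ⟨hv, hvu⟩
      · refine ⟨hwv, ?_, ?_⟩
        · rintro rfl
          obtain ⟨j, hj⟩ := (G.hier s).nonempty _ hw
          exact (G.hier s).disj u hn hu' j (hle j hj) hj
        · refine hL.deg_zero s u hu w hw ?_ fun j hj => hle0 j (hle j hj)
          rintro rfl
          have := (G.hier s).mono _ hw _ (hk0.trans hu') hle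
          omega
      · refine ⟨?_, hwv, ?_⟩
        · rintro rfl
          obtain ⟨j, hj⟩ := (G.hier s).nonempty _ hw
          exact (G.hier s).disj u hn hu' j hj (hle j hj)
        · refine hL.deg_zero s u hu w hw ?_ fun j hj => hle1 j (hle j hj)
          rintro rfl
          have := (G.hier s).mono _ hw _ (hk1.trans hu') hle
          omega
      · refine ⟨?_, ?_, hL.deg_zero s v hv w hw hwv hle⟩
        · rintro rfl; exact h4 v hv hvu hle0 hle
        · rintro rfl; exact h4 v hv hvu hle1 hle
    rw [hdeg5, e2]
    simp [hwk]
  · intro v hv w hw hwv hle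
    rw [replace_other] at hv
    rw [hdeg5, e3, if_neg, hL.deg_zero _ v hv w hw hwv hle]
    intro hm
    exact h.not_le_of_mem hv hm hwv hw hle fun _ h => h

/-! ### The choice of the vertex -/

/-- The number of a side. -/
def sideNum : Side → ℕ
  | .T => 0
  | .S => 1

/-- The registers contain an internal vertex with the largest value of `D` among those in `A`. -/
def Found (G : Setup) (D : Side → ℕ → ℕ) (A : Side → ℕ → Prop) (m : Cell → ℕ) : Prop :=
  (m (.found, 0, 0) = 0 ∧ ∀ t w, A t w → w < G.n) ∨
  (m (.found, 0, 0) = 1 ∧ ∃ t, A t (m (.vert, 0, 0)) ∧ G.n ≤ m (.vert, 0, 0) ∧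
    m (.side, 0, 0) = sideNum t ∧ m (.high, 0, 0) = D t (m (.vert, 0, 0)) ∧
    ∀ t' w, A t' w → G.n ≤ w → D t' w ≤ m (.high, 0, 0))

theorem Found.congr {D : Side → ℕ → ℕ} {A A' : Side → ℕ → Prop} {m : Cell → ℕ}
    (h : G.Found D A m) (hA : ∀ t w, A t w ↔ A' t w) : G.Found D A' m := by
  have : A = A' := funext fun t => funext fun w => propext (hA t w)
  exact this ▸ h

/-- The number of a side, as an expression. -/
def sideExpr : Side → Expr
  | .T => 0
  | .S => 1

/-- Look at the entry number `b` of the list. -/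
def scanStep (s : Side) : Prog :=
  when (all [.lt Name.b (Name.len s), internal (at1 (.lay s) Name.b),
      .or (.eq Name.found 0) (.lt Name.high (at1 (.deg s) (at1 (.lay s) Name.b)))]) [
    put .found 1,
    put .high (at1 (.deg s) (at1 (.lay s) Name.b)),
    put .vert (at1 (.lay s) Name.b),
    put .side (sideExpr s)]

theorem scanDegrees_eq (s : Side) : scanDegrees s = for' .b Name.size [scanStep s] := by
  cases s <;> rfl

theorem exec_scanDegrees (s : Side) {D : Side → ℕ → ℕ} {A : Side → ℕ → Prop} {m : Cell → ℕ}
    {Z : List ℕ} (hsize : m (.size, 0, 0) = G.n) (hZn : Z.length ≤ G.n)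
    (hlen : m (.len s, 0, 0) = Z.length)
    (hlay : ∀ k (h : k < Z.length), m (.lay s, k, 0) = Z[k])
    (hD : ∀ w ∈ Z, m (.deg s, w, 0) = D s w) (h : G.Found D A m) :
    G.Found D (fun t w => A t w ∨ (t = s ∧ w ∈ Z)) ((scanDegrees s).exec m) := by
  rw [scanDegrees_eq]
  have key := for_ind (x := .b) (e := Name.size) (l := [scanStep s])
    (m := m) (N := G.n) (by simpa using hsize)
    (fun b m' => G.Found D (fun t w => A t w ∨ (t = s ∧ w ∈ Z.take b)) m')
    (h.congr (by simp)) (fun k m' v h => by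
      simpa only [Found, update_cell, reduceCtorEq, false_and, if_false] using h) ?_
  · rwa [List.take_of_length_le hZn] at key
  intro b hb m' hF hb' hI
  rw [exec_cons, exec_nil]
  unfold scanStep
  have hlen' : m' (.len s, 0, 0) = Z.length := (hF _ (by cases s <;> decide) _ _).trans hlen
  have hsize' : m' (.size, 0, 0) = G.n := (hF _ (by cases s <;> decide) _ _).trans hsize
  by_cases hbl : b < Z.length
  · have hl' : m' (.lay s, b, 0) = Z[b] := (hF _ (by cases s <;> decide) _ _).trans (hlay b hbl)
    have hD' : m' (.deg s, Z[b], 0) = D s Z[b] :=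
      (hF _ (by cases s <;> decide) _ _).trans (hD _ (List.getElem_mem hbl))
    have hA : ∀ t w, (A t w ∨ (t = s ∧ w ∈ Z.take (b + 1))) ↔
        (A t w ∨ (t = s ∧ w ∈ Z.take b)) ∨ (t = s ∧ w = Z[b]) := by
      intro t w; rw [mem_take_succ hbl]; tauto
    refine Found.congr ?_ fun t w => (hA t w).symm
    by_cases hc : G.n ≤ Z[b] ∧ (m' (.found, 0, 0) = 0 ∨ m' (.high, 0, 0) < D s Z[b])
    · rw [exec_when_pos (by
        simp only [all, internal, Cond.val, Expr.val, reg, at1, val_zero, hb', hlen', hsize', hl',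
          hD', Bool.and_eq_true, Bool.or_eq_true, decide_eq_true_eq, Bool.not_eq_true',
          decide_eq_false_iff_not, not_lt]
        exact ⟨hbl, hc.1, hc.2.imp (fun h => decide_eq_true h) id⟩)]
      have hside : ∀ m'', (sideExpr s).val m'' = sideNum s := by
        intro m''; cases s <;> rfl
      simp only [exec_cons, exec_nil, put, at1, exec_set, Expr.val, reg, val_zero, val_one, hside]
      right
      simp only [update_cell, reduceCtorEq, false_and, if_false, true_and, and_true, if_true, and_self,
        hb', hl', hD']
      refine ⟨s, Or.inr rfl, hc.1, rfl, rfl, ?_⟩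
      rintro t' w (hw | ⟨rfl, rfl⟩) hwn
      · rcases hI with ⟨h1, h2⟩ | ⟨h1, t, h2, h3, h4, h5, h6⟩
        · exact absurd (h2 t' w hw) (by omega)
        · have := h6 t' w hw hwn
          have := hc.2.resolve_left (by omega)
          omega
      · exact le_rfl
    · rw [exec_when_neg (by
        simp only [all, internal, Cond.val, Expr.val, reg, at1, val_zero, hb', hlen', hsize', hl',
          hD', Bool.and_eq_true, Bool.or_eq_true, decide_eq_true_eq, Bool.not_eq_true',
          decide_eq_false_iff_not, not_lt]
        exact fun h => hc ⟨h.2.1, h.2.2.imp (fun h => of_decide_eq_true h) id⟩)]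
      rcases hI with ⟨h1, h2⟩ | ⟨h1, t, h2, h3, h4, h5, h6⟩
      · left
        refine ⟨h1, ?_⟩
        rintro t w (hw | ⟨rfl, rfl⟩)
        · exact h2 t w hw
        · by_contra! hge
          exact hc ⟨hge, Or.inl h1⟩
      · right
        refine ⟨h1, t, Or.inl h2, h3, h4, h5, ?_⟩
        rintro t' w (hw | ⟨rfl, rfl⟩) hwn
        · exact h6 t' w hw hwn
        · by_contra! hlt
          exact hc ⟨hwn, Or.inr hlt⟩
  · rw [exec_when_neg (by simp [all, hb', hlen', hbl])]
    rw [List.take_of_length_le (by omega)] at hI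
    rwa [List.take_of_length_le (by omega)]

/-! ### The list `L` -/

/-- The edges in `A` are those of an entry of the list `L`. -/
def Recorded (G : Setup) (m : Cell → ℕ) (A : ℕ → Prop) : Prop :=
  ∃ a < m (.lenL, 0, 0), ∀ j, j ≠ G.i → (G.c .T (m (.listL .T, a, 0)) j ↔ A j)

/-- The entries of the list `L` are matched pairs. -/
def Valid (G : Setup) (m : Cell → ℕ) : Prop :=
  ∀ a < m (.lenL, 0, 0), m (.listL .T, a, 0) < 2 * G.n - 1 ∧
    m (.listL .S, a, 0) < 2 * G.n - 1 ∧
    G.Matched .T (m (.listL .T, a, 0)) (m (.listL .S, a, 0))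

theorem Matched.symm {u v : ℕ} (h : G.Matched s u v) : G.Matched s.other v u := by
  intro j hj; rw [other_other]; exact (h j hj).symm

/-- If the chosen vertex has degree one, it is recorded. -/
theorem exec_recordPair {m : Cell → ℕ} (hL : G.Link m X) (h : G.Cut X) (hu : u ∈ X s)
    (hvert : m (.vert, 0, 0) = u)
    (hdeg : ∀ y ∈ X s.other, G.Meets s u y → (∀ z ∈ X s.other, G.Meets s u z → z = y) →
      G.Matched s u y) (hV : G.Valid m) :
    G.Valid ((recordPair s).exec m) ∧
    (recordPair s).exec m (.lenL, 0, 0) ≤ m (.lenL, 0, 0) + 1 ∧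
    (∀ A, G.Recorded m A → G.Recorded ((recordPair s).exec m) A) ∧
    ∀ y ∈ X s.other, G.Meets s u y → (∀ z ∈ X s.other, G.Meets s u z → z = y) →
      G.Recorded ((recordPair s).exec m) (G.c s u) := by
  have hdu := hL.deg s u hu
  unfold recordPair
  by_cases hd : G.degree X s u = 1
  · obtain ⟨y, hy, huy⟩ := (degree_pos_iff s u).1 (by rw [hd]; exact one_pos)
    have huniq : ∀ z ∈ X s.other, G.Meets s u z → z = y := fun z hz hm =>
      (h.degree_le_one_iff s u).1 hd.le z hz y hy hm huy
    have hmat := hdeg y hy huy huniq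
    rw [exec_when_pos (by simp [hvert, hdu, hd]), exec_cons]
    have key := for_ind (x := .b) (e := Name.size) (l := [
      when (.and (.lt Name.b (Name.len s.other)) (inE s Name.vert (at1 (.lay s.other) Name.b)))
        [put .nbr (at1 (.lay s.other) Name.b)]]) (m := m) (N := G.n) (by simpa using hL.size)
      (fun b m' => y ∈ (X s.other).take b → m' (.nbr, 0, 0) = y) (by simp)
      (fun k m' v h => by
        simpa only [update_cell, reduceCtorEq, false_and, if_false] using h) ?_
    · rw [List.take_of_length_le (h.length_le _)] at key
      replace key := key hy
      have hF := (for' .b Name.size [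
        when (.and (.lt Name.b (Name.len s.other)) (inE s Name.vert (at1 (.lay s.other) Name.b)))
          [put .nbr (at1 (.lay s.other) Name.b)]]).frame_exec m
      generalize (for' .b Name.size [
        when (.and (.lt Name.b (Name.len s.other)) (inE s Name.vert (at1 (.lay s.other) Name.b)))
          [put .nbr (at1 (.lay s.other) Name.b)]]).exec m = m' at *
      have hv' : m' (.vert, 0, 0) = u := (hF _ (by cases s <;> decide) _ _).trans hvert
      have hlenL : m' (.lenL, 0, 0) = m (.lenL, 0, 0) := hF _ (by cases s <;> decide) _ _
      have hlist : ∀ t a, m' (.listL t, a, 0) = m (.listL t, a, 0) :=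
        fun t a => hF _ (by cases s <;> cases t <;> decide) _ _
      simp only [exec_cons, exec_nil, incr, put, put1, exec_set, Expr.val, reg, val_zero]
      have hlu := h.lt s u hu
      have hly := h.lt s.other y hy
      refine ⟨?_, ?_, ?_, ?_⟩
      · intro a ha
        simp only [update_cell, reduceCtorEq, false_and, if_false, true_and, and_true,
          if_true, and_self, hlenL, hv', key, hlist, Name.listL.injEq] at ha ⊢
        by_cases ha' : a = m (.lenL, 0, 0)
        · subst ha'
          cases s
          · simp only [Side.other, reduceCtorEq, if_true, if_false, false_and, and_self]
            exact ⟨hlu, hly, hmat⟩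
          · simp only [Side.other, reduceCtorEq, if_true, if_false, false_and, and_self]
            exact ⟨hly, hlu, hmat.symm⟩
        · simp only [ha', and_false, if_false]
          exact hV a (by omega)
      · simp [hlenL]
      · rintro A ⟨a, ha, hA⟩
        refine ⟨a, ?_, ?_⟩
        · simp [hlenL]; omega
        · have : a ≠ m (.lenL, 0, 0) := by omega
          simpa [hlenL, this, hlist] using hA
      · intro _ _ _ _
        refine ⟨m (.lenL, 0, 0), ?_, ?_⟩
        · simp [hlenL]
        · cases s
          · simp [hlenL, hv', Side.other]
          · simp only [hlenL, hv', key, Side.other, update_cell, Name.listL.injEq, reduceCtorEq,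
              false_and, if_false, true_and, and_true, if_true, and_self]
            exact fun j hj => (hmat j hj).symm
    · intro b hb m' hF hb' hI hyb
      rw [exec_cons, exec_nil]
      have hlen' : m' (.len s.other, 0, 0) = (X s.other).length :=
        (hF _ (by cases s <;> decide) _ _).trans (hL.len _)
      have hv' : m' (.vert, 0, 0) = u := (hF _ (by cases s <;> decide) _ _).trans hvert
      by_cases hbl : b < (X s.other).length
      · have hl' : m' (.lay s.other, b, 0) = (X s.other)[b] :=
          (hF _ (by cases s <;> decide) _ _).trans (hL.lay _ _ hbl)
        have hE' : m' (edgeCell s u (X s.other)[b]) = 1 ↔ G.Meets s u (X s.other)[b] := by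
          rw [hF.edgeCell (by cases s <;> decide), hL.edge]
          simp [hu]
        by_cases hm : G.Meets s u (X s.other)[b]
        · rw [exec_when_pos (by simp [val_inE, hb', hlen', hv', hl', hbl, hE'.2 hm])]
          simpa [hb', hl'] using huniq _ (List.getElem_mem hbl) hm
        · have hE'' := hE'.not.2 hm
          rw [exec_when_neg (by simp [val_inE, hb', hlen', hv', hl', hbl, hE''])]
          apply hI
          rcases (mem_take_succ hbl y).1 hyb with h1 | rfl
          · exact h1
          · exact absurd huy hm
      · rw [exec_when_neg (by simp [hb', hlen', hbl])]
        apply hI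
        rw [List.take_of_length_le (by omega)]; exact hy
  · rw [exec_when_neg (by simp [hvert, hdu, hd])]
    refine ⟨hV, Nat.le_succ _, fun _ h => h, ?_⟩
    intro y hy huy huniq
    exfalso
    apply hd
    have h1 := (degree_pos_iff s u).2 ⟨y, hy, huy⟩
    have h2 := (h.degree_le_one_iff s u).2 fun a ha b hb h3 h4 =>
      (huniq a ha h3).trans (huniq b hb h4).symm
    omega

end Setup

end Tangle

namespace Tangle

instance : Fintype Side := ⟨{.T, .S}, fun s => by cases s <;> decide⟩

theorem Prog.frame_update (x : Name) (m : Cell → ℕ) (v : ℕ) :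
    (put x 0).Frame m (Function.update m (x, 0, 0) v) := by
  intro y hy a b
  have : x ≠ y := by simpa [put, Prog.keeps] using hy
  simp [this.symm]

namespace Setup

open Hier

variable {G : Setup} {X : Side → List ℕ} {s : Side} {u : ℕ}

theorem Valid.frame {m m' : Cell → ℕ} (h : G.Valid m) {p : Prog} (hF : p.Frame m m')
    (h1 : p.keeps .lenL = true) (h2 : p.keeps (.listL .T) = true)
    (h3 : p.keeps (.listL .S) = true) : G.Valid m' := by
  intro a ha
  rw [hF _ h1] at ha
  rw [hF _ h2, hF _ h3]
  exact h a ha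

theorem Recorded.frame {m m' : Cell → ℕ} {A : ℕ → Prop} (h : G.Recorded m A) {p : Prog}
    (hF : p.Frame m m') (h1 : p.keeps .lenL = true) (h2 : p.keeps (.listL .T) = true) :
    G.Recorded m' A := by
  obtain ⟨a, ha, hA⟩ := h
  refine ⟨a, by rwa [hF _ h1], ?_⟩
  rwa [hF _ h2]

theorem Recorded.congr {m : Cell → ℕ} (A B : ℕ → Prop) (hAB : ∀ j, j ≠ G.i → (A j ↔ B j))
    (h : G.Recorded m A) : G.Recorded m B := by
  obtain ⟨a, ha, hA⟩ := h
  exact ⟨a, ha, fun j hj => (hA j hj).trans (hAB j hj)⟩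

/-- The state of the machine after `k` refinements. -/
def Refining (G : Setup) (k : ℕ) (m : Cell → ℕ) : Prop :=
  ∃ X, G.Link m X ∧ G.Cut X ∧ G.Complete X (G.Recorded m) ∧ G.Valid m ∧ m (.lenL, 0, 0) ≤ k ∧
    ((X .T).length + (X .S).length = 2 + k ∨ ∀ s, ∀ w ∈ X s, w < G.n)

theorem Complete.mono {D D' : (ℕ → Prop) → Prop} (h : G.Complete X D) (hD : ∀ A, D A → D' A) :
    G.Complete X D' :=
  fun s w hw z hz hm h2 => (h s w hw z hz hm h2).imp (hD _) id

theorem Refining.frame {k k' : ℕ} {m m' : Cell → ℕ} (h : G.Refining k m) {p : Prog}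
    (hF : p.Frame m m') (hp : p.keepsAll baseNames = true) (h1 : p.keeps .tabP = true)
    (h2 : p.keeps .edge = true) (h3 : ∀ s, p.keeps (.len s) = true)
    (h4 : ∀ s, p.keeps (.lay s) = true) (h5 : ∀ s, p.keeps (.deg s) = true)
    (h6 : p.keeps .lenL = true) (h7 : p.keeps (.listL .T) = true)
    (h8 : p.keeps (.listL .S) = true) (hk : k = k') :
    G.Refining k' m' := by
  subst hk
  obtain ⟨X, a1, a2, a3, a4, a5, a6⟩ := h
  exact ⟨X, a1.frame hF hp h1 h2 h3 h4 h5, a2, a3.mono fun A hA => hA.frame hF h6 h7,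
    a4.frame hF h6 h7 h8, by rwa [hF _ h6], a6⟩

/-- Record and refine the chosen vertex. -/
theorem exec_record_refine {m : Cell → ℕ} {k : ℕ} (hL : G.Link m X) (h : G.Cut X)
    (hC : G.Complete X (G.Recorded m)) (hV : G.Valid m) (hlen : m (.lenL, 0, 0) ≤ k)
    (hk : (X .T).length + (X .S).length = 2 + k) (hu : u ∈ X s)
    (hn : G.n ≤ u) (hvert : m (.vert, 0, 0) = u)
    (hmax : ∀ t, ∀ w ∈ X t, G.n ≤ w → G.degree X t w ≤ G.degree X s u) :
    G.Refining (k + 1) ((block [recordPair s, Tangle.refine s]).exec m) := by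
  have hdeg : ∀ y ∈ X s.other, G.Meets s u y → (∀ z ∈ X s.other, G.Meets s u z → z = y) →
      G.Matched s u y := fun y hy h1 h2 => h.matched hu hmax hy h1 h2
  rw [exec_cons, exec_cons, exec_nil]
  obtain ⟨r1, r2, r3, r4⟩ := exec_recordPair hL h hu hvert hdeg hV
  have hF := (recordPair s).frame_exec m
  generalize (recordPair s).exec m = m' at *
  have hL' : G.Link m' X := hL.frame hF (by cases s <;> decide) (by cases s <;> decide)
    (by cases s <;> decide) (fun t => by cases s <;> cases t <;> decide)
    (fun t => by cases s <;> cases t <;> decide) (fun t => by cases s <;> cases t <;> decide)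
  obtain ⟨x, y, hxy, c1, c2⟩ := exec_refine hL' h hu hn
    ((hF _ (by cases s <;> decide) _ _).trans hvert) hdeg
  have hF' := (Tangle.refine s).frame_exec m'
  generalize (Tangle.refine s).exec m' = m₂ at *
  refine ⟨Setup.replace X s u x y, c2, c1, ?_, r1.frame hF' (by cases s <;> decide)
    (by cases s <;> decide) (by cases s <;> decide), ?_, Or.inl ?_⟩
  · refine hC.replace h hu hn ?_ Recorded.congr ?_ hxy
    · exact fun A hA => (r3 A hA).frame hF' (by cases s <;> decide) (by cases s <;> decide)
    · exact fun y hy h1 h2 => (r4 y hy h1 h2).frame hF' (by cases s <;> decide)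
        (by cases s <;> decide)
  · rw [hF' _ (by cases s <;> decide)]; omega
  · have h1 := h.length_replace hu x y
    cases s
    · have h2 : Setup.replace X .T u x y .S = X .S := replace_other X .T u x y
      rw [h1, h2]; omega
    · have h2 : Setup.replace X .S u x y .T = X .T := replace_other X .S u x y
      rw [h1, h2]; omega

/-- One iteration of the main loop. -/
def untangleStep : List Prog := [
    put .found 0,
    scanDegrees .T,
    scanDegrees .S,
    when (.eq Name.found 1) [
      .ite (.eq Name.side 0)
        (block [recordPair .T, Tangle.refine .T])
        (block [recordPair .S, Tangle.refine .S])]]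

theorem exec_untangleStep {m : Cell → ℕ} {k : ℕ} (h : G.Refining k m) :
    G.Refining (k + 1) ((block untangleStep).exec m) := by
  have hF0 : ((block [put .found 0, scanDegrees .T, scanDegrees .S])).Frame m
    ((block [put .found 0, scanDegrees .T, scanDegrees .S]).exec m) := Prog.frame_exec _ m
  have e0 : (block untangleStep).exec m = (block [when (.eq Name.found 1) [
      .ite (.eq Name.side 0)
        (block [recordPair .T, Tangle.refine .T])
        (block [recordPair .S, Tangle.refine .S])]]).exec
          ((block [put .found 0, scanDegrees .T, scanDegrees .S]).exec m) := by
    simp only [untangleStep, exec_cons, exec_nil]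
  rw [e0]
  obtain ⟨X, hL, hcut, hC, hV, hlen, hk⟩ := h
  have hfound : G.Found (fun t w => G.degree X t w) (fun t w => w ∈ X t)
      ((block [put .found 0, scanDegrees .T, scanDegrees .S]).exec m) := by
    rw [exec_cons, exec_cons, exec_cons, exec_nil]
    have hf0 : (put .found 0).exec m (.found, 0, 0) = 0 := by simp
    have hL1 := hL.frame ((put .found 0).frame_exec m) (by decide) (by decide) (by decide)
      (by decide) (by decide) (by decide)
    generalize (put .found 0).exec m = m₁ at *
    have h1 := exec_scanDegrees (G := G) .T (D := fun t w => G.degree X t w)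
      (A := fun _ _ => False) hL1.size (hcut.length_le _) (hL1.len .T) (hL1.lay .T) (hL1.deg .T)
      (Or.inl ⟨hf0, by simp⟩)
    have hL2 := hL1.frame ((scanDegrees .T).frame_exec m₁) (by decide) (by decide) (by decide)
      (by decide) (by decide) (by decide)
    generalize (scanDegrees .T).exec m₁ = m₂ at *
    refine Found.congr (exec_scanDegrees (G := G) .S (D := fun t w => G.degree X t w)
      hL2.size (hcut.length_le _) (hL2.len .S) (hL2.lay .S) (hL2.deg .S) h1) ?_
    rintro (_ | _) w <;> simp
  replace hL := hL.frame hF0 (by decide) (by decide) (by decide) (by decide) (by decide)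
    (by decide)
  replace hC := hC.mono fun A (hA : G.Recorded m A) => hA.frame hF0 (by decide) (by decide)
  replace hV := hV.frame hF0 (by decide) (by decide) (by decide)
  rw [← hF0 _ (by decide)] at hlen
  generalize (block [put .found 0, scanDegrees .T, scanDegrees .S]).exec m = m₁ at *
  rw [exec_cons, exec_nil]
  rcases hfound with ⟨h1, h2⟩ | ⟨h1, t, h2, h3, h4, h5, h6⟩
  · rw [exec_when_neg (by simp [h1])]
    exact ⟨X, hL, hcut, hC, hV, by omega, Or.inr h2⟩
  · rw [exec_when_pos (by simp [h1]), exec_cons, exec_nil, exec_ite]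
    rw [h5] at h6
    have hk' := hk.resolve_right fun h => absurd (h t _ h2) (by omega)
    cases t
    · rw [if_pos (by simp [h4, sideNum])]
      exact exec_record_refine hL hcut hC hV hlen hk' h2 h3 rfl h6
    · rw [if_neg (by simp [h4, sideNum])]
      exact exec_record_refine hL hcut hC hV hlen hk' h2 h3 rfl h6

/-- The result of the first part of the algorithm. -/
structure Untangled (G : Setup) (m : Cell → ℕ) : Prop extends G.Base m where
  perm : ∀ s, IsPermArray G.n fun k => m (.lay s, k, 0)
  planar : G.Planar fun s => arrayOrder G.n (G.e s) fun k => m (.lay s, k, 0)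
  valid : G.Valid m
  lenL : m (.lenL, 0, 0) ≤ 2 * G.n - 1
  complete : ∀ w < 2 * G.n - 1, ∀ z < 2 * G.n - 1, G.Matched .T w z →
    (∃ j k, j ≠ k ∧ j ≠ G.i ∧ k ≠ G.i ∧ G.c .T w j ∧ G.c .T w k) → G.Recorded m (G.c .T w)

theorem Planar.congr {b b' : Side → ℕ → ℕ → Prop} (h : G.Planar b)
    (hirr : ∀ s j, ¬ b' s j j)
    (hb : ∀ s, ∀ j < G.n, ∀ k < G.n, j ≠ k → (b s j k ↔ b' s j k)) : G.Planar b' where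
  order s := by
    have H := G.hier s
    refine ⟨fun j hj k hk hjk => ?_, fun w hw hw' x x' y y' hx hx' hy hy' => ?_⟩
    · rw [← hb s j hj k hk hjk, ← hb s k hk j hj hjk.symm]
      exact (h.order s).total j hj k hk hjk
    · have hne : ∀ x y, G.c s (G.k0 s w) x → G.c s (G.k1 s w) y → x ≠ y := by
        rintro x y hx hy rfl; exact H.disj w hw hw' x hx hy
      rw [← hb s x (H.c_lt _ _ hx) y (H.c_lt _ _ hy) (hne x y hx hy),
        ← hb s x' (H.c_lt _ _ hx') y' (H.c_lt _ _ hy') (hne x' y' hx' hy')]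
      exact (h.order s).split w hw hw' x x' y y' hx hx' hy hy'
  planar s j hj k hk hji hki := by
    rcases eq_or_ne j k with rfl | hjk
    · exact iff_of_false (hirr s j) (hirr _ j)
    rw [← hb s j hj k hk hjk, ← hb s.other j hj k hk hjk]
    exact h.planar s j hj k hk hji hki

theorem Refining.untangled {m : Cell → ℕ} (h : G.Refining (2 * G.n - 1) m) : G.Untangled m := by
  obtain ⟨X, hL, hcut, hC, hV, hlen, hk⟩ := h
  have h2n := G.two_le
  have hleaf : ∀ s, ∀ w ∈ X s, w < G.n := by
    refine hk.resolve_left fun h => ?_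
    have h1 := hcut.length_le .T
    have h2 := hcut.length_le .S
    omega
  have hmem : ∀ s, ∀ j < G.n, G.e s j ∈ X s := by
    intro s j hj
    obtain ⟨u, hu, huj⟩ := hcut.cover s j hj
    rwa [((G.hier s).leaf u (hleaf s u hu) j hj).1 huj]
  have hlenX : ∀ s, (X s).length = G.n := by
    intro s
    refine le_antisymm (hcut.length_le s) ?_
    rw [← List.toFinset_card_of_nodup (hcut.nodup s), ← Finset.card_range G.n]
    refine Finset.card_le_card_of_injOn (G.e s) ?_ ?_
    · intro j hj
      simpa using hmem s j (by simpa using hj)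
    · intro j hj k hk hjk
      exact (G.hier s).e_inj j (by simpa using hj) k (by simpa using hk) hjk
  have hlay : ∀ s k (h : k < G.n), m (.lay s, k, 0) = (X s)[k]'((hlenX s).symm ▸ h) :=
    fun s k h => hL.lay s k ((hlenX s).symm ▸ h)
  have hperm : ∀ s, IsPermArray G.n fun k => m (.lay s, k, 0) := by
    intro s
    refine ⟨fun k hk => ?_, fun j hj k hk hjk => ?_⟩
    · simp only [hlay s k hk]
      exact hleaf s _ (List.getElem_mem _)
    · simp only [hlay s k hk, hlay s j hj] at hjk
      exact ((hcut.nodup s).getElem_inj_iff).1 hjk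
  refine ⟨hL.toBase, hperm, ?_, hV, hlen, ?_⟩
  · obtain ⟨b, hb, hbX⟩ := hcut.planar
    have hirr : ∀ s j, ¬ arrayOrder G.n (G.e s) (fun k => m (.lay s, k, 0)) j j := by
      rintro s j ⟨-, -, p, q, hpq, hq, h1, h2⟩
      exact hpq.ne ((hperm s).inj p (hpq.trans hq) q hq (h1.trans h2.symm))
    refine hb.congr hirr fun s j hj k hk hjk => ?_
    have H := G.hier s
    have key : ∀ j < G.n, ∀ k < G.n, arrayOrder G.n (G.e s) (fun k => m (.lay s, k, 0)) j k →
        j ≠ k ∧ b s j k := by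
      rintro j hj k hk ⟨-, -, p, q, hpq, hq, h1, h2⟩
      simp only [hlay s p (hpq.trans hq), hlay s q hq] at h1 h2
      have h3 := List.pairwise_iff_getElem.1 (hbX s) p q (by rw [hlenX]; omega)
        (by rw [hlenX]; omega) hpq
      rw [h1, h2] at h3
      exact h3 j k ((H.leaf _ (H.e_lt j hj) j hj).2 rfl) ((H.leaf _ (H.e_lt k hk) k hk).2 rfl)
    constructor
    · intro hbjk
      obtain ⟨p, hp, hpj⟩ := (hperm s).surj (H.e_lt j hj)
      obtain ⟨q, hq, hqk⟩ := (hperm s).surj (H.e_lt k hk)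
      rcases lt_trichotomy p q with h1 | rfl | h1
      · exact ⟨hj, hk, p, q, h1, hq, hpj, hqk⟩
      · exfalso
        exact hjk (H.e_inj j hj k hk (hpj.symm.trans hqk))
      · have h2 := key k hk j hj ⟨hk, hj, q, p, h1, hp, hqk, hpj⟩
        exact absurd h2.2 (((hb.order s).total j hj k hk h2.1.symm).1 hbjk)
    · exact fun h => (key j hj k hk h).2
  · intro w hw z hz hm h2
    refine (hC .T w hw z hz hm h2).resolve_right ?_
    rintro ⟨x, hx, y, hy, hxy⟩
    obtain ⟨j, k, hjk, hj, hk, h3, h4⟩ := h2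
    have H := G.hier .T
    have hxl := hleaf _ x hx
    have h5 := (H.leaf x hxl j (H.c_lt _ _ h3)).1 (hxy j hj h3).1
    have h6 := (H.leaf x hxl k (H.c_lt _ _ h4)).1 (hxy k hk h4).1
    exact hjk (H.e_inj j (H.c_lt _ _ h3) k (H.c_lt _ _ h4) (h5.trans h6.symm))

/-- The memory before the algorithm starts. -/
structure Start (G : Setup) (m : Cell → ℕ) : Prop extends G.Input m where
  zero : ∀ y ∉ inputNames, ∀ a b, m (y, a, b) = 0

theorem degree_root {r : ℕ} {X : Side → List ℕ} (hX : ∀ s, X s = [r])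
    (h : ∀ s, G.Meets s r r) (s : Side) : G.degree X s r = 1 := by
  classical
  unfold degree
  rw [hX]
  simp [h s]

theorem exec_startLayout {m : Cell → ℕ} (hB : G.Base m) {b : Side → ℕ → ℕ → Prop}
    (hb : G.Planar b)
    (htab : ∀ u < 2 * G.n - 1, ∀ v < 2 * G.n - 1, m (.tabP, u, v) = 1 ↔ G.Adj u v)
    (hedge : ∀ u v, m (.edge, u, v) = 0) (hdeg : ∀ s u, m (.deg s, u, 0) = 0) :
    G.Refining 0 (startLayout.exec m) := by
  have h2n := G.two_le
  have hB' : G.Base (startLayout.exec m) := hB.exec (by decide)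
  have hF := startLayout.frame_exec m
  have hroot : ∀ s, ∀ j < G.n, G.c s (2 * G.n - 2) j := fun s => (G.hier s).root
  obtain ⟨j₀, hj₀, hj₀i⟩ : ∃ j < G.n, j ≠ G.i := by
    rcases eq_or_ne G.i 0 with h | h
    · exact ⟨1, by omega, by omega⟩
    · exact ⟨0, by omega, by omega⟩
  have hmeets : ∀ s, G.Meets s (2 * G.n - 2) (2 * G.n - 2) :=
    fun s => ⟨j₀, hj₀i, hroot s _ hj₀, hroot _ _ hj₀⟩
  have hv : m (.verts, 0, 0) - 1 = 2 * G.n - 2 := by rw [hB.verts]; omega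
  have hlen : ∀ s, startLayout.exec m (.len s, 0, 0) = 1 := by
    intro s; cases s <;> simp [startLayout]
  have hlay : ∀ s, startLayout.exec m (.lay s, 0, 0) = 2 * G.n - 2 := by
    intro s; cases s <;> simp [startLayout, hv]
  have he : ∀ u v, startLayout.exec m (.edge, u, v) = 1 ↔ u = 2 * G.n - 2 ∧ v = 2 * G.n - 2 := by
    intro u v; simp [startLayout, hv, hedge]
  have hd : ∀ s w, startLayout.exec m (.deg s, w, 0) = if w = 2 * G.n - 2 then 1 else 0 := by
    intro s w; cases s <;> simp [startLayout, hv, hdeg]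
  have hlenL : startLayout.exec m (.lenL, 0, 0) = 0 := by simp [startLayout]
  generalize startLayout.exec m = m' at *
  refine ⟨fun _ => [2 * G.n - 2], ⟨hB', ?_, ?_, ?_, ?_, ?_, ?_⟩, ⟨?_, ?_, b, hb, ?_⟩, ?_, ?_, ?_,
    Or.inl rfl⟩
  · intro s u hu v hv
    rw [hF.tabCell (by decide)]
    cases s
    · exact htab u hu v hv
    · exact (htab v hv u hu).trans (meets_comm (s := .S) (u := u) (v := v))
  · intro s; simp [hlen]
  · intro s k hk
    have : k = 0 := by simpa using hk
    subst this
    exact hlay s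
  · intro s u v
    have : m' (edgeCell s u v) = 1 ↔ u = 2 * G.n - 2 ∧ v = 2 * G.n - 2 := by
      cases s
      · exact he u v
      · exact (he v u).trans and_comm
    rw [this]
    simp only [List.mem_singleton]
    constructor
    · rintro ⟨rfl, rfl⟩; exact ⟨rfl, rfl, hmeets s⟩
    · exact fun h => ⟨h.1, h.2.1⟩
  · intro s w hw
    rw [List.mem_singleton] at hw
    subst hw
    rw [hd, if_pos rfl, degree_root (fun _ => rfl) hmeets]
  · intro s u hu w hw hwu _
    rw [List.mem_singleton] at hu
    subst hu
    rw [hd, if_neg hwu]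
  · intro s u hu
    rw [List.mem_singleton] at hu
    omega
  · intro s j hj
    exact ⟨_, List.mem_singleton.2 rfl, hroot s j hj⟩
  · intro s; exact List.pairwise_singleton _ _
  · intro s w hw z hz hm h2
    right
    refine ⟨_, List.mem_singleton.2 rfl, _, List.mem_singleton.2 rfl, fun j hj hjw => ?_⟩
    have := (G.hier s).c_lt _ _ hjw
    exact ⟨hroot s j this, hroot _ j this⟩
  · intro a ha; omega
  · omega

theorem exec_untangleLoop {m : Cell → ℕ} (hv : m (.verts, 0, 0) = 2 * G.n - 1)
    (h : G.Refining 0 m) : G.Untangled (untangleLoop.exec m) := by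
  apply Refining.untangled
  refine for_ind (x := .a) (e := Name.verts) (l := untangleStep) (by simpa using hv)
    (fun k m' => G.Refining k m') h ?_ ?_
  · intro k m' v hk
    exact hk.frame (Prog.frame_update .a m' v) (by decide) (by decide) (by decide) (by decide)
      (by decide) (by decide) (by decide) (by decide) (by decide) rfl
  · intro k _ m' _ _ hk
    exact exec_untangleStep hk

theorem exec_modifiedUntangle {m : Cell → ℕ} (h : G.Start m) {b : Side → ℕ → ℕ → Prop}
    (hb : G.Planar b) : G.Untangled (modifiedUntangle.exec m) := by
  unfold modifiedUntangle
  rw [exec_cons, exec_cons, exec_cons, exec_cons, exec_cons, exec_cons, exec_nil]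
  have hv1 := exec_countVerts h.toInput
  have hF1 := countVerts.frame_exec m
  generalize countVerts.exec m = m₁ at *
  have hI1 := h.toInput.frame hF1 (by decide)
  have z1 : ∀ y ∉ Name.verts :: Name.a :: inputNames, ∀ a b, m₁ (y, a, b) = 0 := by
    intro y hy a b
    simp only [List.mem_cons, not_or] at hy
    rw [hF1 y, h.zero y hy.2.2]
    simp [countVerts, Prog.keeps, for', Ne.symm hy.1, Ne.symm hy.2.1]
  obtain ⟨d1, c1⟩ := exec_descendants .T hI1 hv1 (fun u v => z1 _ (by decide) _ _)
    (fun u => z1 _ (by decide) _ _)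
  have hF2 := (descendants .T).frame_exec m₁
  generalize (descendants .T).exec m₁ = m₂ at *
  have hI2 := hI1.frame hF2 (by decide)
  have hv2 := (hF2 .verts (by decide) 0 0).trans hv1
  obtain ⟨d2, c2⟩ := exec_descendants .S hI2 hv2
    (fun u v => (hF2 _ (by decide) _ _).trans (z1 _ (by decide) _ _))
    (fun u => (hF2 _ (by decide) _ _).trans (z1 _ (by decide) _ _))
  have hF3 := (descendants .S).frame_exec m₂
  generalize (descendants .S).exec m₂ = m₃ at *
  have hB3 : G.Base m₃ := by
    refine ⟨hI2.frame hF3 (by decide), (hF3 _ (by decide) _ _).trans hv2, ?_, ?_⟩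
    · rintro (_ | _) u hu v hv
      · rw [hF3 _ (by decide)]; exact d1 u hu v hv
      · exact d2 u hu v hv
    · rintro (_ | _) u hu
      · rw [hF3 _ (by decide)]; exact c1 u hu
      · exact c2 u hu
  have t3 := exec_tableP hB3.toInput hB3.verts fun u v => (hF3 _ (by decide) _ _).trans
    ((hF2 _ (by decide) _ _).trans (z1 _ (by decide) _ _))
  have hF4 := tableP.frame_exec m₃
  generalize tableP.exec m₃ = m₄ at *
  have hB4 := hB3.frame hF4 (by decide)
  have s4 := exec_startLayout hB4 hb t3
    (fun u v => (hF4 _ (by decide) _ _).trans ((hF3 _ (by decide) _ _).trans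
      ((hF2 _ (by decide) _ _).trans (z1 _ (by decide) _ _))))
    (fun s u => (hF4 _ (by cases s <;> decide) _ _).trans ((hF3 _ (by cases s <;> decide) _ _).trans
      ((hF2 _ (by cases s <;> decide) _ _).trans (z1 _ (by cases s <;> decide) _ _))))
  refine exec_untangleLoop ?_ s4
  rw [startLayout.frame_exec m₄ .verts (by decide)]
  exact hB4.verts

end Setup

end Tangle

namespace Tangle

namespace Setup

open Hier

variable {G : Setup} {s : Side} {u v : ℕ}

/-! ### The set `L(I)` -/

theorem count_eq {t : Side} (h : ∀ j, j ≠ G.i → (G.c s u j ↔ G.c t v j)) :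
    G.count s u = G.count t v := by
  classical
  unfold count
  congr 1
  ext j
  simp only [Finset.mem_filter, Finset.mem_range]
  constructor
  · rintro ⟨h1, h2, h3⟩; exact ⟨h1, h2, (h j h2).1 h3⟩
  · rintro ⟨h1, h2, h3⟩; exact ⟨h1, h2, (h j h2).2 h3⟩

theorem one_lt_count_iff : 1 < G.count s u ↔
    ∃ j k, j ≠ k ∧ j ≠ G.i ∧ k ≠ G.i ∧ G.c s u j ∧ G.c s u k := by
  classical
  unfold count
  rw [Finset.one_lt_card]
  simp only [Finset.mem_filter, Finset.mem_range]
  constructor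
  · rintro ⟨j, ⟨-, h1, h2⟩, k, ⟨-, h3, h4⟩, h5⟩
    exact ⟨j, k, h5, h1, h3, h2, h4⟩
  · rintro ⟨j, k, h5, h1, h3, h2, h4⟩
    exact ⟨j, ⟨(G.hier s).c_lt _ _ h2, h1, h2⟩, k, ⟨(G.hier s).c_lt _ _ h4, h3, h4⟩, h5⟩

theorem iff_of_count_eq (hle : G.Le s v u) (h : G.count s v = G.count s u) {j : ℕ}
    (hj : j ≠ G.i) : G.c s v j ↔ G.c s u j := by
  classical
  refine ⟨hle j, fun hju => ?_⟩
  unfold count at h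
  have hsub : ((Finset.range G.n).filter fun j => j ≠ G.i ∧ G.c s v j) ⊆
      (Finset.range G.n).filter fun j => j ≠ G.i ∧ G.c s u j := by
    intro j
    simp only [Finset.mem_filter, Finset.mem_range]
    rintro ⟨h1, h2, h3⟩; exact ⟨h1, h2, hle j h3⟩
  have := Finset.eq_of_subset_of_card_le hsub h.ge
  have hm : j ∈ (Finset.range G.n).filter fun j => j ≠ G.i ∧ G.c s u j := by
    simp [hj, hju, (G.hier s).c_lt _ _ hju]
  rw [← this] at hm
  simp only [Finset.mem_filter] at hm
  exact hm.2.2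

theorem not_leaf_of_one_lt_count (h : 1 < G.count s u) : G.n ≤ u := by
  by_contra! hlt
  obtain ⟨j, k, hjk, -, -, h1, h2⟩ := one_lt_count_iff.1 h
  have H := G.hier s
  have hj := H.c_lt _ _ h1
  have hk := H.c_lt _ _ h2
  exact hjk (H.e_inj j hj k hk (((H.leaf u hlt j hj).1 h1).trans ((H.leaf u hlt k hk).1 h2).symm))

/-- The first vertex below `u` above the same leaves of the subtanglegram is reduced. -/
theorem red_of_first {w : ℕ} (hu : 1 < G.count s u) (hw : w < 2 * G.n - 1) (hwu : G.Le s w u)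
    (hc : G.count s w = G.count s u)
    (hmin : ∀ w' < w, ¬ (G.Le s w' u ∧ G.count s w' = G.count s u)) : G.Red s w := by
  have hwn : G.n ≤ w := not_leaf_of_one_lt_count (hc ▸ hu)
  have H := G.hier s
  have hnode := H.node w hwn hw
  refine ⟨hwn, hw, ?_, ?_⟩
  · by_contra! hno
    apply hmin _ (H.kid1_lt w hwn hw)
    refine ⟨fun j hj => hwu j ((hnode j).2 (Or.inr hj)), ?_⟩
    rw [← hc]
    refine count_eq fun j hj => ⟨fun h => (hnode j).2 (Or.inr h), fun h => ?_⟩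
    exact ((hnode j).1 h).resolve_left (hno j hj)
  · by_contra! hno
    apply hmin _ (H.kid0_lt w hwn hw)
    refine ⟨fun j hj => hwu j ((hnode j).2 (Or.inl hj)), ?_⟩
    rw [← hc]
    refine count_eq fun j hj => ⟨fun h => (hnode j).2 (Or.inl h), fun h => ?_⟩
    exact ((hnode j).1 h).resolve_right (hno j hj)

theorem Red.one_lt_count (h : G.Red s u) : 1 < G.count s u := by
  rw [one_lt_count_iff]
  obtain ⟨j, hj, hj'⟩ := h.kid0
  obtain ⟨k, hk, hk'⟩ := h.kid1
  have H := G.hier s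
  refine ⟨j, k, ?_, hj, hk, (H.node u h.ge h.lt j).2 (Or.inl hj'),
    (H.node u h.ge h.lt k).2 (Or.inr hk')⟩
  rintro rfl
  exact H.disj u h.ge h.lt j hj' hk'

theorem Red.eq_of_iff (h : G.Red s u) (h' : G.Red s v)
    (he : ∀ j, j ≠ G.i → (G.c s u j ↔ G.c s v j)) : u = v := by
  apply (G.hier s).inj u h.lt v h'.lt
  intro j
  exact ⟨h.le h'.lt (fun j hj => (he j hj).1) j, h'.le h.lt (fun j hj => (he j hj).2) j⟩

theorem Pair.eq_right {v' : ℕ} (h : G.Pair s u v) (h' : G.Pair s u v') : v = v' :=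
  h.right.eq_of_iff h'.right fun j hj => (h.matched j hj).symm.trans (h'.matched j hj)

theorem exec_reduced {s : Side} {x : Name} (hx : x = .vert ∨ x = .nbr) {m : Cell → ℕ}
    (hB : G.Base m) {a : ℕ} (ha : m (.a, 0, 0) = a) (hu : m (.listL s, a, 0) = u)
    (huV : u < 2 * G.n - 1) (hc : 1 < G.count s u) :
    G.Red s ((reduced s (at1 (.listL s) Name.a) x).exec m (x, 0, 0)) ∧
      ∀ j, j ≠ G.i → (G.c s ((reduced s (at1 (.listL s) Name.a) x).exec m (x, 0, 0)) j ↔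
        G.c s u j) := by
  set prog := for' .b Name.verts [
      when (all [.eq Name.found 0, below s (at1 (.listL s) Name.a) Name.b,
          .eq (at1 (.cnt s) Name.b) (at1 (.cnt s) (at1 (.listL s) Name.a))])
        [put .found 1, put x Name.b]] with hprog
  have e1 : (reduced s (at1 (.listL s) Name.a) x).exec m = prog.exec ((put .found 0).exec m) := by
    simp only [reduced, exec_cons, exec_nil, hprog]
  rw [e1]
  have hf : (put .found 0).exec m (.found, 0, 0) = 0 := by simp
  have hF := (put .found 0).frame_exec m
  generalize (put .found 0).exec m = m₁ at *
  have hB1 := hB.frame hF (by decide)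
  have ha1 := (hF .a (by decide) 0 0).trans ha
  have hu1 := (hF (.listL s) (by cases s <;> decide) a 0).trans hu
  have key := for_ind (x := .b) (e := Name.verts) (l := [
      when (all [.eq Name.found 0, below s (at1 (.listL s) Name.a) Name.b,
          .eq (at1 (.cnt s) Name.b) (at1 (.cnt s) (at1 (.listL s) Name.a))])
        [put .found 1, put x Name.b]]) (m := m₁) (N := 2 * G.n - 1) (by simpa using hB1.verts)
    (fun b m' => (m' (.found, 0, 0) = 0 ∧ ∀ w < b, ¬ (G.Le s w u ∧ G.count s w = G.count s u)) ∨
      (m' (.found, 0, 0) = 1 ∧ m' (x, 0, 0) < 2 * G.n - 1 ∧ G.Le s (m' (x, 0, 0)) u ∧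
        G.count s (m' (x, 0, 0)) = G.count s u ∧
        ∀ w < m' (x, 0, 0), ¬ (G.Le s w u ∧ G.count s w = G.count s u)))
    (Or.inl ⟨hf, by simp⟩) (fun k m' v h => by
      rcases hx with rfl | rfl <;>
      simpa only [update_cell, reduceCtorEq, false_and, if_false] using h) ?_
  · rw [← hprog] at key
    rcases key with ⟨-, h2⟩ | ⟨-, h2, h3, h4, h5⟩
    · exact absurd ⟨fun _ h => h, rfl⟩ (h2 u huV)
    · exact ⟨red_of_first hc h2 h3 h4 h5, fun j hj => iff_of_count_eq h3 h4 hj⟩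
  intro b hb m' hF' hb' hI
  rw [exec_cons, exec_nil]
  have hB' := hB1.frame hF' (by rcases hx with rfl | rfl <;> cases s <;> decide)
  have ha' := (hF' .a (by rcases hx with rfl | rfl <;> cases s <;> decide) 0 0).trans ha1
  have hu' := (hF' (.listL s) (by rcases hx with rfl | rfl <;> cases s <;> decide) a 0).trans hu1
  have hd := hB'.desc s u huV b hb
  have hcb := hB'.cnt s b hb
  have hcu := hB'.cnt s u huV
  by_cases hcond : m' (.found, 0, 0) = 0 ∧ G.Le s b u ∧ G.count s b = G.count s u
  · rw [exec_when_pos (by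
      simp [all, below, hb', ha', hu', hd.2 hcond.2.1, hcb, hcu, hcond.1, hcond.2.2])]
    right
    have hI' := (hI.resolve_right fun h => absurd (h.1.symm.trans hcond.1) (by decide)).2
    have hxf : x ≠ .found := by rcases hx with rfl | rfl <;> decide
    simp only [exec_cons, exec_nil, put, exec_set, Expr.val, reg, val_zero, val_one, update_cell,
      reduceCtorEq, false_and, if_false, and_self, if_true, hb', hxf.symm]
    exact ⟨trivial, hb, hcond.2.1, hcond.2.2, hI'⟩
  · rw [exec_when_neg]
    · rcases hI with ⟨h1, h2⟩ | h
      · left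
        refine ⟨h1, fun w hw h3 => ?_⟩
        rcases Nat.lt_succ_iff_lt_or_eq.1 hw with h4 | rfl
        · exact h2 w h4 h3
        · exact hcond ⟨h1, h3⟩
      · exact Or.inr h
    · intro hval
      simp [all, below, hb', ha', hu', hcb, hcu] at hval
      exact hcond ⟨of_decide_eq_true hval.1, hd.1 hval.2.1, hval.2.2⟩

/-- Enter a pair into `L(I)`. -/
def enterPair : List Prog := [
      reduced .T (at1 (.listL .T) Name.a) .vert,
      reduced .S (at1 (.listL .S) Name.a) .nbr,
      put1 (.inL .T) Name.vert 1, put1 (.mate .T) Name.vert Name.nbr,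
      put1 (.inL .S) Name.nbr 1, put1 (.mate .S) Name.nbr Name.vert]

theorem exec_enterPair {m : Cell → ℕ} (hB : G.Base m) {a : ℕ} (ha : m (.a, 0, 0) = a)
    (hu : m (.listL .T, a, 0) = u) (huV : u < 2 * G.n - 1) (hv : m (.listL .S, a, 0) = v)
    (hvV : v < 2 * G.n - 1) (hm : G.Matched .T u v) (hc : 1 < G.count .T u) :
    ∃ w : Side → ℕ, G.Pair .T (w .T) (w .S) ∧ (∀ j, j ≠ G.i → (G.c .T (w .T) j ↔ G.c .T u j)) ∧
      (∀ s x, (block enterPair).exec m (.inL s, x, 0) = if x = w s then 1 else m (.inL s, x, 0)) ∧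
      ∀ s x, (block enterPair).exec m (.mate s, x, 0) =
        if x = w s then w s.other else m (.mate s, x, 0) := by
  unfold enterPair
  rw [exec_cons, exec_cons]
  obtain ⟨r1, r2⟩ := exec_reduced (x := .vert) (Or.inl rfl) hB ha hu huV hc
  have hF1 := (reduced .T (at1 (.listL .T) Name.a) .vert).frame_exec m
  generalize (reduced .T (at1 (.listL .T) Name.a) .vert).exec m = m₁ at *
  obtain ⟨r3, r4⟩ := exec_reduced (x := .nbr) (Or.inr rfl) (hB.frame hF1 (by decide))
    ((hF1 _ (by decide) _ _).trans ha) ((hF1 (.listL .S) (by decide) _ _).trans hv) hvV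
    ((count_eq (s := .T) (t := .S) hm) ▸ hc)
  have hF2 := (reduced .S (at1 (.listL .S) Name.a) .nbr).frame_exec m₁
  generalize (reduced .S (at1 (.listL .S) Name.a) .nbr).exec m₁ = m₂ at *
  rw [← hF2 .vert (by decide)] at r1 r2
  have hin : ∀ s x, m₂ (.inL s, x, 0) = m (.inL s, x, 0) := fun s x =>
    (hF2 _ (by cases s <;> decide) _ _).trans (hF1 _ (by cases s <;> decide) _ _)
  have hmt : ∀ s x, m₂ (.mate s, x, 0) = m (.mate s, x, 0) := fun s x =>
    (hF2 _ (by cases s <;> decide) _ _).trans (hF1 _ (by cases s <;> decide) _ _)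
  refine ⟨fun s => match s with | .T => m₂ (.vert, 0, 0) | .S => m₂ (.nbr, 0, 0),
    ⟨r1, r3, fun j hj => (r2 j hj).trans ((hm j hj).trans (r4 j hj).symm)⟩, r2, ?_, ?_⟩
  · rintro (_ | _) x <;> simp [exec_cons, exec_nil, ← hin]
  · rintro (_ | _) x <;> simp [exec_cons, exec_nil, Side.other, ← hmt]

/-- The set `L(I)` is in the memory. -/
def HasPairs (G : Setup) (m : Cell → ℕ) : Prop :=
  ∀ s w, (m (.inL s, w, 0) = 1 → G.Pair s w (m (.mate s, w, 0))) ∧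
    ((∃ z, G.Pair s w z) → m (.inL s, w, 0) = 1)

theorem exec_constructLI {m : Cell → ℕ} (h : G.Untangled m) (h0 : ∀ s w, m (.inL s, w, 0) = 0) :
    G.HasPairs (constructLI.exec m) := by
  have key := for_ind (x := .a) (e := Name.verts) (l := [
    when (.and (.lt Name.a Name.lenL) (.lt 1 (at1 (.cnt .T) (at1 (.listL .T) Name.a)))) enterPair])
    (m := m) (N := 2 * G.n - 1) (by simpa using h.verts)
    (fun a m' => (∀ s w, m' (.inL s, w, 0) = 1 → G.Pair s w (m' (.mate s, w, 0))) ∧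
      ∀ w z, G.Pair .T w z → (∃ a' < a, a' < m (.lenL, 0, 0) ∧ ∀ j, j ≠ G.i →
        (G.c .T (m (.listL .T, a', 0)) j ↔ G.c .T w j)) →
        m' (.inL .T, w, 0) = 1 ∧ m' (.inL .S, z, 0) = 1)
    ⟨fun s w hw => by rw [h0] at hw; exact absurd hw (by decide), by simp⟩
    (fun k m' v h => by
      simpa only [update_cell, reduceCtorEq, false_and, if_false] using h) ?_
  · change (∀ s w, constructLI.exec m (.inL s, w, 0) = 1 →
      G.Pair s w (constructLI.exec m (.mate s, w, 0))) ∧ _ at key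
    have hfin : ∀ w z, G.Pair .T w z →
        constructLI.exec m (.inL .T, w, 0) = 1 ∧ constructLI.exec m (.inL .S, z, 0) = 1 := by
      intro w z hwz
      apply key.2 w z hwz
      obtain ⟨a, ha, hA⟩ := h.complete w hwz.left.lt z hwz.right.lt hwz.matched
        (one_lt_count_iff.1 hwz.left.one_lt_count)
      exact ⟨a, ha.trans_le h.lenL, ha, hA⟩
    intro s w
    refine ⟨key.1 s w, ?_⟩
    rintro ⟨z, hz⟩
    cases s
    · exact (hfin w z hz).1
    · exact (hfin z w hz.symm).2
  intro a ha m' hF hka ⟨i1, i2⟩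
  rw [exec_cons, exec_nil]
  have hB' := h.toBase.frame hF (by decide)
  have hlen' := hF .lenL (by decide) 0 0
  have hlist : ∀ t, m' (.listL t, a, 0) = m (.listL t, a, 0) :=
    fun t => hF _ (by cases t <;> decide) _ _
  by_cases hc : a < m (.lenL, 0, 0) ∧ 1 < G.count .T (m (.listL .T, a, 0))
  · obtain ⟨v1, v2, v3⟩ := h.valid a hc.1
    have hcnt := hB'.cnt .T _ v1
    rw [exec_when_pos (by simp [hka, hlen', hlist, hcnt, hc])]
    obtain ⟨w, p1, p2, p3, p4⟩ := exec_enterPair hB' hka (hlist .T) v1 (hlist .S) v2 v3 hc.2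
    refine ⟨fun s x hx => ?_, fun x z hxz hex => ?_⟩
    · rw [p3] at hx
      rw [p4]
      split_ifs at hx ⊢ with hxw
      · subst hxw
        cases s
        · exact p1
        · exact p1.symm
      · exact i1 s x hx
    · rw [p3, p3]
      obtain ⟨a', ha', ha'', hA⟩ := hex
      rcases Nat.lt_succ_iff_lt_or_eq.1 ha' with h1 | rfl
      · obtain ⟨h2, h3⟩ := i2 x z hxz ⟨a', h1, ha'', hA⟩
        rw [h2, h3]; simp
      · have hxw : w .T = x := p1.left.eq_of_iff hxz.left
          fun j hj => (p2 j hj).trans (hA j hj)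
        have hzw : w .S = z := p1.eq_right (hxw ▸ hxz)
        simp [hxw, hzw]
  · rw [exec_when_neg]
    · refine ⟨i1, fun x z hxz ⟨a', ha', ha'', hA⟩ => ?_⟩
      rcases Nat.lt_succ_iff_lt_or_eq.1 ha' with h1 | rfl
      · exact i2 x z hxz ⟨a', h1, ha'', hA⟩
      · exfalso
        refine hc ⟨ha'', ?_⟩
        rw [count_eq (t := .T) (v := x) hA]
        exact hxz.left.one_lt_count
    · intro hval
      simp only [Cond.val, Expr.val, reg, at1, val_zero, val_one, hka, hlen', hlist,
        Bool.and_eq_true, decide_eq_true_eq] at hval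
      obtain ⟨h1, h2⟩ := hval
      rw [hB'.cnt .T _ (h.valid a h1).1] at h2
      exact hc ⟨h1, h2⟩

/-! ### The parent of the inserted leaf -/

theorem parent_of_kid (hn : G.n ≤ u) (hu : u < 2 * G.n - 1)
    (h : G.k0 s u = G.e s G.i ∨ G.k1 s u = G.e s G.i) : G.Parent s u := by
  have H := G.hier s
  have key : ∀ j, G.c s (G.e s G.i) j ↔ j = G.i := by
    intro j
    constructor
    · intro hj
      have hjn := H.c_lt _ _ hj
      exact H.e_inj j hjn G.i G.i_lt ((H.leaf _ (H.e_lt _ G.i_lt) j hjn).1 hj)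
    · rintro rfl
      exact (H.leaf _ (H.e_lt _ G.i_lt) _ G.i_lt).2 rfl
  refine ⟨hn, hu, ?_⟩
  rcases h with h | h
  · left; rw [h]; exact key
  · right; rw [h]; exact key

theorem exists_parent (G : Setup) (s : Side) :
    ∃ u, G.n ≤ u ∧ u < 2 * G.n - 1 ∧ (G.k0 s u = G.e s G.i ∨ G.k1 s u = G.e s G.i) := by
  have H := G.hier s
  have key : ∀ u, G.n ≤ u → u < 2 * G.n - 1 → G.c s u G.i →
      ∃ u, G.n ≤ u ∧ u < 2 * G.n - 1 ∧ (G.k0 s u = G.e s G.i ∨ G.k1 s u = G.e s G.i) := by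
    intro u
    induction u using Nat.strong_induction_on with
    | _ u ih =>
      intro hn hu hi
      have h0 := H.kid0_lt u hn hu
      have h1 := H.kid1_lt u hn hu
      rcases (H.node u hn hu _).1 hi with h | h
      · rcases lt_or_ge (G.k0 s u) G.n with h2 | h2
        · exact ⟨u, hn, hu, Or.inl ((H.leaf _ h2 _ G.i_lt).1 h).symm⟩
        · exact ih _ h0 h2 (h0.trans hu) h
      · rcases lt_or_ge (G.k1 s u) G.n with h2 | h2
        · exact ⟨u, hn, hu, Or.inr ((H.leaf _ h2 _ G.i_lt).1 h).symm⟩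
        · exact ih _ h1 h2 (h1.trans hu) h
  have := G.two_le
  exact key (2 * G.n - 2) (by omega) (by omega) (H.root _ G.i_lt)

theorem exec_findParent {m : Cell → ℕ} (hB : G.Base m) (s : Side) :
    G.Parent s ((findParent s).exec m (.own s, 0, 0)) := by
  have key := for_ind (x := .a) (e := Name.verts) (l := [
    when (.and (internal Name.a) (.or
        (.eq (.get (.kid s) Name.a 0) (Name.ins s)) (.eq (.get (.kid s) Name.a 1) (Name.ins s))))
      [put1 (.own s) 0 Name.a]]) (m := m) (N := 2 * G.n - 1) (by simpa using hB.verts)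
    (fun a m' => (∃ u < a, G.n ≤ u ∧ (G.k0 s u = G.e s G.i ∨ G.k1 s u = G.e s G.i)) →
      G.Parent s (m' (.own s, 0, 0))) (by simp)
    (fun k m' v h => by
      simpa only [update_cell, reduceCtorEq, false_and, if_false] using h) ?_
  · obtain ⟨u, h1, h2, h3⟩ := exists_parent G s
    exact key ⟨u, h2, h1, h3⟩
  intro a ha m' hF hka hI ⟨u, hua, hun, hu⟩
  rw [exec_cons, exec_nil]
  have hB' := hB.frame hF (by cases s <;> decide)
  have hins := hB'.ins s
  have hsize := hB'.size
  by_cases hc : G.n ≤ a ∧ (G.k0 s a = G.e s G.i ∨ G.k1 s a = G.e s G.i)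
  · have h0 := hB'.kid0 s a hc.1 ha
    have h1 := hB'.kid1 s a hc.1 ha
    rw [exec_when_pos (by simpa [internal, hka, hins, hsize, h0, h1] using hc)]
    simpa [hka] using parent_of_kid hc.1 ha hc.2
  · rw [exec_when_neg]
    · rcases Nat.lt_succ_iff_lt_or_eq.1 hua with h | rfl
      · exact hI ⟨u, h, hun, hu⟩
      · exact absurd ⟨hun, hu⟩ hc
    · intro hval
      simp [internal, hka, hins, hsize] at hval
      rw [hB'.kid0 s a hval.1 ha, hB'.kid1 s a hval.1 ha] at hval
      exact hc hval

/-! ### The chains -/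

theorem Own.ge (h : G.Own s u) : G.n ≤ u := by
  obtain ⟨v, h, -⟩ := h; exact h.left.ge

theorem Own.inserted (h : G.Own s u) : G.c s u G.i := by
  obtain ⟨v, -, h, -⟩ := h; exact h

theorem Own.le_of_le {u' : ℕ} (h : G.Own s u) (h' : G.Own s u') (hle : u ≤ u') : G.Le s u u' := by
  have H := G.hier s
  rcases H.laminar u h.lt u' h'.lt with h1 | h1 | h1
  · exact h1
  · have := H.mono u' h'.lt u h.lt h1
    have : u = u' := by omega
    subst this
    exact fun _ h => h
  · exact absurd h'.inserted (h1 _ h.inserted)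

/-- The first `q` entries of the chain are in the memory. -/
structure ChainUpTo (G : Setup) (s : Side) (m : Cell → ℕ) (a : ℕ) : Prop where
  own : ∀ k, 1 ≤ k → k ≤ m (.num s, 0, 0) → G.Own s (m (.own s, k, 0)) ∧ m (.own s, k, 0) < a
  mat : ∀ k, 1 ≤ k → k ≤ m (.num s, 0, 0) → G.Pair s (m (.own s, k, 0)) (m (.mat s, k, 0))
  mono : ∀ k l, 1 ≤ k → k < l → l ≤ m (.num s, 0, 0) → m (.own s, k, 0) < m (.own s, l, 0)
  complete : ∀ u < a, G.Own s u → ∃ k, 1 ≤ k ∧ k ≤ m (.num s, 0, 0) ∧ m (.own s, k, 0) = u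

theorem exec_chain {m : Cell → ℕ} (hB : G.Base m) (hP : G.HasPairs m) (s : Side) :
    G.ChainUpTo s ((chain s).exec m) (2 * G.n - 1) ∧
      (chain s).exec m (.own s, 0, 0) = m (.own s, 0, 0) := by
  unfold chain
  rw [exec_cons, exec_cons, exec_nil]
  have h0 : (put (.num s) 0).exec m (.num s, 0, 0) = 0 := by simp
  have hF0 := (put (.num s) 0).frame_exec m
  generalize (put (.num s) 0).exec m = m₀ at *
  rw [← hF0 (.own s) (by cases s <;> decide) 0 0]
  have hB0 := hB.frame hF0 (by cases s <;> decide)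
  have hP0 : G.HasPairs m₀ := by
    intro t w
    rw [hF0 (.inL t) (by cases s <;> cases t <;> decide),
      hF0 (.mate t) (by cases s <;> cases t <;> decide)]
    exact hP t w
  refine for_ind (x := .a) (e := Name.verts) (l := [
      when (all [.eq (at1 (.inL s) Name.a) 1, above s Name.a (Name.ins s),
          .not (above s.other (at1 (.mate s) Name.a) (Name.ins s.other))]) [
        incr (.num s),
        put1 (.own s) (Name.num s) Name.a,
        put1 (.mat s) (Name.num s) (at1 (.mate s) Name.a)]]) (m := m₀) (N := 2 * G.n - 1)
    (by simpa using hB0.verts)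
    (fun a m' => G.ChainUpTo s m' a ∧ m' (.own s, 0, 0) = m₀ (.own s, 0, 0))
    ⟨⟨fun k h1 h2 => by omega, fun k h1 h2 => by omega, fun k l h1 h2 h3 => by omega,
      fun u hu => by omega⟩, rfl⟩
    (fun k m' v ⟨⟨a1, a2, a3, a4⟩, a5⟩ => by
      refine ⟨⟨?_, ?_, ?_, ?_⟩, ?_⟩ <;>
      simpa only [update_cell, reduceCtorEq, false_and, if_false]) ?_
  intro a ha m' hF hka ⟨hI, hI0⟩
  rw [exec_cons, exec_nil]
  have hB' := hB0.frame hF (by cases s <;> decide)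
  have hin := hF (.inL s) (by cases s <;> decide) a 0
  have hmate := hF (.mate s) (by cases s <;> decide) a 0
  have hins := hB'.ins s
  have hins' := hB'.ins s.other
  have hei : ∀ t, G.e t G.i < 2 * G.n - 1 := fun t => by
    have := (G.hier t).e_lt _ G.i_lt; have := G.two_le; omega
  have hcond : (all [.eq (at1 (.inL s) Name.a) 1, above s Name.a (Name.ins s),
      .not (above s.other (at1 (.mate s) Name.a) (Name.ins s.other))]).val m' = true ↔
      G.Own s a := by
    have hval : (all [.eq (at1 (.inL s) Name.a) 1, above s Name.a (Name.ins s),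
      .not (above s.other (at1 (.mate s) Name.a) (Name.ins s.other))]).val m' = true ↔
      m₀ (.inL s, a, 0) = 1 ∧ (m' (.desc s, a, G.e s G.i) = 1 ∧ a ≠ G.e s G.i) ∧
        ¬ (m' (.desc s.other, m₀ (.mate s, a, 0), G.e s.other G.i) = 1 ∧
          m₀ (.mate s, a, 0) ≠ G.e s.other G.i) := by
      simp [all, above, below, hka, hins, hins', hin, hmate]
      exact fun _ _ _ => imp_iff_not_or.symm
    rw [hval]
    have hdesc : ∀ t x, x < 2 * G.n - 1 → (m' (.desc t, x, G.e t G.i) = 1 ↔ G.c t x G.i) :=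
      fun t x hx => (hB'.desc t x hx _ (hei t)).trans (le_end G.i_lt x)
    constructor
    · rintro ⟨h1, ⟨h2, -⟩, h3⟩
      have hp := (hP0 s a).1 h1
      refine ⟨_, hp, (hdesc s a ha).1 h2, fun h4 => h3 ⟨(hdesc _ _ hp.right.lt).2 h4, ?_⟩⟩
      have := hp.right.ge
      have := (G.hier s.other).e_lt _ G.i_lt
      omega
    · rintro ⟨v, hp, h1, h2⟩
      have hin' := (hP0 s a).2 ⟨v, hp⟩
      have hv : m₀ (.mate s, a, 0) = v := ((hP0 s a).1 hin').eq_right hp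
      rw [hv]
      refine ⟨hin', ⟨(hdesc s a ha).2 h1, ?_⟩, fun h3 => h2 ((hdesc _ _ hp.right.lt).1 h3.1)⟩
      have := hp.left.ge
      have := (G.hier s).e_lt _ G.i_lt
      omega
  by_cases hc : G.Own s a
  · rw [exec_when_pos (hcond.2 hc)]
    have hmat : G.Pair s a (m₀ (.mate s, a, 0)) := by
      obtain ⟨v, hp, -⟩ := hc
      exact (hP0 s a).1 ((hP0 s a).2 ⟨v, hp⟩)
    simp only [exec_cons, exec_nil, incr, put, put1, at1, exec_set, Expr.val, reg, val_zero]
    constructor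
    · constructor
      · intro k h1 h2
        simp only [update_cell, reduceCtorEq, false_and, if_false, true_and, and_true, if_true,
          and_self, hka] at h2 ⊢
        split_ifs with h3
        · exact ⟨hc, by omega⟩
        · obtain ⟨h4, h5⟩ := hI.own k h1 (by omega)
          exact ⟨h4, by omega⟩
      · intro k h1 h2
        simp only [update_cell, reduceCtorEq, false_and, if_false, true_and, and_true, if_true,
          and_self, hka, hmate] at h2 ⊢
        split_ifs with h3
        · exact hmat
        · exact hI.mat k h1 (by omega)
      · intro k l h1 h2 h3
        simp only [update_cell, reduceCtorEq, false_and, if_false, true_and, and_true, if_true,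
          and_self, hka] at h3 ⊢
        have hk : k ≠ m' (.num s, 0, 0) + 1 := by omega
        rw [if_neg hk]
        split_ifs with h4
        · exact (hI.own k h1 (by omega)).2
        · exact hI.mono k l h1 h2 (by omega)
      · intro u hu hou
        simp only [update_cell, reduceCtorEq, false_and, if_false, true_and, and_true, if_true,
          and_self, hka]
        rcases Nat.lt_succ_iff_lt_or_eq.1 hu with h1 | rfl
        · obtain ⟨k, h2, h3, h4⟩ := hI.complete u h1 hou
          refine ⟨k, h2, by omega, ?_⟩
          rw [if_neg (by omega)]; exact h4
        · exact ⟨_, by omega, le_rfl, if_pos rfl⟩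
    · simpa using hI0
  · rw [exec_when_neg (hcond.not.2 hc)]
    refine ⟨⟨fun k h1 h2 => ?_, hI.mat, hI.mono, fun u hu hou => ?_⟩, hI0⟩
    · obtain ⟨h4, h5⟩ := hI.own k h1 h2
      exact ⟨h4, by omega⟩
    · rcases Nat.lt_succ_iff_lt_or_eq.1 hu with h1 | rfl
      · exact hI.complete u h1 hou
      · exact absurd hou hc

/-- The parents of the inserted leaves and the chains are in the memory. -/
structure Prepared (G : Setup) (m : Cell → ℕ) : Prop extends G.Base m where
  chain : ∀ s, G.Chain s (fun k => m (.own s, k, 0)) (m (.num s, 0, 0))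
  mat : ∀ s k, 1 ≤ k → k ≤ m (.num s, 0, 0) → G.Pair s (m (.own s, k, 0)) (m (.mat s, k, 0))
  num_lt : ∀ s, m (.num s, 0, 0) < G.n

theorem ChainUpTo.chain {m : Cell → ℕ} (h : G.ChainUpTo s m (2 * G.n - 1))
    (hp : G.Parent s (m (.own s, 0, 0))) :
    G.Chain s (fun k => m (.own s, k, 0)) (m (.num s, 0, 0)) := by
  refine ⟨hp, fun k h1 h2 => (h.own k h1 h2).1, fun u hu => h.complete u hu.lt hu, ?_⟩
  intro k l hkl hl
  rcases Nat.eq_zero_or_pos k with rfl | hk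
  · rcases Nat.eq_zero_or_pos l with rfl | hl'
    · exact fun _ h => h
    · obtain ⟨v, h1, h2, -⟩ := (h.own l hl' hl).1
      exact hp.le_red h1.left h2
  · rcases hkl.lt_or_eq with h1 | rfl
    · exact (h.own k hk (by omega)).1.le_of_le (h.own l (by omega) hl).1 (h.mono k l hk h1 hl).le
    · exact fun _ h => h

theorem ChainUpTo.num_lt {m : Cell → ℕ} (h : G.ChainUpTo s m (2 * G.n - 1)) :
    m (.num s, 0, 0) < G.n := by
  have key : ∀ k, k + 1 ≤ m (.num s, 0, 0) → G.n + k ≤ m (.own s, k + 1, 0) := by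
    intro k
    induction k with
    | zero => intro hk; exact (h.own 1 le_rfl hk).1.ge
    | succ k ih =>
      intro hk
      have h1 := ih (by omega)
      have h2 := h.mono (k + 1) (k + 1 + 1) (by omega) (by omega) hk
      omega
  have h2n := G.two_le
  by_contra! hge
  have h1 := key (m (.num s, 0, 0) - 1) (by omega)
  have h2 := (h.own (m (.num s, 0, 0)) (by omega) le_rfl).2
  have h3 : m (.num s, 0, 0) - 1 + 1 = m (.num s, 0, 0) := by omega
  rw [h3] at h1
  omega

theorem ChainUpTo.frame {m m' : Cell → ℕ} {a : ℕ} (h : G.ChainUpTo s m a) {p : Prog}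
    (hF : p.Frame m m') (h1 : p.keeps (.own s) = true) (h2 : p.keeps (.mat s) = true)
    (h3 : p.keeps (.num s) = true) : G.ChainUpTo s m' a := by
  obtain ⟨a1, a2, a3, a4⟩ := h
  refine ⟨?_, ?_, ?_, ?_⟩ <;> simpa only [hF _ h1, hF _ h2, hF _ h3]

/-- The order of the edges on the side `s` in the layout in the memory. -/
def order (G : Setup) (m : Cell → ℕ) (s : Side) : ℕ → ℕ → Prop :=
  arrayOrder G.n (G.e s) fun k => m (.lay s, k, 0)

/-- A layout that is planar on the subtanglegram is in the memory. -/
structure Layout (G : Setup) (m : Cell → ℕ) : Prop where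
  perm : ∀ s, IsPermArray G.n fun k => m (.lay s, k, 0)
  planar : G.Planar (G.order m)

theorem order_congr {m m' : Cell → ℕ} (h : ∀ s k, m' (.lay s, k, 0) = m (.lay s, k, 0)) :
    G.order m' = G.order m := by
  unfold order
  simp only [h]

theorem order_frame {m m' : Cell → ℕ} {p : Prog} (hF : p.Frame m m')
    (h : ∀ s, p.keeps (.lay s) = true) : G.order m' = G.order m :=
  order_congr fun s _ => hF _ (h s) _ _

theorem Layout.frame {m m' : Cell → ℕ} (h : G.Layout m) {p : Prog} (hF : p.Frame m m')
    (hp : ∀ s, p.keeps (.lay s) = true) : G.Layout m' := by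
  refine ⟨fun s => ?_, ?_⟩
  · have : (fun k => m' (.lay s, k, 0)) = fun k => m (.lay s, k, 0) :=
      funext fun k => hF _ (hp s) _ _
    rw [this]; exact h.perm s
  · rw [order_frame hF hp]; exact h.planar

theorem exec_prepare {m : Cell → ℕ} (h : G.Start m) {b : Side → ℕ → ℕ → Prop}
    (hb : G.Planar b) :
    G.Prepared ((block [modifiedUntangle, constructLI, findParent .T, findParent .S, chain .S,
      chain .T]).exec m) ∧
    G.Layout ((block [modifiedUntangle, constructLI, findParent .T, findParent .S, chain .S,
      chain .T]).exec m) := by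
  simp only [exec_cons, exec_nil]
  have u1 := exec_modifiedUntangle h hb
  have z1 : ∀ s w, modifiedUntangle.exec m (.inL s, w, 0) = 0 := by
    intro s w
    rw [modifiedUntangle.frame_exec m _ (by cases s <;> decide)]
    exact h.zero _ (by cases s <;> decide) _ _
  generalize modifiedUntangle.exec m = m₁ at *
  have l1 : G.Layout m₁ := ⟨u1.perm, u1.planar⟩
  have p2 := exec_constructLI u1 z1
  have hF2 := constructLI.frame_exec m₁
  generalize constructLI.exec m₁ = m₂ at *
  have B2 := u1.toBase.frame hF2 (by decide)
  have l2 := l1.frame hF2 (by decide)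
  have q3 := exec_findParent B2 .T
  have hF3 := (findParent .T).frame_exec m₂
  generalize (findParent .T).exec m₂ = m₃ at *
  have B3 := B2.frame hF3 (by decide)
  have l3 := l2.frame hF3 (by decide)
  have q4 := exec_findParent B3 .S
  have hF4 := (findParent .S).frame_exec m₃
  generalize (findParent .S).exec m₃ = m₄ at *
  have B4 := B3.frame hF4 (by decide)
  have l4 := l3.frame hF4 (by decide)
  rw [← hF4 _ (by decide)] at q3
  have p4 : G.HasPairs m₄ := by
    intro t w
    rw [hF4 (.inL t) (by cases t <;> decide), hF4 (.mate t) (by cases t <;> decide),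
      hF3 (.inL t) (by cases t <;> decide), hF3 (.mate t) (by cases t <;> decide)]
    exact p2 t w
  obtain ⟨c5, e5⟩ := exec_chain B4 p4 .S
  have hF5 := (Tangle.chain .S).frame_exec m₄
  generalize (Tangle.chain .S).exec m₄ = m₅ at *
  have B5 := B4.frame hF5 (by decide)
  have l5 := l4.frame hF5 (by decide)
  have p5 : G.HasPairs m₅ := by
    intro t w
    rw [hF5 (.inL t) (by cases t <;> decide), hF5 (.mate t) (by cases t <;> decide)]
    exact p4 t w
  rw [← e5] at q4
  rw [← hF5 _ (by decide)] at q3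
  obtain ⟨c6, e6⟩ := exec_chain B5 p5 .T
  have hF6 := (Tangle.chain .T).frame_exec m₅
  generalize (Tangle.chain .T).exec m₅ = m₆ at *
  rw [← e6] at q3
  rw [← hF6 _ (by decide)] at q4
  have c5' := c5.frame hF6 (by decide) (by decide) (by decide)
  refine ⟨⟨B5.frame hF6 (by decide), ?_, ?_, ?_⟩, l5.frame hF6 (by decide)⟩
  · rintro (_ | _)
    · exact c6.chain q3
    · exact c5'.chain q4
  · rintro (_ | _)
    · exact c6.mat
    · exact c5'.mat
  · rintro (_ | _)
    · exact c6.num_lt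
    · exact c5'.num_lt

end Setup

end Tangle

namespace Tangle

namespace Setup

open Hier

variable {G : Setup} {s : Side} {u v : ℕ}

/-! ### Flips -/

/-- Some planar drawings of the two trees are in the memory. -/
structure Drawn (G : Setup) (m : Cell → ℕ) : Prop where
  perm : ∀ s, IsPermArray G.n fun k => m (.lay s, k, 0)
  order : ∀ s, IsOrder G.n (G.k0 s) (G.k1 s) (G.c s) (G.order m s)

theorem Layout.drawn {m : Cell → ℕ} (h : G.Layout m) : G.Drawn m := ⟨h.perm, h.planar.order⟩

theorem arrayOrder_iff {a : ℕ → ℕ} (ha : IsPermArray G.n a) {j k p q : ℕ} (hj : j < G.n)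
    (hk : k < G.n) (hp : p < G.n) (hq : q < G.n) (hpj : a p = G.e s j) (hqk : a q = G.e s k) :
    arrayOrder G.n (G.e s) a j k ↔ p < q := by
  constructor
  · rintro ⟨-, -, p', q', h1, h2, h3, h4⟩
    have e1 := ha.inj p' (h1.trans h2) p hp (h3.trans hpj.symm)
    have e2 := ha.inj q' h2 q hq (h4.trans hqk.symm)
    omega
  · exact fun h => ⟨hj, hk, p, q, h, hq, hpj, hqk⟩

theorem exists_pos {a : ℕ → ℕ} (ha : IsPermArray G.n a) {j : ℕ} (hj : j < G.n) (s : Side) :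
    ∃ p < G.n, a p = G.e s j :=
  ha.surj ((G.hier s).e_lt j hj)

/-- The leaves below a vertex are consecutive in each planar drawing. -/
theorem exists_interval {a : ℕ → ℕ} (ha : IsPermArray G.n a)
    (ho : IsOrder G.n (G.k0 s) (G.k1 s) (G.c s) (arrayOrder G.n (G.e s) a))
    (hu : u < 2 * G.n - 1) :
    ∃ p q, p < q ∧ q ≤ G.n ∧ ∀ k < G.n, G.Le s (a k) u ↔ p ≤ k ∧ k < q := by
  classical
  have H := G.hier s
  have hex : ∃ k, k < G.n ∧ G.Le s (a k) u := by
    obtain ⟨j, hj⟩ := H.nonempty u hu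
    have hjn := H.c_lt _ _ hj
    obtain ⟨p, hp, hpj⟩ := exists_pos ha hjn s
    exact ⟨p, hp, by rw [hpj]; exact (le_end hjn u).2 hj⟩
  set K := (Finset.range G.n).filter fun k => G.Le s (a k) u with hK
  have hKm : ∀ k, k ∈ K ↔ k < G.n ∧ G.Le s (a k) u := by intro k; simp [hK]
  have hne : K.Nonempty := by
    obtain ⟨k, hk⟩ := hex
    exact ⟨k, (hKm k).2 hk⟩
  have hmin := (hKm _).1 (K.min'_mem hne)
  have hmax := (hKm _).1 (K.max'_mem hne)
  have hle := K.min'_le _ (K.max'_mem hne)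
  refine ⟨K.min' hne, K.max' hne + 1, by omega, by omega, fun k hk => ⟨fun h => ?_, ?_⟩⟩
  · have hkK := (hKm k).2 ⟨hk, h⟩
    exact ⟨K.min'_le k hkK, Nat.lt_succ_of_le (K.le_max' k hkK)⟩
  · rintro ⟨h1, h2⟩
    by_contra hno
    set p := K.min' hne
    set q := K.max' hne
    obtain ⟨j, hj, hje⟩ := H.e_surj _ (ha.lt p hmin.1)
    obtain ⟨l, hl, hle'⟩ := H.e_surj _ (ha.lt q hmax.1)
    obtain ⟨x, hx, hxe⟩ := H.e_surj _ (ha.lt k hk)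
    rw [← hje, le_end hj] at hmin
    rw [← hle', le_end hl] at hmax
    rw [← hxe, le_end hx] at hno
    have hpk : p ≠ k := by
      rintro h3
      rw [← h3, ← hje] at hxe
      exact hno (H.e_inj x hx j hj hxe ▸ hmin.2)
    have hqk : q ≠ k := by
      rintro h3
      rw [← h3, ← hle'] at hxe
      exact hno (H.e_inj x hx l hl hxe ▸ hmax.2)
    have hc := (ho.contig H hu hmin.2 hmax.2 hx hno).1
    rw [arrayOrder_iff ha hj hx hmin.1 hk hje.symm hxe.symm,
      arrayOrder_iff ha hl hx hmax.1 hk hle'.symm hxe.symm] at hc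
    omega

/-- The array after a flip of the interval from `p` to `q - 1`. -/
def flipArray (p q : ℕ) (a : ℕ → ℕ) (k : ℕ) : ℕ := if p ≤ k ∧ k < q then a (p + q - 1 - k) else a k

theorem flipArray_spec {a a' : ℕ → ℕ} (ha : IsPermArray G.n a) {p q : ℕ} (hqn : q ≤ G.n)
    (hS : ∀ k < G.n, G.Le s (a k) u ↔ p ≤ k ∧ k < q)
    (ha' : ∀ k < G.n, a' k = flipArray p q a k) :
    IsPermArray G.n a' ∧
      arrayOrder G.n (G.e s) a' = flipOrder (G.c s) u (arrayOrder G.n (G.e s) a) := by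
  have H := G.hier s
  have hperm : IsPermArray G.n a' := by
    refine ⟨fun k hk => ?_, fun j hj k hk h => ?_⟩
    · rw [ha' k hk]
      unfold flipArray
      split_ifs
      · exact ha.lt _ (by omega)
      · exact ha.lt k hk
    · rw [ha' j hj, ha' k hk] at h
      unfold flipArray at h
      split_ifs at h <;> have := ha.inj _ (by omega) _ (by omega) h <;> omega
  refine ⟨hperm, ?_⟩
  have hpos : ∀ j < G.n, ∃ r < G.n, a r = G.e s j ∧ (G.c s u j ↔ p ≤ r ∧ r < q) ∧
      ∃ r' < G.n, a' r' = G.e s j ∧ r' = if p ≤ r ∧ r < q then p + q - 1 - r else r := by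
    intro j hj
    obtain ⟨r, hr, hrj⟩ := exists_pos ha hj s
    refine ⟨r, hr, hrj, ?_, if p ≤ r ∧ r < q then p + q - 1 - r else r, ?_, ?_, rfl⟩
    · rw [← hS r hr, hrj, le_end hj]
    · split_ifs <;> omega
    · rw [ha' _ (by split_ifs <;> omega)]
      unfold flipArray
      split_ifs with h1 h2
      · rw [← hrj]; congr 1; omega
      · exact absurd (by omega) h2
      · exact hrj
  funext j k
  apply propext
  by_cases hjk : j < G.n ∧ k < G.n
  · obtain ⟨r, hr, hrj, hrc, r', hr', hrj', er⟩ := hpos j hjk.1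
    obtain ⟨t, ht, htk, htc, t', ht', htk', et⟩ := hpos k hjk.2
    unfold flipOrder
    rw [arrayOrder_iff hperm hjk.1 hjk.2 hr' ht' hrj' htk', arrayOrder_iff ha hjk.1 hjk.2 hr ht hrj htk,
      arrayOrder_iff ha hjk.2 hjk.1 ht hr htk hrj, hrc, htc]
    split_ifs at er et <;> omega
  · constructor
    · exact fun h => absurd ⟨h.1, h.2.1⟩ hjk
    · rintro (⟨-, -, h⟩ | ⟨-, h⟩)
      · exact absurd ⟨h.2.1, h.1⟩ hjk
      · exact absurd ⟨h.1, h.2.1⟩ hjk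

/-- The value of the expression does not depend on the registers that are used by a flip. -/
def Stable (s : Side) (e : Expr) (m : Cell → ℕ) (u : ℕ) : Prop :=
  ∀ m' : Cell → ℕ, (∀ y, y ≠ .d → y ≠ .b → y ≠ .tmp → y ≠ .lay s → ∀ a b,
    m' (y, a, b) = m (y, a, b)) → e.val m' = u

/-- Collect the leaves below a vertex. -/
def flipCollect (s : Side) (u : Expr) : Prog :=
  for' .b Name.size [
      when (below s u (at1 (.lay s) Name.b)) [put1 .tmp Name.d (at1 (.lay s) Name.b), incr .d]]

/-- Write the collected leaves in the reverse order. -/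
def flipWrite (s : Side) (u : Expr) : Prog :=
  for' .b Name.size [
      when (below s u (at1 (.lay s) Name.b)) [decr .d, put1 (.lay s) Name.b (at1 .tmp Name.d)]]

theorem keeps_flipCollect (s : Side) (e : Expr) {y : Name} (h1 : y ≠ .d) (h2 : y ≠ .b)
    (h3 : y ≠ .tmp) : (flipCollect s e).keeps y = true := by
  simp [flipCollect, for', Prog.keeps, h1.symm, h2.symm, h3.symm]

theorem keeps_flipWrite (s : Side) (e : Expr) {y : Name} (h1 : y ≠ .d) (h2 : y ≠ .b)
    (h4 : y ≠ .lay s) : (flipWrite s e).keeps y = true := by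
  simp [flipWrite, for', Prog.keeps, h1.symm, h2.symm, h4.symm]

theorem keeps_flip (s : Side) (e : Expr) {y : Name} (h1 : y ≠ .d) (h2 : y ≠ .b)
    (h3 : y ≠ .tmp) (h4 : y ≠ .lay s) : (flip s e).keeps y = true := by
  simp [flip, for', Prog.keeps, h1.symm, h2.symm, h3.symm, h4.symm]

theorem exec_flip {s : Side} {e : Expr} {m : Cell → ℕ} (hB : G.Base m) (hD : G.Drawn m)
    (he : Stable s e m u) (hu : u < 2 * G.n - 1) :
    G.Drawn ((flip s e).exec m) ∧ G.order ((flip s e).exec m) = G.flipAt s u (G.order m) := by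
  obtain ⟨p, q, hpq, hqn, hS⟩ := exists_interval (hD.perm s) (hD.order s) hu
  have hFall := (flip s e).frame_exec m
  have key : ∀ k < G.n, (flip s e).exec m (.lay s, k, 0) =
      flipArray p q (fun k => m (.lay s, k, 0)) k := by
    have e1 : (flip s e).exec m = (flipWrite s e).exec ((flipCollect s e).exec
      ((put .d 0).exec m)) := by
      simp only [flip, flipWrite, flipCollect, exec_cons, exec_nil]
    rw [e1]
    have hd0 : (put .d 0).exec m (.d, 0, 0) = 0 := by simp
    have hF0 : ∀ y, y ≠ .d → ∀ a b, (put .d 0).exec m (y, a, b) = m (y, a, b) := by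
      intro y hy a b; simp [hy]
    generalize (put .d 0).exec m = m₀ at *
    have hlt := fun k (hk : k < G.n) => (hD.perm s).lt k hk
    have h2n := G.two_le
    have hbelow : ∀ m' : Cell → ℕ, (∀ y, y ≠ .d → y ≠ .b → y ≠ .tmp → y ≠ .lay s → ∀ a b,
        m' (y, a, b) = m (y, a, b)) → ∀ k < G.n, m' (.b, 0, 0) = k →
        m' (.lay s, k, 0) = m (.lay s, k, 0) →
        ((below s e (at1 (.lay s) Name.b)).val m' = true ↔ p ≤ k ∧ k < q) := by
      intro m' hm' k hk hkb hl
      rw [← hS k hk, ← hB.desc s u hu _ ((hlt k hk).trans (by omega))]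
      simp [below, he m' hm', hkb, hl, hm']
    have hsz : m₀ (.size, 0, 0) = G.n := (hF0 _ (by decide) _ _).trans hB.size
    have L1 := for_ind (x := .b) (e := Name.size) (l := [
      when (below s e (at1 (.lay s) Name.b)) [put1 .tmp Name.d (at1 (.lay s) Name.b), incr .d]])
      (m := m₀) (N := G.n) (by simpa using hsz)
      (fun b m' => m' (.d, 0, 0) = min b q - p ∧
        ∀ r < min b q - p, m' (.tmp, r, 0) = m (.lay s, p + r, 0))
      ⟨by simpa using hd0, by simp⟩ (fun k m' v h => by
        simpa only [update_cell, reduceCtorEq, false_and, if_false] using h) ?_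
    · change (flipCollect s e).exec m₀ (.d, 0, 0) = _ ∧
        ∀ r < _, (flipCollect s e).exec m₀ (.tmp, r, 0) = _ at L1
      have hF1 := (flipCollect s e).frame_exec m₀
      generalize (flipCollect s e).exec m₀ = m₁ at *
      have hF1' : ∀ y, y ≠ .d → y ≠ .b → y ≠ .tmp → ∀ a b, m₁ (y, a, b) = m (y, a, b) := by
        intro y h1 h2 h3 a b
        rw [hF1 y (keeps_flipCollect s e h1 h2 h3), hF0 y h1]
      have hsz1 : m₁ (.size, 0, 0) = G.n :=
        (hF1' _ (by decide) (by decide) (by decide) _ _).trans hB.size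
      have L2 := for_ind (x := .b) (e := Name.size) (l := [
        when (below s e (at1 (.lay s) Name.b)) [decr .d, put1 (.lay s) Name.b (at1 .tmp Name.d)]])
        (m := m₁) (N := G.n) (by simpa using hsz1)
        (fun b m' => m' (.d, 0, 0) = (q - p) - (min b q - p) ∧
          ∀ k < G.n, m' (.lay s, k, 0) = if k < b then flipArray p q (fun k => m (.lay s, k, 0)) k
            else m (.lay s, k, 0))
        ⟨by rw [L1.1]; omega, fun k hk => by
          simpa using hF1' _ (by simp) (by simp) (by simp) _ _⟩ (fun k m' v h => by
          simpa only [update_cell, reduceCtorEq, false_and, if_false] using h) ?_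
      · intro k hk
        have := L2.2 k hk
        rwa [if_pos hk] at this
      · intro b hb m' hF hkb ⟨i1, i2⟩
        rw [exec_cons, exec_nil]
        have hm' : ∀ y, y ≠ .d → y ≠ .b → y ≠ .tmp → y ≠ .lay s → ∀ a b,
            m' (y, a, b) = m (y, a, b) := by
          intro y h1 h2 h3 h4 a b
          rw [hF y (keeps_flipWrite s e h1 h2 h4), hF1' y h1 h2 h3]
        have htmp : ∀ r, m' (.tmp, r, 0) = m₁ (.tmp, r, 0) := fun r =>
          hF .tmp (keeps_flipWrite s e (by simp) (by simp) (by simp)) _ _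
        have hlb : m' (.lay s, b, 0) = m (.lay s, b, 0) := by rw [i2 b hb, if_neg (by omega)]
        have hc := hbelow m' hm' b hb hkb hlb
        by_cases hb' : p ≤ b ∧ b < q
        · rw [exec_when_pos (hc.2 hb')]
          simp only [exec_cons, exec_nil, decr, put, put1, at1, exec_set, Expr.val, reg, val_zero,
            update_cell, reduceCtorEq, false_and, if_false, true_and, and_true, if_true, and_self,
            hkb]
          refine ⟨by rw [i1]; omega, fun k hk => ?_⟩
          by_cases hkb' : k = b
          · subst hkb'
            rw [if_pos rfl, if_pos (by omega), htmp, L1.2 _ (by omega)]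
            unfold flipArray
            rw [if_pos hb', i1]
            congr 3; omega
          · rw [if_neg hkb', i2 k hk]
            split_ifs <;> first | rfl | omega
        · rw [exec_when_neg (hc.not.2 hb')]
          refine ⟨by rw [i1]; omega, fun k hk => ?_⟩
          rw [i2 k hk]
          by_cases hkb' : k = b
          · subst hkb'
            rw [if_neg (by omega), if_pos (by omega)]
            unfold flipArray
            rw [if_neg hb']
          · split_ifs <;> first | rfl | omega
    · intro b hb m' hF hkb ⟨i1, i2⟩
      rw [exec_cons, exec_nil]
      have hF' : ∀ y, y ≠ .d → y ≠ .b → y ≠ .tmp → ∀ a b, m' (y, a, b) = m (y, a, b) := by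
        intro y h1 h2 h3 a b
        rw [hF y (keeps_flipCollect s e h1 h2 h3), hF0 y h1]
      have hlb := hF' (.lay s) (by simp) (by simp) (by simp) b 0
      have hc := hbelow m' (fun y h1 h2 h3 _ => hF' y h1 h2 h3) b hb hkb hlb
      by_cases hb' : p ≤ b ∧ b < q
      · rw [exec_when_pos (hc.2 hb')]
        simp only [exec_cons, exec_nil, incr, put, put1, at1, exec_set, Expr.val, reg, val_zero,
          update_cell, reduceCtorEq, false_and, if_false, true_and, and_true, if_true, and_self,
          hkb, hlb]
        refine ⟨by rw [i1]; omega, fun r hr => ?_⟩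
        split_ifs with h1
        · have h2 : r = min b q - p := by rw [← i1]; exact h1
          rw [show p + r = b by omega]
        · have h2 : r ≠ min b q - p := by rw [← i1]; exact h1
          exact i2 r (by omega)
      · rw [exec_when_neg (hc.not.2 hb')]
        exact ⟨by rw [i1]; omega, fun r hr => i2 r (by omega)⟩
  obtain ⟨f1, f2⟩ := flipArray_spec (hD.perm s) hqn hS key
  have hoth : ∀ t, t ≠ s → ∀ k, (flip s e).exec m (.lay t, k, 0) = m (.lay t, k, 0) := by
    intro t ht k
    exact hFall _ (keeps_flip s e (by simp) (by simp) (by simp) (by simpa using ht)) _ _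
  have hord : G.order ((flip s e).exec m) = G.flipAt s u (G.order m) := by
    funext t
    by_cases ht : t = s
    · subst ht
      simp only [flipAt, if_true]
      exact f2
    · simp only [flipAt, if_neg ht, order, hoth t ht]
  refine ⟨⟨fun t => ?_, fun t => ?_⟩, hord⟩
  · by_cases ht : t = s
    · subst ht; exact f1
    · simp only [hoth t ht]; exact hD.perm t
  · rw [hord]; exact isOrder_flipAt hD.order s hu t

/-- The arrays that are not changed by flips and by the counting of crossings. -/
def Same (m m' : Cell → ℕ) : Prop :=
  ∀ y, y ∉ [Name.d, .b, .tmp, .lay .T, .lay .S, .pos .T, .pos .S, .crossed, .uncrossed] →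
    ∀ a b, m' (y, a, b) = m (y, a, b)

theorem Same.trans {m m' m'' : Cell → ℕ} (h : Same m m') (h' : Same m' m'') : Same m m'' :=
  fun y hy a b => (h' y hy a b).trans (h y hy a b)

theorem same_flip (s : Side) (e : Expr) (m : Cell → ℕ) : Same m ((flip s e).exec m) := by
  intro y hy a b
  simp only [List.mem_cons, not_or] at hy
  apply (flip s e).frame_exec m
  apply keeps_flip s e hy.1 hy.2.1 hy.2.2.1
  cases s
  · exact hy.2.2.2.1
  · exact hy.2.2.2.2.1

theorem Base.same {m m' : Cell → ℕ} (h : G.Base m) (hs : Same m m') : G.Base m' :=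
  h.congr fun y hy a b => hs y (by revert hy; revert y; decide) a b

theorem exec_pairedFlip {e f : Expr} {m : Cell → ℕ} (hB : G.Base m)
    (hL : G.Layout m) (he : Stable s e m u) (hu : u < 2 * G.n - 1)
    (hf : ∀ m', Same m m' → f.val m' = v) (hv : v < 2 * G.n - 1) (h : G.Matched s u v) :
    G.Layout ((pairedFlip s e f).exec m) ∧ Same m ((pairedFlip s e f).exec m) ∧
      G.order ((pairedFlip s e f).exec m) = G.flipAt s.other v (G.flipAt s u (G.order m)) := by
  unfold pairedFlip
  rw [exec_cons, exec_cons, exec_nil]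
  have s1 := same_flip s e m
  obtain ⟨d1, o1⟩ := exec_flip hB hL.drawn he hu
  generalize (flip s e).exec m = m₁ at *
  have s2 := same_flip s.other f m₁
  obtain ⟨d2, o2⟩ := exec_flip (e := f) (hB.same s1) d1 (s := s.other) (fun m' hm' =>
    hf m' (s1.trans fun y hy a b => by
      simp only [List.mem_cons, not_or] at hy
      exact hm' y hy.1 hy.2.1 hy.2.2.1 (by cases s; exacts [hy.2.2.2.2.1, hy.2.2.2.1]) a b)) hv
  generalize (flip s.other f).exec m₁ = m₂ at *
  have o3 : G.order m₂ = G.flipAt s.other v (G.flipAt s u (G.order m)) := by rw [o2, o1]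
  refine ⟨⟨d2.perm, ?_⟩, s1.trans s2, o3⟩
  rw [o3]
  exact hL.planar.pairedFlip hu hv h

theorem Stable.of_same {e : Expr} {m : Cell → ℕ} (h : ∀ m', Same m m' → e.val m' = u) :
    Stable s e m u := by
  intro m' hm'
  apply h
  intro y hy a b
  simp only [List.mem_cons, not_or] at hy
  exact hm' y hy.1 hy.2.1 hy.2.2.1 (by cases s; exacts [hy.2.2.2.1, hy.2.2.2.2.1]) a b

theorem exec_subtreeSwitch {e : Expr} {m : Cell → ℕ} (hB : G.Base m) (hL : G.Layout m)
    (he : ∀ m', Same m m' → e.val m' = u) (hp : G.Parent s u) :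
    G.Layout ((subtreeSwitch s e).exec m) ∧ Same m ((subtreeSwitch s e).exec m) ∧
      G.order ((subtreeSwitch s e).exec m) = G.switchAt s u (G.order m) := by
  unfold subtreeSwitch
  rw [exec_cons, exec_cons, exec_cons, exec_nil]
  have H := G.hier s
  have s1 := same_flip s e m
  obtain ⟨d1, o1⟩ := exec_flip hB hL.drawn (Stable.of_same (s := s) he) hp.lt
  generalize (flip s e).exec m = m₁ at *
  have s2 := s1.trans (same_flip s (.get (.kid s) e 0) m₁)
  obtain ⟨d2, o2⟩ := exec_flip (hB.same s1) d1 (e := .get (.kid s) e 0) (u := G.k0 s u)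
    (Stable.of_same (s := s) fun m' hm' => by
      have := (hB.same (s1.trans hm')).kid0 s u hp.ge hp.lt
      simpa [he m' (s1.trans hm')] using this) ((H.kid0_lt u hp.ge hp.lt).trans hp.lt)
  generalize (flip s (.get (.kid s) e 0)).exec m₁ = m₂ at *
  have s3 := s2.trans (same_flip s (.get (.kid s) e 1) m₂)
  obtain ⟨d3, o3⟩ := exec_flip (hB.same s2) d2 (e := .get (.kid s) e 1) (u := G.k1 s u)
    (Stable.of_same (s := s) fun m' hm' => by
      have := (hB.same (s2.trans hm')).kid1 s u hp.ge hp.lt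
      simpa [he m' (s2.trans hm')] using this) ((H.kid1_lt u hp.ge hp.lt).trans hp.lt)
  generalize (flip s (.get (.kid s) e 1)).exec m₂ = m₃ at *
  have o4 : G.order m₃ = G.switchAt s u (G.order m) := by rw [o3, o2, o1]; rfl
  refine ⟨⟨d3.perm, ?_⟩, s3, o4⟩
  rw [o4]
  exact hL.planar.switchAt hp

/-! ### Counting crossings -/

theorem exec_positions {m : Cell → ℕ} (hs : m (.size, 0, 0) = G.n) (s : Side)
    (hp : IsPermArray G.n fun k => m (.lay s, k, 0)) (k : ℕ) (hk : k < G.n) :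
    (positions s).exec m (.pos s, m (.lay s, k, 0), 0) = k := by
  refine for_ind (x := .b) (e := Name.size) (l := [put1 (.pos s) (at1 (.lay s) Name.b) Name.b])
    (m := m) (N := G.n) (by simpa using hs)
    (fun b m' => ∀ k < b, m' (.pos s, m (.lay s, k, 0), 0) = k) (by simp)
    (fun k m' v h => by
      simpa only [update_cell, reduceCtorEq, false_and, if_false] using h) ?_ k hk
  intro b hb m' hF hkb hI k hk
  have hl : m' (.lay s, b, 0) = m (.lay s, b, 0) := hF _ (by cases s <;> decide) _ _
  simp only [exec_cons, exec_nil, put1, at1, exec_set, Expr.val, reg, val_zero, update_cell,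
    hkb, hl, true_and, and_true]
  rcases Nat.lt_succ_iff_lt_or_eq.1 hk with h | rfl
  · rw [if_neg fun h1 => ?_, hI k h]
    have := hp.inj k (h.trans hb) b hb h1
    omega
  · rw [if_pos rfl]

/-- The positions of the leaves are in the memory. -/
def HasPos (G : Setup) (m : Cell → ℕ) : Prop :=
  ∀ s, ∀ k < G.n, m (.pos s, m (.lay s, k, 0), 0) = k

theorem exec_positions_both {m : Cell → ℕ} (hB : G.Base m) (hL : G.Layout m) :
    G.HasPos ((positions .S).exec ((positions .T).exec m)) := by
  have h1 := exec_positions hB.size .T (hL.perm .T)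
  have hF1 := (positions .T).frame_exec m
  generalize (positions .T).exec m = m₁ at *
  have hB1 := hB.frame hF1 (by decide)
  have h2 := exec_positions hB1.size .S ((hL.frame hF1 (by decide)).perm .S)
  have hF2 := (positions .S).frame_exec m₁
  generalize (positions .S).exec m₁ = m₂ at *
  rintro (_ | _) k hk
  · rw [hF2 _ (by decide), hF2 _ (by decide), hF1 (.lay .T) (by decide)]
    exact h1 k hk
  · rw [hF2 (.lay .S) (by decide)]; exact h2 k hk

theorem val_isAbove {m : Cell → ℕ} (hB : G.Base m) (hL : G.Layout m) (hp : G.HasPos m) {e f : Expr}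
    {j k : ℕ} (he : e.val m = j) (hf : f.val m = k) (hj : j < G.n) (hk : k < G.n) (s : Side) :
    (isAbove s e f).val m = true ↔ G.order m s j k := by
  have hend : ∀ (e : Expr) j, e.val m = j → j < G.n → (endpoint s e).val m = G.e s j := by
    intro e j he hj
    cases s
    · exact he.trans (hB.eT j hj).symm
    · simpa [endpoint, he] using hB.phi j hj
  obtain ⟨p, hp1, hp2⟩ := exists_pos (hL.perm s) hj s
  obtain ⟨q, hq1, hq2⟩ := exists_pos (hL.perm s) hk s
  unfold order
  rw [arrayOrder_iff (hL.perm s) hj hk hp1 hq1 hp2 hq2]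
  have h1 : m (.pos s, G.e s j, 0) = p := by rw [← hp2]; exact hp s p hp1
  have h2 : m (.pos s, G.e s k, 0) = q := by rw [← hq2]; exact hp s q hq1
  simp [isAbove, hend e j he hj, hend f k hf hk, h1, h2]

theorem val_cross {m : Cell → ℕ} (hB : G.Base m) (hL : G.Layout m) (hp : G.HasPos m) {e : Expr}
    {j : ℕ} (he : e.val m = j) (hj : j < G.n) (hji : j ≠ G.i) :
    (cross e (Name.ins .T)).val m = true ↔ G.Crosses (G.order m) j := by
  have hi : (reg (Name.ins .T)).val m = G.i := by
    have := hB.ins .T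
    rw [hB.eT _ G.i_lt] at this
    simpa using this
  have t1 := (hL.planar.order .T).total j hj _ G.i_lt hji
  have t2 := (hL.planar.order .S).total j hj _ G.i_lt hji
  simp only [cross, Cond.val, Bool.or_eq_true, Bool.and_eq_true,
    val_isAbove hB hL hp he hi hj G.i_lt, val_isAbove hB hL hp hi he G.i_lt hj]
  unfold Crosses
  tauto

/-- The edge set number `k` on the side `s` is in the memory. -/
def IsEdgeSet (G : Setup) (m : Cell → ℕ) (s : Side) (k : ℕ) (R : ℕ → Prop) : Prop :=
  ∀ j < G.n, (m (.eset s, k, j) = 1 ↔ j ≠ G.i ∧ R j)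

/-- Add one edge to the counters. -/
def countStep (s : Side) (k : Expr) : Prog :=
  when (holds (.eset s) k Name.b) [.ite (cross Name.b (Name.ins .T)) (incr .crossed) (incr .uncrossed)]

open Classical in
theorem exec_countInserted {s : Side} {e : Expr} {k : ℕ} {m : Cell → ℕ} (hB : G.Base m)
    (hL : G.Layout m) (he : ∀ m', Same m m' → e.val m' = k) {R : ℕ → Prop}
    (hR : G.IsEdgeSet m s k R) :
    Same m ((countInserted s e).exec m) ∧ G.Layout ((countInserted s e).exec m) ∧
    G.order ((countInserted s e).exec m) = G.order m ∧
    (countInserted s e).exec m (.crossed, 0, 0) = ((Finset.range G.n).filter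
      fun j => (j ≠ G.i ∧ R j) ∧ G.Crosses (G.order m) j).card ∧
    (countInserted s e).exec m (.uncrossed, 0, 0) = ((Finset.range G.n).filter
      fun j => (j ≠ G.i ∧ R j) ∧ ¬ G.Crosses (G.order m) j).card := by
  have hkeep : ∀ y, y ∉ [Name.d, .b, .tmp, .lay .T, .lay .S, .pos .T, .pos .S, .crossed,
      .uncrossed] → (countInserted s e).keeps y = true := by
    intro y hy
    simp only [List.mem_cons, not_or] at hy
    simp [countInserted, for', positions, Prog.keeps, Ne.symm hy.1, Ne.symm hy.2.1,
      Ne.symm hy.2.2.1, Ne.symm hy.2.2.2.1, Ne.symm hy.2.2.2.2.1, Ne.symm hy.2.2.2.2.2.1,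
      Ne.symm hy.2.2.2.2.2.2.1, Ne.symm hy.2.2.2.2.2.2.2.1, Ne.symm hy.2.2.2.2.2.2.2.2.1]
  have hF := (countInserted s e).frame_exec m
  have hlay : ∀ t, (countInserted s e).keeps (.lay t) = true := by
    intro t; cases t <;> rfl
  refine ⟨fun y hy => hF y (hkeep y hy), hL.frame hF hlay, order_frame hF hlay, ?_⟩
  have e1 : (countInserted s e).exec m = (for' .b Name.size [countStep s e]).exec
      ((put .uncrossed 0).exec ((put .crossed 0).exec
        ((positions .S).exec ((positions .T).exec m)))) := by
    simp only [countInserted, countStep, exec_cons, exec_nil]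
  rw [e1]
  have hpos := exec_positions_both hB hL
  have hF2 : (block [positions .T, positions .S]).Frame m
      ((positions .S).exec ((positions .T).exec m)) :=
    Prog.frame_exec (block [positions .T, positions .S]) m
  generalize (positions .S).exec ((positions .T).exec m) = m₂ at *
  have hF3 := (block [put .crossed 0, put .uncrossed 0]).frame_exec m₂
  have e3 : (put .uncrossed 0).exec ((put .crossed 0).exec m₂) =
    (block [put .crossed 0, put .uncrossed 0]).exec m₂ := rfl
  rw [e3]
  have hz : (block [put .crossed 0, put .uncrossed 0]).exec m₂ (.crossed, 0, 0) = 0 ∧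
      (block [put .crossed 0, put .uncrossed 0]).exec m₂ (.uncrossed, 0, 0) = 0 := by
    constructor <;> simp
  generalize (block [put .crossed 0, put .uncrossed 0]).exec m₂ = m₃ at *
  have hB3 := (hB.frame hF2 (by decide)).frame hF3 (by decide)
  have hL3 := (hL.frame hF2 (by decide)).frame hF3 (by decide)
  have ho3 : G.order m₃ = G.order m :=
    (order_frame hF3 (by decide)).trans (order_frame hF2 (by decide))
  have hpos3 : G.HasPos m₃ := by
    intro t k hk
    rw [hF3 _ (by cases t <;> decide), hF3 _ (by cases t <;> decide)]
    exact hpos t k hk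
  have hs3 : Same m m₃ := by
    intro y hy a b
    simp only [List.mem_cons, not_or] at hy
    rw [hF3, hF2]
    · simp [positions, for', Prog.keeps, Ne.symm hy.2.1, Ne.symm hy.2.2.2.2.2.1,
        Ne.symm hy.2.2.2.2.2.2.1]
    · simp [Prog.keeps, Ne.symm hy.2.2.2.2.2.2.2.1, Ne.symm hy.2.2.2.2.2.2.2.2.1]
  refine for_ind (x := .b) (e := Name.size) (l := [countStep s e]) (m := m₃) (N := G.n)
    (by simpa using hB3.size)
    (fun b m' => m' (.crossed, 0, 0) = ((Finset.range b).filter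
        fun j => (j ≠ G.i ∧ R j) ∧ G.Crosses (G.order m) j).card ∧
      m' (.uncrossed, 0, 0) = ((Finset.range b).filter
        fun j => (j ≠ G.i ∧ R j) ∧ ¬ G.Crosses (G.order m) j).card)
    (by simpa using hz) (fun k m' v h => by
      simpa only [update_cell, reduceCtorEq, false_and, if_false] using h) ?_
  intro b hb m' hF' hkb ⟨i1, i2⟩
  rw [exec_cons, exec_nil]
  have hk' : ∀ y, y ≠ .b → y ≠ .crossed → y ≠ .uncrossed → ∀ a b, m' (y, a, b) = m₃ (y, a, b) := by
    intro y h1 h2 h3 a b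
    apply hF'
    simp [countStep, for', Prog.keeps, h1.symm, h2.symm, h3.symm]
  have hs' : Same m m' := hs3.trans fun y hy a b => by
    simp only [List.mem_cons, not_or] at hy
    exact hk' y hy.2.1 hy.2.2.2.2.2.2.2.1 hy.2.2.2.2.2.2.2.2.1 a b
  have hlay' : ∀ t k, m' (.lay t, k, 0) = m₃ (.lay t, k, 0) :=
    fun t k => hk' _ (by simp) (by simp) (by simp) _ _
  have ho' : G.order m' = G.order m := (order_congr hlay').trans ho3
  have hL' : G.Layout m' := by
    refine ⟨fun t => ?_, by rw [ho']; exact hL.planar⟩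
    simp only [hlay']; exact hL3.perm t
  have hpos' : G.HasPos m' := by
    intro t k hk
    rw [hlay', hk' _ (by simp) (by simp) (by simp)]
    exact hpos3 t k hk
  have heset : m' (.eset s, k, b) = m (.eset s, k, b) := hs' _ (by cases s <;> simp) _ _
  have hev := he m' hs'
  have hins := Finset.notMem_range_self (n := b)
  rw [Finset.range_add_one, Finset.filter_insert, Finset.filter_insert]
  unfold countStep
  by_cases hRb : b ≠ G.i ∧ R b
  · rw [exec_when_pos (by simp [hev, hkb, heset, (hR b hb).2 hRb]), exec_cons, exec_nil, exec_ite]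
    have hcr := val_cross (hB.same hs') hL' hpos' (e := Name.b) (by simpa using hkb) hb hRb.1
    rw [ho'] at hcr
    by_cases hc : G.Crosses (G.order m) b
    · rw [if_pos (hcr.2 hc), if_pos ⟨hRb, hc⟩, if_neg (fun h => h.2 hc),
        Finset.card_insert_of_notMem (by simp)]
      simp [i1, i2]
    · rw [if_neg (hcr.not.2 hc), if_neg (fun h => hc h.2), if_pos ⟨hRb, hc⟩,
        Finset.card_insert_of_notMem (by simp)]
      simp [i1, i2]
  · rw [exec_when_neg (by
      simp only [holds, Cond.val, Expr.val, reg, val_zero, val_one, hev, hkb, heset, hR b hb,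
        decide_eq_true_eq]
      exact hRb), if_neg (fun h => hRb h.1), if_neg (fun h => hRb h.1)]
    exact ⟨i1, i2⟩

theorem not_half_iff {m : Cell → ℕ} {b : Side → ℕ → ℕ → Prop} {R : ℕ → Prop}
    (h1 : m (.crossed, 0, 0) = (open Classical in ((Finset.range G.n).filter
      fun j => (j ≠ G.i ∧ R j) ∧ G.Crosses b j).card))
    (h2 : m (.uncrossed, 0, 0) = (open Classical in ((Finset.range G.n).filter
      fun j => (j ≠ G.i ∧ R j) ∧ ¬ G.Crosses b j).card)) :
    moreThanHalf.val m = true ↔ ¬ G.Half b R := by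
  classical
  unfold Half
  have h3 := Finset.card_filter_add_card_filter_not
    (s := (Finset.range G.n).filter fun j => j ≠ G.i ∧ R j) (fun j => G.Crosses b j)
  rw [Finset.filter_filter, Finset.filter_filter] at h3
  simp only [moreThanHalf, Cond.val, Expr.val, reg, val_zero, h1, h2, decide_eq_true_eq]
  omega

theorem half_of_toggle {b b' : Side → ℕ → ℕ → Prop} {R : ℕ → Prop} (h : ¬ G.Half b R)
    (ht : ∀ j < G.n, j ≠ G.i → R j → (G.Crosses b' j ↔ ¬ G.Crosses b j)) : G.Half b' R := by
  classical
  unfold Half at h ⊢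
  have h3 := Finset.card_filter_add_card_filter_not
    (s := (Finset.range G.n).filter fun j => j ≠ G.i ∧ R j) (fun j => G.Crosses b j)
  rw [Finset.filter_filter, Finset.filter_filter] at h3
  have h4 : ((Finset.range G.n).filter fun j => (j ≠ G.i ∧ R j) ∧ G.Crosses b' j) =
      (Finset.range G.n).filter fun j => (j ≠ G.i ∧ R j) ∧ ¬ G.Crosses b j := by
    apply Finset.filter_congr
    intro j hj
    exact and_congr_right fun h => ht j (Finset.mem_range.1 hj) h.1 h.2
  rw [h4]
  omega

end Setup

end Tangle

namespace Tangle

namespace Setup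

open Hier

variable {G : Setup} {s : Side} {u v : ℕ}

/-! ### Edge sets -/

theorem Prepared.congr {m m' : Cell → ℕ} (h : G.Prepared m)
    (he : ∀ y ∈ baseNames ++ [.own .T, .own .S, .mat .T, .mat .S, .num .T, .num .S],
      ∀ a b, m' (y, a, b) = m (y, a, b)) : G.Prepared m' := by
  have e1 : ∀ t k, m' (.own t, k, 0) = m (.own t, k, 0) :=
    fun t k => he _ (by cases t <;> decide) _ _
  have e2 : ∀ t k, m' (.mat t, k, 0) = m (.mat t, k, 0) :=
    fun t k => he _ (by cases t <;> decide) _ _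
  have e3 : ∀ t, m' (.num t, 0, 0) = m (.num t, 0, 0) :=
    fun t => he _ (by cases t <;> decide) _ _
  refine ⟨h.toBase.congr fun y hy => he y (List.mem_append_left _ hy), ?_, ?_, ?_⟩
  · simpa only [e1, e3] using h.chain
  · simpa only [e1, e2, e3] using h.mat
  · simpa only [e3] using h.num_lt

theorem Prepared.frame {m m' : Cell → ℕ} (h : G.Prepared m) {p : Prog} (hF : p.Frame m m')
    (hp : p.keepsAll (baseNames ++ [.own .T, .own .S, .mat .T, .mat .S, .num .T, .num .S]) = true) :
    G.Prepared m' :=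
  h.congr fun _ hy a b => hF.of_keepsAll hp hy a b

theorem Prepared.same {m m' : Cell → ℕ} (h : G.Prepared m) (hs : Same m m') : G.Prepared m' :=
  h.congr fun y hy a b => hs y (by revert hy; revert y; decide) a b

theorem IsEdgeSet.congr {m m' : Cell → ℕ} {k : ℕ} {R R' : ℕ → Prop} (h : G.IsEdgeSet m s k R)
    (he : ∀ j, m' (.eset s, k, j) = m (.eset s, k, j))
    (hR : ∀ j, j ≠ G.i → (R j ↔ R' j)) : G.IsEdgeSet m' s k R' := by
  intro j hj
  rw [he, h j hj]
  exact and_congr_right fun h => hR j h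

theorem Base.ins_eq {m : Cell → ℕ} (h : G.Base m) : m (.ins .T, 0, 0) = G.i := by
  rw [h.ins .T, h.eT _ G.i_lt]

theorem exec_edgeSet {k e f : Expr} {r : ℕ} {m : Cell → ℕ} (hB : G.Base m)
    (hst : ∀ m' : Cell → ℕ, (∀ y, y ≠ .b → y ≠ .eset s → ∀ a b, m' (y, a, b) = m (y, a, b)) →
      k.val m' = r ∧ e.val m' = u ∧ f.val m' = v)
    (hu : u < 2 * G.n - 1) (hv : v < 2 * G.n - 1) :
    G.IsEdgeSet ((edgeSet s k e f).exec m) s r (fun j => G.c s u j ∧ ¬ G.c s v j) ∧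
    (∀ a, a ≠ r → ∀ j, (edgeSet s k e f).exec m (.eset s, a, j) = m (.eset s, a, j)) ∧
    ∀ y, y ≠ .b → y ≠ .eset s → ∀ a b, (edgeSet s k e f).exec m (y, a, b) = m (y, a, b) := by
  have hkeep : ∀ y, y ≠ .b → y ≠ .eset s → (edgeSet s k e f).keeps y = true := by
    intro y h1 h2
    simp [edgeSet, for', Prog.keeps, block, h1.symm, h2.symm]
  have main := for_ind (x := .b) (e := Name.size) (l := [
    .ite (all [below s e (endpoint s Name.b), .not (below s f (endpoint s Name.b)),
        .not (.eq Name.b (Name.ins .T))])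
      (.set (.eset s) k Name.b 1) (.set (.eset s) k Name.b 0)]) (m := m) (N := G.n)
    (by simpa using hB.size)
    (fun b m' => (∀ j < b, (m' (.eset s, r, j) = 1 ↔ j ≠ G.i ∧ G.c s u j ∧ ¬ G.c s v j)) ∧
      ∀ a, a ≠ r → ∀ j, m' (.eset s, a, j) = m (.eset s, a, j))
    (by simp) (fun k m' v h => by
      simpa only [update_cell, reduceCtorEq, false_and, if_false] using h) ?_
  · exact ⟨main.1, main.2, fun y h1 h2 =>
      (edgeSet s k e f).frame_exec m y (hkeep y h1 h2)⟩
  · intro b hb m' hF hkb ⟨i1, i2⟩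
    have hm' : ∀ y, y ≠ .b → y ≠ .eset s → ∀ a b, m' (y, a, b) = m (y, a, b) :=
      fun y h1 h2 => hF y (hkeep y h1 h2)
    have hB' : G.Base m' := hB.congr fun y hy => hm' y
      (by rintro rfl; revert hy; decide) (by rintro rfl; revert hy; cases s <;> decide)
    obtain ⟨v1, v2, v3⟩ := hst m' hm'
    have hend : (endpoint s Name.b).val m' = G.e s b := by
      cases s
      · simpa [endpoint, hkb] using (hB.eT b hb).symm
      · simpa [endpoint, hkb] using hB'.phi b hb
    have helt := ((G.hier s).e_lt b hb).trans (show G.n < 2 * G.n - 1 by have := G.two_le; omega)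
    have hd1 := hB'.desc s u hu _ helt
    have hd2 := hB'.desc s v hv _ helt
    rw [le_end hb] at hd1 hd2
    rw [exec_cons, exec_nil, exec_ite]
    have hc : (all [below s e (endpoint s Name.b), .not (below s f (endpoint s Name.b)),
        .not (.eq Name.b (Name.ins .T))]).val m' = true ↔
        b ≠ G.i ∧ G.c s u b ∧ ¬ G.c s v b := by
      have b1 : (below s e (endpoint s Name.b)).val m' = true ↔ G.c s u b := by
        rw [← hd1]; generalize endpoint s (reg Name.b) = ep at *; simp [below, v2, hend]
      have b2 : (below s f (endpoint s Name.b)).val m' = true ↔ G.c s v b := by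
        rw [← hd2]; generalize endpoint s (reg Name.b) = ep at *; simp [below, v3, hend]
      have b3 : (Cond.eq Name.b (Name.ins .T)).val m' = true ↔ b = G.i := by
        simp [Cond.val, hkb, hB'.ins_eq]
      simp only [all, Cond.val.eq_4, Cond.val.eq_3, Bool.and_eq_true, Bool.not_eq_true',
        ← Bool.not_eq_true, b1, b2, b3]
      tauto
    split_ifs with h1
    · refine ⟨fun j hj => ?_, fun a ha j => ?_⟩
      · simp only [exec_set, Expr.val, reg, val_one, val_zero, update_cell, v1, hkb]
        by_cases hjb : j = b
        · subst hjb
          simpa using hc.1 h1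
        · simpa [hjb] using i1 j (by omega)
      · simp only [exec_set, Expr.val, reg, val_one, val_zero, update_cell, v1, hkb]
        simpa [ha] using i2 a ha j
    · refine ⟨fun j hj => ?_, fun a ha j => ?_⟩
      · simp only [exec_set, Expr.val, reg, val_one, val_zero, update_cell, v1, hkb]
        by_cases hjb : j = b
        · subst hjb
          simpa using hc.not.1 h1
        · simpa [hjb] using i1 j (by omega)
      · simp only [exec_set, Expr.val, reg, val_one, val_zero, update_cell, v1, hkb]
        simpa [ha] using i2 a ha j

/-- The edge set of the parent of the inserted leaf. -/
theorem exec_edgeSet_parent {m : Cell → ℕ} (h : G.Prepared m) (s : Side) :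
    G.IsEdgeSet ((edgeSet s 0 (parent s) (Name.ins s)).exec m) s 0 (G.c s (m (.own s, 0, 0))) ∧
    ∀ a, a ≠ 0 → ∀ j,
      (edgeSet s 0 (parent s) (Name.ins s)).exec m (.eset s, a, j) = m (.eset s, a, j) := by
  have hi := (G.hier s).e_lt _ G.i_lt
  have h2 := G.two_le
  obtain ⟨h1, h2, -⟩ := exec_edgeSet (s := s) (k := 0) (e := parent s) (f := Name.ins s)
    (r := 0) (u := m (.own s, 0, 0)) (v := G.e s G.i) h.toBase (fun m' hm' => by
      have e1 := hm' (.own s) (by simp) (by simp) 0 0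
      have e2 := hm' (.ins s) (by simp) (by simp) 0 0
      refine ⟨rfl, e1, e2.trans (h.ins s)⟩) (h.chain s).parent.lt (by omega)
  refine ⟨h1.congr (fun _ => rfl) fun j hj => ?_, h2⟩
  refine and_iff_left_of_imp fun hc hc' => hj ?_
  have hjn := (G.hier s).c_lt _ _ hc
  exact ((G.hier s).e_inj _ G.i_lt _ hjn (((G.hier s).leaf _ hi j hjn).1 hc').symm).symm

theorem exec_chainEdgeSets {m : Cell → ℕ} (h : G.Prepared m) (s : Side) :
    (∀ k, 1 ≤ k → k ≤ m (.num s, 0, 0) → G.IsEdgeSet ((chainEdgeSets s).exec m) s k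
      (G.Ring s (fun k => m (.own s, k, 0)) k)) ∧
    ∀ j, (chainEdgeSets s).exec m (.eset s, 0, j) = m (.eset s, 0, j) := by
  have hq := h.num_lt s
  have main := for_ind (x := .a) (e := Name.size) (l := [
    when (.and (.lt 0 Name.a) (.not (.lt (Name.num s) Name.a)))
      [edgeSet s Name.a (at1 (.own s) Name.a) (at1 (.own s) (.pred Name.a))]]) (m := m) (N := G.n)
    (by simpa using h.size)
    (fun a m' => (∀ k < a, 1 ≤ k → k ≤ m (.num s, 0, 0) →
      G.IsEdgeSet m' s k (G.Ring s (fun k => m (.own s, k, 0)) k)) ∧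
      ∀ j, m' (.eset s, 0, j) = m (.eset s, 0, j))
    (by simp) (fun k m' v h => by
      simpa only [IsEdgeSet, update_cell, reduceCtorEq, false_and, if_false] using h) ?_
  · exact ⟨fun k h1 h2 => main.1 k (h2.trans_lt hq) h1 h2, main.2⟩
  intro a ha m' hF hka ⟨i1, i2⟩
  have h' : G.Prepared m' := h.frame hF (by cases s <;> decide)
  have eo : ∀ k, m' (.own s, k, 0) = m (.own s, k, 0) := fun k => hF _ (by cases s <;> decide) _ _
  have en : m' (.num s, 0, 0) = m (.num s, 0, 0) := hF _ (by cases s <;> decide) _ _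
  rw [exec_cons, exec_nil]
  by_cases hc : 1 ≤ a ∧ a ≤ m (.num s, 0, 0)
  · rw [exec_when_pos (by
      simp only [Cond.val, Expr.val, reg, val_zero, hka, en, Bool.and_eq_true, Bool.not_eq_true',
        decide_eq_true_eq, decide_eq_false_iff_not]
      omega), exec_cons, exec_nil]
    obtain ⟨h1, h2, -⟩ := exec_edgeSet (s := s) (k := Name.a) (e := at1 (.own s) Name.a)
      (f := at1 (.own s) (.pred Name.a)) (r := a) (u := m (.own s, a, 0))
      (v := m (.own s, a - 1, 0)) h'.toBase (fun m'' hm'' => by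
        have e1 := hm'' (.own s) (by simp) (by simp)
        have e2 := hm'' .a (by simp) (by simp) 0 0
        simp [e1, e2, hka, eo, at1]) ((h.chain s).lt hc.2) ((h.chain s).lt (by omega))
    refine ⟨fun k hk k1 k2 => ?_, fun j => ?_⟩
    · by_cases hka' : k = a
      · subst hka'
        refine h1.congr (fun _ => rfl) fun j _ => ?_
        exact and_congr_right fun _ => ⟨fun h _ => h, fun h => h (by omega)⟩
      · exact (i1 k (by omega) k1 k2).congr (h2 k hka') fun _ _ => Iff.rfl
    · rw [h2 0 (by omega), i2]
  · rw [exec_when_neg (by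
      simp only [Cond.val, Expr.val, reg, val_zero, hka, en, Bool.and_eq_true, Bool.not_eq_true',
        decide_eq_true_eq, decide_eq_false_iff_not]
      omega)]
    refine ⟨fun k hk k1 k2 => i1 k ?_ k1 k2, i2⟩
    rcases Nat.lt_succ_iff_lt_or_eq.1 hk with h | rfl
    · exact h
    · exact absurd ⟨k1, k2⟩ hc

/-! ### Paired flips along a chain -/

/-- Treat the edge set whose number is in the register `c`. -/
def chainFlipStep (s : Side) : List Prog :=
  [countInserted s Name.c,
    when moreThanHalf [pairedFlip s (at1 (.own s) Name.c) (at1 (.mat s) Name.c)],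
    decr .c]

theorem exec_chainFlipStep {m : Cell → ℕ} (h : G.Prepared m) (hL : G.Layout m) {k : ℕ}
    (hc : m (.c, 0, 0) = k) (h1 : 1 ≤ k) (h2 : k ≤ m (.num s, 0, 0)) {R : ℕ → Prop}
    (hR : G.IsEdgeSet m s k R) (hRc : ∀ j, R j → G.c s (m (.own s, k, 0)) j) :
    G.Layout ((block (chainFlipStep s)).exec m) ∧
    (block (chainFlipStep s)).exec m (.c, 0, 0) = k - 1 ∧
    G.Half (G.order ((block (chainFlipStep s)).exec m)) R ∧
    ∀ j < G.n, j ≠ G.i → ¬ G.c s (m (.own s, k, 0)) j →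
      (G.Crosses (G.order ((block (chainFlipStep s)).exec m)) j ↔ G.Crosses (G.order m) j) := by
  unfold chainFlipStep
  rw [exec_cons, exec_cons, exec_cons, exec_nil]
  obtain ⟨s1, l1, o1, c1, c2⟩ := exec_countInserted (s := s) (e := Name.c) h.toBase hL
    (fun m' hm' => (hm' .c (by simp) 0 0).trans hc) hR
  have hhalf := not_half_iff (G := G) (b := G.order m) c1 c2
  generalize (countInserted s Name.c).exec m = m₁ at *
  have p1 := h.same s1
  have hpair := h.mat s k h1 h2
  obtain ⟨v', hown, hi, hi'⟩ := (h.chain s).own k h1 h2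
  have hv' := hpair.eq_right hown
  rw [← hv'] at hi'
  have hdec : ∀ m' : Cell → ℕ, G.Layout m' → m' (.c, 0, 0) = k → G.Layout ((decr .c).exec m') ∧
      (decr .c).exec m' (.c, 0, 0) = k - 1 ∧ G.order ((decr .c).exec m') = G.order m' := by
    intro m' hl hk
    have hF := (decr .c).frame_exec m'
    exact ⟨hl.frame hF (by decide), by simp [hk, decr], order_frame hF (by decide)⟩
  by_cases hh : G.Half (G.order m) R
  · rw [exec_when_neg (fun h => hhalf.1 h hh)]
    obtain ⟨d1, d2, d3⟩ := hdec m₁ l1 ((s1 .c (by simp) 0 0).trans hc)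
    rw [d3, o1]
    exact ⟨d1, d2, hh, fun _ _ _ _ => Iff.rfl⟩
  · rw [exec_when_pos (hhalf.2 hh), exec_cons, exec_nil]
    obtain ⟨l2, s2, o2⟩ := exec_pairedFlip (s := s) (e := at1 (.own s) Name.c)
      (f := at1 (.mat s) Name.c) (u := m (.own s, k, 0)) (v := m (.mat s, k, 0)) p1.toBase l1
      (Stable.of_same fun m' hm' => by
        have e1 := (s1.trans hm') .c (by simp) 0 0
        have e2 := (s1.trans hm') (.own s) (by cases s <;> simp) k 0
        simp [at1, e1, e2, hc]) hpair.left.lt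
      (fun m' hm' => by
        have e1 := (s1.trans hm') .c (by simp) 0 0
        have e2 := (s1.trans hm') (.mat s) (by cases s <;> simp) k 0
        simp [at1, e1, e2, hc]) hpair.right.lt hpair.matched
    rw [o1] at o2
    obtain ⟨d1, d2, d3⟩ := hdec _ l2 (((s1.trans s2) .c (by simp) 0 0).trans hc)
    have key : ∀ j < G.n, j ≠ G.i → (G.Crosses (G.flipAt s.other (m (.mat s, k, 0))
        (G.flipAt s (m (.own s, k, 0)) (G.order m))) j ↔
        ¬ (G.Crosses (G.order m) j ↔ G.c s (m (.own s, k, 0)) j)) := fun j hj hji =>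
      hL.planar.crosses_pairedFlip hpair.left.lt hi hi' hj hji
    rw [d3, o2]
    refine ⟨d1, d2, half_of_toggle hh fun j hj hji hjR => ?_, fun j hj hji hjk => ?_⟩
    · rw [key j hj hji]; simp [hRc j hjR]
    · rw [key j hj hji]; simp [hjk]

theorem exec_chainFlips {m : Cell → ℕ} (h : G.Prepared m) (hL : G.Layout m)
    (hE : ∀ k, 1 ≤ k → k ≤ m (.num s, 0, 0) → G.IsEdgeSet m s k
      (G.Ring s (fun k => m (.own s, k, 0)) k)) :
    G.Layout ((chainFlips s).exec m) ∧
    (∀ k, 1 ≤ k → k ≤ m (.num s, 0, 0) → G.Half (G.order ((chainFlips s).exec m))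
      (G.Ring s (fun k => m (.own s, k, 0)) k)) ∧
    ∀ j < G.n, j ≠ G.i →
      (∀ k, 1 ≤ k → k ≤ m (.num s, 0, 0) → ¬ G.c s (m (.own s, k, 0)) j) →
      (G.Crosses (G.order ((chainFlips s).exec m)) j ↔ G.Crosses (G.order m) j) := by
  have hq := h.num_lt s
  set q := m (.num s, 0, 0) with hqdef
  unfold chainFlips
  rw [exec_cons, exec_cons, exec_nil]
  have hF0 := (put .c (Name.num s)).frame_exec m
  have hc0 : (put .c (Name.num s)).exec m (.c, 0, 0) = q := by simp [hqdef]
  have hP0 := h.frame hF0 (by cases s <;> decide)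
  have hL0 := hL.frame hF0 (by cases s <;> decide)
  have ho0 : G.order ((put .c (Name.num s)).exec m) = G.order m :=
    order_frame hF0 (by cases s <;> decide)
  have ee : ∀ k j, (put .c (Name.num s)).exec m (.eset s, k, j) = m (.eset s, k, j) :=
    fun k j => hF0 _ (by cases s <;> decide) _ _
  have ew : ∀ k, (put .c (Name.num s)).exec m (.own s, k, 0) = m (.own s, k, 0) :=
    fun k => hF0 _ (by cases s <;> decide) _ _
  have en : (put .c (Name.num s)).exec m (.num s, 0, 0) = q := hF0 _ (by cases s <;> decide) _ _
  generalize (put .c (Name.num s)).exec m = m₀ at *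
  have main := for_ind (x := .a) (e := Name.size) (l := [when (.lt 0 Name.c) (chainFlipStep s)])
    (m := m₀) (N := G.n) (by simpa using hP0.size)
    (fun a m' => G.Layout m' ∧ m' (.c, 0, 0) = q - a ∧
      (∀ k, q - a < k → k ≤ q → G.Half (G.order m') (G.Ring s (fun k => m (.own s, k, 0)) k)) ∧
      ∀ j < G.n, j ≠ G.i → (∀ k, 1 ≤ k → k ≤ q → ¬ G.c s (m (.own s, k, 0)) j) →
        (G.Crosses (G.order m') j ↔ G.Crosses (G.order m) j))
    ⟨hL0, hc0, fun k h1 h2 => by omega, fun j _ _ _ => by rw [ho0]⟩ (fun k m' v h => ?_) ?_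
  · obtain ⟨r1, -, r3, r4⟩ := main
    exact ⟨r1, fun k h1 h2 => r3 k (by omega) h2, r4⟩
  · have hF := Prog.frame_update .a m' v
    rw [order_frame hF (by decide)]
    exact ⟨h.1.frame hF (by decide), by simpa using h.2.1, h.2.2⟩
  intro a ha m' hF hka ⟨i1, i2, i3, i4⟩
  have hP' : G.Prepared m' := hP0.frame hF (by cases s <;> decide)
  have eo : ∀ k, m' (.own s, k, 0) = m (.own s, k, 0) :=
    fun k => (hF _ (by cases s <;> decide) _ _).trans (ew k)
  have en' : m' (.num s, 0, 0) = q := (hF _ (by cases s <;> decide) _ _).trans en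
  have ee' : ∀ k j, m' (.eset s, k, j) = m (.eset s, k, j) :=
    fun k j => (hF _ (by cases s <;> decide) _ _).trans (ee k j)
  rw [exec_cons, exec_nil]
  by_cases hpos : 0 < q - a
  · rw [exec_when_pos (by simpa [Cond.val, i2] using hpos)]
    obtain ⟨t1, t2, t3, t4⟩ := exec_chainFlipStep (s := s) hP' i1 i2 hpos (by omega)
      ((hE (q - a) hpos (by omega)).congr (ee' _) fun _ _ => Iff.rfl)
      (fun j hj => by rw [eo]; exact hj.1)
    simp only [eo] at t4
    refine ⟨t1, by rw [t2]; omega, fun k h1 h2 => ?_, fun j hj hji hjk => ?_⟩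
    · by_cases hk : k = q - a
      · rw [hk]; exact t3
      · refine (i3 k (by omega) h2).congr (fun _ _ _ => Iff.rfl) fun j hj hji hr => ?_
        refine (t4 j hj hji fun hc => hr.2 (by omega) ?_).symm
        exact (h.chain s).mono (q - a) (k - 1) (by omega) (by omega) j hc
    · rw [t4 j hj hji (hjk _ hpos (by omega)), i4 j hj hji hjk]
  · rw [exec_when_neg (by simpa [Cond.val, i2] using hpos)]
    exact ⟨i1, by omega, fun k h1 h2 => i3 k (by omega) h2, i4⟩

/-! ### Subtree switches at the parents -/

theorem stable_parent {m m' : Cell → ℕ} (hs : Same m m') :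
    (parent s).val m' = m (.own s, 0, 0) :=
  hs (.own s) (by cases s <;> simp) 0 0

theorem exec_parentSwitch {m : Cell → ℕ} (h : G.Prepared m) (hL : G.Layout m) {R : ℕ → Prop}
    (hR : G.IsEdgeSet m s 0 R) (hRc : ∀ j, R j → G.c s (m (.own s, 0, 0)) j) :
    G.Layout ((parentSwitch s).exec m) ∧ G.Half (G.order ((parentSwitch s).exec m)) R ∧
    ∀ j < G.n, j ≠ G.i → ¬ G.c s (m (.own s, 0, 0)) j →
      (G.Crosses (G.order ((parentSwitch s).exec m)) j ↔ G.Crosses (G.order m) j) := by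
  unfold parentSwitch
  rw [exec_cons, exec_cons, exec_nil]
  obtain ⟨s1, l1, o1, c1, c2⟩ := exec_countInserted (s := s) (e := 0) h.toBase hL
    (fun _ _ => rfl) hR
  have hhalf := not_half_iff (G := G) (b := G.order m) c1 c2
  generalize (countInserted s 0).exec m = m₁ at *
  by_cases hh : G.Half (G.order m) R
  · rw [exec_when_neg (fun h => hhalf.1 h hh), o1]
    exact ⟨l1, hh, fun _ _ _ _ => Iff.rfl⟩
  · have hp := (h.chain s).parent
    obtain ⟨l2, -, o2⟩ := exec_subtreeSwitch (s := s) (e := parent s) (h.same s1).toBase l1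
      (fun m' hm' => stable_parent (s1.trans hm')) hp
    rw [exec_when_pos (hhalf.2 hh), exec_cons, exec_nil, o2, o1]
    refine ⟨l2, half_of_toggle hh fun j hj hji hjR => ?_, fun j hj hji hjk => ?_⟩
    · rw [hL.planar.crosses_switchAt hp hj hji]; simp [hRc j hjR]
    · rw [hL.planar.crosses_switchAt hp hj hji]; simp [hjk]

open Classical in
theorem exec_parentSwitchAll {m : Cell → ℕ} (h : G.Prepared m) (hL : G.Layout m)
    (hR : G.IsEdgeSet m s 0 (G.c s (m (.own s, 0, 0))))
    (huni : ∀ j k, j ≠ G.i → k ≠ G.i → G.c s (m (.own s, 0, 0)) j → G.c s (m (.own s, 0, 0)) k →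
      (G.Crosses (G.order m) j ↔ G.Crosses (G.order m) k)) :
    G.Layout ((parentSwitchAll s).exec m) ∧
    (∀ j, j ≠ G.i → G.c s (m (.own s, 0, 0)) j →
      ¬ G.Crosses (G.order ((parentSwitchAll s).exec m)) j) ∧
    ∀ j < G.n, j ≠ G.i → ¬ G.c s (m (.own s, 0, 0)) j →
      (G.Crosses (G.order ((parentSwitchAll s).exec m)) j ↔ G.Crosses (G.order m) j) := by
  unfold parentSwitchAll
  rw [exec_cons, exec_cons, exec_nil]
  obtain ⟨s1, l1, o1, -, c2⟩ := exec_countInserted (s := s) (e := 0) h.toBase hL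
    (fun _ _ => rfl) hR
  have H := G.hier s
  generalize (countInserted s 0).exec m = m₁ at *
  by_cases hz : m₁ (.uncrossed, 0, 0) = 0
  · have hp := (h.chain s).parent
    obtain ⟨l2, -, o2⟩ := exec_subtreeSwitch (s := s) (e := parent s) (h.same s1).toBase l1
      (fun m' hm' => stable_parent (s1.trans hm')) hp
    rw [exec_when_pos (by simpa [Cond.val] using decide_eq_true hz), exec_cons, exec_nil, o2, o1]
    refine ⟨l2, fun j hji hjk => ?_, fun j hj hji hjk => ?_⟩
    · have hj := H.c_lt _ _ hjk
      rw [hL.planar.crosses_switchAt hp hj hji]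
      rw [hz] at c2
      have := Finset.filter_eq_empty_iff.1 (Finset.card_eq_zero.1 c2.symm) (Finset.mem_range.2 hj)
      have : G.Crosses (G.order m) j := by
        by_contra hc; exact this ⟨⟨hji, hjk⟩, hc⟩
      simp [this, hjk]
    · rw [hL.planar.crosses_switchAt hp hj hji]; simp [hjk]
  · rw [exec_when_neg (by intro h; exact hz (by simpa [Cond.val] using h)), o1]
    refine ⟨l1, fun j hji hjk => ?_, fun _ _ _ _ => Iff.rfl⟩
    obtain ⟨k, hk⟩ := Finset.card_pos.1 (Nat.pos_of_ne_zero (fun h => hz (c2.trans h)))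
    obtain ⟨-, ⟨hki, hkp⟩, hkc⟩ := Finset.mem_filter.1 hk
    rwa [huni j k hji hki hjk hkp]

end Setup

end Tangle

namespace Tangle

theorem arrayOrder_congr_of_lt {n : ℕ} {e a a' : ℕ → ℕ} (h : ∀ k < n, a' k = a k) :
    arrayOrder n e a' = arrayOrder n e a := by
  funext j k
  refine propext (and_congr_right fun _ => and_congr_right fun _ => ?_)
  refine exists_congr fun p => exists_congr fun q => and_congr_right fun h1 =>
    and_congr_right fun h2 => ?_
  rw [h p (h1.trans h2), h q h2]

theorem IsPermArray.congr {n : ℕ} {a a' : ℕ → ℕ} (ha : IsPermArray n a)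
    (h : ∀ k < n, a' k = a k) : IsPermArray n a' := by
  refine ⟨fun k hk => by rw [h k hk]; exact ha.lt k hk, fun j hj k hk => ?_⟩
  rw [h j hj, h k hk]
  exact ha.inj j hj k hk

theorem IsPermArray.arrayOrder_irrefl {n : ℕ} {e a : ℕ → ℕ} (ha : IsPermArray n a) (j : ℕ) :
    ¬ arrayOrder n e a j j := by
  rintro ⟨-, -, p, q, h1, h2, h3, h4⟩
  have := ha.inj p (h1.trans h2) q h2 (h3.trans h4.symm)
  omega

namespace Setup

open Hier

variable {G : Setup} {s : Side} {u v : ℕ}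

/-! ### All crossings -/

open Classical in
theorem Planar.sum_crossings {b : Side → ℕ → ℕ → Prop} (hb : G.Planar b)
    (hirr : ∀ s j, ¬ b s j j) :
    ∑ j ∈ Finset.range G.n, ((Finset.range G.n).filter fun k => b .T j k ∧ b .S k j).card =
      G.numCross b := by
  rw [← Finset.card_sigma]
  unfold numCross
  have asymm : ∀ s j k, j < G.n → k < G.n → b s j k → ¬ b s k j := by
    intro s j k hj hk h
    exact ((hb.order s).total j hj k hk (by rintro rfl; exact hirr _ _ h)).1 h
  have total : ∀ s j, j < G.n → j ≠ G.i → (b s j G.i ↔ ¬ b s G.i j) := fun s j hj hji =>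
    (hb.order s).total j hj _ G.i_lt hji
  have one : ∀ j k, j < G.n → k < G.n → b .T j k → b .S k j → j = G.i ∨ k = G.i := by
    intro j k hj hk h1 h2
    by_contra! h
    exact asymm .S k j hk hj h2 ((hb.planar .T j hj k hk h.1 h.2).1 h1)
  have hmem : ∀ p : (_ : ℕ) × ℕ, p ∈ ((Finset.range G.n).sigma fun j =>
      (Finset.range G.n).filter fun k => b .T j k ∧ b .S k j) ↔
      p.1 < G.n ∧ p.2 < G.n ∧ b .T p.1 p.2 ∧ b .S p.2 p.1 := by
    intro p; simp only [Finset.mem_sigma, Finset.mem_filter, Finset.mem_range]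
  refine Finset.card_bij (fun p _ => if p.1 = G.i then p.2 else p.1) ?_ ?_ ?_
  · rintro ⟨j, k⟩ hjk
    obtain ⟨hj, hk, h1, h2⟩ := (hmem _).1 hjk
    simp only at hj hk h1 h2
    rw [Finset.mem_filter, Finset.mem_range]
    unfold Crosses
    split_ifs with hji
    · subst hji
      have hki : k ≠ G.i := by rintro rfl; exact hirr _ _ h1
      refine ⟨hk, hki, ?_⟩
      have := total .T k hk hki
      tauto
    · obtain rfl := (one j k hj hk h1 h2).resolve_left hji
      refine ⟨hj, hji, ?_⟩
      have := total .S j hj hji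
      tauto
  · rintro ⟨j, k⟩ h ⟨j', k'⟩ h' heq
    obtain ⟨hj, hk, h1, h2⟩ := (hmem _).1 h
    obtain ⟨hj', hk', h1', h2'⟩ := (hmem _).1 h'
    simp only at hj hk h1 h2 hj' hk' h1' h2' heq
    have o := one j k hj hk h1 h2
    have o' := one j' k' hj' hk' h1' h2'
    split_ifs at heq with c1 c2 c2
    · rw [c1, c2, heq]
    · obtain rfl := o'.resolve_left c2
      subst c1 heq
      exact absurd h1' (asymm _ _ _ hj hk h1)
    · obtain rfl := o.resolve_left c1
      subst c2 heq
      exact absurd h1' (asymm _ _ _ hj hk h1)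
    · rw [o.resolve_left c1, o'.resolve_left c2, heq]
  · intro j hj
    obtain ⟨hj, hji, hc⟩ := Finset.mem_filter.1 hj
    rw [Finset.mem_range] at hj
    unfold Crosses at hc
    have t1 := total .T j hj hji
    have t2 := total .S j hj hji
    by_cases h : b .T j G.i
    · exact ⟨⟨j, G.i⟩, (hmem _).2 ⟨hj, G.i_lt, h, by tauto⟩, by simp [hji]⟩
    · exact ⟨⟨G.i, j⟩, (hmem _).2 ⟨G.i_lt, hj, by tauto, by tauto⟩, by simp⟩

theorem Layout.irrefl {m : Cell → ℕ} (h : G.Layout m) (s : Side) (j : ℕ) : ¬ G.order m s j j :=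
  (h.perm s).arrayOrder_irrefl j

/-- Count the crossings of the edge in the register `b` with the edges that start below it. -/
def countRow : Prog :=
  for' .c Name.size [
    when (.and (isAbove .T Name.b Name.c) (isAbove .S Name.c Name.b)) [incr .total]]

theorem HasPos.frame {m m' : Cell → ℕ} (h : G.HasPos m) {p : Prog} (hF : p.Frame m m')
    (hp : p.keepsAll [.lay .T, .lay .S, .pos .T, .pos .S] = true) : G.HasPos m' := by
  intro s k hk
  rw [hF.of_keepsAll hp (y := .lay s) (by cases s <;> decide),
    hF.of_keepsAll hp (y := .pos s) (by cases s <;> decide)]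
  exact h s k hk

open Classical in
theorem exec_countRow {m : Cell → ℕ} (hB : G.Base m) (hL : G.Layout m) (hp : G.HasPos m) {j : ℕ}
    (hb : m (.b, 0, 0) = j) (hj : j < G.n) :
    countRow.exec m (.total, 0, 0) = m (.total, 0, 0) + ((Finset.range G.n).filter
      fun k => G.order m .T j k ∧ G.order m .S k j).card := by
  refine for_ind (N := G.n) (by simpa using hB.size) (fun c m' => m' (.total, 0, 0) =
    m (.total, 0, 0) + ((Finset.range c).filter
      fun k => G.order m .T j k ∧ G.order m .S k j).card) (by simp) (fun k m' v h => by
      simpa only [update_cell, reduceCtorEq, false_and, if_false] using h) ?_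
  intro k hk m' hF hkc hI
  have ho : G.order m' = G.order m := order_frame hF (by decide)
  have hL' := hL.frame hF (by decide)
  have hp' := hp.frame hF (by decide)
  have hB' := hB.frame hF (by decide)
  have hb' : m' (.b, 0, 0) = j := (hF _ (by decide) _ _).trans hb
  rw [exec_cons, exec_nil, Finset.range_add_one, Finset.filter_insert]
  have hc : (Cond.and (isAbove .T Name.b Name.c) (isAbove .S Name.c Name.b)).val m' = true ↔
      G.order m .T j k ∧ G.order m .S k j := by
    simp only [Cond.val, Bool.and_eq_true]
    rw [val_isAbove hB' hL' hp' (j := j) (k := k) (by simpa using hb') (by simpa using hkc) hj hk,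
      val_isAbove hB' hL' hp' (j := k) (k := j) (by simpa using hkc) (by simpa using hb') hk hj, ho]
  by_cases h : G.order m .T j k ∧ G.order m .S k j
  · rw [exec_when_pos (hc.2 h), if_pos h, Finset.card_insert_of_notMem (by simp)]
    simp [exec_cons, exec_nil, hI]
    rfl
  · rw [exec_when_neg (hc.not.2 h), if_neg h]
    exact hI

theorem exec_countAll {m : Cell → ℕ} (hB : G.Base m) (hL : G.Layout m) :
    countAll.exec m (.total, 0, 0) = G.numCross (G.order m) := by
  classical
  have e1 : countAll.exec m = (for' .b Name.size [countRow]).exec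
      ((put .total 0).exec ((positions .S).exec ((positions .T).exec m))) := rfl
  rw [e1]
  have hpos := exec_positions_both hB hL
  have hF := Prog.frame_exec (block [positions .T, positions .S, put .total 0]) m
  have hF3 := Prog.frame_exec (put .total 0) ((positions .S).exec ((positions .T).exec m))
  have e2 : (block [positions .T, positions .S, put .total 0]).exec m =
    (put .total 0).exec ((positions .S).exec ((positions .T).exec m)) := rfl
  rw [e2] at hF
  have hpos' := hpos.frame hF3 (by decide)
  have h0 : (put .total 0).exec ((positions .S).exec ((positions .T).exec m)) (.total, 0, 0) = 0 := by
    simp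
  generalize (put .total 0).exec ((positions .S).exec ((positions .T).exec m)) = m₁ at *
  have hB1 := hB.frame hF (by decide)
  have hL1 := hL.frame hF (by decide)
  have ho : G.order m₁ = G.order m := order_frame hF (by decide)
  rw [← ho, ← hL1.planar.sum_crossings hL1.irrefl]
  refine for_ind (N := G.n) (by simpa using hB1.size) (fun b m' => m' (.total, 0, 0) =
    ∑ j ∈ Finset.range b, ((Finset.range G.n).filter
      fun k => G.order m₁ .T j k ∧ G.order m₁ .S k j).card) (by simpa using h0) (fun k m' v h => by
      simpa only [update_cell, reduceCtorEq, false_and, if_false] using h) ?_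
  intro b hb m' hF' hkb hI
  have ho' : G.order m' = G.order m₁ := order_frame hF' (by decide)
  rw [exec_cons, exec_nil, exec_countRow (hB1.frame hF' (by decide)) (hL1.frame hF' (by decide))
    (hpos'.frame hF' (by decide)) hkb hb, hI, Finset.sum_range_succ, ho']

/-! ### Comparison of layouts -/

/-- The order of the edges on the side `s` in the best layout so far. -/
def optOrder (G : Setup) (m : Cell → ℕ) (s : Side) : ℕ → ℕ → Prop :=
  arrayOrder G.n (G.e s) fun k => m (.opt s, k, 0)

/-- The best layout so far is at least as good as the layouts in `B`. -/
def Kept (G : Setup) (m : Cell → ℕ) (B : List (Side → ℕ → ℕ → Prop)) : Prop :=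
  (B = [] ∧ m (.found, 0, 0) = 0) ∨ (m (.found, 0, 0) = 1 ∧
    (∀ s, IsPermArray G.n fun k => m (.opt s, k, 0)) ∧ G.Planar (G.optOrder m) ∧
    m (.best, 0, 0) = G.numCross (G.optOrder m) ∧ ∀ b ∈ B, m (.best, 0, 0) ≤ G.numCross b)

theorem Kept.congr {m m' : Cell → ℕ} {B : List (Side → ℕ → ℕ → Prop)} (h : G.Kept m B)
    (he : ∀ y ∈ [Name.found, .best, .opt .T, .opt .S], ∀ a b, m' (y, a, b) = m (y, a, b)) :
    G.Kept m' B := by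
  have e1 : ∀ s k, m' (.opt s, k, 0) = m (.opt s, k, 0) :=
    fun s k => he _ (by cases s <;> decide) _ _
  unfold Kept optOrder at *
  simp only [e1, he .found (by decide), he .best (by decide)]
  exact h

/-- Copy the lists `x T` and `x S` to `y T` and `y S`. -/
def copyLists (x y : Side → Name) : Prog :=
  for' .b Name.size [
    put1 (y .T) Name.b (at1 (x .T) Name.b), put1 (y .S) Name.b (at1 (x .S) Name.b)]

theorem exec_copyLists {x y : Side → Name} (hne : ∀ s t, x s ≠ y t) (hy : y .T ≠ y .S)
    (hb : ∀ s, x s ≠ .b ∧ y s ≠ .b) {m : Cell → ℕ} (hs : m (.size, 0, 0) = G.n) (s : Side) :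
    ∀ k < G.n, (copyLists x y).exec m (y s, k, 0) = m (x s, k, 0) := by
  have main := for_ind (N := G.n) (x := .b) (e := Name.size) (m := m) (l := [
    put1 (y .T) Name.b (at1 (x .T) Name.b), put1 (y .S) Name.b (at1 (x .S) Name.b)])
    (by simpa using hs) (fun b m' => ∀ s, ∀ k < b, m' (y s, k, 0) = m (x s, k, 0)) (by simp)
    (fun k m' v h s j hj => by
      simpa only [update_cell, (hb s).2, false_and, if_false] using h s j hj) ?_
  · exact main s
  intro b _ m' hF hkb hI s k hk
  have hx : ∀ s k, m' (x s, k, 0) = m (x s, k, 0) := fun s k => hF _ (by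
    simp [for', block, put1, Prog.keeps, (hb s).1.symm, (hne s _).symm]) _ _
  have hI' := hI s k
  have h1 := hne .S .T
  have h2 := hy.symm
  cases s
  all_goals
    simp only [exec_cons, exec_nil, put1, at1, exec_set, Expr.val, reg, val_zero, update_cell, hkb,
      hx, hy, h1, h2, (hb _).2.symm, true_and, and_true, false_and, if_false]
    split_ifs with h
    · rw [h]
    · exact hI' (by omega)

theorem exec_compareLayout {m : Cell → ℕ} (hB : G.Base m) (hL : G.Layout m)
    {B : List (Side → ℕ → ℕ → Prop)} (hK : G.Kept m B) :
    G.Kept (compareLayout.exec m) (G.order m :: B) := by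
  have e1 : compareLayout.exec m = (when (.or (.eq Name.found 0) (.lt Name.total Name.best))
      [put .found 1, put .best Name.total, copyLists .lay .opt]).exec (countAll.exec m) := rfl
  rw [e1]
  have ht := exec_countAll hB hL
  have hF := countAll.frame_exec m
  generalize countAll.exec m = m₁ at *
  have hK1 : G.Kept m₁ B := hK.congr fun y hy => hF y (by revert hy; revert y; decide)
  have hB1 := hB.frame hF (by decide)
  have hL1 := hL.frame hF (by decide)
  have ho : G.order m₁ = G.order m := order_frame hF (by decide)
  by_cases hc : m₁ (.found, 0, 0) = 0 ∨ m₁ (.total, 0, 0) < m₁ (.best, 0, 0)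
  · rw [exec_when_pos (by simpa [Cond.val] using hc), exec_cons, exec_cons, exec_cons, exec_nil]
    have hF2 := Prog.frame_exec (block [put .found 1, put .best Name.total]) m₁
    have e2 : (put .best Name.total).exec ((put .found 1).exec m₁) =
      (block [put .found 1, put .best Name.total]).exec m₁ := rfl
    rw [e2]
    have v1 : (block [put .found 1, put .best Name.total]).exec m₁ (.found, 0, 0) = 1 ∧
        (block [put .found 1, put .best Name.total]).exec m₁ (.best, 0, 0) =
          m₁ (.total, 0, 0) := by
      simp [exec_cons, exec_nil, put]
    generalize (block [put .found 1, put .best Name.total]).exec m₁ = m₂ at *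
    have hc3 := fun s => exec_copyLists (G := G) (x := .lay) (y := .opt) (m := m₂) (by decide)
      (by decide) (by decide) (hB1.frame hF2 (by decide)).size s
    have hF3 := (copyLists .lay .opt).frame_exec m₂
    generalize (copyLists .lay .opt).exec m₂ = m₃ at *
    have hL2 := hL1.frame hF2 (by decide)
    have ho3 : G.optOrder m₃ = G.order m := by
      rw [← ho, ← order_frame hF2 (by decide)]
      funext s
      exact arrayOrder_congr_of_lt (hc3 s)
    refine Or.inr ⟨(hF3 _ (by decide) _ _).trans v1.1, fun s => (hL2.perm s).congr (hc3 s), ?_, ?_, ?_⟩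
    · rw [ho3]; exact hL.planar
    · rw [hF3 _ (by decide), v1.2, ht, ho3]
    · rw [hF3 _ (by decide), v1.2, ht]
      intro b hb
      rcases List.mem_cons.1 hb with rfl | hb
      · exact le_rfl
      · rcases hK1 with ⟨rfl, -⟩ | ⟨h1, -, -, -, h5⟩
        · simp at hb
        · have := h5 b hb
          omega
  · rw [exec_when_neg (by simpa [Cond.val] using hc)]
    push Not at hc
    rcases hK1 with ⟨-, h⟩ | ⟨h1, h2, h3, h4, h5⟩
    · exact absurd h hc.1
    · refine Or.inr ⟨h1, h2, h3, h4, fun b hb => ?_⟩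
      rcases List.mem_cons.1 hb with rfl | hb
      · rw [← ht]; exact hc.2
      · exact h5 b hb

end Setup

end Tangle

namespace Tangle

namespace Setup

open Hier

variable {G : Setup} {s : Side} {u v : ℕ}

/-- The memory holds a layout with the fewest crossings. -/
structure Optimal (G : Setup) (m : Cell → ℕ) : Prop extends G.Layout m where
  le : ∀ b, G.Planar b → G.numCross (G.order m) ≤ G.numCross b

theorem numCross_congr {b b' : Side → ℕ → ℕ → Prop}
    (h : ∀ j < G.n, j ≠ G.i → (G.Crosses b j ↔ G.Crosses b' j)) : G.numCross b = G.numCross b' := by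
  classical
  unfold numCross
  congr 1
  refine Finset.filter_congr fun j hj => and_congr_right fun hji => ?_
  exact h j (Finset.mem_range.1 hj) hji

theorem half_of_forall_not {b : Side → ℕ → ℕ → Prop} {R : ℕ → Prop}
    (h : ∀ j, j ≠ G.i → R j → ¬ G.Crosses b j) : G.Half b R := by
  classical
  unfold Half
  rw [Finset.filter_false_of_mem (p := fun j => (j ≠ G.i ∧ R j) ∧ G.Crosses b j)
    (fun j _ h' => h j h'.1.1 h'.1.2 h'.2)]
  simp

/-! ### Trying four layouts -/

theorem exec_trySwitch {m : Cell → ℕ} (h : G.Prepared m) (hL : G.Layout m)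
    {B : List (Side → ℕ → ℕ → Prop)} (hK : G.Kept m B) (s : Side) :
    ∃ m', (block [subtreeSwitch s (parent s), compareLayout]).exec m = m' ∧
      G.Prepared m' ∧ G.Layout m' ∧ (∀ t, m' (.own t, 0, 0) = m (.own t, 0, 0)) ∧
      G.order m' = G.switchAt s (m (.own s, 0, 0)) (G.order m) ∧ G.Kept m' (G.order m' :: B) := by
  refine ⟨_, rfl, ?_⟩
  rw [exec_cons, exec_cons, exec_nil]
  obtain ⟨l1, s1, o1⟩ := exec_subtreeSwitch (s := s) (e := parent s) h.toBase hL
    (fun m' hm' => stable_parent hm') (h.chain s).parent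
  generalize (subtreeSwitch s (parent s)).exec m = m₁ at *
  have p1 := h.same s1
  have k1 : G.Kept m₁ B := hK.congr fun y hy => s1 y (by revert hy; revert y; decide)
  have k2 := exec_compareLayout p1.toBase l1 k1
  have hF := compareLayout.frame_exec m₁
  generalize compareLayout.exec m₁ = m₂ at *
  have o2 : G.order m₂ = G.order m₁ := order_frame hF (by decide)
  refine ⟨p1.frame hF (by decide), l1.frame hF (by decide), fun t => ?_, o2.trans o1, ?_⟩
  · rw [hF _ (by cases t <;> decide)]; exact s1 _ (by cases t <;> decide) _ _
  · rw [o2]; exact k2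

theorem exec_tryAll {m : Cell → ℕ} (h : G.Prepared m) (hL : G.Layout m)
    (hemp : ∀ s u, ¬ G.Own s u) : G.Optimal (tryAll.exec m) := by
  have e1 : tryAll.exec m = (copyLists .opt .lay).exec
      ((block [subtreeSwitch .T (parent .T), compareLayout]).exec
        ((block [subtreeSwitch .S (parent .S), compareLayout]).exec
          ((block [subtreeSwitch .T (parent .T), compareLayout]).exec
            (compareLayout.exec ((put .found 0).exec m))))) := rfl
  rw [e1]
  have hF0 := (put .found 0).frame_exec m
  have k0 : G.Kept ((put .found 0).exec m) [] := Or.inl ⟨rfl, by simp⟩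
  generalize (put .found 0).exec m = m₀ at *
  have p0 := h.frame hF0 (by decide)
  have l0 := hL.frame hF0 (by decide)
  have k1 := exec_compareLayout p0.toBase l0 k0
  have hF1 := compareLayout.frame_exec m₀
  generalize compareLayout.exec m₀ = m₁ at *
  have p1 := p0.frame hF1 (by decide)
  have l1 := l0.frame hF1 (by decide)
  rw [← order_frame hF1 (by decide)] at k1
  obtain ⟨m₂, e2, p2, l2, w2, o2, k2⟩ := exec_trySwitch p1 l1 k1 .T
  rw [e2]
  obtain ⟨m₃, e3, p3, l3, w3, o3, k3⟩ := exec_trySwitch p2 l2 k2 .S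
  rw [e3]
  obtain ⟨m₄, e4, p4, l4, w4, o4, k4⟩ := exec_trySwitch p3 l3 k3 .T
  rw [e4]
  have hcp := fun s => exec_copyLists (G := G) (x := .opt) (y := .lay) (m := m₄) (by decide)
    (by decide) (by decide) p4.size s
  generalize (copyLists .opt .lay).exec m₄ = m₅ at *
  obtain ⟨k, -⟩ | ⟨-, k5, k6, k7, k8⟩ := k4
  · simp at k
  have o5 : G.order m₅ = G.optOrder m₄ := by
    funext s
    exact arrayOrder_congr_of_lt (hcp s)
  refine ⟨⟨fun s => (k5 s).congr (hcp s), by rw [o5]; exact k6⟩, fun b hb => ?_⟩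
  rw [o5, ← k7]
  have hp := fun s => (p1.chain s).parent
  obtain ⟨x, hx⟩ := l1.planar.crosses_of_empty hb (p := fun s => m₁ (.own s, 0, 0)) hp hemp
  have c2 : ∀ j < G.n, j ≠ G.i → (G.Crosses (G.order m₂) j ↔
      ¬ (G.Crosses (G.order m₁) j ↔ G.c .T (m₁ (.own .T, 0, 0)) j)) := fun j hj hji => by
    rw [o2]; exact l1.planar.crosses_switchAt (hp .T) hj hji
  have c3 : ∀ j < G.n, j ≠ G.i → (G.Crosses (G.order m₃) j ↔
      ¬ (G.Crosses (G.order m₂) j ↔ G.c .S (m₁ (.own .S, 0, 0)) j)) := fun j hj hji => by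
    rw [o3, w2]; exact l2.planar.crosses_switchAt (hp .S) hj hji
  have c4 : ∀ j < G.n, j ≠ G.i → (G.Crosses (G.order m₄) j ↔
      ¬ (G.Crosses (G.order m₃) j ↔ G.c .T (m₁ (.own .T, 0, 0)) j)) := fun j hj hji => by
    rw [o4, w3, w2]; exact l3.planar.crosses_switchAt (hp .T) hj hji
  have key : ∀ b' ∈ [G.order m₄, G.order m₃, G.order m₂, G.order m₁],
      (∀ j < G.n, j ≠ G.i → (G.Crosses b' j ↔ G.Crosses b j)) →
      m₄ (.best, 0, 0) ≤ G.numCross b := fun b' hb' hc => by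
    rw [← numCross_congr hc]; exact k8 b' hb'
  have taut : ∀ a t s : Prop, (¬ (¬ (a ↔ t) ↔ s) ↔ (a ↔ (t ↔ s))) ∧
      (¬ (a ↔ t) ↔ (a ↔ (t ↔ False))) ∧ (¬ (¬ (¬ (a ↔ t) ↔ s) ↔ t) ↔ (a ↔ (False ↔ s))) := by
    intro a t s
    by_cases a <;> by_cases t <;> by_cases s <;> simp [*]
  by_cases xT : x .T <;> by_cases xS : x .S <;> simp only [xT, xS, true_and, false_and] at hx
  · refine key (G.order m₃) (by simp) fun j hj hji => ?_
    rw [hx j hj hji, c3 j hj hji, c2 j hj hji]; exact (taut _ _ _).1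
  · refine key (G.order m₂) (by simp) fun j hj hji => ?_
    rw [hx j hj hji, c2 j hj hji]; exact (taut _ _ True).2.1
  · refine key (G.order m₄) (by simp) fun j hj hji => ?_
    rw [hx j hj hji, c4 j hj hji, c3 j hj hji, c2 j hj hji]; exact (taut _ _ _).2.2
  · refine key (G.order m₁) (by simp) fun j hj hji => ?_
    rw [hx j hj hji]; simp

/-! ### The case of a parent above a chain -/

theorem parentAboveMax_iff {m : Cell → ℕ} (h : G.Prepared m) (s : Side) :
    (parentAboveMax s).val m = true ↔ 0 < m (.num s, 0, 0) ∧
      G.Le s.other (m (.mat s, m (.num s, 0, 0), 0)) (m (.own s.other, 0, 0)) := by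
  by_cases hq : 0 < m (.num s, 0, 0)
  · have hp := h.mat s _ hq le_rfl
    obtain ⟨v', hown, hi, hi'⟩ := (h.chain s).own _ hq le_rfl
    have hv' := hp.eq_right hown
    rw [← hv'] at hi'
    have hpar := (h.chain s.other).parent
    have hne : m (.own s.other, 0, 0) ≠ m (.mat s, m (.num s, 0, 0), 0) := by
      intro heq; rw [← heq] at hi'; exact hi' hpar.inserted
    have hd := h.desc s.other _ hpar.lt _ hp.right.lt
    simp [parentAboveMax, above, below, parent, at1, Cond.val, hq, ← hd, hne]
    exact ⟨of_decide_eq_true, decide_eq_true⟩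
  · simp [parentAboveMax, Cond.val, hq]

theorem not_meet {m : Cell → ℕ} (h : G.Prepared m) (hs : ¬ (parentAboveMax s).val m = true)
    (hq : 0 < m (.num s, 0, 0)) {j : ℕ} (hji : j ≠ G.i)
    (hj : G.c s (m (.own s, m (.num s, 0, 0), 0)) j) : ¬ G.c s.other (m (.own s.other, 0, 0)) j := by
  intro hj'
  have hp := h.mat s _ hq le_rfl
  obtain ⟨v', hown, hi, hi'⟩ := (h.chain s).own _ hq le_rfl
  have hv' := hp.eq_right hown
  rw [← hv'] at hi'
  refine hs ((parentAboveMax_iff h s).2 ⟨hq, ?_⟩)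
  refine (h.chain s.other).parent.mate_le (u := m (.own s, m (.num s, 0, 0), 0)) ?_ hi' hji hj'
    (by rwa [other_other])
  rw [other_other]; exact hp

theorem exec_insertionChain {m : Cell → ℕ} (h : G.Prepared m) (hL : G.Layout m)
    (hs : (parentAboveMax s).val m = true) : G.Optimal ((insertionChain s).exec m) := by
  obtain ⟨hq, hle⟩ := (parentAboveMax_iff h s).1 hs
  have hpair := h.mat s _ hq le_rfl
  have hch := h.chain
  have hmono := (hch s).mono
  have hother : s.other ≠ s := by cases s <;> decide
  have habove : ∀ j, j ≠ G.i → G.c s (m (.own s, m (.num s, 0, 0), 0)) j →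
      G.c s.other (m (.own s.other, 0, 0)) j := fun j hji hj =>
    hle j ((hpair.matched j hji).1 hj)
  have hq0 : m (.num s.other, 0, 0) = 0 := by
    by_contra hne
    obtain ⟨j, hji, hj⟩ := hpair.left.exists_ne
    have hown := (hch s.other).own 1 le_rfl (by omega)
    refine ((hch s).own _ hq le_rfl).disjoint hown hji hj ?_
    exact (hch s.other).mono 0 1 (by omega) (by omega) j (habove j hji hj)
  set q := m (.num s, 0, 0) with hqd
  unfold insertionChain
  rw [exec_cons, exec_cons, exec_cons, exec_cons, exec_cons, exec_cons, exec_nil]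
  -- the edge sets
  obtain ⟨r1, -, -⟩ := exec_edgeSet (s := s.other) (k := 0) (e := parent s.other)
    (f := at1 (.mat s) (Name.num s)) (r := 0) (u := m (.own s.other, 0, 0))
    (v := m (.mat s, q, 0)) h.toBase (fun m' hm' => by
      have e1 := hm' (.own s.other) (by simp) (by simp) 0 0
      have e2 := hm' (.mat s) (by simp) (by simp)
      have e3 := hm' (.num s) (by simp) (by simp) 0 0
      refine ⟨rfl, e1, ?_⟩
      simp [at1, e2, e3, hqd]) (hch s.other).parent.lt hpair.right.lt
  have F1 := Prog.frame_exec (edgeSet s.other 0 (parent s.other) (at1 (.mat s) (Name.num s))) m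
  generalize (edgeSet s.other 0 (parent s.other) (at1 (.mat s) (Name.num s))).exec m = m₁ at *
  have p1 := h.frame F1 (by cases s <;> decide)
  have l1 := hL.frame F1 (by cases s <;> decide)
  have w1 : ∀ k, m₁ (.own s, k, 0) = m (.own s, k, 0) := fun k => F1 _ (by cases s <;> decide) _ _
  have x1 : ∀ k, m₁ (.own s.other, k, 0) = m (.own s.other, k, 0) :=
    fun k => F1 _ (by cases s <;> decide) _ _
  have n1 : m₁ (.num s, 0, 0) = q := F1 _ (by cases s <;> decide) _ _
  obtain ⟨r2, -⟩ := exec_edgeSet_parent p1 s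
  rw [w1] at r2
  have F2 := Prog.frame_exec (edgeSet s 0 (parent s) (Name.ins s)) m₁
  generalize (edgeSet s 0 (parent s) (Name.ins s)).exec m₁ = m₂ at *
  have p2 := p1.frame F2 (by cases s <;> decide)
  have l2 := l1.frame F2 (by cases s <;> decide)
  have w2 : ∀ k, m₂ (.own s, k, 0) = m (.own s, k, 0) := fun k =>
    (F2 _ (by cases s <;> decide) _ _).trans (w1 k)
  have x2 : ∀ k, m₂ (.own s.other, k, 0) = m (.own s.other, k, 0) := fun k =>
    (F2 _ (by cases s <;> decide) _ _).trans (x1 k)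
  have n2 : m₂ (.num s, 0, 0) = q := (F2 _ (by cases s <;> decide) _ _).trans n1
  have r12 := r1.congr (m' := m₂) (fun j => F2 _ (by cases s <;> decide) _ _) fun j _ => Iff.rfl
  obtain ⟨r3, z3⟩ := exec_chainEdgeSets p2 s
  simp only [w2, n2] at r3
  have F3 := (chainEdgeSets s).frame_exec m₂
  generalize (chainEdgeSets s).exec m₂ = m₃ at *
  have p3 := p2.frame F3 (by cases s <;> decide)
  have l3 := l2.frame F3 (by cases s <;> decide)
  have w3 : ∀ k, m₃ (.own s, k, 0) = m (.own s, k, 0) := fun k =>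
    (F3 _ (by cases s <;> decide) _ _).trans (w2 k)
  have x3 : ∀ k, m₃ (.own s.other, k, 0) = m (.own s.other, k, 0) := fun k =>
    (F3 _ (by cases s <;> decide) _ _).trans (x2 k)
  have n3 : m₃ (.num s, 0, 0) = q := (F3 _ (by cases s <;> decide) _ _).trans n2
  have r13 := r12.congr (m' := m₃) (fun j => F3 _ (by cases s <;> decide) _ _) fun j _ => Iff.rfl
  have r23 := r2.congr (m' := m₃) z3 fun j _ => Iff.rfl
  -- the parent on the other side
  obtain ⟨l4, h4, -⟩ := exec_parentSwitch p3 l3 r13 (fun j hj => by rw [x3]; exact hj.1)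
  have F4 := (parentSwitch s.other).frame_exec m₃
  generalize (parentSwitch s.other).exec m₃ = m₄ at *
  have p4 := p3.frame F4 (by cases s <;> decide)
  have w4 : ∀ k, m₄ (.own s, k, 0) = m (.own s, k, 0) := fun k =>
    (F4 _ (by cases s <;> decide) _ _).trans (w3 k)
  have n4 : m₄ (.num s, 0, 0) = q := (F4 _ (by cases s <;> decide) _ _).trans n3
  have s4 : ∀ k j, m₄ (.eset s, k, j) = m₃ (.eset s, k, j) := fun k j =>
    F4 _ (by cases s <;> decide) _ _
  -- the chain
  obtain ⟨l5, h5, c5⟩ := exec_chainFlips (s := s) p4 l4 (fun k k1 k2 => by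
    simp only [w4]
    exact (r3 k k1 (n4 ▸ k2)).congr (s4 k) fun _ _ => Iff.rfl)
  simp only [w4, n4] at h5 c5
  have F5 := (chainFlips s).frame_exec m₄
  generalize (chainFlips s).exec m₄ = m₅ at *
  have p5 := p4.frame F5 (by cases s <;> decide)
  have w5 : ∀ k, m₅ (.own s, k, 0) = m (.own s, k, 0) := fun k =>
    (F5 _ (by cases s <;> decide) _ _).trans (w4 k)
  have s5 : ∀ k j, m₅ (.eset s, k, j) = m₃ (.eset s, k, j) := fun k j =>
    (F5 _ (by cases s <;> decide) _ _).trans (s4 k j)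
  -- the parent on this side
  obtain ⟨l6, h6, c6⟩ := exec_parentSwitch p5 l5 (r23.congr (s5 0) fun _ _ => Iff.rfl)
    (fun j hj => by rw [w5]; exact hj)
  simp only [w5] at c6
  generalize (parentSwitch s).exec m₅ = m₆ at *
  refine ⟨l6, fun b hb => l6.planar.numCross_le_of_above hb hch (s := s) hq0 habove ?_ ?_⟩
  · intro k hk
    rcases Nat.eq_zero_or_pos k with rfl | hpos
    · exact h6.congr (fun j _ _ => by simp [Ring]) fun _ _ _ _ => Iff.rfl
    · refine (h5 k hpos hk).congr (fun _ _ _ => Iff.rfl) fun j hj hji hr => (c6 j hj hji ?_).symm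
      exact fun hc => hr.2 hpos (hmono 0 (k - 1) (Nat.zero_le _) (by omega) j hc)
  · refine h4.congr (fun j _ hji => ?_) fun j hj hji hr => ?_
    · exact and_congr_right fun _ => not_congr (hpair.matched j hji).symm
    · have hnq : ∀ k, k ≤ q → ¬ G.c s (m (.own s, k, 0)) j := fun k hk hc =>
        hr.2 ((hpair.matched j hji).1 (hmono k q hk le_rfl j hc))
      rw [c6 j hj hji (hnq 0 (Nat.zero_le _)), c5 j hj hji fun k _ hk => hnq k hk]

end Setup

end Tangle

namespace Tangle

namespace Setup

open Hier

variable {G : Setup} {s : Side} {u v : ℕ}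

/-! ### The remaining case -/

/-- Look for an edge that belongs to the edge sets of both parents. -/
def findCommon : Prog :=
  for' .b Name.size [
    when (.and (holds (.eset .T) 0 Name.b) (holds (.eset .S) 0 Name.b)) [put .found 1]]

theorem exec_findCommon {m : Cell → ℕ} (hs : m (.size, 0, 0) = G.n) (h0 : m (.found, 0, 0) = 0)
    {R : Side → ℕ → Prop} (hR : ∀ s, G.IsEdgeSet m s 0 (R s)) :
    findCommon.exec m (.found, 0, 0) = 0 ↔ ∀ j < G.n, j ≠ G.i → R .T j → ¬ R .S j := by
  refine for_ind (N := G.n) (by simpa using hs)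
    (fun b m' => m' (.found, 0, 0) = 0 ↔ ∀ j < b, j ≠ G.i → R .T j → ¬ R .S j) (by simpa using h0)
    (fun k m' v h => by simpa only [update_cell, reduceCtorEq, false_and, if_false] using h) ?_
  intro b hb m' hF hkb hI
  have e : ∀ s j, m' (.eset s, 0, j) = m (.eset s, 0, j) :=
    fun s j => hF _ (by cases s <;> decide) _ _
  have hc : (Cond.and (holds (.eset .T) 0 Name.b) (holds (.eset .S) 0 Name.b)).val m' = true ↔
      b ≠ G.i ∧ R .T b ∧ R .S b := by
    have hv : ∀ s, (holds (.eset s) 0 Name.b).val m' = true ↔ b ≠ G.i ∧ R s b := by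
      intro s
      rw [← hR s b hb, ← e]
      subst hkb
      exact decide_eq_true_iff
    simp only [Cond.val, Bool.and_eq_true, hv]
    tauto
  rw [exec_cons, exec_nil]
  by_cases h : b ≠ G.i ∧ R .T b ∧ R .S b
  · rw [exec_when_pos (hc.2 h)]
    simp only [exec_cons, exec_nil, put, exec_set, Expr.val, val_zero, val_one, update_cell,
      and_self, if_true, one_ne_zero, false_iff]
    exact fun h' => h' b (by omega) h.1 h.2.1 h.2.2
  · rw [exec_when_neg (hc.not.2 h), hI]
    constructor
    · intro h' j hj hji h1 h2
      rcases Nat.lt_succ_iff_lt_or_eq.1 hj with hj | rfl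
      · exact h' j hj hji h1 h2
      · exact h ⟨hji, h1, h2⟩
    · exact fun h' j hj => h' j (by omega)

/-- The edge sets of the remaining case. -/
def allEdgeSets : Prog :=
  block [chainEdgeSets .S, chainEdgeSets .T, edgeSet .S 0 (parent .S) (Name.ins .S),
    edgeSet .T 0 (parent .T) (Name.ins .T)]

theorem exec_allEdgeSets {m : Cell → ℕ} (h : G.Prepared m) (s : Side) :
    (∀ k, 1 ≤ k → k ≤ m (.num s, 0, 0) → G.IsEdgeSet (allEdgeSets.exec m) s k
      (G.Ring s (fun k => m (.own s, k, 0)) k)) ∧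
    G.IsEdgeSet (allEdgeSets.exec m) s 0 (G.c s (m (.own s, 0, 0))) := by
  unfold allEdgeSets
  rw [exec_cons, exec_cons, exec_cons, exec_cons, exec_nil]
  obtain ⟨r1, -⟩ := exec_chainEdgeSets h .S
  have F1 := (chainEdgeSets .S).frame_exec m
  generalize (chainEdgeSets .S).exec m = m₁ at *
  have p1 := h.frame F1 (by decide)
  have w1 : ∀ t k, m₁ (.own t, k, 0) = m (.own t, k, 0) :=
    fun t k => F1 _ (by cases t <;> decide) _ _
  have n1 : ∀ t, m₁ (.num t, 0, 0) = m (.num t, 0, 0) := fun t => F1 _ (by cases t <;> decide) _ _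
  obtain ⟨r2, -⟩ := exec_chainEdgeSets p1 .T
  have F2 := (chainEdgeSets .T).frame_exec m₁
  generalize (chainEdgeSets .T).exec m₁ = m₂ at *
  have p2 := p1.frame F2 (by decide)
  have w2 : ∀ t k, m₂ (.own t, k, 0) = m₁ (.own t, k, 0) :=
    fun t k => F2 _ (by cases t <;> decide) _ _
  have e2 : ∀ k j, m₂ (.eset .S, k, j) = m₁ (.eset .S, k, j) := fun k j => F2 _ (by decide) _ _
  obtain ⟨r3, z3⟩ := exec_edgeSet_parent p2 .S
  have F3 := (edgeSet .S 0 (parent .S) (Name.ins .S)).frame_exec m₂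
  generalize (edgeSet .S 0 (parent .S) (Name.ins .S)).exec m₂ = m₃ at *
  have p3 := p2.frame F3 (by decide)
  have w3 : ∀ t k, m₃ (.own t, k, 0) = m₂ (.own t, k, 0) :=
    fun t k => F3 _ (by cases t <;> decide) _ _
  have e3 : ∀ k j, m₃ (.eset .T, k, j) = m₂ (.eset .T, k, j) := fun k j => F3 _ (by decide) _ _
  obtain ⟨r4, z4⟩ := exec_edgeSet_parent p3 .T
  have F4 := (edgeSet .T 0 (parent .T) (Name.ins .T)).frame_exec m₃
  generalize (edgeSet .T 0 (parent .T) (Name.ins .T)).exec m₃ = m₄ at *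
  have e4 : ∀ k j, m₄ (.eset .S, k, j) = m₃ (.eset .S, k, j) := fun k j => F4 _ (by decide) _ _
  simp only [w3, w2, w1, n1] at r2 r3 r4
  cases s
  · exact ⟨fun k k1 k2 => (r2 k k1 k2).congr (fun j => by rw [z4 k (by omega), e3])
      fun _ _ => Iff.rfl, r4⟩
  · exact ⟨fun k k1 k2 => (r1 k k1 k2).congr (fun j => by rw [e4, z3 k (by omega), e2])
      fun _ _ => Iff.rfl, r3.congr (fun j => e4 0 j) fun _ _ => Iff.rfl⟩

theorem exec_insertionRest {m : Cell → ℕ} (h : G.Prepared m) (hL : G.Layout m)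
    (hs : ∀ s, ¬ (parentAboveMax s).val m = true) : G.Optimal (insertionRest.exec m) := by
  have e1 : insertionRest.exec m = (Prog.ite (.eq Name.found 0)
      (block [parentSwitchAll .T, parentSwitchAll .S]) tryAll).exec (findCommon.exec
        ((put .found 0).exec ((chainFlips .S).exec ((chainFlips .T).exec
          (allEdgeSets.exec m))))) := rfl
  rw [e1]
  have hch := h.chain
  have r1 := exec_allEdgeSets h
  have F1 := allEdgeSets.frame_exec m
  generalize allEdgeSets.exec m = m₁ at *
  have p1 := h.frame F1 (by decide)
  have l1 := hL.frame F1 (by decide)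
  have w1 : ∀ t k, m₁ (.own t, k, 0) = m (.own t, k, 0) :=
    fun t k => F1 _ (by cases t <;> decide) _ _
  have n1 : ∀ t, m₁ (.num t, 0, 0) = m (.num t, 0, 0) := fun t => F1 _ (by cases t <;> decide) _ _
  -- flips in `T`
  obtain ⟨l2, h2, -⟩ := exec_chainFlips (s := .T) p1 l1 (by simpa only [w1, n1] using (r1 .T).1)
  simp only [w1, n1] at h2
  have F2 := (chainFlips .T).frame_exec m₁
  generalize (chainFlips .T).exec m₁ = m₂ at *
  have p2 := p1.frame F2 (by decide)
  have w2 : ∀ t k, m₂ (.own t, k, 0) = m (.own t, k, 0) :=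
    fun t k => (F2 _ (by cases t <;> decide) _ _).trans (w1 t k)
  have n2 : ∀ t, m₂ (.num t, 0, 0) = m (.num t, 0, 0) :=
    fun t => (F2 _ (by cases t <;> decide) _ _).trans (n1 t)
  have e2 : ∀ s k j, m₂ (.eset s, k, j) = m₁ (.eset s, k, j) :=
    fun s k j => F2 _ (by cases s <;> decide) _ _
  -- flips in `S`
  obtain ⟨l3, h3, c3⟩ := exec_chainFlips (s := .S) p2 l2 (by
    simp only [w2, n2]
    exact fun k k1 k2 => ((r1 .S).1 k k1 k2).congr (e2 .S k) fun _ _ => Iff.rfl)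
  simp only [w2, n2] at h3 c3
  have F3 := (chainFlips .S).frame_exec m₂
  generalize (chainFlips .S).exec m₂ = m₃ at *
  have half3 : ∀ s k, 1 ≤ k → k ≤ m (.num s, 0, 0) →
      G.Half (G.order m₃) (G.Ring s (fun k => m (.own s, k, 0)) k) := by
    intro s k k1 k2
    cases s
    · refine (h2 k k1 k2).congr (fun _ _ _ => Iff.rfl) fun j hj hji hr => ?_
      exact (c3 j hj hji fun l hl1 hl2 => ((hch .T).own k k1 k2).disjoint
        ((hch .S).own l hl1 hl2) hji hr.1).symm
    · exact h3 k k1 k2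
  -- common edges of the parents
  have F4 := (put .found 0).frame_exec m₃
  have f4 : (put .found 0).exec m₃ (.found, 0, 0) = 0 := by simp
  generalize (put .found 0).exec m₃ = m₄ at *
  have p4 := (p2.frame F3 (by decide)).frame F4 (by decide)
  have w4 : ∀ t k, m₄ (.own t, k, 0) = m (.own t, k, 0) := fun t k =>
    (F4 _ (by cases t <;> decide) _ _).trans ((F3 _ (by cases t <;> decide) _ _).trans (w2 t k))
  have e4 : ∀ s k j, m₄ (.eset s, k, j) = m₁ (.eset s, k, j) := fun s k j =>
    (F4 _ (by cases s <;> decide) _ _).trans ((F3 _ (by cases s <;> decide) _ _).trans (e2 s k j))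
  have r4 : ∀ s, G.IsEdgeSet m₄ s 0 (G.c s (m (.own s, 0, 0))) := fun s =>
    (r1 s).2.congr (e4 s 0) fun _ _ => Iff.rfl
  have hfound := exec_findCommon p4.size f4 r4
  have F5 := findCommon.frame_exec m₄
  generalize findCommon.exec m₄ = m₅ at *
  have p5 := p4.frame F5 (by decide)
  have l5 := (l3.frame F4 (by decide)).frame F5 (by decide)
  have o5 : G.order m₅ = G.order m₃ :=
    (order_frame F5 (by decide)).trans (order_frame F4 (by decide))
  have w5 : ∀ t k, m₅ (.own t, k, 0) = m (.own t, k, 0) := fun t k =>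
    (F5 _ (by cases t <;> decide) _ _).trans (w4 t k)
  have r5 : ∀ s, G.IsEdgeSet m₅ s 0 (G.c s (m (.own s, 0, 0))) := fun s =>
    (r4 s).congr (fun j => F5 _ (by cases s <;> decide) _ _) fun _ _ => Iff.rfl
  rw [exec_ite]
  by_cases hf : m₅ (.found, 0, 0) = 0
  · rw [if_pos (by simpa [Cond.val] using hf), exec_cons, exec_cons, exec_nil]
    have hdis : ∀ j, j ≠ G.i → G.c .T (m (.own .T, 0, 0)) j → ¬ G.c .S (m (.own .S, 0, 0)) j :=
      fun j hji hj => hfound.1 hf j ((G.hier .T).c_lt _ _ hj) hji hj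
    obtain ⟨l6, h6, c6⟩ := exec_parentSwitchAll (s := .T) p5 l5 (by rw [w5]; exact r5 .T)
      (fun j k hji hki hj hk => by
        rw [w5] at hj hk
        exact l5.planar.crosses_parent (hch .T).parent (hch .S).parent hdis hji hki hj hk)
    simp only [w5] at h6 c6
    have F6 := (parentSwitchAll .T).frame_exec m₅
    generalize (parentSwitchAll .T).exec m₅ = m₆ at *
    have p6 := p5.frame F6 (by decide)
    have w6 : ∀ t k, m₆ (.own t, k, 0) = m (.own t, k, 0) := fun t k =>
      (F6 _ (by cases t <;> decide) _ _).trans (w5 t k)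
    have r6 := (r5 .S).congr (m' := m₆) (fun j => F6 _ (by decide) _ _) fun _ _ => Iff.rfl
    obtain ⟨l7, h7, c7⟩ := exec_parentSwitchAll (s := .S) p6 l6 (by rw [w6]; exact r6)
      (fun j k hji hki hj hk => by
        rw [w6] at hj hk
        exact l6.planar.crosses_parent (hch .S).parent (hch .T).parent
          (fun j hji h1 h2 => hdis j hji h2 h1) hji hki hj hk)
    simp only [w6] at h7 c7
    generalize (parentSwitchAll .S).exec m₆ = m₇ at *
    have nm := fun (s : Side) => not_meet h (hs s)
    have hdisj : ∀ j, j ≠ G.i → G.c .T (m (.own .T, m (.num .T, 0, 0), 0)) j →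
        ¬ G.c .S (m (.own .S, m (.num .S, 0, 0), 0)) j := by
      intro j hji hj hj'
      rcases Nat.eq_zero_or_pos (m (.num .T, 0, 0)) with hT | hT <;>
        rcases Nat.eq_zero_or_pos (m (.num .S, 0, 0)) with hS | hS
      · rw [hT] at hj; rw [hS] at hj'; exact hdis j hji hj hj'
      · rw [hT] at hj; exact nm .S hS hji hj' hj
      · rw [hS] at hj'; exact nm .T hT hji hj hj'
      · exact ((hch .T).own _ hT le_rfl).disjoint ((hch .S).own _ hS le_rfl) hji hj hj'
    have hnot : ∀ s j, j ≠ G.i → G.c s (m (.own s, 0, 0)) j → ¬ G.Crosses (G.order m₇) j := by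
      intro s j hji hj
      have hjn := (G.hier s).c_lt _ _ hj
      cases s
      · rw [c7 j hjn hji (hdis j hji hj)]; exact h6 j hji hj
      · exact h7 j hji hj
    refine ⟨l7, fun b hb => l7.planar.numCross_le_of_disjoint hb hch hdisj fun s k hk => ?_⟩
    rcases Nat.eq_zero_or_pos k with rfl | hpos
    · exact half_of_forall_not fun j hji hr => hnot s j hji hr.1
    · refine (half3 s k hpos hk).congr (fun _ _ _ => Iff.rfl) fun j hj hji hr => ?_
      have a1 : ¬ G.c s (m (.own s, 0, 0)) j := fun hc =>
        hr.2 hpos ((hch s).mono 0 (k - 1) (Nat.zero_le _) (by omega) j hc)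
      have a2 := nm s (by omega) hji ((hch s).mono k _ hk le_rfl j hr.1)
      rw [← o5]
      cases s
      · rw [c7 j hj hji a2, c6 j hj hji a1]
      · rw [c7 j hj hji a1, c6 j hj hji a2]
  · rw [if_neg (by simpa [Cond.val] using hf)]
    obtain ⟨j, hji, hT, hS⟩ : ∃ j, j ≠ G.i ∧ G.c .T (m (.own .T, 0, 0)) j ∧
        G.c .S (m (.own .S, 0, 0)) j := by
      have := mt hfound.2 hf
      push Not at this
      obtain ⟨j, -, h1, h2, h3⟩ := this
      exact ⟨j, h1, h2, h3⟩
    have hpar : ∀ s, G.c s (m (.own s, 0, 0)) j := by rintro (_ | _) <;> assumption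
    refine exec_tryAll p5 l5 fun s u hu => ?_
    obtain ⟨k, hk1, hk2, -⟩ := (hch s).complete u hu
    exact not_meet h (hs s) (by omega) hji ((hch s).mono 0 _ (Nat.zero_le _) le_rfl j (hpar s))
      (hpar s.other)

/-- The Insertion algorithm finds a layout with the fewest crossings. -/
theorem exec_insertion {m : Cell → ℕ} (h : G.Start m) {b : Side → ℕ → ℕ → Prop}
    (hb : G.Planar b) : G.Optimal (insertion.exec m) := by
  have e1 : insertion.exec m = (Prog.ite (parentAboveMax .S) (insertionChain .S)
      (.ite (parentAboveMax .T) (insertionChain .T) insertionRest)).exec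
      ((block [modifiedUntangle, constructLI, findParent .T, findParent .S, Tangle.chain .S,
        Tangle.chain .T]).exec m) := rfl
  rw [e1]
  obtain ⟨hP, hL⟩ := exec_prepare h hb
  generalize (block [modifiedUntangle, constructLI, findParent .T, findParent .S, Tangle.chain .S,
    Tangle.chain .T]).exec m = m₁ at *
  rw [exec_ite]
  split_ifs with h1
  · exact exec_insertionChain hP hL h1
  · rw [exec_ite]
    split_ifs with h2
    · exact exec_insertionChain hP hL h2
    · exact exec_insertionRest hP hL (by rintro (_ | _) <;> assumption)

end Setup

end Tangle

namespace Tangle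

namespace Tanglegram

variable {n : ℕ} {G : Tanglegram n} {l r l' r' : ℕ → ℕ}

theorem start_inputMemory (h : G.IsStored l r l' r') (hn : 2 ≤ n) (i : Fin n) :
    (G.setup h hn i).Start (inputMemory G.φ i l r l' r') := by
  refine ⟨⟨rfl, fun j _ => rfl, fun j hj => ?_, fun s => ?_, fun s v _ _ => ?_,
    fun s v _ _ => ?_⟩, ?_⟩
  · have hj' : j < n := hj
    simp [setup, endIndex, hj', sidePerm]
  · cases s <;> simp [setup, endIndex, sidePerm, inputMemory]
  · cases s <;> rfl
  · cases s <;> rfl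
  · intro y hy a b
    unfold inputMemory
    split <;> simp_all [Setup.inputNames]

end Tanglegram

end Tangle

open Tangle in
theorem insertionRun_bounds :
    ∃ C : ℕ, ∀ (n : ℕ) (G : Tanglegram n) (i : Fin n) (l r l' r' : ℕ → ℕ),
      2 ≤ n → G.IsStored l r l' r' →
      (insertionRun G.φ i l r l' r').time ≤ C * n ^ 2 ∧
      (insertionRun G.φ i l r l' r').space ≤ C * n ^ 2 := by
  obtain ⟨p, q, heq, b1, d1, b2, d2⟩ := insertion_eq
  refine ⟨countVerts.coef + (Prog.seq p q).coef, fun n G i l r l' r' hn h => ?_⟩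
  have hspace : (insertionRun G.φ i l r l' r').space ≤ (insertionRun G.φ i l r l' r').time :=
    Prog.card_used_run_le _ (by simp)
  refine (fun ht => ⟨ht, hspace.trans ht⟩) ?_
  have hst := Tanglegram.start_inputMemory h hn i
  have hrun : insertionRun G.φ i l r l' r' = (Prog.seq p q).run
      (countVerts.run ⟨inputMemory G.φ i l r l' r', 0, ∅⟩) := by
    unfold insertionRun
    rw [heq]
    rfl
  rw [hrun]
  have t1 := countVerts.time_run_le (n := n) (by omega) b1
    (s := ⟨inputMemory G.φ i l r l' r', 0, ∅⟩) (fun y hy => by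
      obtain rfl := List.mem_singleton.1 hy
      exact (show n ≤ 2 * n by omega))
  have hsize : (countVerts.run ⟨inputMemory G.φ i l r l' r', 0, ∅⟩).mem (.size, 0, 0) = n := by
    rw [Prog.run_mem]
    exact countVerts.frame_exec _ .size (by decide) 0 0
  have hverts : (countVerts.run ⟨inputMemory G.φ i l r l' r', 0, ∅⟩).mem (.verts, 0, 0) =
      2 * n - 1 := by
    rw [Prog.run_mem]
    exact Setup.exec_countVerts hst.toInput
  have t2 := (Prog.seq p q).time_run_le (n := n) (by omega) b2
    (s := countVerts.run ⟨inputMemory G.φ i l r l' r', 0, ∅⟩) (fun y hy => by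
      simp only [List.mem_cons, List.not_mem_nil, or_false] at hy
      rcases hy with rfl | rfl <;> omega)
  have e1 : n ^ countVerts.depth ≤ n ^ 2 := Nat.pow_le_pow_right (by omega) d1
  have e2 : n ^ (Prog.seq p q).depth ≤ n ^ 2 := Nat.pow_le_pow_right (by omega) d2
  have m1 := Nat.mul_le_mul_left countVerts.coef e1
  have m2 := Nat.mul_le_mul_left (Prog.seq p q).coef e2
  rw [Nat.add_mul]
  simp only at t1
  omega

theorem theorem1p3 :
    ∃ C : ℕ, ∀ (n : ℕ) (G : Tangle.Tanglegram n) (i : Fin n) (l r l' r' : ℕ → ℕ),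
      G.PlanarOn (Finset.univ.erase i) →
      G.IsStored l r l' r' →
      (∃ X Y : List (Fin n),
        (Tangle.insertionRun G.φ i l r l' r').output n .T = X.map Fin.val ∧
        (Tangle.insertionRun G.φ i l r l' r').output n .S = Y.map Fin.val ∧
        G.IsSingleEdgeInsertion i X Y) ∧
      (Tangle.insertionRun G.φ i l r l' r').time ≤ C * n ^ 2 ∧
      (Tangle.insertionRun G.φ i l r l' r').space ≤ C * n ^ 2 := by
  obtain ⟨C, hC⟩ := insertionRun_bounds
  refine ⟨C, fun n G i l r l' r' hp h => ?_⟩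
  have hn : 2 ≤ n := Tangle.Tanglegram.two_le_of_planarOn hp
  refine ⟨?_, hC n G i l r l' r' hn h⟩
  obtain ⟨b, hb⟩ := Tangle.Tanglegram.exists_planar h hn hp
  have hopt := Tangle.Setup.exec_insertion (Tangle.Tanglegram.start_inputMemory h hn i) hb
  simp only [Tangle.State.output, Tangle.insertionRun, Tangle.Prog.run_mem]
  exact Tangle.Tanglegram.exists_solution h hn hp
    (a := fun s k => Tangle.insertion.exec (Tangle.inputMemory G.φ i l r l' r') (.lay s, k, 0))
    hopt.perm hopt.planar hopt.le
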